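/- A *cograph* is a graph with no induced path on four vertices; the *cotree* of a cograph is the rooted tree whose leaves are its vertices, whose internal nodes have at least two children and are labelled series or parallel with labels alternating along each branch, and in which two vertices are adjacent iff their lowest common ancestor is a series node. Given a cograph $K$ and a new vertex $x$ with neighbourhood $N\subseteq V(K)$, a *constrained completion* is a set $M$ with $N\subseteq M\subseteq V(K)$ such that adding $x$ to $K$ with neighbourhood $M$ gives a cograph; its *cost* is $|M\setminus N|$; it is *minimal* if it is minimal for inclusion. For a node $u$ of the cotree of $K$, the completion *anchored at $u$* consists of $N$, of all vertices not below $u$ whose lowest common ancestor with $u$ is a series node, and of all vertices below a child $c$ of $u$ such that some vertex below $c$ is in $N$. A node $u$ is the *insertion node* of $M$ if some but not all vertices below $u$ are in $M$, for every child of $u$ all or none of the vertices below it are in $M$, and a vertex not below $u$ is in $M$ iff its lowest common ancestor with $u$ is a series node. There is an incremental algorithm on a RAM (unit-cost operations, words of $O(\log n)$ bits, additive arithmetic only) with the following properties. The vertices $x_1,\dots,x_n$ of an arbitrary graph $G$ are presented one by one in an arbitrary order, each with the list of its neighbours among the preceding vertices. After step $i$ the algorithm has computed an inclusion-minimal cograph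 completion $H_i$ of $G_i=G[\{x_1,\dots,x_i\}]$ (the list of its edges and its cotree), and $H_i$ is obtained from $H_{i-1}$ by adding $x_i$ and edges incident to $x_i$ only. In each step $i\ge 2$ the algorithm lists all minimal constrained completions of the neighbourhood $N_{G_i}(x_i)$ of $x_i$ with respect to $H_{i-1}$, each exactly once, as a node of the cotree of $H_{i-1}$ at which it is anchored together with its cost; this node is the insertion node of the completion unless the completed neighbourhood is empty or all of $V(H_{i-1})$. In every step, the neighbourhood of $x_i$ in $H_i$ is a minimal constrained completion of minimum cardinality among all of them. If $d'_i$ is the degree of $x_i$ in $H_i$, step $i$ takes time $O(1+d'_i)$. In particular $H=H_n$ is an inclusion-minimal cograph completion of $G$, and the total running time, including initialization, is $O(n+m'+1)$, where $m'$ is the number of edges of $H$. The same holds, with the same step procedure and the same bounds, for the complete program that reads $G$ from adjacency lists, together with an arbitrary order of its vertices, and performs all the steps, the total time now including the preprocessing of the input and the retrieval of the neighbours of $x_i$ in each step. -/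

import Mathlib

/-! ### Cographs, completions, insertion of a vertex -/

namespace CographCompletion

/-- A cograph is a graph without an induced path on four vertices. -/
def IsCograph {V : Type*} (G : SimpleGraph V) : Prop :=
  IsEmpty (SimpleGraph.pathGraph 4 ↪g G)

/-- `H` is a cograph completion of `G` (same vertices, edges only added) that is minimal for
inclusion of edge sets. -/
def IsMinimalCographCompletion {V : Type*} (G H : SimpleGraph V) : Prop :=
  Minimal (fun K : SimpleGraph V => G ≤ K ∧ IsCograph K) H

/-- The graph obtained from `G` by adding one new vertex, `none`, with neighbourhood `N`. -/
def addVertex {V : Type*} (G : SimpleGraph V) (N : Set V) : SimpleGraph (Option V) where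
  Adj
    | some a, some b => G.Adj a b
    | none, some b => b ∈ N
    | some a, none => a ∈ N
    | none, none => False
  symm := ⟨by rintro (_ | a) (_ | b) h <;> first | exact h | exact G.symm.symm _ _ h⟩
  loopless := ⟨by rintro (_ | a) h <;> first | exact h | exact G.loopless.irrefl _ h⟩

/-- `M` is a constrained completion of the neighbourhood `N` of a new vertex `x` that is inserted in
the graph `H[S]`: only edges incident to `x` are added, and the result is a cograph. -/
def IsConstrainedCompletion {V : Type*} (H : SimpleGraph V) (S N M : Set V) : Prop :=
  N ⊆ M ∧ M ⊆ S ∧ IsCograph (addVertex (H.induce S) (Subtype.val ⁻¹' M))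

/-- The constrained completions that are minimal for inclusion. -/
def IsMinimalConstrainedCompletion {V : Type*} (H : SimpleGraph V) (S N M : Set V) : Prop :=
  Minimal (IsConstrainedCompletion H S N) M

/-- The first `i` vertices `π 0, …, π (i - 1)` of the insertion order `π`. -/
def firstVertices {n : ℕ} (π : Equiv.Perm (Fin n)) (i : ℕ) : Set (Fin n) :=
  {v | (π.symm v).val < i}

/-- The neighbours of the `i`-th vertex `π i` among the vertices that precede it. -/
def earlierNeighbours {n : ℕ} (G : SimpleGraph (Fin n)) (π : Equiv.Perm (Fin n)) (i : Fin n) :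
    Set (Fin n) :=
  G.neighborSet (π i) ∩ firstVertices π i

/-! ### Cotrees -/

/-- The data of a rooted tree whose nodes are natural numbers and carry a label (`true` for series,
`false` for parallel). The nodes smaller than `n` stand for the vertices in `Fin n`. -/
structure LabelledTree (n : ℕ) where
  nodes : Finset ℕ
  root : ℕ
  parent : ℕ → ℕ
  series : ℕ → Bool

namespace LabelledTree

variable {n : ℕ} (T : LabelledTree n)

/-- The children of the node `u`. -/
def children (u : ℕ) : Set ℕ :=
  {c | c ∈ T.nodes ∧ c ≠ T.root ∧ T.parent c = u}

/-- `u` is an ancestor of `v` (every node is an ancestor of itself). -/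
def IsAncestor (u v : ℕ) : Prop :=
  ∃ k : ℕ, T.parent^[k] v = u

/-- `w` is the lowest common ancestor of `u` and `v`. -/
def IsLCA (w u v : ℕ) : Prop :=
  T.IsAncestor w u ∧ T.IsAncestor w v ∧
    ∀ w', T.IsAncestor w' u → T.IsAncestor w' v → T.IsAncestor w' w

/-- The set of vertices whose leaf is a descendant of the node `u`. -/
def below (u : ℕ) : Set (Fin n) :=
  {v | v.val ∈ T.nodes ∧ T.IsAncestor u v.val}

/-- `T` is the cotree of the induced subgraph `H[S]`: it is a rooted tree whose leaves are the
vertices in `S`, every internal node has at least two children, the labels of adjacent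
internal nodes differ, and two vertices are adjacent iff their lowest common ancestor is series. -/
structure IsCotreeOf (H : SimpleGraph (Fin n)) (S : Set (Fin n)) : Prop where
  root_mem : T.root ∈ T.nodes
  parent_root : T.parent T.root = T.root
  parent_mem : ∀ u ∈ T.nodes, T.parent u ∈ T.nodes
  reaches_root : ∀ u ∈ T.nodes, T.IsAncestor T.root u
  leaf_iff : ∀ v : Fin n, v.val ∈ T.nodes ↔ v ∈ S
  children_leaf : ∀ u ∈ T.nodes, u < n → T.children u = ∅
  children_internal : ∀ u ∈ T.nodes, n ≤ u → (T.children u).Nontrivial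
  alternating : ∀ u ∈ T.nodes, n ≤ u → u ≠ T.root → T.series u ≠ T.series (T.parent u)
  adj_iff : ∀ v ∈ S, ∀ w ∈ S, v ≠ w → ∀ u, T.IsLCA u v.val w.val →
    (H.Adj v w ↔ T.series u = true)

/-- The vertices outside the subtree of `u` whose lowest common ancestor with `u` is series. -/
def seriesAbove (u : ℕ) : Set (Fin n) :=
  {y | y.val ∈ T.nodes ∧ y ∉ T.below u ∧ ∃ w, T.IsLCA w y.val u ∧ T.series w = true}

/-- The completion, anchored at the node `u`, of the neighbourhood `N` of a new vertex `x`: `x` is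
made adjacent to all vertices outside the subtree of `u` whose lowest common ancestor with `u` is
series, and to all vertices below the non-hollow children of `u`. -/
def anchored (N : Set (Fin n)) (u : ℕ) : Set (Fin n) :=
  N ∪ T.seriesAbove u ∪ {y | ∃ c ∈ T.children u, (T.below c ∩ N).Nonempty ∧ y ∈ T.below c}

/-- `u` is the insertion node of a vertex with neighbourhood `M`: `u` is mixed, its children are full
or hollow, and a vertex outside the subtree of `u` is in `M` iff its lowest common ancestor with `u`
is series. -/
def IsInsertionNode (M : Set (Fin n)) (u : ℕ) : Prop :=
  u ∈ T.nodes ∧ (T.below u ∩ M).Nonempty ∧ ¬ T.below u ⊆ M ∧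
    (∀ c ∈ T.children u, T.below c ⊆ M ∨ T.below c ∩ M = ∅) ∧
    ∀ y : Fin n, y.val ∈ T.nodes → y ∉ T.below u → (y ∈ M ↔ y ∈ T.seriesAbove u)

end LabelledTree

/-! ### The machine: structured programs on a word RAM

The memory consists of registers and one-dimensional arrays, all holding natural numbers. A program
mentions finitely many of them. Every executed operation has unit cost. The only arithmetic is
addition and truncated subtraction, and no value computed, read or used as an address may exceed the
word bound `W`; otherwise the execution is stuck. -/

structure State where
  reg : ℕ → ℕ
  arr : ℕ → ℕ → ℕ

/-- Arithmetic expressions; `get a e` is the cell of the array `a` at the address `e`. -/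
inductive Exp where
  | const (c : ℕ)
  | var (r : ℕ)
  | get (a : ℕ) (e : Exp)
  | add (e₁ e₂ : Exp)
  | sub (e₁ e₂ : Exp)

namespace Exp

def eval (s : State) : Exp → ℕ
  | const c => c
  | var r => s.reg r
  | get a e => s.arr a (e.eval s)
  | add e₁ e₂ => e₁.eval s + e₂.eval s
  | sub e₁ e₂ => e₁.eval s - e₂.eval s

/-- The number of operations in an expression. -/
def cost : Exp → ℕ
  | const _ => 1
  | var _ => 1
  | get _ e => e.cost + 1
  | add e₁ e₂ => e₁.cost + e₂.cost + 1
  | sub e₁ e₂ => e₁.cost + e₂.cost + 1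

/-- All values occurring in the evaluation are at most `W`. -/
def Fits (W : ℕ) (s : State) : Exp → Prop
  | const c => c ≤ W
  | var r => s.reg r ≤ W
  | get a e => e.Fits W s ∧ s.arr a (e.eval s) ≤ W
  | add e₁ e₂ => e₁.Fits W s ∧ e₂.Fits W s ∧ e₁.eval s + e₂.eval s ≤ W
  | sub e₁ e₂ => e₁.Fits W s ∧ e₂.Fits W s

end Exp

/-- Tests. -/
inductive Test where
  | lt (e₁ e₂ : Exp)
  | eq (e₁ e₂ : Exp)

namespace Test

def Holds (s : State) : Test → Prop
  | lt e₁ e₂ => e₁.eval s < e₂.eval s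
  | eq e₁ e₂ => e₁.eval s = e₂.eval s

def cost : Test → ℕ
  | lt e₁ e₂ => e₁.cost + e₂.cost + 1
  | eq e₁ e₂ => e₁.cost + e₂.cost + 1

def Fits (W : ℕ) (s : State) : Test → Prop
  | lt e₁ e₂ => e₁.Fits W s ∧ e₂.Fits W s
  | eq e₁ e₂ => e₁.Fits W s ∧ e₂.Fits W s

end Test

/-- Programs. -/
inductive Cmd where
  | skip
  | assign (r : ℕ) (e : Exp)
  | store (a : ℕ) (i e : Exp)
  | seq (c₁ c₂ : Cmd)
  | ite (b : Test) (c₁ c₂ : Cmd)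
  | while (b : Test) (c : Cmd)

/-- `Exec W c s t s'`: on a machine with word bound `W`, the program `c` started in the state `s`
halts in the state `s'` after `t` operations. -/
inductive Exec (W : ℕ) : Cmd → State → ℕ → State → Prop
  | skip (s : State) : Exec W .skip s 1 s
  | assign (r : ℕ) (e : Exp) (s : State) (h : e.Fits W s) :
      Exec W (.assign r e) s (e.cost + 1)
        { s with reg := Function.update s.reg r (e.eval s) }
  | store (a : ℕ) (i e : Exp) (s : State) (hi : i.Fits W s) (he : e.Fits W s) :
      Exec W (.store a i e) s (i.cost + e.cost + 1)
        { s with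
          arr := Function.update s.arr a (Function.update (s.arr a) (i.eval s) (e.eval s)) }
  | seq {c₁ c₂ : Cmd} {s₁ s₂ s₃ : State} {t₁ t₂ : ℕ} (h₁ : Exec W c₁ s₁ t₁ s₂)
      (h₂ : Exec W c₂ s₂ t₂ s₃) : Exec W (.seq c₁ c₂) s₁ (t₁ + t₂) s₃
  | ite_true {b : Test} {c₁ c₂ : Cmd} {s s' : State} {t : ℕ} (hf : b.Fits W s) (hb : b.Holds s)
      (h : Exec W c₁ s t s') : Exec W (.ite b c₁ c₂) s (b.cost + 1 + t) s'
  | ite_false {b : Test} {c₁ c₂ : Cmd} {s s' : State} {t : ℕ} (hf : b.Fits W s) (hb : ¬ b.Holds s)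
      (h : Exec W c₂ s t s') : Exec W (.ite b c₁ c₂) s (b.cost + 1 + t) s'
  | while_false {b : Test} {c : Cmd} {s : State} (hf : b.Fits W s) (hb : ¬ b.Holds s) :
      Exec W (.while b c) s (b.cost + 1) s
  | while_true {b : Test} {c : Cmd} {s₁ s₂ s₃ : State} {t₁ t₂ : ℕ} (hf : b.Fits W s₁)
      (hb : b.Holds s₁) (h : Exec W c s₁ t₁ s₂) (h' : Exec W (.while b c) s₂ t₂ s₃) :
      Exec W (.while b c) s₁ (b.cost + 1 + t₁ + t₂) s₃

/-! ### Input and output conventions -/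

/-- Registers: number of vertices, number of vertices inserted so far, root of the stored cotree,
length of the list of enumerated completions, the vertex to insert, its number of neighbours. -/
abbrev rN : ℕ := 0
abbrev rI : ℕ := 1
abbrev rRoot : ℕ := 2
abbrev rCount : ℕ := 3
abbrev rX : ℕ := 4
abbrev rDeg : ℕ := 5

/-- Arrays: neighbours of the vertex to insert; parent and label of the nodes of the stored cotree;
output lists with their offsets; anchors and costs of the enumerated completions; insertion order
and adjacency lists of an input graph. -/
abbrev aNbr : ℕ := 0
abbrev aParent : ℕ := 1
abbrev aSeries : ℕ := 2
abbrev aOutOff : ℕ := 3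
abbrev aOut : ℕ := 4
abbrev aAnchor : ℕ := 5
abbrev aCost : ℕ := 6
abbrev aOrder : ℕ := 7
abbrev aAdjOff : ℕ := 8
abbrev aAdj : ℕ := 9

/-- The cells `b, …, e - 1` of the array `a` list every vertex in `F` exactly once, and nothing
else. -/
def Lists {n : ℕ} (a : ℕ → ℕ) (b e : ℕ) (F : Set (Fin n)) : Prop :=
  b ≤ e ∧ Set.BijOn a (Set.Ico b e) (Fin.val '' F)

/-- The initial state that knows nothing but the number of vertices. -/
def blankState (n : ℕ) : State where
  reg := Function.update (fun _ => 0) rN n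
  arr := fun _ _ => 0

/-- The state `s` after a new vertex `x` with a list of `d` neighbours has been presented. -/
def State.feed (s : State) (x d : ℕ) (nbr : ℕ → ℕ) : State where
  reg := Function.update (Function.update s.reg rX x) rDeg d
  arr := Function.update s.arr aNbr nbr

/-- `s` is an initial state whose memory contains the graph `G`, given by adjacency lists, and the
order `π` in which its vertices have to be inserted. -/
structure IsGraphInput {n : ℕ} (G : SimpleGraph (Fin n)) (π : Equiv.Perm (Fin n)) (s : State) :
    Prop where
  reg_eq : s.reg = (blankState n).reg
  arr_eq : ∀ a, a ≠ aOrder → a ≠ aAdjOff → a ≠ aAdj → ∀ k, s.arr a k = 0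
  order : ∀ i : Fin n, s.arr aOrder i = (π i).val
  off_zero : s.arr aAdjOff 0 = 0
  adj : ∀ v : Fin n, Lists (s.arr aAdj) (s.arr aAdjOff v) (s.arr aAdjOff (v + 1)) (G.neighborSet v)

/-- The labelled tree `T` is stored in the memory of `s`. -/
structure StoresTree {n : ℕ} (s : State) (T : LabelledTree n) : Prop where
  root : s.reg rRoot = T.root
  parent : ∀ u ∈ T.nodes, s.arr aParent u = T.parent u
  series : ∀ u ∈ T.nodes, n ≤ u → s.arr aSeries u = (T.series u).toNat

/-- The memory of `s` contains a list of all minimal constrained completions of the neighbourhood `N`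
of a vertex to be inserted in the cograph `H[S]` with cotree `T`. Every one occurs exactly once and
is given by a node of `T` at which it is anchored, together with its cost, i.e. its number of fill
edges. If the completed neighbourhood is neither empty nor all of `S`, then the node is the insertion
node of the completion. -/
structure EnumeratesCompletions {n : ℕ} (s : State) (T : LabelledTree n) (H : SimpleGraph (Fin n))
    (S N : Set (Fin n)) : Prop where
  bij : Set.BijOn (fun k => T.anchored N (s.arr aAnchor k)) (Set.Iio (s.reg rCount))
    {M | IsMinimalConstrainedCompletion H S N M}
  node_mem : ∀ k < s.reg rCount, s.arr aAnchor k ∈ T.nodes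
  cost : ∀ k < s.reg rCount, s.arr aCost k = (T.anchored N (s.arr aAnchor k) \ N).ncard
  insertion : ∀ k < s.reg rCount, (T.anchored N (s.arr aAnchor k)).Nonempty →
    T.anchored N (s.arr aAnchor k) ≠ S →
    T.IsInsertionNode (T.anchored N (s.arr aAnchor k)) (s.arr aAnchor k)

/-- What the states `s 0, …, s n` reached after `0, …, n` insertions have to satisfy. The graph `H` is
the completion obtained at the end, so that the completion after `i` insertions is the subgraph
induced by the first `i` vertices; `T i` is its cotree. -/
structure CorrectRun {n : ℕ} (G : SimpleGraph (Fin n)) (π : Equiv.Perm (Fin n))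
    (H : SimpleGraph (Fin n)) (T : ℕ → LabelledTree n) (s : ℕ → State) : Prop where
  counters : ∀ i ≤ n, (s i).reg rN = n ∧ (s i).reg rI = i
  /-- After every insertion, an inclusion-minimal cograph completion has been computed. -/
  minimal_prefix : ∀ i ≤ n, IsMinimalCographCompletion
    (G.induce (firstVertices π i)) (H.induce (firstVertices π i))
  minimal : IsMinimalCographCompletion G H
  /-- The cotree of the current completion is stored. -/
  cotree : ∀ i, 1 ≤ i → i ≤ n → (T i).IsCotreeOf H (firstVertices π i) ∧ StoresTree (s i) (T i)
  /-- The edges of the current completion are listed, each at its later end. -/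
  output : ∀ i ≤ n, ∀ j : Fin n, j.val < i →
    Lists ((s i).arr aOut) ((s i).arr aOutOff j) ((s i).arr aOutOff (j + 1))
      (earlierNeighbours H π j)
  /-- The completed neighbourhood is a minimal constrained completion. -/
  selected : ∀ i : Fin n, IsMinimalConstrainedCompletion H (firstVertices π i)
    (earlierNeighbours G π i) (earlierNeighbours H π i)
  /-- It is one of minimum cardinality. -/
  minimum : ∀ i : Fin n, ∀ M, IsMinimalConstrainedCompletion H (firstVertices π i)
    (earlierNeighbours G π i) M → (earlierNeighbours H π i).ncard ≤ M.ncard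
  /-- All minimal constrained completions have been enumerated (if there is a cotree already). -/
  enumeration : ∀ i : Fin n, 1 ≤ i.val →
    EnumeratesCompletions (s (i + 1)) (T i) H (firstVertices π i) (earlierNeighbours G π i)

end CographCompletion

/-! The cotree turns the problem into combinatorics of a labelled tree. If a new vertex gets the
neighbourhood `M`, the result is a cograph exactly when `M` is empty, complete, or has an insertion
node (`isConstrainedCompletion_iff`). For one direction, any four vertices among which is the new
one are separated by a cut that is complete or empty, and an induced path on four vertices admits no
such cut (`not_path_of_cut`). For the other, a lowest node that is neither full nor hollow is an
insertion node: a vertex outside its subtree that violates the rule given by lowest common ancestors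
produces an induced path.

A candidate is a node with a vertex of `N` below it and with a hollow child (no vertex of `N`
below), such that all of `N` outside its subtree is joined to it from above. The completion anchored
at a candidate is the smallest one with that insertion node. Going from a parallel candidate down to
another candidate makes the completion strictly smaller; going down from a series candidate forces
its hollow children into the completion, so the two become incomparable. Hence, for nonempty `N`,
the minimal completions are those anchored at the series candidates and at the parallel candidates
without a candidate strictly below, or the complete one if there is no candidate
(`isMinimalConstrainedCompletion_iff`).

The running time rests on the fact that only non-hollow nodes need to be inspected, and that their
number is linear in the size of every minimal completion `M`. Indeed a non-hollow node either has
all its vertices in `M`, and `M` contains at most `2 * M.ncard` clusters because internal nodes have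
at least two children (`card_full_le`), or it is an ancestor of the anchor, and since the labels
alternate the depth of a node is linear in the number of vertices joined to it from above
(`card_ancestors_le`). All conditions on nodes become comparisons of leaf counts: being joined to
all of `N` outside is inherited from parent to child (`outside_child_iff`), a hollow child shows in
a count (`hollow_child_iff`), and the size of an anchored completion is a sum of two counters
(`ncard_anchored`). So one sweep down and one sweep up over the marked nodes enumerate all minimal
completions with their costs and select a cheapest one.

To insert the vertex at `u`, the children next to which it goes (the hollow ones if `u` is series,
the non-hollow ones if `u` is parallel) are gathered below one node. In both cases only the
non-hollow children are moved, since only their number is bounded by `M.ncard`: below a parallel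
node they get a new parent, and at a series node they move to a new node above, while the hollow
ones stay (`ready_splitBelow`, `ready_splitAbove`). Two adjacent nodes then have the same label for
a moment, which is why updates are verified on `IsClusterTree`, where labels need not alternate.
Adding the leaf restores alternation (`Ready.attach`, `Ready.insert`). The lists of children are
circular and doubly linked, so that each move takes constant time. A step creates at most two nodes,
so node numbers stay below `3 * n`.

Minimality is inherited (`isMinimalCographCompletion_insert`): a completion inside the new graph
restricts to a completion of the old prefix, hence to the old graph itself, and then the
neighbourhood of the new vertex is a constrained completion, to which minimality applies. Every edge
of the final graph is counted at its later end, so the step bounds add up to a total linear in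
vertices plus edges.

Programs are verified with the triple `Ter`, which combines termination, time, word bound and
postcondition. Loops carry a ghost state whose potential pays for the iterations, and the syntactic
`Frame` keeps untouched memory out of the specifications. -/

namespace CographCompletion

open Function (update update_self update_of_ne update_apply)

open Finset (mem_insert mem_filter mem_insert_of_mem)

/-! ### Reasoning about programs -/

/-- The arrays that hold the input; the machine gives no guarantee on their unused cells. -/
def isInput (a : ℕ) : Bool := a == aNbr || a == aOrder || a == aAdjOff || a == aAdj

/-- All registers and all cells of the working arrays respect the word bound. -/
structure Bounded (W : ℕ) (s : State) : Prop where
  reg : ∀ r, s.reg r ≤ W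
  arr : ∀ a, isInput a = false → ∀ k, s.arr a k ≤ W

/-- The part of `Exp.Fits` that does not follow from `Bounded`. -/
def Exp.RFits (W : ℕ) (s : State) : Exp → Prop
  | const c => c ≤ W
  | var _ => True
  | get a e => e.RFits W s ∧ (isInput a = true → s.arr a (e.eval s) ≤ W)
  | add e1 e2 => e1.RFits W s ∧ e2.RFits W s ∧ e1.eval s + e2.eval s ≤ W
  | sub e1 e2 => e1.RFits W s ∧ e2.RFits W s

/-- Every command preserves `Bounded`, so what remains to be checked in each expression is only
constants, sums, and reads from input arrays, whose unused cells may hold anything. -/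
theorem Exp.RFits.fits {W : ℕ} {s : State} (hs : Bounded W s) :
    ∀ {e : Exp}, e.RFits W s → e.Fits W s ∧ e.eval s ≤ W
  | const _, h => ⟨h, h⟩
  | var r, _ => ⟨hs.reg r, hs.reg r⟩
  | get a e, h => by
      have h' : s.arr a (e.eval s) ≤ W := by
        cases ha : isInput a with
        | true => exact h.2 ha
        | false => exact hs.arr a ha _
      exact ⟨⟨(Exp.RFits.fits hs h.1).1, h'⟩, h'⟩
  | add e1 e2, h => ⟨⟨(Exp.RFits.fits hs h.1).1, (Exp.RFits.fits hs h.2.1).1, h.2.2⟩, h.2.2⟩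
  | sub e1 e2, h =>
      ⟨⟨(Exp.RFits.fits hs h.1).1, (Exp.RFits.fits hs h.2).1⟩,
        (Nat.sub_le _ _).trans (Exp.RFits.fits hs h.1).2⟩

/-- The part of `Test.Fits` that does not follow from `Bounded`. -/
def Test.RFits (W : ℕ) (s : State) : Test → Prop
  | lt e1 e2 => e1.RFits W s ∧ e2.RFits W s
  | eq e1 e2 => e1.RFits W s ∧ e2.RFits W s

theorem Test.RFits.fits {W : ℕ} {s : State} (hs : Bounded W s) :
    ∀ {b : Test}, b.RFits W s → b.Fits W s
  | lt _ _, h => ⟨(h.1.fits hs).1, (h.2.fits hs).1⟩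
  | eq _ _, h => ⟨(h.1.fits hs).1, (h.2.fits hs).1⟩

/-- Started in the state `s`, the program `c` halts after at most `T` operations in a state that
satisfies `Q`. -/
def Ter (W : ℕ) (c : Cmd) (s : State) (T : ℕ) (Q : State → Prop) : Prop :=
  Bounded W s → ∃ t s', Exec W c s t s' ∧ t ≤ T ∧ Bounded W s' ∧ Q s'

theorem Bounded.updateReg {W : ℕ} {s : State} (hs : Bounded W s) (r : ℕ) {v : ℕ} (hv : v ≤ W) :
    Bounded W { s with reg := update s.reg r v } := by
  refine ⟨fun r' => ?_, hs.arr⟩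
  by_cases h : r' = r
  · subst h; simpa using hv
  · simpa [h] using hs.reg r'

theorem Bounded.updateArr {W : ℕ} {s : State} (hs : Bounded W s) (a i : ℕ) {v : ℕ} (hv : v ≤ W) :
    Bounded W { s with arr := update s.arr a (update (s.arr a) i v) } := by
  refine ⟨hs.reg, fun a' ha' k => ?_⟩
  by_cases h : a' = a
  · subst h
    by_cases hk : k = i
    · subst hk; simpa using hv
    · simpa [hk] using hs.arr a' ha' k
  · simpa [h] using hs.arr a' ha' k

theorem Ter.mono {W : ℕ} {c : Cmd} {s : State} {T T' : ℕ} {Q Q' : State → Prop}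
    (h : Ter W c s T Q) (hT : T ≤ T') (hQ : ∀ s', Q s' → Q' s') : Ter W c s T' Q' := by
  intro hs
  obtain ⟨t, s', h1, h2, h3, h4⟩ := h hs
  exact ⟨t, s', h1, h2.trans hT, h3, hQ _ h4⟩

theorem Ter.seq {W : ℕ} {c1 c2 : Cmd} {s : State} {T1 T2 : ℕ} {Q Q' : State → Prop}
    (h1 : Ter W c1 s T1 Q) (h2 : ∀ s', Q s' → Ter W c2 s' T2 Q') :
    Ter W (.seq c1 c2) s (T1 + T2) Q' := by
  intro hs
  obtain ⟨t, s', e, ht, hs', hq⟩ := h1 hs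
  obtain ⟨t', s'', e', ht', hs'', hq'⟩ := h2 s' hq hs'
  exact ⟨_, s'', .seq e e', by omega, hs'', hq'⟩

theorem Ter.ite {W : ℕ} {b : Test} {c1 c2 : Cmd} {s : State} {T : ℕ} {Q : State → Prop}
    (hb : b.RFits W s) (h1 : b.Holds s → Ter W c1 s T Q) (h2 : ¬ b.Holds s → Ter W c2 s T Q) :
    Ter W (.ite b c1 c2) s (b.cost + 1 + T) Q := by
  intro hs
  by_cases h : b.Holds s
  · obtain ⟨t, s', e, ht, hs', hq⟩ := h1 h hs
    exact ⟨_, s', .ite_true (hb.fits hs) h e, by omega, hs', hq⟩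
  · obtain ⟨t, s', e, ht, hs', hq⟩ := h2 h hs
    exact ⟨_, s', .ite_false (hb.fits hs) h e, by omega, hs', hq⟩

/-- The rule for loops. The invariant `I` depends on a ghost state with potential `Φ`. -/
theorem Ter.loop {W : ℕ} {σ : Type*} {b : Test} {c : Cmd} (I : σ → State → Prop) (Φ : σ → ℕ)
    (hb : ∀ g s, I g s → b.RFits W s)
    (hI : ∀ g s, I g s → b.Holds s →
      ∃ g' T, T + b.cost + 1 + Φ g' ≤ Φ g ∧ Ter W c s T (I g')) (g : σ) (s : State) (h : I g s) :
    Ter W (.while b c) s (Φ g + b.cost + 1) (fun s' => (∃ g', I g' s') ∧ ¬ b.Holds s') := by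
  induction hm : Φ g using Nat.strong_induction_on generalizing g s with
  | _ m ih =>
    intro hs
    by_cases hh : b.Holds s
    · obtain ⟨g', T, hT, hc⟩ := hI g s h hh
      obtain ⟨t, s', e, ht, hs', hq⟩ := hc hs
      obtain ⟨t', s'', e', ht', hs'', hq'⟩ := ih (Φ g') (by omega) g' s' hq rfl hs'
      exact ⟨_, s'', .while_true ((hb g s h).fits hs) hh e e', by omega, hs'', hq'⟩
    · exact ⟨_, s, .while_false ((hb g s h).fits hs) hh, by omega, hs, ⟨g, h⟩, hh⟩

/-- The worst-case running time of a program without loops. -/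
def Cmd.bound : Cmd → ℕ
  | skip => 1
  | assign _ e => e.cost + 1
  | store _ i e => i.cost + e.cost + 1
  | seq c1 c2 => c1.bound + c2.bound
  | ite b c1 c2 => b.cost + 1 + max c1.bound c2.bound
  | .while _ _ => 0

/-- The weakest precondition of a program without loops. -/
def wp (W : ℕ) : Cmd → State → (State → Prop) → Prop
  | .skip, s, Q => Q s
  | .assign r e, s, Q => e.RFits W s ∧ Q { s with reg := update s.reg r (e.eval s) }
  | .store a i e, s, Q => i.RFits W s ∧ e.RFits W s ∧
      Q { s with arr := update s.arr a (update (s.arr a) (i.eval s) (e.eval s)) }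
  | .seq c1 c2, s, Q => wp W c1 s (fun s' => wp W c2 s' Q)
  | .ite b c1 c2, s, Q => b.RFits W s ∧ (b.Holds s → wp W c1 s Q) ∧ (¬ b.Holds s → wp W c2 s Q)
  | .while _ _, _, _ => False

/-- Loops have precondition `False`, so the default value `0` that `Cmd.bound` assigns to them is
never used. -/
theorem Ter.of_wp {W : ℕ} {c : Cmd} : ∀ {s : State} {Q : State → Prop},
    wp W c s Q → Ter W c s c.bound Q := by
  induction c with
  | skip => exact fun {s Q} h hs => ⟨_, s, .skip s, le_rfl, hs, h⟩
  | assign r e =>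
    exact fun {s Q} h hs => ⟨_, _, .assign r e s (h.1.fits hs).1, le_rfl,
      hs.updateReg r (h.1.fits hs).2, h.2⟩
  | store a i e =>
    exact fun {s Q} h hs => ⟨_, _, .store a i e s (h.1.fits hs).1 (h.2.1.fits hs).1, le_rfl,
      hs.updateArr a _ (h.2.1.fits hs).2, h.2.2⟩
  | seq c1 c2 ih1 ih2 => exact fun {s Q} h => Ter.seq (ih1 h) (fun s' h' => ih2 h')
  | ite b c1 c2 ih1 ih2 =>
    exact fun {s Q} h => Ter.ite h.1 (fun hb => (ih1 (h.2.1 hb)).mono (le_max_left _ _) fun _ => id)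
      (fun hb => (ih2 (h.2.2 hb)).mono (le_max_right _ _) fun _ => id)
  | _ => exact fun {s Q} h => h.elim

/-- Sequential composition of a list of programs. -/
def block : List Cmd → Cmd
  | [] => .skip
  | c :: l => .seq c (block l)

/-- `c` may change the register `r`. -/
def Cmd.modReg : Cmd → ℕ → Bool
  | skip, _ => false
  | assign r' _, r => r' == r
  | store _ _ _, _ => false
  | seq c1 c2, r => c1.modReg r || c2.modReg r
  | ite _ c1 c2, r => c1.modReg r || c2.modReg r
  | .while _ c, r => c.modReg r

/-- `c` may change the array `a`. -/
def Cmd.modArr : Cmd → ℕ → Bool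
  | skip, _ => false
  | assign _ _, _ => false
  | store a' _ _, a => a' == a
  | seq c1 c2, a => c1.modArr a || c2.modArr a
  | ite _ c1 c2, a => c1.modArr a || c2.modArr a
  | .while _ c, a => c.modArr a

/-- `s'` differs from `s` at most in what `c` may change. -/
structure Frame (c : Cmd) (s s' : State) : Prop where
  reg : ∀ {r}, c.modReg r = false → s'.reg r = s.reg r
  arr : ∀ {a}, c.modArr a = false → s'.arr a = s.arr a

theorem Frame.refl (c : Cmd) (s : State) : Frame c s s := ⟨fun _ => rfl, fun _ => rfl⟩

theorem Frame.trans {c : Cmd} {s1 s2 s3 : State} (h : Frame c s1 s2) (h' : Frame c s2 s3) :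
    Frame c s1 s3 :=
  ⟨fun hr => (h'.reg hr).trans (h.reg hr), fun ha => (h'.arr ha).trans (h.arr ha)⟩

/-- What may change is read off the program text, so the side conditions hold by `rfl` for concrete
programs. This lets postconditions mention only what a program does change. -/
theorem Exec.frame {W : ℕ} {c : Cmd} {s s' : State} {t : ℕ} (h : Exec W c s t s') :
    Frame c s s' := by
  have or := fun {a b : Bool} => (Bool.or_eq_false_iff (x := a) (y := b)).1
  induction h with
  | skip s => exact .refl _ _
  | assign r e s h =>
    refine ⟨fun {r'} hr => ?_, fun _ => rfl⟩
    have : r' ≠ r := by rintro rfl; simp [Cmd.modReg] at hr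
    simp [this]
  | store a i e s hi he =>
    refine ⟨fun _ => rfl, fun {a'} ha => ?_⟩
    have : a' ≠ a := by rintro rfl; simp [Cmd.modArr] at ha
    simp [this]
  | seq h1 h2 ih1 ih2 =>
    exact ⟨fun h => (ih2.reg (or h).2).trans (ih1.reg (or h).1),
      fun h => (ih2.arr (or h).2).trans (ih1.arr (or h).1)⟩
  | ite_true hf hb h ih => exact ⟨fun h => ih.reg (or h).1, fun h => ih.arr (or h).1⟩
  | ite_false hf hb h ih => exact ⟨fun h => ih.reg (or h).2, fun h => ih.arr (or h).2⟩
  | while_false hf hb => exact .refl _ _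
  | while_true hf hb h h' ih ih' =>
    exact ⟨fun h => (ih'.reg h).trans (ih.reg h), fun h => (ih'.arr h).trans (ih.arr h)⟩

theorem Ter.frame {W : ℕ} {c : Cmd} {s : State} {T : ℕ} {Q : State → Prop}
    (h : Ter W c s T Q) : Ter W c s T (fun s' => Q s' ∧ Frame c s s') := by
  intro hs
  obtain ⟨t, s', h1, h2, h3, h4⟩ := h hs
  exact ⟨t, s', h1, h2, h3, h4, h1.frame⟩

/-- The rule for loops, with the frame of the loop body built into the invariant. -/
theorem Ter.loop_frame {W : ℕ} {σ : Type*} {b : Test} {c : Cmd} {s0 : State}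
    (I : σ → State → Prop) (Φ : σ → ℕ)
    (hb : ∀ g s, Frame c s0 s → I g s → b.RFits W s)
    (hI : ∀ g s, Frame c s0 s → I g s → b.Holds s →
      ∃ g' T, T + b.cost + 1 + Φ g' ≤ Φ g ∧ Ter W c s T (I g')) (g : σ) (h : I g s0) :
    Ter W (.while b c) s0 (Φ g + b.cost + 1)
      (fun s' => Frame c s0 s' ∧ (∃ g', I g' s') ∧ ¬ b.Holds s') := by
  refine (Ter.loop (fun g s => Frame c s0 s ∧ I g s) Φ (fun g s h => hb g s h.1 h.2)
    (fun g s h hh => ?_) g s0 ⟨.refl _ _, h⟩).mono le_rfl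
    (fun s' h => ⟨h.1.choose_spec.1, ⟨_, h.1.choose_spec.2⟩, h.2⟩)
  obtain ⟨g', T, hT, hc⟩ := hI g s h.1 h.2 hh
  exact ⟨g', T, hT, hc.frame.mono le_rfl fun s' hs' => ⟨h.1.trans hs'.2, hs'.1⟩⟩

namespace LabelledTree

/-! ### Rooted trees given by parent pointers -/

variable {n : ℕ} {T : LabelledTree n} {u v c d : ℕ} {y : Fin n}

theorem IsAncestor.refl (u : ℕ) : T.IsAncestor u u := ⟨0, rfl⟩

theorem IsAncestor.trans {u v w : ℕ} (h : T.IsAncestor u v) (h' : T.IsAncestor v w) :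
    T.IsAncestor u w := by
  obtain ⟨k, rfl⟩ := h
  obtain ⟨l, rfl⟩ := h'
  exact ⟨k + l, Function.iterate_add_apply _ _ _ _⟩

theorem isAncestor_parent (v : ℕ) : T.IsAncestor (T.parent v) v := ⟨1, rfl⟩

theorem IsAncestor.eq_or_parent (h : T.IsAncestor u v) :
    u = v ∨ T.IsAncestor u (T.parent v) := by
  obtain ⟨_ | k, rfl⟩ := h
  · exact .inl rfl
  · exact .inr ⟨k, rfl⟩

theorem IsAncestor.total {u v w : ℕ} (h : T.IsAncestor u w) (h' : T.IsAncestor v w) :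
    T.IsAncestor u v ∨ T.IsAncestor v u := by
  obtain ⟨k, rfl⟩ := h
  obtain ⟨l, rfl⟩ := h'
  rcases le_total k l with hkl | hkl
  · obtain ⟨m, rfl⟩ := Nat.exists_eq_add_of_le' hkl
    exact .inr ⟨m, (Function.iterate_add_apply _ _ _ _).symm⟩
  · obtain ⟨m, rfl⟩ := Nat.exists_eq_add_of_le' hkl
    exact .inl ⟨m, (Function.iterate_add_apply _ _ _ _).symm⟩

/-- The axioms of a rooted tree. -/
structure IsRooted (T : LabelledTree n) : Prop where
  root_mem : T.root ∈ T.nodes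
  parent_root : T.parent T.root = T.root
  parent_mem : ∀ u ∈ T.nodes, T.parent u ∈ T.nodes
  reaches_root : ∀ u ∈ T.nodes, T.IsAncestor T.root u

theorem isAncestor_child (h : c ∈ T.children u) : T.IsAncestor u c := ⟨1, h.2.2⟩

namespace IsRooted

variable (hT : T.IsRooted)
include hT

theorem iterate_root (k : ℕ) : T.parent^[k] T.root = T.root :=
  Function.iterate_fixed hT.parent_root k

theorem mem_of_isAncestor (hv : v ∈ T.nodes) (h : T.IsAncestor u v) : u ∈ T.nodes := by
  obtain ⟨k, rfl⟩ := h
  induction k with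
  | zero => exact hv
  | succ k ih =>
    rw [Function.iterate_succ_apply']
    exact hT.parent_mem _ ih

theorem eq_root_of_isAncestor (h : T.IsAncestor u T.root) : u = T.root := by
  obtain ⟨k, rfl⟩ := h
  exact hT.iterate_root k

/-- Two distinct mutual ancestors would lie on a cycle of parent pointers. Iterating around the
cycle often enough returns to `v`, but has also reached the root, where the iteration is stuck; so
`v` is the root. -/
theorem antisymm (hv : v ∈ T.nodes) (h : T.IsAncestor u v) (h' : T.IsAncestor v u) :
    u = v := by
  obtain ⟨k, rfl⟩ := h
  obtain ⟨l, hl⟩ := h'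
  rw [← Function.iterate_add_apply] at hl
  rcases Nat.eq_zero_or_pos k with rfl | hk
  · rfl
  obtain ⟨r, hr⟩ := hT.reaches_root v hv
  have h1 : T.parent^[(l + k) * r] v = v := by
    rw [Function.iterate_mul]
    exact Function.iterate_fixed hl r
  have h2 : T.parent^[(l + k) * r] v = T.root := by
    have : r ≤ (l + k) * r := Nat.le_mul_of_pos_left _ (by omega)
    obtain ⟨m, hm⟩ := Nat.exists_eq_add_of_le' this
    rw [hm, Function.iterate_add_apply, hr, hT.iterate_root]
  have : v = T.root := h1.symm.trans h2
  rw [this, hT.iterate_root]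

theorem parent_ne (hc : c ∈ T.nodes) (h : c ≠ T.root) : T.parent c ≠ c := by
  intro h'
  obtain ⟨k, hk⟩ := hT.reaches_root c hc
  exact h ((Function.iterate_fixed h' k).symm.trans hk)

theorem mem_children_parent (hc : c ∈ T.nodes) (h : c ≠ T.root) :
    c ∈ T.children (T.parent c) := ⟨hc, h, rfl⟩

theorem mem_of_mem_children (h : c ∈ T.children u) : u ∈ T.nodes :=
  h.2.2 ▸ hT.parent_mem c h.1

theorem not_isAncestor_of_mem_children (h : c ∈ T.children u) : ¬ T.IsAncestor c u := by
  intro h'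
  have := hT.antisymm h.1 (isAncestor_child h) h'
  exact hT.parent_ne h.1 h.2.1 (h.2.2.trans this)

theorem ne_of_mem_children (h : c ∈ T.children u) : c ≠ u := by
  rintro rfl
  exact hT.not_isAncestor_of_mem_children h (.refl _)

theorem exists_child (hv : v ∈ T.nodes) (h : T.IsAncestor u v) (hne : u ≠ v) :
    ∃ c ∈ T.children u, T.IsAncestor c v := by
  obtain ⟨k, hk⟩ := h
  induction k generalizing v with
  | zero => exact absurd hk.symm hne
  | succ k ih =>
    by_cases h : T.parent v = u
    · refine ⟨v, ⟨hv, ?_, h⟩, .refl _⟩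
      rintro rfl
      exact hne (h.symm.trans hT.parent_root)
    · obtain ⟨c, hc, hcv⟩ := ih (hT.parent_mem v hv) (Ne.symm h) hk
      exact ⟨c, hc, hcv.trans (isAncestor_parent v)⟩

/-- The ancestors of `v` form a chain, so one of the two children is an ancestor of the other; if
they differed, it would be an ancestor of the common parent `u`. -/
theorem children_unique {u c c' v : ℕ} (hc : c ∈ T.children u) (hc' : c' ∈ T.children u)
    (h : T.IsAncestor c v) (h' : T.IsAncestor c' v) : c = c' := by
  wlog H : T.IsAncestor c c' generalizing c c'
  · exact (this hc' hc h' h ((h.total h').resolve_left H)).symm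
  rcases H.eq_or_parent with h | h
  · exact h
  · rw [hc'.2.2] at h
    exact absurd h (hT.not_isAncestor_of_mem_children hc)

/-- A common ancestor that is not above `u` would lie below both children, which `children_unique`
excludes. -/
theorem isLCA_of_children {u c c' v w : ℕ} (hc : c ∈ T.children u) (hc' : c' ∈ T.children u)
    (hne : c ≠ c') (h : T.IsAncestor c v) (h' : T.IsAncestor c' w) : T.IsLCA u v w := by
  refine ⟨(isAncestor_child hc).trans h, (isAncestor_child hc').trans h', fun z hz hz' => ?_⟩
  have key : ∀ {c v}, c ∈ T.children u → T.IsAncestor c v → T.IsAncestor z v →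
      T.IsAncestor z u ∨ T.IsAncestor c z := by
    intro c v hc h hz
    rcases h.total hz with h1 | h1
    · exact .inr h1
    · rcases h1.eq_or_parent with rfl | h2
      · exact .inr (.refl _)
      · exact .inl (hc.2.2 ▸ h2)
  rcases key hc h hz with h1 | h1
  · exact h1
  rcases key hc' h' hz' with h2 | h2
  · exact h2
  exact absurd (hT.children_unique hc hc' h1 h2) hne

theorem isLCA_unique {u u' v w : ℕ} (hv : v ∈ T.nodes) (h : T.IsLCA u v w) (h' : T.IsLCA u' v w) :
    u = u' :=
  hT.antisymm (hT.mem_of_isAncestor hv h'.1) (h'.2.2 _ h.1 h.2.1) (h.2.2 _ h'.1 h'.2.1)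

open Classical in
/-- Induction from the leaves to the root. -/
theorem child_induction {P : ℕ → Prop} (h : ∀ u ∈ T.nodes, (∀ c ∈ T.children u, P c) → P u) :
    ∀ u ∈ T.nodes, P u := by
  intro u hu
  induction hm : (T.nodes.filter (fun v => T.IsAncestor u v)).card using Nat.strong_induction_on
    generalizing u with
  | _ m ih =>
    refine h u hu fun c hc => ih _ ?_ c hc.1 rfl
    rw [← hm]
    refine Finset.card_lt_card ⟨fun v hv => ?_, fun hs => ?_⟩
    · rw [mem_filter] at hv ⊢
      exact ⟨hv.1, (isAncestor_child hc).trans hv.2⟩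
    · have := hs (mem_filter.2 ⟨hu, .refl u⟩)
      exact hT.not_isAncestor_of_mem_children hc (mem_filter.1 this).2

/-- Induction from the root to the leaves. -/
theorem parent_induction {P : ℕ → Prop} (h0 : P T.root)
    (h : ∀ u ∈ T.nodes, ∀ c ∈ T.children u, P u → P c) : ∀ u ∈ T.nodes, P u := by
  intro u hu
  obtain ⟨k, hk⟩ := hT.reaches_root u hu
  induction k generalizing u with
  | zero => exact (show u = T.root from hk) ▸ h0
  | succ k ih =>
    by_cases hr : u = T.root
    · exact hr ▸ h0
    · exact h _ (hT.parent_mem u hu) u ⟨hu, hr, rfl⟩ (ih _ (hT.parent_mem u hu) hk)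

end IsRooted

theorem below_mono (h : T.IsAncestor u v) : T.below v ⊆ T.below u :=
  fun _ hy => ⟨hy.1, h.trans hy.2⟩

namespace IsCotreeOf

/-! ### Cotrees -/

variable {H : SimpleGraph (Fin n)} {S : Set (Fin n)} (hT : T.IsCotreeOf H S)
include hT

theorem rooted : T.IsRooted := ⟨hT.root_mem, hT.parent_root, hT.parent_mem, hT.reaches_root⟩

theorem mem_below_self {v : Fin n} (hv : v ∈ S) : v ∈ T.below v.val :=
  ⟨(hT.leaf_iff v).2 hv, .refl _⟩

theorem below_subset (u : ℕ) : T.below u ⊆ S := fun y hy => (hT.leaf_iff y).1 hy.1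

theorem below_root : T.below T.root = S := (hT.below_subset _).antisymm fun y hy =>
    ⟨(hT.leaf_iff y).2 hy, hT.reaches_root _ ((hT.leaf_iff y).2 hy)⟩

theorem below_leaf {v : Fin n} (hv : v ∈ S) : T.below v.val = {v} := by
  ext y
  refine ⟨fun hy => ?_, fun hy => ?_⟩
  · by_contra hne
    obtain ⟨c, hc, -⟩ := hT.rooted.exists_child hy.1 hy.2 (fun h => hne (Fin.ext h.symm))
    rw [hT.children_leaf _ ((hT.leaf_iff v).2 hv) v.2] at hc
    exact hc
  · rw [Set.mem_singleton_iff.1 hy]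
    exact hT.mem_below_self hv

theorem internal_of_child (h : c ∈ T.children u) : n ≤ u := by
  by_contra hu
  rw [hT.children_leaf u (hT.rooted.mem_of_mem_children h) (by omega)] at h
  exact h

theorem below_nonempty : ∀ u ∈ T.nodes, (T.below u).Nonempty := by
  refine hT.rooted.child_induction fun u hu ih => ?_
  by_cases h : u < n
  · exact ⟨⟨u, h⟩, hT.mem_below_self ((hT.leaf_iff ⟨u, h⟩).1 hu)⟩
  · obtain ⟨c, hc, -⟩ := hT.children_internal u hu (by omega)
    exact (ih c hc).mono (below_mono (isAncestor_child hc))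

theorem mem_below_iff (hu : n ≤ u) :
    y ∈ T.below u ↔ ∃ c ∈ T.children u, y ∈ T.below c := by
  constructor
  · intro hy
    obtain ⟨c, hc, hcy⟩ := hT.rooted.exists_child hy.1 hy.2 (by have := y.2; omega)
    exact ⟨c, hc, hy.1, hcy⟩
  · rintro ⟨c, hc, hy⟩
    exact below_mono (isAncestor_child hc) hy

theorem children_eq_of_mem {u c c' : ℕ} (hc : c ∈ T.children u) (hc' : c' ∈ T.children u)
    (h : y ∈ T.below c) (h' : y ∈ T.below c') : c = c' :=
  hT.rooted.children_unique hc hc' h.2 h'.2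

theorem below_disjoint {u c c' : ℕ} (hc : c ∈ T.children u) (hc' : c' ∈ T.children u)
    (h : c ≠ c') : Disjoint (T.below c) (T.below c') :=
  Set.disjoint_left.2 fun _ hy hy' => h (hT.children_eq_of_mem hc hc' hy hy')

theorem exists_other_child (hc : c ∈ T.children u) : ∃ c' ∈ T.children u, c' ≠ c :=
  (hT.children_internal u (hT.rooted.mem_of_mem_children hc) (hT.internal_of_child hc)).exists_ne c

theorem not_below_subset_of_mem_children (hc : c ∈ T.children u) :
    ¬ T.below u ⊆ T.below c := by
  intro h
  obtain ⟨c', hc', hne⟩ := hT.exists_other_child hc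
  obtain ⟨y, hy⟩ := hT.below_nonempty c' hc'.1
  exact hne (hT.children_eq_of_mem hc' hc hy (h (below_mono (isAncestor_child hc') hy)))

/-- Clusters determine the tree order because every internal node has two children with nonempty
disjoint clusters, so that clusters grow strictly towards the root. -/
theorem isAncestor_iff (hu : u ∈ T.nodes) (hv : v ∈ T.nodes) :
    T.IsAncestor u v ↔ T.below v ⊆ T.below u := by
  refine ⟨below_mono, fun h => ?_⟩
  obtain ⟨y, hy⟩ := hT.below_nonempty v hv
  rcases (h hy).2.total hy.2 with h1 | h1
  · exact h1
  · by_cases hne : v = u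
    · exact hne ▸ .refl _
    · obtain ⟨c, hc, hcu⟩ := hT.rooted.exists_child hu h1 hne
      exact absurd (h.trans (below_mono hcu)) (hT.not_below_subset_of_mem_children hc)

theorem adj_of_children {u c c' : ℕ} (hc : c ∈ T.children u) (hc' : c' ∈ T.children u)
    (hne : c ≠ c') {y z : Fin n} (hy : y ∈ T.below c) (hz : z ∈ T.below c') :
    H.Adj y z ↔ T.series u = true :=
  hT.adj_iff y ((hT.leaf_iff y).1 hy.1) z ((hT.leaf_iff z).1 hz.1)
    (by rintro rfl; exact hne (hT.children_eq_of_mem hc hc' hy hz)) u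
    (hT.rooted.isLCA_of_children hc hc' hne hy.2 hz.2)

theorem adj_of_child (hc : c ∈ T.children u) {y z : Fin n} (hy : y ∈ T.below c)
    (hz : z ∈ T.below u) (hz' : z ∉ T.below c) : H.Adj y z ↔ T.series u = true := by
  obtain ⟨c', hc', hzc⟩ := (hT.mem_below_iff (hT.internal_of_child hc)).1 hz
  exact hT.adj_of_children hc hc' (by rintro rfl; exact hz' hzc) hy hzc

/-- A vertex outside the subtree of `u` branches off the path from the root to `u` somewhere. -/
theorem exists_branch (hu : u ∈ T.nodes) (hy : y ∈ S) (hyu : y ∉ T.below u) :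
    ∃ w, ∃ c ∈ T.children w, T.IsAncestor c u ∧ y ∈ T.below w ∧ y ∉ T.below c := by
  revert hyu
  refine hT.rooted.parent_induction (P := fun u => y ∉ T.below u → ∃ w, ∃ c ∈ T.children w,
    T.IsAncestor c u ∧ y ∈ T.below w ∧ y ∉ T.below c) ?_ ?_ u hu
  · intro h
    exact absurd (hT.below_root ▸ hy) h
  · intro u hu c hc ih hyc
    by_cases h : y ∈ T.below u
    · exact ⟨u, c, hc, .refl _, h, hyc⟩
    · obtain ⟨w, d, hd, hdu, h1, h2⟩ := ih h
      exact ⟨w, d, hd, hdu.trans (isAncestor_child hc), h1, h2⟩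

/-- The node `w` at which `y` branches off the path to `u` is their lowest common ancestor. Together
with `exists_branch` this decides every membership in `seriesAbove`. -/
theorem mem_seriesAbove_iff {u w c : ℕ} (hc : c ∈ T.children w) (hcu : T.IsAncestor c u)
    (hy : y ∈ T.below w) (hyc : y ∉ T.below c) :
    y ∈ T.seriesAbove u ↔ T.series w = true := by
  obtain ⟨c', hc', hyc'⟩ := (hT.mem_below_iff (hT.internal_of_child hc)).1 hy
  have hlca : T.IsLCA w y.val u :=
    hT.rooted.isLCA_of_children hc' hc (by rintro rfl; exact hyc hyc') hyc'.2 hcu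
  constructor
  · rintro ⟨h1, h2, w', h3, h4⟩
    rwa [hT.rooted.isLCA_unique h1 hlca h3]
  · intro h
    exact ⟨hy.1, fun h' => hyc (below_mono hcu h'), w, hlca, h⟩

theorem seriesAbove_subset (u : ℕ) : T.seriesAbove u ⊆ S := fun y hy => (hT.leaf_iff y).1 hy.1

theorem seriesAbove_disjoint (u : ℕ) : Disjoint (T.seriesAbove u) (T.below u) :=
  Set.disjoint_left.2 fun _ hy => hy.2.1

theorem seriesAbove_root : T.seriesAbove T.root = ∅ := by
  ext y
  refine ⟨fun hy => ?_, fun h => h.elim⟩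
  exact hy.2.1 (hT.below_root ▸ hT.seriesAbove_subset _ hy)

/-- One step down adds the siblings of `c` if `u` is series, and nothing otherwise. The inductions
along branches and the counters of the program follow this recursion. -/
theorem mem_seriesAbove_child (hc : c ∈ T.children u) : y ∈ T.seriesAbove c ↔
      y ∈ T.seriesAbove u ∨ (T.series u = true ∧ y ∈ T.below u ∧ y ∉ T.below c) := by
  by_cases hyS : y ∈ S
  swap
  · exact ⟨fun h => absurd (hT.seriesAbove_subset _ h) hyS, fun h => h.elim
      (fun h => absurd (hT.seriesAbove_subset _ h) hyS)
      (fun h => absurd (hT.below_subset _ h.2.1) hyS)⟩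
  by_cases hyu : y ∈ T.below u
  · by_cases hyc : y ∈ T.below c
    · exact ⟨fun h => absurd hyc h.2.1, fun h => h.elim (fun h => absurd hyu h.2.1)
        (fun h => absurd hyc h.2.2)⟩
    · rw [hT.mem_seriesAbove_iff hc (.refl c) hyu hyc]
      exact ⟨fun h => .inr ⟨h, hyu, hyc⟩, fun h => h.elim (fun h => absurd hyu h.2.1) (·.1)⟩
  · obtain ⟨w, d, hd, hdu, h1, h2⟩ := hT.exists_branch (hT.rooted.mem_of_mem_children hc) hyS hyu
    rw [hT.mem_seriesAbove_iff hd (hdu.trans (isAncestor_child hc)) h1 h2,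
      hT.mem_seriesAbove_iff hd hdu h1 h2]
    exact ⟨.inl, fun h => h.elim id (fun h => absurd h.2.1 hyu)⟩

end IsCotreeOf

end LabelledTree

/-! ### Cographs -/

/-- The six adjacency conditions already force the four vertices to be distinct, so no injectivity
has to be carried along. -/
theorem isCograph_iff {V : Type*} {G : SimpleGraph V} :
    IsCograph G ↔ ∀ a b c d, G.Adj a b → G.Adj b c → G.Adj c d → ¬ G.Adj a c → ¬ G.Adj a d →
      ¬ G.Adj b d → False := by
  constructor
  · intro h a b c d hab hbc hcd hac had hbd
    have hba := hab.symm
    have hcb := hbc.symm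
    have hdc := hcd.symm
    have hca : ¬ G.Adj c a := fun h => hac h.symm
    have hda : ¬ G.Adj d a := fun h => had h.symm
    have hdb : ¬ G.Adj d b := fun h => hbd h.symm
    have nab := hab.ne
    have nbc := hbc.ne
    have ncd := hcd.ne
    have nac : a ≠ c := by rintro rfl; exact had hcd
    have nad : a ≠ d := by rintro rfl; exact hac hcd.symm
    have nbd : b ≠ d := by rintro rfl; exact had hab
    refine h.false ⟨⟨![a, b, c, d], ?_⟩, ?_⟩
    · intro i j hij
      fin_cases i <;> fin_cases j <;> simp_all
    · intro i j
      change G.Adj (![a, b, c, d] i) (![a, b, c, d] j) ↔ _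
      fin_cases i <;> fin_cases j <;> simp_all [SimpleGraph.pathGraph_adj]
  · intro h
    refine ⟨fun f => ?_⟩
    have key : ∀ i j : Fin 4, G.Adj (f i) (f j) ↔ (i.val + 1 = j.val ∨ j.val + 1 = i.val) :=
      fun i j => f.map_rel_iff.trans SimpleGraph.pathGraph_adj
    refine h (f 0) (f 1) (f 2) (f 3) ?_ ?_ ?_ ?_ ?_ ?_ <;> rw [key] <;> decide

/-- Four vertices that can be separated by a uniform cut do not induce a path. -/
theorem not_path_of_cut {V : Type*} {G : SimpleGraph V} (P : V → Prop) (β : Prop) {a b c d : V}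
    (hP : P a ∨ P b ∨ P c ∨ P d) (hP' : ¬ (P a ∧ P b ∧ P c ∧ P d))
    (h : ∀ p ∈ [a, b, c, d], ∀ q ∈ [a, b, c, d], P p → ¬ P q → (G.Adj p q ↔ β))
    (hab : G.Adj a b) (hbc : G.Adj b c) (hcd : G.Adj c d) (hac : ¬ G.Adj a c)
    (had : ¬ G.Adj a d) (hbd : ¬ G.Adj b d) : False := by
  have hba := hab.symm
  have hcb := hbc.symm
  have hdc := hcd.symm
  have hca : ¬ G.Adj c a := fun h => hac h.symm
  have hda : ¬ G.Adj d a := fun h => had h.symm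
  have hdb : ¬ G.Adj d b := fun h => hbd h.symm
  have h1 := h a (by simp) b (by simp)
  have h2 := h a (by simp) c (by simp)
  have h3 := h a (by simp) d (by simp)
  have h4 := h b (by simp) a (by simp)
  have h5 := h b (by simp) c (by simp)
  have h6 := h b (by simp) d (by simp)
  have h7 := h c (by simp) a (by simp)
  have h8 := h c (by simp) b (by simp)
  have h9 := h c (by simp) d (by simp)
  have h10 := h d (by simp) a (by simp)
  have h11 := h d (by simp) b (by simp)
  have h12 := h d (by simp) c (by simp)
  clear h
  -- The path on four vertices and its complement are both connected, so each nontrivial cut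
  -- contains an edge and a non-edge; this is checked for all cuts.
  by_cases pa : P a <;> by_cases pb : P b <;> by_cases pc : P c <;> by_cases pd : P d <;>
    by_cases hβ : β <;> simp_all

/-- Four vertices of `addVertex (H.induce S) M` among which is the new one do not induce a path if
they can be separated by a uniform cut. -/
theorem not_path_addVertex {V : Type*} {H : SimpleGraph V} {S M : Set V} (Q : V → Prop) (β : Prop)
    {a b c d : Option S} (hx : none ∈ [a, b, c, d])
    (hQ : ∃ y : S, some y ∈ [a, b, c, d] ∧ ¬ Q y)
    (h1 : ∀ y : S, some y ∈ [a, b, c, d] → ¬ Q y → (y.val ∈ M ↔ β))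
    (h2 : ∀ z y : S, some z ∈ [a, b, c, d] → some y ∈ [a, b, c, d] → Q z → ¬ Q y → (H.Adj z y ↔ β))
    (hab : (addVertex (H.induce S) (Subtype.val ⁻¹' M)).Adj a b)
    (hbc : (addVertex (H.induce S) (Subtype.val ⁻¹' M)).Adj b c)
    (hcd : (addVertex (H.induce S) (Subtype.val ⁻¹' M)).Adj c d)
    (hac : ¬ (addVertex (H.induce S) (Subtype.val ⁻¹' M)).Adj a c)
    (had : ¬ (addVertex (H.induce S) (Subtype.val ⁻¹' M)).Adj a d)
    (hbd : ¬ (addVertex (H.induce S) (Subtype.val ⁻¹' M)).Adj b d) : False := by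
  -- The new vertex satisfies the predicate vacuously, so it lies on the same side of the cut as the
  -- vertices in `Q`.
  refine not_path_of_cut (fun v : Option S => ∀ y : S, v = some y → Q y) β ?_ ?_ ?_
    hab hbc hcd hac had hbd
  · simp only [List.mem_cons, List.not_mem_nil, or_false] at hx
    rcases hx with rfl | rfl | rfl | rfl <;> simp
  · rintro ⟨pa, pb, pc, pd⟩
    obtain ⟨y, hy, hQy⟩ := hQ
    simp only [List.mem_cons, List.not_mem_nil, or_false] at hy
    rcases hy with hy | hy | hy | hy
    · exact hQy (pa y hy.symm)
    · exact hQy (pb y hy.symm)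
    · exact hQy (pc y hy.symm)
    · exact hQy (pd y hy.symm)
  · rintro p hp q hq hPp hPq
    push Not at hPq
    obtain ⟨y, rfl, hQy⟩ := hPq
    cases p with
    | none => exact h1 y hq hQy
    | some z => exact h2 z y hp hq (hPp z rfl) hQy

namespace LabelledTree

variable {n : ℕ} {T : LabelledTree n} {H : SimpleGraph (Fin n)} {S : Set (Fin n)}
  {u v c d : ℕ} {y : Fin n}

namespace IsCotreeOf

variable (hT : T.IsCotreeOf H S)
include hT

/-- The form of `exists_branch` for several vertices at once: `w` is the lowest node over `u` that
has all of `X` below it. -/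
theorem exists_branch_set (hu : u ∈ T.nodes) {X : Set (Fin n)} (hX : X ⊆ S)
    (hXu : ¬ X ⊆ T.below u) :
    ∃ w, ∃ c ∈ T.children w, T.IsAncestor c u ∧ X ⊆ T.below w ∧ ¬ X ⊆ T.below c := by
  revert hXu
  refine hT.rooted.parent_induction (P := fun u => ¬ X ⊆ T.below u → ∃ w, ∃ c ∈ T.children w,
    T.IsAncestor c u ∧ X ⊆ T.below w ∧ ¬ X ⊆ T.below c) ?_ ?_ u hu
  · intro h
    exact absurd (hT.below_root ▸ hX) h
  · intro u hu c hc ih hyc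
    by_cases h : X ⊆ T.below u
    · exact ⟨u, c, hc, .refl _, h, hyc⟩
    · obtain ⟨w, d, hd, hdu, h1, h2⟩ := ih h
      exact ⟨w, d, hd, hdu.trans (isAncestor_child hc), h1, h2⟩

/-- Inserting a vertex at its insertion node, or with an empty or complete neighbourhood, preserves
cographs. -/
theorem isCograph_addVertex (hH : IsCograph (H.induce S)) {M : Set (Fin n)}
    (hM : M = ∅ ∨ M = S ∨ ∃ u, T.IsInsertionNode M u) :
    IsCograph (addVertex (H.induce S) (Subtype.val ⁻¹' M)) := by
  rw [isCograph_iff]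
  intro a b c d hab hbc hcd hac had hbd
  by_cases hx : none ∈ [a, b, c, d]
  swap
  · simp only [List.mem_cons, List.not_mem_nil, or_false, not_or] at hx
    obtain ⟨a, rfl⟩ := Option.ne_none_iff_exists'.1 (Ne.symm hx.1)
    obtain ⟨b, rfl⟩ := Option.ne_none_iff_exists'.1 (Ne.symm hx.2.1)
    obtain ⟨c, rfl⟩ := Option.ne_none_iff_exists'.1 (Ne.symm hx.2.2.1)
    obtain ⟨d, rfl⟩ := Option.ne_none_iff_exists'.1 (Ne.symm hx.2.2.2)
    exact isCograph_iff.1 hH a b c d hab hbc hcd hac had hbd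
  have hex : ∃ y : S, some y ∈ [a, b, c, d] := by
    cases a with
    | some y => exact ⟨y, by simp⟩
    | none =>
      cases b with
      | some y => exact ⟨y, by simp⟩
      | none => exact hab.elim
  obtain ⟨y0, hy0⟩ := hex
  rcases hM with rfl | rfl | ⟨u, hu, -, -, hch, hout⟩
  -- For an empty or complete neighbourhood, the cut isolates the new vertex.
  · exact not_path_addVertex (fun _ => False) False hx ⟨y0, hy0, id⟩ (by simp) (by simp)
      hab hbc hcd hac had hbd
  · exact not_path_addVertex (fun _ => False) True hx ⟨y0, hy0, id⟩ (by simp) (by simp)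
      hab hbc hcd hac had hbd
  let X : Set (Fin n) := {y | ∃ h : y ∈ S, some ⟨y, h⟩ ∈ [a, b, c, d]}
  have hXS : X ⊆ S := fun y hy => hy.1
  have hmemX : ∀ y : S, some y ∈ [a, b, c, d] → y.val ∈ X := fun y hy => ⟨y.2, hy⟩
  by_cases hXu : X ⊆ T.below u
  · -- all vertices are below the insertion node
    -- The children of `u` are full or hollow, so a vertex in `M` and one outside `M` are below
    -- different children, and the label of `u` decides their adjacency.
    have hadj : ∀ z y : S, some z ∈ [a, b, c, d] → some y ∈ [a, b, c, d] → z.val ∈ M → y.val ∉ M →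
        (H.Adj z y ↔ T.series u = true) := by
      intro z y hz hy hzM hyM
      have hne : (z.val.val) ≠ y.val.val := by
        intro h; exact hyM ((Fin.ext h : z.val = y.val) ▸ hzM)
      have hun : n ≤ u := by
        by_contra hlt
        have h1 := hXu (hmemX z hz)
        have h2 := hXu (hmemX y hy)
        have hb := hT.below_leaf ((hT.leaf_iff ⟨u, by omega⟩).1 hu)
        simp only at hb
        rw [hb] at h1 h2
        exact hne (by rw [h1, h2])
      obtain ⟨f, hf, hzf⟩ := (hT.mem_below_iff hun).1 (hXu (hmemX z hz))
      obtain ⟨g, hg, hyg⟩ := (hT.mem_below_iff hun).1 (hXu (hmemX y hy))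
      refine hT.adj_of_children hf hg ?_ hzf hyg
      rintro rfl
      rcases hch f hf with h | h
      · exact hyM (h hyg)
      · exact (h ▸ (⟨hzf, hzM⟩ : z.val ∈ T.below f ∩ M) : z.val ∈ (∅ : Set (Fin n)))
    -- For a series node, the new vertex and the non-members of `M` are completely joined to the
    -- members; for a parallel node, the new vertex and the members have no edges to the
    -- non-members. If the far side of the cut is empty, the new vertex alone is cut off.
    cases hs : T.series u with
    | true =>
      by_cases hall : ∃ y : S, some y ∈ [a, b, c, d] ∧ y.val ∈ M
      · refine not_path_addVertex (fun y => y ∉ M) True hx ?_ ?_ ?_ hab hbc hcd hac had hbd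
        · simpa using hall
        · simp
        · intro z y hz hy hzM hyM
          rw [SimpleGraph.adj_comm, hadj y z hy hz (not_not.1 hyM) hzM, hs]
          simp
      · push Not at hall
        exact not_path_addVertex (fun _ => False) False hx ⟨y0, hy0, id⟩
          (fun y hy _ => by simp [hall y hy]) (by simp) hab hbc hcd hac had hbd
    | false =>
      by_cases hall : ∃ y : S, some y ∈ [a, b, c, d] ∧ y.val ∉ M
      · refine not_path_addVertex (fun y => y ∈ M) False hx hall ?_ ?_ hab hbc hcd hac had hbd
        · simp
        · intro z y hz hy hzM hyM
          rw [hadj z y hz hy hzM hyM, hs]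
          simp
      · push Not at hall
        exact not_path_addVertex (fun _ => False) True hx ⟨y0, hy0, id⟩
          (fun y hy _ => by simp [hall y hy]) (by simp) hab hbc hcd hac had hbd
  · obtain ⟨w, e, he, heu, h1, h2⟩ := hT.exists_branch_set hu hXS hXu
    rw [Set.not_subset] at h2
    obtain ⟨y1, hy1, hy1'⟩ := h2
    -- Some vertex of the path branches off above `u`. The cut at the edge from `w` to its child `e`
    -- is uniform, with the new vertex on the side of `e`.
    refine not_path_addVertex (fun y => y ∈ T.below e) (T.series w = true) hx
      ⟨⟨y1, hy1.1⟩, hy1.2, hy1'⟩ ?_ ?_ hab hbc hcd hac had hbd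
    · intro y hy hye
      rw [hout y ((hT.leaf_iff y).2 y.2) (fun h => hye (below_mono heu h))]
      exact hT.mem_seriesAbove_iff he heu (h1 (hmemX y hy)) hye
    · intro z y hz hy hze hye
      exact hT.adj_of_child he hze (h1 (hmemX y hy)) hye

/-- A node that is neither full nor hollow has a lowest such descendant. -/
theorem exists_lowest_mixed {M : Set (Fin n)} : ∀ u ∈ T.nodes, (T.below u ∩ M).Nonempty →
    ¬ T.below u ⊆ M → ∃ v ∈ T.nodes, (T.below v ∩ M).Nonempty ∧ ¬ T.below v ⊆ M ∧
      ∀ c ∈ T.children v, T.below c ⊆ M ∨ T.below c ∩ M = ∅ := by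
  refine hT.rooted.child_induction fun u hu ih h1 h2 => ?_
  by_cases h : ∀ c ∈ T.children u, T.below c ⊆ M ∨ T.below c ∩ M = ∅
  · exact ⟨u, hu, h1, h2, h⟩
  · push Not at h
    obtain ⟨c, hc, h3, h4⟩ := h
    exact ih c hc h4 h3

theorem internal_of_mixed {M : Set (Fin n)} (hu : u ∈ T.nodes)
    (h1 : (T.below u ∩ M).Nonempty) (h2 : ¬ T.below u ⊆ M) : n ≤ u := by
  by_contra hlt
  have hb := hT.below_leaf ((hT.leaf_iff ⟨u, by omega⟩).1 hu)
  simp only at hb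
  rw [hb] at h1 h2
  obtain ⟨y, hy, hyM⟩ := h1
  exact h2 (by rw [← Set.mem_singleton_iff.1 hy]; simpa using hyM)

/-- If inserting a vertex preserves cographs, then there is an insertion node, unless the
neighbourhood is empty or complete. -/
theorem exists_isInsertionNode {M : Set (Fin n)} (hMS : M ⊆ S) (hM : M.Nonempty) (hM' : M ≠ S)
    (hG : IsCograph (addVertex (H.induce S) (Subtype.val ⁻¹' M))) :
    ∃ u, T.IsInsertionNode M u := by
  have hr1 : (T.below T.root ∩ M).Nonempty := by
    rw [hT.below_root, Set.inter_eq_right.2 hMS]; exact hM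
  have hr2 : ¬ T.below T.root ⊆ M := by rw [hT.below_root]; exact fun h => hM' (hMS.antisymm h)
  obtain ⟨v, hv, h1, h2, hch⟩ := hT.exists_lowest_mixed _ hT.root_mem hr1 hr2
  refine ⟨v, hv, h1, h2, hch, fun y hyn hy => ?_⟩
  have hyS := (hT.leaf_iff y).1 hyn
  have hvn := hT.internal_of_mixed hv h1 h2
  rw [isCograph_iff] at hG
  obtain ⟨a, hav, haM⟩ := h1
  obtain ⟨b, hbv, hbM⟩ := Set.not_subset.1 h2
  have haS := hT.below_subset _ hav
  have hbS := hT.below_subset _ hbv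
  obtain ⟨f, hf, haf⟩ := (hT.mem_below_iff hvn).1 hav
  obtain ⟨g, hg, hbg⟩ := (hT.mem_below_iff hvn).1 hbv
  have hfg : f ≠ g := by
    rintro rfl
    rcases hch f hf with h | h
    · exact hbM (h hbg)
    · exact (h ▸ (⟨haf, haM⟩ : a ∈ T.below f ∩ M) : a ∈ (∅ : Set (Fin n)))
  have hab := hT.adj_of_children hf hg hfg haf hbg
  obtain ⟨w, c, hc, hcv, hyw, hyc⟩ := hT.exists_branch hv hyS hy
  rw [hT.mem_seriesAbove_iff hc hcv hyw hyc]
  have hay := hT.adj_of_child hc (below_mono hcv hav) hyw hyc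
  have hby := hT.adj_of_child hc (below_mono hcv hbv) hyw hyc
  -- if the labels of `v` and `w` agree, there is a vertex in between
  have hz : T.series v = T.series w → ∃ z ∈ S, (H.Adj z y ↔ T.series w = true) ∧
      (H.Adj a z ↔ ¬ T.series w = true) ∧ (H.Adj b z ↔ ¬ T.series w = true) := by
    intro hvw
    have hvr : v ≠ T.root := by
      rintro rfl
      exact hy (hT.below_root ▸ hyS)
    have halt := hT.alternating v hv hvn hvr
    have hvp := hT.rooted.mem_children_parent hv hvr
    have hcp : T.IsAncestor c (T.parent v) := by
      rcases hcv.eq_or_parent with rfl | h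
      · rw [hc.2.2] at halt
        exact absurd hvw halt
      · exact h
    obtain ⟨d, hd, hdv⟩ := hT.exists_other_child hvp
    obtain ⟨z, hz⟩ := hT.below_nonempty d hd.1
    have hzc : z ∈ T.below c := below_mono (hcp.trans (isAncestor_child hd)) hz
    have hlab : T.series (T.parent v) = true ↔ ¬ T.series w = true := by
      rw [hvw] at halt
      cases h1 : T.series w <;> cases h2 : T.series (T.parent v) <;> simp_all
    refine ⟨z, hT.below_subset _ hz, hT.adj_of_child hc hzc hyw hyc, ?_, ?_⟩
    · rw [hT.adj_of_children hvp hd hdv.symm hav hz, hlab]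
    · rw [hT.adj_of_children hvp hd hdv.symm hbv hz, hlab]
  by_contra hcon
  have hya := (H.adj_comm y a).trans hay
  have hyb := (H.adj_comm y b).trans hby
  -- If the membership of `y` contradicts the label of `w`, then the new vertex, `a`, `b`, `y` and,
  -- for equal labels, `z` contain an induced path. The possible paths are collected in `k1, …`; the
  -- label of `w` and the membership of `z` determine which of them is present.
  by_cases hvw : T.series v = T.series w
  · obtain ⟨z, hzS, hzy, haz, hbz⟩ := hz hvw
    have hyz := (H.adj_comm y z).trans hzy
    have hzb := (H.adj_comm z b).trans hbz
    have k1 := hG none (some ⟨a, haS⟩) (some ⟨y, hyS⟩) (some ⟨z, hzS⟩)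
    have k2 := hG none (some ⟨z, hzS⟩) (some ⟨y, hyS⟩) (some ⟨b, hbS⟩)
    have k3 := hG (some ⟨y, hyS⟩) none (some ⟨z, hzS⟩) (some ⟨b, hbS⟩)
    have k4 := hG (some ⟨y, hyS⟩) none (some ⟨a, haS⟩) (some ⟨z, hzS⟩)
    simp only [addVertex, SimpleGraph.comap_adj, Function.Embedding.subtype_apply,
      Set.mem_preimage, hay, hya, hyb, hzy, hyz, haz, hzb] at k1 k2 k3 k4
    revert hcon k1 k2 k3 k4
    by_cases hw : T.series w = true <;> by_cases hyM : y ∈ M <;> by_cases hzM : z ∈ M <;>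
      simp [hw, hyM, hzM, haM, hbM]
  · have k1 := hG none (some ⟨a, haS⟩) (some ⟨y, hyS⟩) (some ⟨b, hbS⟩)
    have k2 := hG (some ⟨y, hyS⟩) none (some ⟨a, haS⟩) (some ⟨b, hbS⟩)
    have hlab : T.series v = true ↔ ¬ T.series w = true := by
      cases h1 : T.series w <;> cases h2 : T.series v <;> simp_all
    simp only [addVertex, SimpleGraph.comap_adj, Function.Embedding.subtype_apply,
      Set.mem_preimage, hay, hya, hyb, hab, hlab] at k1 k2
    revert hcon k1 k2
    by_cases hw : T.series w = true <;> by_cases hyM : y ∈ M <;> simp [hw, hyM, haM, hbM]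

/-- From here on, completions are handled through insertion nodes alone, without induced paths. -/
theorem isConstrainedCompletion_iff (hH : IsCograph (H.induce S)) {N M : Set (Fin n)} :
    IsConstrainedCompletion H S N M ↔
      N ⊆ M ∧ M ⊆ S ∧ (M = ∅ ∨ M = S ∨ ∃ u, T.IsInsertionNode M u) := by
  refine ⟨fun ⟨h1, h2, h3⟩ => ⟨h1, h2, ?_⟩,
    fun ⟨h1, h2, h3⟩ => ⟨h1, h2, hT.isCograph_addVertex hH h3⟩⟩
  by_cases hM : M = ∅
  · exact .inl hM
  by_cases hM' : M = S
  · exact .inr (.inl hM')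
  exact .inr (.inr (hT.exists_isInsertionNode h2 (Set.nonempty_iff_ne_empty.2 hM) hM' h3))

end IsCotreeOf

/-! ### Minimal constrained completions -/

variable {n : ℕ} {T : LabelledTree n} {H : SimpleGraph (Fin n)} {S N : Set (Fin n)}
  {u v c d : ℕ} {y : Fin n}

/-- The completion anchored at `u` has insertion node `u`. -/
structure IsCandidate (T : LabelledTree n) (N : Set (Fin n)) (u : ℕ) : Prop where
  mem : u ∈ T.nodes
  outside : N \ T.below u ⊆ T.seriesAbove u
  nonhollow : (T.below u ∩ N).Nonempty
  hollow_child : ∃ c ∈ T.children u, T.below c ∩ N = ∅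

/-- A candidate at which the anchored completion is minimal. -/
structure IsMinCandidate (T : LabelledTree n) (N : Set (Fin n)) (u : ℕ) : Prop where
  cand : T.IsCandidate N u
  lowest : T.series u = true ∨ ∀ v, T.IsCandidate N v → T.IsAncestor u v → v = u

/-- At a candidate, `N` contributes nothing outside the subtree that is not joined from above
anyway. -/
theorem IsCandidate.mem_anchored_of_not_below (h : T.IsCandidate N u)
    (hy : y ∉ T.below u) : y ∈ T.anchored N u ↔ y ∈ T.seriesAbove u := by
  constructor
  · rintro ((h1 | h1) | ⟨c, hc, -, h1⟩)
    · exact h.outside ⟨h1, hy⟩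
    · exact h1
    · exact absurd (below_mono (isAncestor_child hc) h1) hy
  · exact fun h1 => .inl (.inr h1)

namespace IsCotreeOf

variable (hT : T.IsCotreeOf H S)
include hT

theorem mem_anchored_of_child (hc : c ∈ T.children u) (hy : y ∈ T.below c) :
    y ∈ T.anchored N u ↔ (T.below c ∩ N).Nonempty := by
  constructor
  · rintro ((h1 | h1) | ⟨d, hd, h1, h2⟩)
    · exact ⟨y, hy, h1⟩
    · exact absurd (below_mono (isAncestor_child hc) hy) h1.2.1
    · rwa [hT.children_eq_of_mem hc hd hy h2]
  · exact fun h => .inr ⟨c, hc, h, hy⟩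

theorem anchored_subset (hN : N ⊆ S) (u : ℕ) : T.anchored N u ⊆ S := by
  rintro y ((h1 | h1) | ⟨c, hc, -, h1⟩)
  · exact hN h1
  · exact hT.seriesAbove_subset _ h1
  · exact hT.below_subset _ h1

theorem subset_anchored (u : ℕ) : N ⊆ T.anchored N u := fun _ h => .inl (.inl h)

theorem exists_not_mem_anchored (h : T.IsCandidate N u) :
    ∃ y ∈ T.below u, y ∉ T.anchored N u := by
  obtain ⟨c, hc, hcN⟩ := h.hollow_child
  obtain ⟨y, hy⟩ := hT.below_nonempty c hc.1
  refine ⟨y, below_mono (isAncestor_child hc) hy, ?_⟩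
  rw [hT.mem_anchored_of_child hc hy, hcN]
  exact Set.not_nonempty_empty

/-- The hollow child and the vertex of `N` below `u` make `u` mixed; the other conditions hold by
the construction of the anchored set. -/
theorem isInsertionNode_anchored (h : T.IsCandidate N u) :
    T.IsInsertionNode (T.anchored N u) u := by
  refine ⟨h.mem, ?_, ?_, ?_, ?_⟩
  · obtain ⟨y, hy, hyN⟩ := h.nonhollow
    exact ⟨y, hy, hT.subset_anchored u hyN⟩
  · obtain ⟨y, hy, hyN⟩ := hT.exists_not_mem_anchored h
    exact fun h => hyN (h hy)
  · intro c hc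
    by_cases hcN : (T.below c ∩ N).Nonempty
    · exact .inl fun y hy => (hT.mem_anchored_of_child hc hy).2 hcN
    · refine .inr (Set.eq_empty_iff_forall_notMem.2 fun y hy => ?_)
      exact hcN ((hT.mem_anchored_of_child hc hy.1).1 hy.2)
  · exact fun y _ hy => h.mem_anchored_of_not_below hy

/-- The vertices that are joined to a node from above form an empty set or have an insertion node. -/
theorem exists_isInsertionNode_seriesAbove : ∀ u ∈ T.nodes,
    T.seriesAbove u = ∅ ∨ ∃ v, T.IsInsertionNode (T.seriesAbove u) v := by
  refine hT.rooted.parent_induction (.inl hT.seriesAbove_root) fun u hu c hc ih => ?_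
  -- Passing a parallel node does not change the set. Passing a series node `u` makes `u` the
  -- insertion node, with `c` as its only hollow child.
  cases hs : T.series u with
  | false =>
    have : T.seriesAbove c = T.seriesAbove u := by
      ext y
      simp [hT.mem_seriesAbove_child hc, hs]
    rwa [this]
  | true =>
    refine .inr ⟨u, hu, ?_, ?_, ?_, ?_⟩
    · obtain ⟨d, hd, hdc⟩ := hT.exists_other_child hc
      obtain ⟨y, hy⟩ := hT.below_nonempty d hd.1
      have hyu := below_mono (isAncestor_child hd) hy
      exact ⟨y, hyu, (hT.mem_seriesAbove_child hc).2 (.inr ⟨hs, hyu, fun h =>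
        hdc (hT.children_eq_of_mem hd hc hy h)⟩)⟩
    · intro h
      obtain ⟨y, hy⟩ := hT.below_nonempty c hc.1
      exact (h (below_mono (isAncestor_child hc) hy)).2.1 hy
    · intro d hd
      by_cases hdc : d = c
      · subst hdc
        exact .inr (Set.eq_empty_iff_forall_notMem.2 fun y hy => hy.2.2.1 hy.1)
      · refine .inl fun y hy => (hT.mem_seriesAbove_child hc).2 (.inr ⟨hs,
          below_mono (isAncestor_child hd) hy, fun h =>
          hdc (hT.children_eq_of_mem hd hc hy h)⟩)
    · intro y _ hy
      rw [hT.mem_seriesAbove_child hc]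
      simp [hy]

variable (hH : IsCograph (H.induce S)) (hN : N ⊆ S)

include hH hN

theorem isConstrainedCompletion_anchored (h : T.IsCandidate N u) :
    IsConstrainedCompletion H S N (T.anchored N u) :=
  (hT.isConstrainedCompletion_iff hH).2 ⟨hT.subset_anchored u, hT.anchored_subset hN u,
    .inr (.inr ⟨u, hT.isInsertionNode_anchored h⟩)⟩

theorem isConstrainedCompletion_univ : IsConstrainedCompletion H S N S :=
  (hT.isConstrainedCompletion_iff hH).2 ⟨hN, subset_rfl, .inr (.inl rfl)⟩

omit hH hN in
/-- Below a parallel candidate, the anchored completions are smaller. -/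
theorem anchored_ssubset (hu : T.IsCandidate N u) (hv : T.IsCandidate N v)
    (huv : T.IsAncestor u v) (hne : v ≠ u) (hs : T.series u = false) :
    T.anchored N v ⊂ T.anchored N u := by
  obtain ⟨c, hc, hcv⟩ := hT.rooted.exists_child hv.mem huv hne.symm
  have hcN : (T.below c ∩ N).Nonempty :=
    hv.nonhollow.mono (Set.inter_subset_inter_left _ (below_mono hcv))
  have hsub : T.below c ⊆ T.anchored N u := fun y hy => (hT.mem_anchored_of_child hc hy).2 hcN
  refine ⟨fun y hy => ?_, fun h => ?_⟩
  · by_cases hyc : y ∈ T.below c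
    · exact hsub hyc
    -- Such a vertex is joined to `v` from above. It cannot branch off at `u`, which is parallel, so
    -- it branches off higher up and is joined to `u` as well.
    have hyv : y ∉ T.below v := fun h => hyc (below_mono hcv h)
    rw [hv.mem_anchored_of_not_below hyv] at hy
    by_cases hyu : y ∈ T.below u
    · rw [hT.mem_seriesAbove_iff hc hcv hyu hyc, hs] at hy
      cases hy
    · obtain ⟨w, d, hd, hdu, h1, h2⟩ := hT.exists_branch hu.mem (hT.seriesAbove_subset _ hy) hyu
      rw [hT.mem_seriesAbove_iff hd (hdu.trans huv) h1 h2] at hy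
      rw [hu.mem_anchored_of_not_below hyu, hT.mem_seriesAbove_iff hd hdu h1 h2]
      exact hy
  · obtain ⟨y, hy, hyN⟩ := hT.exists_not_mem_anchored hv
    exact hyN (h (hsub (below_mono hcv hy)))

omit hH in
/-- The completions anchored at different minimal candidates are incomparable. -/
theorem eq_of_anchored_subset (hu : T.IsMinCandidate N u) (hv : T.IsMinCandidate N v)
    (h : T.anchored N u ⊆ T.anchored N v) : u = v := by
  by_contra hne
  obtain ⟨y, hy, hyN⟩ := hT.exists_not_mem_anchored hv.cand
  -- If `u` is above `v`, the completion at `u` contains everything below its child towards `v`, in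
  -- particular the vertex `y` that is missing at `v`.
  by_cases huv : T.IsAncestor u v
  · obtain ⟨c, hc, hcv⟩ := hT.rooted.exists_child hv.cand.mem huv hne
    refine hyN (h ((hT.mem_anchored_of_child hc (below_mono hcv hy)).2 ?_))
    exact hv.cand.nonhollow.mono (Set.inter_subset_inter_left _ (below_mono hcv))
  by_cases hvu : T.IsAncestor v u
  -- If `v` is above `u`, minimality makes `v` a series node. Its hollow child is then joined to `u`
  -- from above, but is not in the completion at `v`.
  · rcases hv.lowest with hs | hs
    swap
    · exact hne (hs u hu.cand hvu)
    obtain ⟨c, hc, hcu⟩ := hT.rooted.exists_child hu.cand.mem hvu (Ne.symm hne)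
    obtain ⟨d, hd, hdN⟩ := hv.cand.hollow_child
    obtain ⟨z, hz⟩ := hT.below_nonempty d hd.1
    have hdc : d ≠ c := by
      rintro rfl
      obtain ⟨z, hz, hzN⟩ := hu.cand.nonhollow
      exact (hdN ▸ (⟨below_mono hcu hz, hzN⟩ : z ∈ T.below d ∩ N) : z ∈ (∅ : Set (Fin n)))
    have hzv := below_mono (isAncestor_child hd) hz
    have hzc : z ∉ T.below c := fun h => hdc (hT.children_eq_of_mem hd hc hz h)
    have hzu : z ∈ T.anchored N u := .inl (.inr ((hT.mem_seriesAbove_iff hc hcu hzv hzc).2 hs))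
    have := (hT.mem_anchored_of_child hd hz).1 (h hzu)
    rw [hdN] at this
    exact Set.not_nonempty_empty this
  -- For incomparable nodes, a vertex `z` of `N` below `v` must be joined to `u` at a series node;
  -- the whole subtree of `v`, and `y` in it, hangs off the same branch.
  · obtain ⟨z, hz, hzN⟩ := hv.cand.nonhollow
    have hzu : z ∉ T.below u := fun h' => (hz.2.total h'.2).elim hvu huv
    obtain ⟨w, c, hc, hcu, h1, h2⟩ := hT.exists_branch hu.cand.mem (hN hzN) hzu
    have hs := (hT.mem_seriesAbove_iff hc hcu h1 h2).1 (hu.cand.outside ⟨hzN, hzu⟩)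
    have hwv : T.IsAncestor w v := (h1.2.total hz.2).resolve_right
      fun h' => hvu ((h'.trans (isAncestor_child hc)).trans hcu)
    have hyc : y ∉ T.below c := fun h' => (h'.2.total hy.2).elim
      (fun h'' => h2 (below_mono h'' hz)) (fun h'' => hvu (h''.trans hcu))
    exact hyN (h (.inl (.inr ((hT.mem_seriesAbove_iff hc hcu (below_mono hwv hy) hyc).2 hs))))

/-- Suppose `M` has an insertion node `u`. If some vertex of `N` is below `u`, then `u` is a
candidate and `M` contains, hence equals, the completion anchored there. If not, `T.seriesAbove u`
alone is a smaller completion, since it is empty or has an insertion node itself. -/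
theorem isMinCandidate_of_minimal (hne : N.Nonempty) {M : Set (Fin n)}
    (hM : IsMinimalConstrainedCompletion H S N M) :
    (∃ u, T.IsMinCandidate N u ∧ M = T.anchored N u) ∨ ((∀ u, ¬ T.IsCandidate N u) ∧ M = S) := by
  obtain ⟨h1, h2, h3⟩ := (hT.isConstrainedCompletion_iff hH).1 hM.1
  have hMne : M.Nonempty := hne.mono h1
  rcases h3 with rfl | rfl | ⟨u, hu⟩
  · exact absurd hMne Set.not_nonempty_empty
  · refine .inr ⟨fun u hu => ?_, rfl⟩
    obtain ⟨y, hy, hyN⟩ := hT.exists_not_mem_anchored hu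
    exact hyN (hM.2 (hT.isConstrainedCompletion_anchored hH hN hu) (hT.anchored_subset hN u)
      (hT.below_subset _ hy))
  obtain ⟨hu0, hu1, hu2, hu3, hu4⟩ := hu
  have hun := hT.internal_of_mixed hu0 hu1 hu2
  by_cases huN : (T.below u ∩ N).Nonempty
  · have hc : T.IsCandidate N u := by
      refine ⟨hu0, fun y hy => ?_, huN, ?_⟩
      · exact (hu4 y ((hT.leaf_iff y).2 (hN hy.1)) hy.2).1 (h1 hy.1)
      · obtain ⟨y, hy, hyM⟩ := Set.not_subset.1 hu2
        obtain ⟨c, hc, hyc⟩ := (hT.mem_below_iff hun).1 hy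
        refine ⟨c, hc, ?_⟩
        have := (hu3 c hc).resolve_left fun h => hyM (h hyc)
        exact Set.subset_empty_iff.1 (this ▸ Set.inter_subset_inter_right _ h1)
    have hsub : T.anchored N u ⊆ M := by
      rintro y ((hy | hy) | ⟨c, hc, ⟨z, hz, hzN⟩, hy⟩)
      · exact h1 hy
      · exact (hu4 y hy.1 hy.2.1).2 hy
      · refine ((hu3 c hc).resolve_right fun h => ?_) hy
        exact (h ▸ (⟨hz, h1 hzN⟩ : z ∈ T.below c ∩ M) : z ∈ (∅ : Set (Fin n)))
    have heq : M = T.anchored N u :=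
      (hM.2 (hT.isConstrainedCompletion_anchored hH hN hc) hsub).antisymm hsub
    refine .inl ⟨u, ⟨hc, ?_⟩, heq⟩
    cases hs : T.series u with
    | true => exact .inl rfl
    | false =>
      refine .inr fun v hv huv => ?_
      by_contra hvu
      have hlt := hT.anchored_ssubset hc hv huv hvu hs
      exact hlt.2 (heq ▸ hM.2 (hT.isConstrainedCompletion_anchored hH hN hv) (heq ▸ hlt.1))
  · exfalso
    have hNu : N ⊆ T.seriesAbove u := fun y hy =>
      (hu4 y ((hT.leaf_iff y).2 (hN hy)) fun h => huN ⟨y, h, hy⟩).1 (h1 hy)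
    have hsub : T.seriesAbove u ⊆ M := fun y hy => (hu4 y hy.1 hy.2.1).2 hy
    have hcc : IsConstrainedCompletion H S N (T.seriesAbove u) := by
      refine (hT.isConstrainedCompletion_iff hH).2 ⟨hNu, hT.seriesAbove_subset u, ?_⟩
      rcases hT.exists_isInsertionNode_seriesAbove u hu0 with h | h
      · exact .inl h
      · exact .inr (.inr h)
    obtain ⟨y, hy, hyM⟩ := hu1
    exact (hM.2 hcc hsub hyM).2.1 hy

theorem exists_minimal_subset {M : Set (Fin n)} (hM : IsConstrainedCompletion H S N M) :
    ∃ M' ⊆ M, IsMinimalConstrainedCompletion H S N M' := by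
  obtain ⟨M', h1, h2⟩ := exists_minimal_le_of_wellFoundedLT (IsConstrainedCompletion H S N) M hM
  exact ⟨M', h1, h2⟩

/-- The minimal constrained completions of a nonempty neighbourhood. -/
theorem isMinimalConstrainedCompletion_iff (hne : N.Nonempty) {M : Set (Fin n)} :
    IsMinimalConstrainedCompletion H S N M ↔ (∃ u, T.IsMinCandidate N u ∧ M = T.anchored N u) ∨
        ((∀ u, ¬ T.IsCandidate N u) ∧ M = S) := by
  refine ⟨hT.isMinCandidate_of_minimal hH hN hne, ?_⟩
  rintro (⟨u, hu, rfl⟩ | ⟨hno, rfl⟩)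
  -- Any smaller completion contains a minimal one; that one is anchored at a minimal candidate, and
  -- such completions are pairwise incomparable.
  · refine ⟨hT.isConstrainedCompletion_anchored hH hN hu.cand, fun M hM hsub => ?_⟩
    obtain ⟨M', hM', hmin⟩ := hT.exists_minimal_subset hH hN hM
    rcases hT.isMinCandidate_of_minimal hH hN hne hmin with ⟨v, hv, rfl⟩ | ⟨hno, -⟩
    · rw [← hT.eq_of_anchored_subset hN hv hu (hM'.trans hsub)]
      exact hM'
    · exact absurd hu.cand (hno u)
  · obtain ⟨M', hM', hmin⟩ := hT.exists_minimal_subset hH hN (hT.isConstrainedCompletion_univ hH hN)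
    rcases hT.isMinCandidate_of_minimal hH hN hne hmin with ⟨v, hv, rfl⟩ | ⟨-, rfl⟩
    · exact absurd hv.cand (hno v)
    · exact hmin

omit hN in
theorem isMinimalConstrainedCompletion_empty_iff {M : Set (Fin n)} :
    IsMinimalConstrainedCompletion H S ∅ M ↔ M = ∅ := by
  have h0 : IsConstrainedCompletion H S ∅ ∅ :=
    (hT.isConstrainedCompletion_iff hH).2 ⟨subset_rfl, Set.empty_subset _, .inl rfl⟩
  constructor
  · exact fun h => Set.subset_empty_iff.1 (h.2 h0 (Set.empty_subset _))
  · rintro rfl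
    exact ⟨h0, fun M _ _ => Set.empty_subset M⟩

/-- An empty list of minimal candidates therefore certifies that there is no candidate, and that the
complete neighbourhood is the only completion. -/
theorem exists_isMinCandidate (hne : N.Nonempty) (hu : T.IsCandidate N u) :
    ∃ v, T.IsMinCandidate N v := by
  obtain ⟨M', hM', hmin⟩ := hT.exists_minimal_subset hH hN (hT.isConstrainedCompletion_univ hH hN)
  rcases hT.isMinCandidate_of_minimal hH hN hne hmin with ⟨v, hv, rfl⟩ | ⟨hno, -⟩
  · exact ⟨v, hv⟩
  · exact absurd hu (hno u)

omit hH hN in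
/-- If no node is a candidate, the completion anchored at the root is complete. -/
theorem anchored_root_eq (hN : N ⊆ S) (hne : N.Nonempty) (hno : ∀ u, ¬ T.IsCandidate N u) :
    T.anchored N T.root = S := by
  refine (hT.anchored_subset hN _).antisymm fun y hy => ?_
  by_cases hr : T.root < n
  · have hb := hT.below_leaf ((hT.leaf_iff ⟨T.root, hr⟩).1 hT.root_mem)
    simp only at hb
    rw [hT.below_root] at hb
    obtain ⟨z, hz⟩ := hne
    have : y = z := by
      have h1 := hb ▸ hy
      have h2 := hb ▸ hN hz
      rw [Set.mem_singleton_iff] at h1 h2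
      rw [h1, h2]
    exact hT.subset_anchored _ (this ▸ hz)
  · obtain ⟨c, hc, hyc⟩ := (hT.mem_below_iff (by omega)).1 (hT.below_root ▸ hy)
    rw [hT.mem_anchored_of_child hc hyc]
    by_contra hcN
    refine hno T.root ⟨hT.root_mem, fun z hz => ?_, ?_, c, hc, Set.not_nonempty_iff_eq_empty.1 hcN⟩
    · exact absurd (hT.below_root ▸ hN hz.1) hz.2
    · rw [hT.below_root, Set.inter_eq_right.2 hN]
      exact hne

omit hH hN in
theorem anchored_empty_root : T.anchored ∅ T.root = ∅ := by
  simp [anchored, hT.seriesAbove_root]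

end IsCotreeOf

/-! ### Counting -/

variable {n : ℕ} {T : LabelledTree n} {H : SimpleGraph (Fin n)} {S N : Set (Fin n)}
  {u v c d : ℕ} {y : Fin n}

/-- The vertices below the non-hollow children of `u`. -/
def nonhollowPart (T : LabelledTree n) (N : Set (Fin n)) (u : ℕ) : Set (Fin n) :=
  {y | ∃ c ∈ T.children u, (T.below c ∩ N).Nonempty ∧ y ∈ T.below c}

theorem nonhollowPart_subset (u : ℕ) : T.nonhollowPart N u ⊆ T.below u := by
  rintro y ⟨c, hc, -, hy⟩
  exact below_mono (isAncestor_child hc) hy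

theorem anchored_eq (hu : n ≤ u) (hT : T.IsCotreeOf H S)
    (h : N \ T.below u ⊆ T.seriesAbove u) :
    T.anchored N u = T.seriesAbove u ∪ T.nonhollowPart N u := by
  ext y
  constructor
  · rintro ((hy | hy) | hy)
    · by_cases hyu : y ∈ T.below u
      · obtain ⟨c, hc, hyc⟩ := (hT.mem_below_iff hu).1 hyu
        exact .inr ⟨c, hc, ⟨y, hyc, hy⟩, hyc⟩
      · exact .inl (h ⟨hy, hyu⟩)
    · exact .inl hy
    · exact .inr hy
  · rintro (hy | hy)
    · exact .inl (.inr hy)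
    · exact .inr hy

namespace IsCotreeOf

variable (hT : T.IsCotreeOf H S)
include hT

/-- The two summands are the values that the program keeps in `aSA` and `aNh`, so the cost of a
candidate is available in constant time. -/
theorem ncard_anchored (hu : n ≤ u) (h : N \ T.below u ⊆ T.seriesAbove u) :
    (T.anchored N u).ncard = (T.seriesAbove u).ncard + (T.nonhollowPart N u).ncard := by
  rw [anchored_eq hu hT h, Set.ncard_union_eq]
  exact (hT.seriesAbove_disjoint u).mono_right (nonhollowPart_subset u)

theorem ncard_anchored_diff (u : ℕ) :
    (T.anchored N u \ N).ncard = (T.anchored N u).ncard - N.ncard :=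
  Set.ncard_sdiff (hT.subset_anchored u)

/-- A hollow child has a nonempty cluster that the non-hollow part misses. No child list has to be
searched: two leaf counts are compared. -/
theorem hollow_child_iff (hu : n ≤ u) : (∃ c ∈ T.children u, T.below c ∩ N = ∅) ↔
      (T.nonhollowPart N u).ncard < (T.below u).ncard := by
  constructor
  · rintro ⟨c, hc, hcN⟩
    refine Set.ncard_lt_ncard ⟨nonhollowPart_subset u, fun h => ?_⟩
    obtain ⟨y, hy⟩ := hT.below_nonempty c hc.1
    obtain ⟨d, hd, hdN, hyd⟩ := h (below_mono (isAncestor_child hc) hy)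
    rw [hT.children_eq_of_mem hd hc hyd hy, hcN] at hdN
    exact Set.not_nonempty_empty hdN
  · intro h
    by_contra hno
    push Not at hno
    refine absurd (Set.ncard_le_ncard (s := T.below u) (t := T.nonhollowPart N u) fun y hy => ?_)
      (by omega)
    obtain ⟨c, hc, hyc⟩ := (hT.mem_below_iff hu).1 hy
    exact ⟨c, hc, hno c hc, hyc⟩

theorem ncard_seriesAbove_child (hc : c ∈ T.children u) :
    (T.seriesAbove c).ncard = (T.seriesAbove u).ncard +
      if T.series u = true then (T.below u).ncard - (T.below c).ncard else 0 := by
  have hsub : T.below c ⊆ T.below u := below_mono (isAncestor_child hc)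
  split_ifs with hs
  · have : T.seriesAbove c = T.seriesAbove u ∪ (T.below u \ T.below c) := by
      ext y
      simp [hT.mem_seriesAbove_child hc, hs]
    rw [this, Set.ncard_union_eq, Set.ncard_sdiff hsub]
    exact (hT.seriesAbove_disjoint u).mono_right Set.sdiff_subset
  · congr 1
    ext y
    simp [hT.mem_seriesAbove_child hc, hs]

theorem below_subset_nonhollowPart (hc : c ∈ T.children u)
    (hcN : (T.below c ∩ N).Nonempty) : T.below c ⊆ T.nonhollowPart N u :=
  fun _ hy => ⟨c, hc, hcN, hy⟩

/-- At a series node the siblings of `c` are joined to it, so they impose nothing. At a parallel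
node they are not, so `c` must be the only non-hollow child, which is a comparison of leaf counts.
-/
theorem outside_child_iff (hc : c ∈ T.children u) (hcN : (T.below c ∩ N).Nonempty) :
    N \ T.below c ⊆ T.seriesAbove c ↔ N \ T.below u ⊆ T.seriesAbove u ∧
      (T.series u = true ∨ (T.nonhollowPart N u).ncard = (T.below c).ncard) := by
  have hsub : T.below c ⊆ T.below u := below_mono (isAncestor_child hc)
  have hun := hT.internal_of_child hc
  constructor
  · intro h
    refine ⟨fun y hy => ?_, ?_⟩
    · have := (hT.mem_seriesAbove_child hc).1 (h ⟨hy.1, fun h => hy.2 (hsub h)⟩)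
      exact this.resolve_right fun h => hy.2 h.2.1
    · refine or_iff_not_imp_left.2 fun hs => ?_
      congr 1
      refine Set.Subset.antisymm ?_ (hT.below_subset_nonhollowPart hc hcN)
      rintro y ⟨d, hd, ⟨z, hz, hzN⟩, hyd⟩
      by_cases hdc : d = c
      · exact hdc ▸ hyd
      have hzc : z ∉ T.below c := fun h => hdc (hT.children_eq_of_mem hd hc hz h)
      rcases (hT.mem_seriesAbove_child hc).1 (h ⟨hzN, hzc⟩) with h | h
      · exact absurd (below_mono (isAncestor_child hd) hz) h.2.1
      · exact absurd h.1 hs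
  · rintro ⟨h1, h2⟩ y ⟨hyN, hyc⟩
    rw [hT.mem_seriesAbove_child hc]
    by_cases hyu : y ∈ T.below u
    · rcases h2 with h2 | h2
      · exact .inr ⟨h2, hyu, hyc⟩
      · have heq := Set.eq_of_subset_of_ncard_le (hT.below_subset_nonhollowPart hc hcN) h2.le
        obtain ⟨d, hd, hyd⟩ := (hT.mem_below_iff hun).1 hyu
        have : y ∈ T.nonhollowPart N u := ⟨d, hd, ⟨y, hyd, hyN⟩, hyd⟩
        exact absurd (heq ▸ this) hyc
    · exact .inl (h1 ⟨hyN, hyu⟩)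

open Classical in
/-- A set of `k` vertices contains at most `2 k` clusters of the tree. -/
theorem card_full_le (M : Set (Fin n)) :
    (T.nodes.filter fun v => T.below v ⊆ M).card ≤ 2 * M.ncard := by
  set X := T.nodes.filter fun v => T.below v ⊆ M with hX
  have hsplit := Finset.card_filter_add_card_filter_not (s := X) (fun v => v < n)
  have hleaf : (X.filter fun v => v < n).card ≤ M.ncard := by
    rw [Set.ncard_eq_toFinset_card']
    refine (Finset.card_le_card_of_injOn (t := M.toFinset.map Fin.valEmbedding) id ?_
      (Set.injOn_id _)).trans (Finset.card_map _).le
    intro v hv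
    simp only [Finset.coe_filter, hX, mem_filter, Set.mem_ofPred_eq] at hv
    simp only [id, Finset.coe_map, Set.coe_toFinset]
    refine ⟨⟨v, hv.2⟩, hv.1.2 ?_, rfl⟩
    exact hT.mem_below_self ((hT.leaf_iff ⟨v, hv.2⟩).1 hv.1.1)
  -- Double counting: every internal node in `X` has at least two children, all of them in `X`, and
  -- a node has only one parent. Together with the bound on the leaves this gives the factor `2`.
  have hint : 2 * (X.filter fun v => ¬ v < n).card ≤ X.card := by
    set Y := X.filter (fun c => c ≠ T.root ∧ T.parent c ∈ X.filter fun v => ¬ v < n) with hY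
    have h1 : Y.card = ∑ b ∈ X.filter (fun v => ¬ v < n), (Y.filter (T.parent · = b)).card :=
      Finset.card_eq_sum_card_fiberwise fun c hc => (mem_filter.1 hc).2.2
    have h2 : ∀ b ∈ X.filter (fun v => ¬ v < n), 2 ≤ (Y.filter (T.parent · = b)).card := by
      intro b hb
      have hb' := hb
      simp only [hX, mem_filter] at hb'
      obtain ⟨c, hc, d, hd, hcd⟩ := hT.children_internal b hb'.1.1 (by omega)
      have hmem : ∀ e ∈ T.children b, e ∈ Y.filter (T.parent · = b) := by
        intro e he
        refine mem_filter.2 ⟨mem_filter.2 ⟨mem_filter.2 ⟨he.1, ?_⟩, he.2.1, ?_⟩,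
          he.2.2⟩
        · exact (below_mono (isAncestor_child he)).trans hb'.1.2
        · rw [he.2.2]; exact hb
      exact Finset.one_lt_card.2 ⟨c, hmem c hc, d, hmem d hd, hcd⟩
    calc 2 * (X.filter fun v => ¬ v < n).card
        = ∑ b ∈ X.filter (fun v => ¬ v < n), 2 := by simp [mul_comm]
      _ ≤ _ := Finset.sum_le_sum h2
      _ = Y.card := h1.symm
      _ ≤ X.card := Finset.card_le_card (Finset.filter_subset _ _)
  omega

open Classical in
theorem ancestors_child (hc : c ∈ T.children u) :
    (T.nodes.filter (T.IsAncestor · c)).card = (T.nodes.filter (T.IsAncestor · u)).card + 1 := by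
  have : T.nodes.filter (T.IsAncestor · c) = insert c (T.nodes.filter (T.IsAncestor · u)) := by
    ext v
    simp only [mem_filter, mem_insert]
    constructor
    · rintro ⟨h1, h2⟩
      rcases h2.eq_or_parent with h | h
      · exact .inl h
      · exact .inr ⟨h1, hc.2.2 ▸ h⟩
    · rintro (rfl | ⟨h1, h2⟩)
      · exact ⟨hc.1, .refl _⟩
      · exact ⟨h1, h2.trans (isAncestor_child hc)⟩
  rw [this, Finset.card_insert_of_notMem]
  intro h
  exact hT.rooted.not_isAncestor_of_mem_children hc (mem_filter.1 h).2

open Classical in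
theorem ancestors_root : (T.nodes.filter (T.IsAncestor · T.root)).card = 1 := by
  rw [Finset.card_eq_one]
  refine ⟨T.root, ?_⟩
  ext v
  simp only [mem_filter, Finset.mem_singleton]
  exact ⟨fun h => hT.rooted.eq_root_of_isAncestor h.2, fun h => ⟨h ▸ hT.root_mem, h ▸ .refl _⟩⟩

open Classical in
/-- The depth of a node is bounded by the number of vertices joined to it from above. -/
theorem card_ancestors_le (u : ℕ) (hu : u ∈ T.nodes) :
    (T.nodes.filter (T.IsAncestor · u)).card ≤ 2 * (T.seriesAbove u).ncard + 2 := by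
  -- A parallel step adds depth without enlarging `seriesAbove`. The sharper bound after a series
  -- step, or at the root, leaves room for the one parallel step that may follow, since labels
  -- alternate.
  suffices h : ∀ u ∈ T.nodes,
      (T.nodes.filter (T.IsAncestor · u)).card ≤ 2 * (T.seriesAbove u).ncard + 2 ∧
      ((u = T.root ∨ T.series (T.parent u) = true) →
        (T.nodes.filter (T.IsAncestor · u)).card ≤ 2 * (T.seriesAbove u).ncard + 1) from
    (h u hu).1
  refine hT.rooted.parent_induction ?_ fun u hu c hc ih => ?_
  · rw [hT.ancestors_root]
    omega
  · rw [hT.ancestors_child hc, hT.ncard_seriesAbove_child hc]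
    have hun := hT.internal_of_child hc
    have hlt : (T.below c).ncard < (T.below u).ncard := Set.ncard_lt_ncard
      ⟨below_mono (isAncestor_child hc), hT.not_below_subset_of_mem_children hc⟩
    cases hs : T.series u with
    | true =>
      simp only [if_true]
      refine ⟨by have := ih.1; omega, fun _ => by have := ih.1; omega⟩
    | false =>
      have h1 : u = T.root ∨ T.series (T.parent u) = true := by
        by_cases hr : u = T.root
        · exact .inl hr
        · have := hT.alternating u hu hun hr
          rw [hs] at this
          right
          cases h : T.series (T.parent u) <;> simp_all
      have h2 := ih.2 h1
      simp only [Bool.false_eq_true, if_false]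
      refine ⟨by omega, ?_⟩
      rintro (h | h)
      · exact absurd h hc.2.1
      · rw [hc.2.2, hs] at h
        cases h

open Classical in
/-- The number of non-hollow nodes is linear in the size of any anchored completion. -/
theorem card_nonhollow_le (hN : N ⊆ S) (hu : T.IsCandidate N u) :
    (T.nodes.filter fun v => (T.below v ∩ N).Nonempty).card ≤ 4 * (T.anchored N u).ncard + 2 := by
  -- A non-hollow node not above `u` lies below a non-hollow child of `u`, or hangs off a series
  -- branch above `u` because it has a vertex of `N` below it; in both cases its cluster is
  -- contained in the completion.
  have hsub : (T.nodes.filter fun v => (T.below v ∩ N).Nonempty) ⊆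
      (T.nodes.filter fun v => T.below v ⊆ T.anchored N u) ∪ T.nodes.filter (T.IsAncestor · u) := by
    intro v hv
    rw [mem_filter] at hv
    obtain ⟨hv, hvN⟩ := hv
    rw [Finset.mem_union, mem_filter, mem_filter]
    by_cases hvu : T.IsAncestor v u
    · exact .inr ⟨hv, hvu⟩
    refine .inl ⟨hv, fun y hy => ?_⟩
    by_cases huv : T.IsAncestor u v
    · obtain ⟨c, hc, hcv⟩ := hT.rooted.exists_child hv huv (fun h => hvu (h ▸ .refl _))
      refine (hT.mem_anchored_of_child hc (below_mono hcv hy)).2 ?_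
      exact hvN.mono (Set.inter_subset_inter_left _ (below_mono hcv))
    · obtain ⟨z, hz, hzN⟩ := hvN
      have hzu : z ∉ T.below u := fun h' => (hz.2.total h'.2).elim hvu huv
      obtain ⟨w, c, hc, hcu, h1, h2⟩ := hT.exists_branch hu.mem (hN hzN) hzu
      have hs := (hT.mem_seriesAbove_iff hc hcu h1 h2).1 (hu.outside ⟨hzN, hzu⟩)
      have hwv : T.IsAncestor w v := (h1.2.total hz.2).resolve_right
        fun h' => hvu ((h'.trans (isAncestor_child hc)).trans hcu)
      have hyc : y ∉ T.below c := fun h' => (h'.2.total hy.2).elim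
        (fun h'' => h2 (below_mono h'' hz)) (fun h'' => hvu (h''.trans hcu))
      exact .inl (.inr ((hT.mem_seriesAbove_iff hc hcu (below_mono hwv hy) hyc).2 hs))
  have h1 := (Finset.card_le_card hsub).trans (Finset.card_union_le _ _)
  have h2 := hT.card_full_le (T.anchored N u)
  have h3 := hT.card_ancestors_le u hu.mem
  have h4 : (T.seriesAbove u).ncard ≤ (T.anchored N u).ncard :=
    Set.ncard_le_ncard fun y hy => .inl (.inr hy)
  omega

/-- The leaf counts of the non-hollow children of `u` add up to the size of its non-hollow part. -/
theorem sum_ncard_eq {X : Finset ℕ}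
    (hX : ∀ v, v ∈ X ↔ v ∈ T.nodes ∧ (T.below v ∩ N).Nonempty) (u : ℕ) :
    ∑ v ∈ X with (v ≠ T.root ∧ T.parent v = u), (T.below v).ncard =
      (T.nonhollowPart N u).ncard := by
  classical
  have h : T.nonhollowPart N u =
      ⋃ v ∈ (X.filter fun v => v ≠ T.root ∧ T.parent v = u), T.below v := by
    ext y
    simp only [nonhollowPart, Set.mem_ofPred_eq, Set.mem_iUnion, mem_filter, hX, children,
      exists_prop]
    constructor
    · rintro ⟨c, ⟨h1, h2, h3⟩, h4, h5⟩
      exact ⟨c, ⟨⟨h1, h4⟩, h2, h3⟩, h5⟩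
    · rintro ⟨c, ⟨⟨h1, h4⟩, h2, h3⟩, h5⟩
      exact ⟨c, ⟨h1, h2, h3⟩, h4, h5⟩
  rw [h]
  have hd : ∀ v ∈ (X.filter fun v => v ≠ T.root ∧ T.parent v = u),
      ∀ w ∈ (X.filter fun v => v ≠ T.root ∧ T.parent v = u), v ≠ w →
        Disjoint (T.below v) (T.below w) := by
    intro v hv w hw hvw
    rw [mem_filter, hX] at hv hw
    exact hT.below_disjoint ⟨hv.1.1, hv.2⟩ ⟨hw.1.1, hw.2⟩ hvw
  generalize (X.filter fun v => v ≠ T.root ∧ T.parent v = u) = Y at hd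
  induction Y using Finset.induction_on with
  | empty => simp
  | insert a s ha ih =>
    rw [Finset.sum_insert ha, Finset.set_biUnion_insert, Set.ncard_union_eq,
      ih fun v hv w hw => hd v (mem_insert_of_mem hv) w (mem_insert_of_mem hw)]
    rw [Set.disjoint_iUnion₂_right]
    exact fun v hv => hd a (Finset.mem_insert_self _ _) v (mem_insert_of_mem hv)
      (fun h => ha (h ▸ hv))

end IsCotreeOf

/-! ### Updating a cotree -/

variable {n : ℕ} {u v c d : ℕ} {y : Fin n}

/-- A local description of cotrees (without the condition that labels alternate): `B u` is the set of
vertices below the node `u`. -/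
structure IsClusterTree (T : LabelledTree n) (H : SimpleGraph (Fin n)) (S : Set (Fin n))
    (B : ℕ → Set (Fin n)) : Prop where
  root_mem : T.root ∈ T.nodes
  parent_root : T.parent T.root = T.root
  parent_mem : ∀ c ∈ T.nodes, c ≠ T.root → T.parent c ∈ T.nodes ∧ n ≤ T.parent c
  leaf : ∀ v ∈ T.nodes, v < n → ∀ y : Fin n, y ∈ B v ↔ y.val = v
  node : ∀ u ∈ T.nodes, n ≤ u → ∀ y, y ∈ B u ↔ ∃ c ∈ T.children u, y ∈ B c
  disj : ∀ u, ∀ c ∈ T.children u, ∀ d ∈ T.children u, c ≠ d → ∀ y ∈ B c, y ∉ B d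
  two : ∀ u ∈ T.nodes, n ≤ u → (T.children u).Nontrivial
  nonempty : ∀ u ∈ T.nodes, (B u).Nonempty
  adj : ∀ u, ∀ c ∈ T.children u, ∀ d ∈ T.children u, c ≠ d → ∀ v ∈ B c, ∀ w ∈ B d,
    (H.Adj v w ↔ T.series u = true)
  root_eq : B T.root = S

theorem IsCotreeOf.isClusterTree {T : LabelledTree n} {H : SimpleGraph (Fin n)}
    {S : Set (Fin n)} (hT : T.IsCotreeOf H S) : T.IsClusterTree H S T.below where
  root_mem := hT.root_mem
  parent_root := hT.parent_root
  parent_mem c hc h := ⟨hT.parent_mem c hc,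
    hT.internal_of_child (hT.rooted.mem_children_parent hc h)⟩
  leaf v hv hvn y := by
    have := hT.below_leaf ((hT.leaf_iff ⟨v, hvn⟩).1 hv)
    simp only at this
    rw [this, Set.mem_singleton_iff, Fin.ext_iff]
  node u _ hun y := hT.mem_below_iff hun
  disj u c hc d hd h y hy hy' := h (hT.children_eq_of_mem hc hd hy hy')
  two := hT.children_internal
  nonempty := hT.below_nonempty
  adj u c hc d hd h v hv w hw := hT.adj_of_children hc hd h hv hw
  root_eq := hT.below_root

namespace IsClusterTree

variable {T : LabelledTree n} {H : SimpleGraph (Fin n)} {S : Set (Fin n)} {B : ℕ → Set (Fin n)}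
  (hT : T.IsClusterTree H S B)
include hT

theorem mem_of_child (hc : c ∈ T.children u) : u ∈ T.nodes ∧ n ≤ u :=
  hc.2.2 ▸ hT.parent_mem c hc.1 hc.2.1

theorem subset_of_child (hc : c ∈ T.children u) : B c ⊆ B u := fun y hy =>
  (hT.node u (hT.mem_of_child hc).1 (hT.mem_of_child hc).2 y).2 ⟨c, hc, hy⟩

theorem not_subset_of_mem_children (hc : c ∈ T.children u) : ¬ B u ⊆ B c := by
  intro h
  obtain ⟨hu, hun⟩ := hT.mem_of_child hc
  obtain ⟨d, hd, hdc⟩ := (hT.two u hu hun).exists_ne c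
  obtain ⟨y, hy⟩ := hT.nonempty d hd.1
  exact hT.disj u d hd c hc hdc y hy (h (hT.subset_of_child hd hy))

/-- Reaching the root is not among the local axioms: clusters grow strictly from child to parent and
have at most `n` elements. -/
theorem rooted : T.IsRooted := by
  refine ⟨hT.root_mem, hT.parent_root, fun u hu => ?_, fun u hu => ?_⟩
  · by_cases h : u = T.root
    · rw [h, hT.parent_root]; exact hT.root_mem
    · exact (hT.parent_mem u hu h).1
  · induction hm : n - (B u).ncard using Nat.strong_induction_on generalizing u with
    | _ m ih =>
      by_cases h : u = T.root
      · exact h ▸ .refl _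
      have hc : u ∈ T.children (T.parent u) := ⟨hu, h, rfl⟩
      have hlt : (B u).ncard < (B (T.parent u)).ncard := Set.ncard_lt_ncard
        ⟨hT.subset_of_child hc, hT.not_subset_of_mem_children hc⟩
      have hle : (B (T.parent u)).ncard ≤ n := by
        simpa using Set.ncard_le_ncard (Set.subset_univ (B (T.parent u)))
      exact (ih _ (by omega) _ (hT.parent_mem u hu h).1 rfl).trans (isAncestor_parent u)

theorem subset_of_isAncestor (hv : v ∈ T.nodes) (h : T.IsAncestor u v) : B v ⊆ B u := by
  obtain ⟨k, rfl⟩ := h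
  induction k generalizing v with
  | zero => exact subset_rfl
  | succ k ih =>
    rw [Function.iterate_succ_apply]
    refine Set.Subset.trans ?_ (ih (hT.rooted.parent_mem v hv))
    by_cases h : v = T.root
    · rw [h, hT.parent_root]
    · exact hT.subset_of_child ⟨hv, h, rfl⟩

theorem below_eq : ∀ u ∈ T.nodes, T.below u = B u := by
  refine hT.rooted.child_induction fun u hu ih => Set.Subset.antisymm (fun y hy => ?_) fun y hy => ?_
  · exact hT.subset_of_isAncestor hy.1 hy.2 ((hT.leaf _ hy.1 y.2 y).2 rfl)
  · by_cases hun : u < n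
    · have := (hT.leaf u hu hun y).1 hy
      exact ⟨this ▸ hu, this ▸ .refl _⟩
    · obtain ⟨c, hc, hyc⟩ := (hT.node u hu (by omega) y).1 hy
      rw [← ih c hc] at hyc
      exact below_mono (isAncestor_child hc) hyc

theorem isAncestor_of_subset (hu : u ∈ T.nodes) (hv : v ∈ T.nodes) (h : B v ⊆ B u) :
    T.IsAncestor u v := by
  obtain ⟨y, hy⟩ := hT.nonempty v hv
  have h1 : y ∈ T.below v := hT.below_eq v hv ▸ hy
  have h2 : y ∈ T.below u := hT.below_eq u hu ▸ h hy
  rcases h2.2.total h1.2 with h3 | h3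
  · exact h3
  by_cases hne : v = u
  · exact hne ▸ .refl _
  obtain ⟨c, hc, hcu⟩ := hT.rooted.exists_child hu h3 hne
  exact absurd (h.trans (hT.subset_of_isAncestor hu hcu)) (hT.not_subset_of_mem_children hc)

theorem exists_child_of_subset (hu : u ∈ T.nodes) (hv : v ∈ T.nodes) (h : B v ⊆ B u)
    (hne : u ≠ v) : ∃ c ∈ T.children u, B v ⊆ B c := by
  obtain ⟨c, hc, hcv⟩ := hT.rooted.exists_child hv (hT.isAncestor_of_subset hu hv h) hne
  exact ⟨c, hc, hT.subset_of_isAncestor hv hcv⟩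

theorem children_unique (hv : v ∈ T.nodes) (hc : c ∈ T.children u)
    (hd : d ∈ T.children u) (h : B v ⊆ B c) (h' : B v ⊆ B d) : c = d := by
  obtain ⟨y, hy⟩ := hT.nonempty v hv
  by_contra hne
  exact hT.disj u c hc d hd hne y (h hy) (h' hy)

/-- Alternation is the only property of cotrees that the local description does not yield; it fails
temporarily while a tree is updated. -/
theorem isCotreeOf (halt : ∀ u ∈ T.nodes, n ≤ u → u ≠ T.root → T.series u ≠ T.series (T.parent u)) :
    T.IsCotreeOf H S where
  root_mem := hT.root_mem
  parent_root := hT.parent_root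
  parent_mem := hT.rooted.parent_mem
  reaches_root := hT.rooted.reaches_root
  leaf_iff v := by
    rw [← hT.root_eq, ← hT.below_eq _ hT.root_mem]
    exact ⟨fun h => ⟨h, hT.rooted.reaches_root _ h⟩, fun h => h.1⟩
  children_leaf u hu hun := by
    refine Set.eq_empty_iff_forall_notMem.2 fun c hc => ?_
    have := (hT.mem_of_child hc).2
    omega
  children_internal := hT.two
  alternating := halt
  adj_iff v hv w hw hvw u hu := by
    rw [← hT.root_eq, ← hT.below_eq _ hT.root_mem] at hv hw
    have hne : ∀ {v w : Fin n}, v.val ∈ T.nodes → w.val ∈ T.nodes → v ≠ w →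
        T.IsAncestor u v.val → T.IsAncestor u w.val → u ≠ v.val := by
      rintro v w hv hw hvw h1 h2 rfl
      obtain ⟨c, hc, -⟩ := hT.rooted.exists_child hw h2 (fun h => hvw (Fin.ext h))
      have := (hT.mem_of_child hc).2
      have := v.2
      omega
    obtain ⟨c, hc, hcv⟩ := hT.rooted.exists_child hv.1 hu.1 (hne hv.1 hw.1 hvw hu.1 hu.2.1)
    obtain ⟨d, hd, hdw⟩ := hT.rooted.exists_child hw.1 hu.2.1 (hne hw.1 hv.1 hvw.symm hu.2.1 hu.1)
    refine hT.adj u c hc d hd ?_ v ?_ w ?_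
    · rintro rfl
      exact hT.rooted.not_isAncestor_of_mem_children hc (hu.2.2 c hcv hdw)
    · rw [← hT.below_eq c hc.1]; exact ⟨hv.1, hcv⟩
    · rw [← hT.below_eq d hd.1]; exact ⟨hw.1, hdw⟩

end IsClusterTree

/-! #### Grouping children -/

/-- `T'` arises from `T` by inserting a node `z` above `u` and moving the children of `u` in `F` to
`z`. -/
structure SplitAbove (T T' : LabelledTree n) (u z : ℕ) (F : Finset ℕ) : Prop where
  nodes : T'.nodes = insert z T.nodes
  root : T'.root = if u = T.root then z else T.root
  parent : ∀ c ∈ T.nodes, c ∉ F → c ≠ u → T'.parent c = T.parent c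
  parent_F : ∀ c ∈ F, T'.parent c = z
  parent_u : T'.parent u = z
  parent_z : T'.parent z = if u = T.root then z else T.parent u
  series : ∀ v ∈ T.nodes, T'.series v = T.series v
  series_z : T'.series z = T.series u

/-- `T'` arises from `T` by adding a child `z` to `u` and moving the children of `u` in `F` to `z`. -/
structure SplitBelow (T T' : LabelledTree n) (u z : ℕ) (F : Finset ℕ) : Prop where
  nodes : T'.nodes = insert z T.nodes
  root : T'.root = T.root
  parent : ∀ c ∈ T.nodes, c ∉ F → T'.parent c = T.parent c
  parent_F : ∀ c ∈ F, T'.parent c = z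
  parent_z : T'.parent z = u
  series : ∀ v ∈ T.nodes, T'.series v = T.series v
  series_z : T'.series z = T.series u

section Split

variable {T T' : LabelledTree n} {H : SimpleGraph (Fin n)} {S : Set (Fin n)} {B B' : ℕ → Set (Fin n)}
  {u z : ℕ} {F : Finset ℕ}

/-- The pairs that branch at the node `v` of `T'` branched at a node of `T` with the same label. -/
def CrossAt (T T' : LabelledTree n) (B B' : ℕ → Set (Fin n)) (v c d : ℕ) : Prop :=
  ∀ y ∈ B' c, ∀ w ∈ B' d, ∃ v0, ∃ c0 ∈ T.children v0, ∃ d0 ∈ T.children v0, c0 ≠ d0 ∧ y ∈ B c0 ∧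
    w ∈ B d0 ∧ T'.series v = T.series v0

theorem CrossAt.symm (h : CrossAt T T' B B' v c d) : CrossAt T T' B B' v d c := by
  intro y hy w hw
  obtain ⟨v0, c0, hc, d0, hd, h1, h2, h3, h4⟩ := h w hw y hy
  exact ⟨v0, d0, hd, c0, hc, h1.symm, h3, h2, h4⟩

theorem CrossAt.disj (h : CrossAt T T' B B' v c d) (hT : T.IsClusterTree H S B) :
    ∀ y ∈ B' c, y ∉ B' d := by
  intro y hy hy'
  obtain ⟨v0, c0, hc, d0, hd, h1, h2, h3, -⟩ := h y hy y hy'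
  exact hT.disj v0 c0 hc d0 hd h1 y h2 h3

theorem CrossAt.adj (h : CrossAt T T' B B' v c d) (hT : T.IsClusterTree H S B) :
    ∀ y ∈ B' c, ∀ w ∈ B' d, (H.Adj y w ↔ T'.series v = true) := by
  intro y hy w hw
  obtain ⟨v0, c0, hc, d0, hd, h1, h2, h3, h4⟩ := h y hy w hw
  rw [h4]
  exact hT.adj v0 c0 hc d0 hd h1 y h2 w h3

theorem SplitAbove.mem_children_iff (h : SplitAbove T T' u z F) (hT : T.IsClusterTree H S B)
    (hu : u ∈ T.nodes) (hF : ∀ c ∈ F, c ∈ T.children u) (hz : z ∉ T.nodes) :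
    c ∈ T'.children v ↔ (c ∈ T.children v ∧ c ∉ F ∧ c ≠ u) ∨
      (c = z ∧ u ≠ T.root ∧ v = T.parent u) ∨ (v = z ∧ (c ∈ F ∨ c = u)) := by
  have hFn : ∀ c ∈ F, c ∈ T.nodes := fun c hc => (hF c hc).1
  have hFr : ∀ c ∈ F, c ≠ T.root := fun c hc => (hF c hc).2.1
  have hFu : ∀ c ∈ F, T.parent c = u := fun c hc => (hF c hc).2.2
  have hzu : z ≠ u := fun e => hz (e ▸ hu)
  have hzr : z ≠ T.root := fun e => hz (e ▸ hT.root_mem)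
  have hzF : z ∉ F := fun e => hz (hFn z e)
  have huF : u ∉ F := fun e => hT.rooted.ne_of_mem_children (hF u e) rfl
  have hpz : ∀ c ∈ T.nodes, T.parent c ≠ z := fun c hc e => hz (e ▸ hT.rooted.parent_mem c hc)
  have h1 := h.parent
  have h2 := h.parent_F
  have h3 := h.parent_u
  have h4 := h.parent_z
  simp only [children, Set.mem_ofPred_eq, h.nodes, h.root, mem_insert]
  clear hF h
  by_cases hr : u = T.root
  · rw [if_pos hr] at h4 ⊢
    grind
  · rw [if_neg hr] at h4 ⊢
    grind

theorem SplitBelow.mem_children_iff (h : SplitBelow T T' u z F) (hT : T.IsClusterTree H S B)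
    (hF : ∀ c ∈ F, c ∈ T.children u) (hz : z ∉ T.nodes) :
    c ∈ T'.children v ↔ (c ∈ T.children v ∧ c ∉ F) ∨ (c = z ∧ v = u) ∨ (v = z ∧ c ∈ F) := by
  have hFn : ∀ c ∈ F, c ∈ T.nodes := fun c hc => (hF c hc).1
  have hFr : ∀ c ∈ F, c ≠ T.root := fun c hc => (hF c hc).2.1
  have hzr : z ≠ T.root := fun e => hz (e ▸ hT.root_mem)
  have hzF : z ∉ F := fun e => hz (hFn z e)
  have h1 := h.parent
  have h2 := h.parent_F
  have h4 := h.parent_z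
  simp only [children, Set.mem_ofPred_eq, h.nodes, h.root, mem_insert]
  clear hF h
  grind

open Classical in
/-- The clusters after `SplitBelow`. -/
def belowClusters (B : ℕ → Set (Fin n)) (z : ℕ) (F : Finset ℕ) (v : ℕ) : Set (Fin n) :=
  if v = z then {y | ∃ c ∈ F, y ∈ B c} else B v

open Classical in
/-- The clusters after `SplitAbove`. -/
def aboveClusters (B : ℕ → Set (Fin n)) (u z : ℕ) (F : Finset ℕ) (v : ℕ) : Set (Fin n) :=
  if v = z then B u else if v = u then {y | y ∈ B u ∧ ∀ c ∈ F, y ∉ B c} else B v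

/-- As `z` inherits the label of `u`, the pairs that branched at `u` now branch at `u` or at `z`
with the same label. `hF2` and `hF1` ensure that `z` and `u` have two children each. -/
theorem SplitBelow.isClusterTree (h : SplitBelow T T' u z F) (hT : T.IsClusterTree H S B)
    (hu : u ∈ T.nodes) (hun : n ≤ u) (hF : ∀ c ∈ F, c ∈ T.children u) (hz : z ∉ T.nodes)
    (hzn : n ≤ z) (hF2 : ∃ c ∈ F, ∃ d ∈ F, c ≠ d) (hF1 : ∃ c ∈ T.children u, c ∉ F) :
    T'.IsClusterTree H S (belowClusters B z F) := by
  have hch := fun {v c : ℕ} => h.mem_children_iff (v := v) (c := c) hT hF hz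
  have hzr : z ≠ T.root := fun e => hz (e ▸ hT.root_mem)
  have hzu : z ≠ u := fun e => hz (e ▸ hu)
  have hnz : ∀ {v c}, c ∈ T.children v → c ≠ z := fun hc e => hz (e ▸ hc.1)
  have hvz : ∀ {v c}, c ∈ T.children v → v ≠ z := fun hc e => hz (e ▸ (hT.mem_of_child hc).1)
  have hBz : belowClusters B z F z = {y | ∃ c ∈ F, y ∈ B c} := if_pos rfl
  have hB : ∀ {c}, c ≠ z → belowClusters B z F c = B c := fun hc => if_neg hc
  -- Disjointness and adjacency both follow by tracing each branching of `T'` to a branching of `T`.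
  have hcross : ∀ v, ∀ c ∈ T'.children v, ∀ d ∈ T'.children v, c ≠ d →
      CrossAt T T' B (belowClusters B z F) v c d := by
    have h12 : ∀ {v c}, c ∈ T.children v → c ∉ F → v = u →
        CrossAt T T' B (belowClusters B z F) v c z := by
      rintro v c hc hcF rfl y hy w hw
      rw [hB (hnz hc)] at hy
      rw [hBz] at hw
      obtain ⟨e, he, hwe⟩ := hw
      exact ⟨v, c, hc, e, hF e he, fun e' => hcF (e' ▸ he), hy, hwe, h.series v hu⟩
    intro v c hc d hd hcd
    rcases hch.1 hc with h1 | h1 | h1 <;> rcases hch.1 hd with h2 | h2 | h2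
    · intro y hy w hw
      rw [hB (hnz h1.1)] at hy
      rw [hB (hnz h2.1)] at hw
      exact ⟨v, c, h1.1, d, h2.1, hcd, hy, hw, h.series v (hT.mem_of_child h1.1).1⟩
    · exact h2.1 ▸ h12 h1.1 h1.2 h2.2
    · exact absurd h2.1 (hvz h1.1)
    · exact h1.1 ▸ (h12 h2.1 h2.2 h1.2).symm
    · exact absurd (h1.1.trans h2.1.symm) hcd
    · exact absurd (h2.1.symm.trans h1.2) hzu
    · exact absurd h1.1 (hvz h2.1)
    · exact absurd (h1.1.symm.trans h2.2) hzu
    · intro y hy w hw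
      rw [hB (hnz (hF _ h1.2))] at hy
      rw [hB (hnz (hF _ h2.2))] at hw
      exact ⟨u, c, hF _ h1.2, d, hF _ h2.2, hcd, hy, hw, h1.1 ▸ h.series_z⟩
  refine ⟨?_, ?_, ?_, ?_, ?_, fun v c hc d hd hcd => (hcross v c hc d hd hcd).disj hT, ?_, ?_,
    fun v c hc d hd hcd => (hcross v c hc d hd hcd).adj hT, ?_⟩
  · rw [h.nodes, h.root]; exact mem_insert_of_mem hT.root_mem
  · by_cases hr : T.root ∈ F
    · exact absurd rfl (hF _ hr).2.1
    · rw [h.root, h.parent _ hT.root_mem hr, hT.parent_root]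
  · intro c hc hcr
    rw [h.nodes, mem_insert] at hc ⊢
    rw [h.root] at hcr
    rcases hc with rfl | hc
    · rw [h.parent_z]; exact ⟨.inr hu, hun⟩
    by_cases hcF : c ∈ F
    · rw [h.parent_F c hcF]; exact ⟨.inl rfl, hzn⟩
    · rw [h.parent c hc hcF]
      exact ⟨.inr (hT.parent_mem c hc hcr).1, (hT.parent_mem c hc hcr).2⟩
  · intro v hv hvn y
    rw [h.nodes, mem_insert] at hv
    have : v ≠ z := by omega
    rw [hB this]
    exact hT.leaf v (hv.resolve_left this) hvn y
  · intro v hv hvn y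
    rw [h.nodes, mem_insert] at hv
    by_cases hvz' : v = z
    · subst hvz'
      rw [hBz]
      constructor
      · rintro ⟨c, hc, hy⟩
        exact ⟨c, hch.2 (.inr (.inr ⟨rfl, hc⟩)), (hB (hnz (hF c hc))).symm ▸ hy⟩
      · rintro ⟨c, hc, hy⟩
        rcases hch.1 hc with h1 | h1 | h1
        · exact absurd rfl (hvz h1.1)
        · exact absurd h1.2 hzu
        · exact ⟨c, h1.2, hB (hnz (hF c h1.2)) ▸ hy⟩
    · rw [hB hvz', hT.node v (hv.resolve_left hvz') hvn y]
      constructor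
      · rintro ⟨c, hc, hy⟩
        by_cases hcF : c ∈ F
        · have hvu : v = u := hc.2.2.symm.trans (hF c hcF).2.2
          exact ⟨z, hch.2 (.inr (.inl ⟨rfl, hvu⟩)), hBz.symm ▸ ⟨c, hcF, hy⟩⟩
        · exact ⟨c, hch.2 (.inl ⟨hc, hcF⟩), (hB (hnz hc)).symm ▸ hy⟩
      · rintro ⟨c, hc, hy⟩
        rcases hch.1 hc with h1 | h1 | h1
        · exact ⟨c, h1.1, hB (hnz h1.1) ▸ hy⟩
        · rw [h1.1, hBz] at hy
          obtain ⟨d, hd, hy⟩ := hy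
          exact ⟨d, h1.2 ▸ hF d hd, hy⟩
        · exact absurd h1.1 hvz'
  · intro v hv hvn
    rw [h.nodes, mem_insert] at hv
    by_cases hvz' : v = z
    · obtain ⟨c, hc, d, hd, hcd⟩ := hF2
      exact ⟨c, hch.2 (.inr (.inr ⟨hvz', hc⟩)), d, hch.2 (.inr (.inr ⟨hvz', hd⟩)), hcd⟩
    · by_cases hvu : v = u
      · obtain ⟨c, hc, hcF⟩ := hF1
        exact ⟨c, hch.2 (.inl ⟨hvu ▸ hc, hcF⟩), z, hch.2 (.inr (.inl ⟨rfl, hvu⟩)), hnz hc⟩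
      · obtain ⟨c, hc, d, hd, hcd⟩ := hT.two v (hv.resolve_left hvz') hvn
        have : ∀ e ∈ T.children v, e ∉ F := fun e he heF => hvu (he.2.2.symm.trans (hF e heF).2.2)
        exact ⟨c, hch.2 (.inl ⟨hc, this c hc⟩), d, hch.2 (.inl ⟨hd, this d hd⟩), hcd⟩
  · intro v hv
    rw [h.nodes, mem_insert] at hv
    by_cases hvz' : v = z
    · obtain ⟨c, hc, -⟩ := hF2
      obtain ⟨y, hy⟩ := hT.nonempty c (hF c hc).1
      exact ⟨y, by rw [hvz', hBz]; exact ⟨c, hc, hy⟩⟩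
    · rw [hB hvz']
      exact hT.nonempty v (hv.resolve_left hvz')
  · rw [h.root, hB hzr.symm]
    exact hT.root_eq

/-- Here `z` takes over the cluster of `u`, and `u` keeps only the children outside `F`. At least
two of these are required, so that `u` remains a legitimate internal node. -/
theorem SplitAbove.isClusterTree (h : SplitAbove T T' u z F) (hT : T.IsClusterTree H S B)
    (hu : u ∈ T.nodes) (hun : n ≤ u) (hF : ∀ c ∈ F, c ∈ T.children u) (hz : z ∉ T.nodes)
    (hzn : n ≤ z) (hF1 : F.Nonempty)
    (hF2 : ∃ c ∈ T.children u, ∃ d ∈ T.children u, c ∉ F ∧ d ∉ F ∧ c ≠ d) :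
    T'.IsClusterTree H S (aboveClusters B u z F) := by
  have hch := fun {v c : ℕ} => h.mem_children_iff (v := v) (c := c) hT hu hF hz
  have hzu : z ≠ u := fun e => hz (e ▸ hu)
  have hnz : ∀ {v c}, c ∈ T.children v → c ≠ z := fun hc e => hz (e ▸ hc.1)
  have hvz : ∀ {v c}, c ∈ T.children v → v ≠ z := fun hc e => hz (e ▸ (hT.mem_of_child hc).1)
  have huF : u ∉ F := fun e => hT.rooted.ne_of_mem_children (hF u e) rfl
  have hFu : ∀ {c}, c ∈ F → c ≠ u := fun hc e => huF (e ▸ hc)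
  have hcu : ∀ {c}, c ∈ T.children u → c ≠ u := fun hc => hT.rooted.ne_of_mem_children hc
  have hpu : u ≠ T.root → u ∈ T.children (T.parent u) := fun hr => ⟨hu, hr, rfl⟩
  have hBz : aboveClusters B u z F z = B u := if_pos rfl
  have hBu : aboveClusters B u z F u = {y | y ∈ B u ∧ ∀ c ∈ F, y ∉ B c} := by
    simp [aboveClusters, hzu.symm]
  have hB : ∀ {c}, c ≠ z → c ≠ u → aboveClusters B u z F c = B c := fun hc hc' => by
    simp [aboveClusters, hc, hc']
  have hcross : ∀ v, ∀ c ∈ T'.children v, ∀ d ∈ T'.children v, c ≠ d →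
      CrossAt T T' B (aboveClusters B u z F) v c d := by
    have h12 : ∀ {v c}, c ∈ T.children v → c ≠ u → u ≠ T.root → v = T.parent u →
        CrossAt T T' B (aboveClusters B u z F) v c z := by
      rintro v c hc hcu hur rfl y hy w hw
      rw [hB (hnz hc) hcu] at hy
      rw [hBz] at hw
      exact ⟨_, c, hc, u, hpu hur, hcu, hy, hw, h.series _ (hT.mem_of_child hc).1⟩
    have h33 : ∀ {c}, c ∈ F → CrossAt T T' B (aboveClusters B u z F) z c u := by
      intro c hc y hy w hw
      rw [hB (hnz (hF c hc)) (hFu hc)] at hy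
      rw [hBu] at hw
      obtain ⟨d, hd, hwd⟩ := (hT.node u hu hun w).1 hw.1
      exact ⟨u, c, hF c hc, d, hd, fun e => hw.2 c hc (e ▸ hwd), hy, hwd, h.series_z⟩
    intro v c hc d hd hcd
    rcases hch.1 hc with h1 | h1 | h1 <;> rcases hch.1 hd with h2 | h2 | h2
    · intro y hy w hw
      rw [hB (hnz h1.1) h1.2.2] at hy
      rw [hB (hnz h2.1) h2.2.2] at hw
      exact ⟨v, c, h1.1, d, h2.1, hcd, hy, hw, h.series v (hT.mem_of_child h1.1).1⟩
    · exact h2.1 ▸ h12 h1.1 h1.2.2 h2.2.1 h2.2.2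
    · exact absurd h2.1 (hvz h1.1)
    · exact h1.1 ▸ (h12 h2.1 h2.2.2 h1.2.1 h1.2.2).symm
    · exact absurd (h1.1.trans h2.1.symm) hcd
    · exact absurd (h1.2.2.symm.trans h2.1) (hvz (hpu h1.2.1))
    · exact absurd h1.1 (hvz h2.1)
    · exact absurd (h2.2.2.symm.trans h1.1) (hvz (hpu h2.2.1))
    · obtain ⟨rfl, h1⟩ := h1
      rcases h1 with h1 | rfl <;> rcases h2.2 with h2 | rfl
      · intro y hy w hw
        rw [hB (hnz (hF _ h1)) (hFu h1)] at hy
        rw [hB (hnz (hF _ h2)) (hFu h2)] at hw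
        exact ⟨u, c, hF _ h1, d, hF _ h2, hcd, hy, hw, h.series_z⟩
      · exact h33 h1
      · exact (h33 h2).symm
      · exact absurd rfl hcd
  refine ⟨?_, ?_, ?_, ?_, ?_, fun v c hc d hd hcd => (hcross v c hc d hd hcd).disj hT, ?_, ?_,
    fun v c hc d hd hcd => (hcross v c hc d hd hcd).adj hT, ?_⟩
  · rw [h.nodes, h.root]
    split_ifs
    · exact Finset.mem_insert_self _ _
    · exact mem_insert_of_mem hT.root_mem
  · rw [h.root]
    split_ifs with hr
    · rw [h.parent_z, if_pos hr]
    · have hrF : T.root ∉ F := fun e => (hF _ e).2.1 rfl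
      rw [h.parent _ hT.root_mem hrF (Ne.symm hr), hT.parent_root]
  · intro c hc hcr
    rw [h.nodes, mem_insert] at hc ⊢
    rw [h.root] at hcr
    rcases hc with rfl | hc
    · rw [h.parent_z]
      split_ifs at hcr ⊢ with hr
      · exact absurd rfl hcr
      · exact ⟨.inr (hT.parent_mem u hu hr).1, (hT.parent_mem u hu hr).2⟩
    by_cases hcF : c ∈ F
    · rw [h.parent_F c hcF]; exact ⟨.inl rfl, hzn⟩
    by_cases hcu' : c = u
    · rw [hcu', h.parent_u]; exact ⟨.inl rfl, hzn⟩
    · rw [h.parent c hc hcF hcu']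
      have hcr' : c ≠ T.root := by
        split_ifs at hcr with hr
        · exact hr ▸ hcu'
        · exact hcr
      exact ⟨.inr (hT.parent_mem c hc hcr').1, (hT.parent_mem c hc hcr').2⟩
  · intro v hv hvn y
    rw [h.nodes, mem_insert] at hv
    have h1 : v ≠ z := by omega
    have h2 : v ≠ u := by omega
    rw [hB h1 h2]
    exact hT.leaf v (hv.resolve_left h1) hvn y
  · intro v hv hvn y
    rw [h.nodes, mem_insert] at hv
    by_cases hvz' : v = z
    · subst hvz'
      rw [hBz]
      constructor
      · intro hy
        by_cases hyF : ∃ c ∈ F, y ∈ B c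
        · obtain ⟨c, hc, hyc⟩ := hyF
          exact ⟨c, hch.2 (.inr (.inr ⟨rfl, .inl hc⟩)), (hB (hnz (hF c hc)) (hFu hc)).symm ▸ hyc⟩
        · push Not at hyF
          exact ⟨u, hch.2 (.inr (.inr ⟨rfl, .inr rfl⟩)), hBu.symm ▸ ⟨hy, hyF⟩⟩
      · rintro ⟨c, hc, hy⟩
        rcases hch.1 hc with h1 | h1 | h1
        · exact absurd rfl (hvz h1.1)
        · exact absurd h1.2.2.symm (hvz (hpu h1.2.1))
        · rcases h1.2 with h1 | rfl
          · exact hT.subset_of_child (hF c h1) (hB (hnz (hF c h1)) (hFu h1) ▸ hy)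
          · rw [hBu] at hy; exact hy.1
    by_cases hvu : v = u
    · subst hvu
      rw [hBu]
      constructor
      · rintro ⟨hy, hyF⟩
        obtain ⟨c, hc, hyc⟩ := (hT.node v hu hun y).1 hy
        exact ⟨c, hch.2 (.inl ⟨hc, fun e => hyF c e hyc, hcu hc⟩),
          (hB (hnz hc) (hcu hc)).symm ▸ hyc⟩
      · rintro ⟨c, hc, hy⟩
        rcases hch.1 hc with h1 | h1 | h1
        · rw [hB (hnz h1.1) h1.2.2] at hy
          exact ⟨hT.subset_of_child h1.1 hy,
            fun d hd => hT.disj v c h1.1 d (hF d hd) (fun e => h1.2.1 (e ▸ hd)) y hy⟩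
        · exact absurd h1.2.2.symm (hT.rooted.parent_ne hu h1.2.1)
        · exact absurd h1.1 hvz'
    · rw [hB hvz' hvu, hT.node v (hv.resolve_left hvz') hvn y]
      constructor
      · rintro ⟨c, hc, hy⟩
        have hcF : c ∉ F := fun e => hvu (hc.2.2.symm.trans (hF c e).2.2)
        by_cases hcu' : c = u
        · exact ⟨z, hch.2 (.inr (.inl ⟨rfl, hcu' ▸ hc.2.1, hcu' ▸ hc.2.2.symm⟩)),
            hBz.symm ▸ hcu' ▸ hy⟩
        · exact ⟨c, hch.2 (.inl ⟨hc, hcF, hcu'⟩), (hB (hnz hc) hcu').symm ▸ hy⟩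
      · rintro ⟨c, hc, hy⟩
        rcases hch.1 hc with h1 | h1 | h1
        · exact ⟨c, h1.1, hB (hnz h1.1) h1.2.2 ▸ hy⟩
        · rw [h1.1, hBz] at hy
          exact ⟨u, ⟨hu, h1.2.1, h1.2.2.symm⟩, hy⟩
        · exact absurd h1.1 hvz'
  · intro v hv hvn
    rw [h.nodes, mem_insert] at hv
    by_cases hvz' : v = z
    · obtain ⟨c, hc⟩ := hF1
      exact ⟨c, hch.2 (.inr (.inr ⟨hvz', .inl hc⟩)), u, hch.2 (.inr (.inr ⟨hvz', .inr rfl⟩)),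
        hFu hc⟩
    by_cases hvu : v = u
    · obtain ⟨c, hc, d, hd, hcF, hdF, hcd⟩ := hF2
      exact ⟨c, hch.2 (.inl ⟨hvu ▸ hc, hcF, hcu hc⟩), d, hch.2 (.inl ⟨hvu ▸ hd, hdF, hcu hd⟩), hcd⟩
    · obtain ⟨c, hc, d, hd, hcd⟩ := hT.two v (hv.resolve_left hvz') hvn
      have hnF : ∀ e ∈ T.children v, e ∉ F := fun e he heF => hvu (he.2.2.symm.trans (hF e heF).2.2)
      -- the child `u` is replaced by `z`
      have key : ∀ e ∈ T.children v, (if e = u then z else e) ∈ T'.children v := by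
        intro e he
        split_ifs with heu
        · exact hch.2 (.inr (.inl ⟨rfl, heu ▸ he.2.1, heu ▸ he.2.2.symm⟩))
        · exact hch.2 (.inl ⟨he, hnF e he, heu⟩)
      refine ⟨_, key c hc, _, key d hd, ?_⟩
      have := hnz hc
      have := hnz hd
      split_ifs <;> omega
  · intro v hv
    rw [h.nodes, mem_insert] at hv
    by_cases hvz' : v = z
    · rw [hvz', hBz]; exact hT.nonempty u hu
    by_cases hvu : v = u
    · obtain ⟨c, hc, -, -, hcF, -, -⟩ := hF2
      obtain ⟨y, hy⟩ := hT.nonempty c hc.1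
      refine ⟨y, ?_⟩
      rw [hvu, hBu]
      exact ⟨hT.subset_of_child hc hy,
        fun d hd => hT.disj u c hc d (hF d hd) (fun e => hcF (e ▸ hd)) y hy⟩
    · rw [hB hvz' hvu]
      exact hT.nonempty v (hv.resolve_left hvz')
  · rw [h.root]
    split_ifs with hr
    · rw [hBz, hr]; exact hT.root_eq
    · rw [hB (fun e => hz (e ▸ hT.root_mem)) (Ne.symm hr)]
      exact hT.root_eq

end Split

/-! #### Adding a leaf -/

variable {n : ℕ} {T T' : LabelledTree n} {H H' : SimpleGraph (Fin n)} {S M : Set (Fin n)}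
  {B : ℕ → Set (Fin n)} {g q : ℕ} {x : Fin n} {lab : Bool} {u v c d : ℕ} {y : Fin n}

/-- A new vertex with neighbourhood `M` can be joined to the node `g` by a node with label `lab`. -/
structure JoinsAt (T : LabelledTree n) (B : ℕ → Set (Fin n)) (M : Set (Fin n)) (g : ℕ)
    (lab : Bool) : Prop where
  above : ∀ u, ∀ c ∈ T.children u, B g ⊆ B c → ∀ y ∈ B u, y ∉ B c → (y ∈ M ↔ T.series u = true)
  inside : ∀ y ∈ B g, (y ∈ M ↔ lab = true)

/-- `T'` arises from `T` by adding the leaf `x` to the node `g`. -/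
structure AttachLeaf (T T' : LabelledTree n) (x : Fin n) (g : ℕ) : Prop where
  nodes : T'.nodes = insert x.val T.nodes
  root : T'.root = T.root
  parent : ∀ c ∈ T.nodes, T'.parent c = T.parent c
  parent_x : T'.parent x = g
  series : ∀ v ∈ T.nodes, T'.series v = T.series v

/-- `T'` arises from `T` by inserting above `g` a node `q` that gets `x` as a second child. -/
structure InsertLeaf (T T' : LabelledTree n) (x : Fin n) (g q : ℕ) (lab : Bool) : Prop where
  nodes : T'.nodes = insert x.val (insert q T.nodes)
  root : T'.root = if g = T.root then q else T.root
  parent : ∀ c ∈ T.nodes, c ≠ g → T'.parent c = T.parent c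
  parent_g : T'.parent g = q
  parent_x : T'.parent x = q
  parent_q : T'.parent q = if g = T.root then q else T.parent g
  series : ∀ v ∈ T.nodes, T'.series v = T.series v
  series_q : T'.series q = lab

/-- `H'` arises from `H` by adding the vertex `x` with neighbourhood `M` to `S`. -/
structure AddsVertex (H H' : SimpleGraph (Fin n)) (S M : Set (Fin n)) (x : Fin n) : Prop where
  old : ∀ v ∈ S, ∀ w ∈ S, (H'.Adj v w ↔ H.Adj v w)
  new : ∀ y ∈ S, (H'.Adj x y ↔ y ∈ M)

theorem IsClusterTree.subset_S (hT : T.IsClusterTree H S B) (hu : u ∈ T.nodes) :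
    B u ⊆ S := hT.root_eq ▸ hT.subset_of_isAncestor hu (hT.rooted.reaches_root u hu)

open Classical in
/-- The clusters after `AttachLeaf`. -/
def attachClusters (B : ℕ → Set (Fin n)) (x : Fin n) (g v : ℕ) : Set (Fin n) :=
  if v = x then {x} else if B g ⊆ B v then insert x (B v) else B v

open Classical in
/-- The clusters after `InsertLeaf`. -/
def insertClusters (B : ℕ → Set (Fin n)) (x : Fin n) (g q v : ℕ) : Set (Fin n) :=
  if v = x then {x} else if v = q then insert x (B g) else
    if B g ⊆ B v ∧ v ≠ g then insert x (B v) else B v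

/-- How two vertices below different children of `v` in `T'` are related. -/
def CrossJoin (T T' : LabelledTree n) (B : ℕ → Set (Fin n)) (S M : Set (Fin n)) (x : Fin n)
    (v : ℕ) (y w : Fin n) : Prop :=
  (∃ v0, ∃ c0 ∈ T.children v0, ∃ d0 ∈ T.children v0, c0 ≠ d0 ∧ y ∈ B c0 ∧
    w ∈ B d0 ∧ T'.series v = T.series v0) ∨
  (y = x ∧ w ∈ S ∧ (w ∈ M ↔ T'.series v = true)) ∨
  (w = x ∧ y ∈ S ∧ (y ∈ M ↔ T'.series v = true))

theorem CrossJoin.symm {y w : Fin n} (h : CrossJoin T T' B S M x v y w) :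
    CrossJoin T T' B S M x v w y := by
  rcases h with ⟨v0, c0, hc, d0, hd, h1, h2, h3, h4⟩ | h | h
  · exact .inl ⟨v0, d0, hd, c0, hc, h1.symm, h3, h2, h4⟩
  · exact .inr (.inr h)
  · exact .inr (.inl h)

theorem CrossJoin.ne {y w : Fin n} (h : CrossJoin T T' B S M x v y w)
    (hT : T.IsClusterTree H S B) (hx : x ∉ S) : y ≠ w := by
  rintro rfl
  rcases h with ⟨v0, c0, hc, d0, hd, h1, h2, h3, h4⟩ | ⟨rfl, h, -⟩ | ⟨rfl, h, -⟩
  · exact hT.disj v0 c0 hc d0 hd h1 y h2 h3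
  · exact hx h
  · exact hx h

theorem CrossJoin.adj {y w : Fin n} (h : CrossJoin T T' B S M x v y w)
    (hT : T.IsClusterTree H S B) (hH : AddsVertex H H' S M x) :
    H'.Adj y w ↔ T'.series v = true := by
  rcases h with ⟨v0, c0, hc, d0, hd, h1, h2, h3, h4⟩ | ⟨rfl, h1, h2⟩ | ⟨rfl, h1, h2⟩
  · rw [h4, hH.old y (hT.subset_S hc.1 h2) w (hT.subset_S hd.1 h3)]
    exact hT.adj v0 c0 hc d0 hd h1 y h2 w h3
  · rw [hH.new w h1, h2]
  · rw [H'.adj_comm, hH.new y h1, h2]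

theorem AttachLeaf.mem_children_iff (h : AttachLeaf T T' x g) (hT : T.IsClusterTree H S B)
    (hx : x.val ∉ T.nodes) :
    c ∈ T'.children v ↔ c ∈ T.children v ∨ (c = x ∧ v = g) := by
  have hxr : x.val ≠ T.root := fun e => hx (e ▸ hT.root_mem)
  have h1 := h.parent
  have h2 := h.parent_x
  simp only [children, Set.mem_ofPred_eq, h.nodes, h.root, mem_insert]
  clear h
  grind

theorem InsertLeaf.mem_children_iff (h : InsertLeaf T T' x g q lab) (hT : T.IsClusterTree H S B)
    (hg : g ∈ T.nodes) (hx : x.val ∉ T.nodes) (hq : q ∉ T.nodes) (hxq : x.val ≠ q) :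
    c ∈ T'.children v ↔ (c ∈ T.children v ∧ c ≠ g) ∨ (c = q ∧ g ≠ T.root ∧ v = T.parent g) ∨
      (v = q ∧ (c = g ∨ c = x)) := by
  have hxr : x.val ≠ T.root := fun e => hx (e ▸ hT.root_mem)
  have hqr : q ≠ T.root := fun e => hq (e ▸ hT.root_mem)
  have hqg : q ≠ g := fun e => hq (e ▸ hg)
  have hxg : x.val ≠ g := fun e => hx (e ▸ hg)
  have h1 := h.parent
  have h2 := h.parent_x
  have h3 := h.parent_g
  have h4 := h.parent_q
  simp only [children, Set.mem_ofPred_eq, h.nodes, h.root, mem_insert]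
  clear h
  by_cases hr : g = T.root
  · rw [if_pos hr] at h4 ⊢
    grind
  · rw [if_neg hr] at h4 ⊢
    grind

/-- The clusters over `g` gain `x`. Branchings that do not involve `x` are old ones; those that
involve `x` are settled by `JoinsAt`: by `above` at the nodes over `g` and by `inside` at `g`. -/
theorem AttachLeaf.isClusterTree (h : AttachLeaf T T' x g) (hT : T.IsClusterTree H S B)
    (hg : g ∈ T.nodes) (hgn : n ≤ g) (hx : x ∉ S) (hxn : x.val ∉ T.nodes)
    (hH : AddsVertex H H' S M x) (hM : T.JoinsAt B M g (T.series g)) :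
    T'.IsClusterTree H' (insert x S) (attachClusters B x g) := by
  have hch := fun {v c : ℕ} => h.mem_children_iff (v := v) (c := c) hT hxn
  have hxc : ∀ {v c}, c ∈ T.children v → c ≠ x.val := fun hc e => hxn (e ▸ hc.1)
  have hBx : attachClusters B x g x = {x} := if_pos rfl
  have hmem : ∀ {c y}, c ≠ x.val →
      (y ∈ attachClusters B x g c ↔ y ∈ B c ∨ (y = x ∧ B g ⊆ B c)) := by
    intro c y hc
    simp only [attachClusters, hc, if_false]
    split_ifs with hs <;> simp [hs, or_comm]
  have hcross : ∀ v, ∀ c ∈ T'.children v, ∀ d ∈ T'.children v, c ≠ d →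
      ∀ y ∈ attachClusters B x g c, ∀ w ∈ attachClusters B x g d, CrossJoin T T' B S M x v y w := by
    have h11 : ∀ {v c d y w}, c ∈ T.children v → d ∈ T.children v → c ≠ d → y = x → B g ⊆ B c →
        w ∈ B d → CrossJoin T T' B S M x v y w := by
      intro v c d y w hc hd hcd hy hgc hw
      refine .inr (.inl ⟨hy, hT.subset_S hd.1 hw, ?_⟩)
      rw [h.series v (hT.mem_of_child hc).1]
      exact hM.above v c hc hgc w (hT.subset_of_child hd hw) (hT.disj v d hd c hc hcd.symm w hw)
    have h12 : ∀ {c y w}, c ∈ T.children g → y ∈ attachClusters B x g c → w = x →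
        CrossJoin T T' B S M x g y w := by
      intro c y w hc hy hw
      have hyc := ((hmem (hxc hc)).1 hy).resolve_right fun h => hT.not_subset_of_mem_children hc h.2
      have hyg := hT.subset_of_child hc hyc
      refine .inr (.inr ⟨hw, hT.subset_S hg hyg, ?_⟩)
      rw [h.series g hg]
      exact hM.inside y hyg
    intro v c hc d hd hcd y hy w hw
    rcases hch.1 hc with h1 | h1 <;> rcases hch.1 hd with h2 | h2
    · rw [hmem (hxc h1)] at hy
      rw [hmem (hxc h2)] at hw
      rcases hy with hy | hy <;> rcases hw with hw | hw
      · exact .inl ⟨v, c, h1, d, h2, hcd, hy, hw, h.series v (hT.mem_of_child h1).1⟩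
      · exact (h11 h2 h1 hcd.symm hw.1 hw.2 hy).symm
      · exact h11 h1 h2 hcd hy.1 hy.2 hw
      · exact absurd (hT.children_unique hg h1 h2 hy.2 hw.2) hcd
    · obtain ⟨rfl, rfl⟩ := h2
      rw [hBx] at hw
      exact h12 h1 hy hw
    · obtain ⟨rfl, rfl⟩ := h1
      rw [hBx] at hy
      exact (h12 h2 hw hy).symm
    · exact absurd (h1.1.trans h2.1.symm) hcd
  refine ⟨?_, ?_, ?_, ?_, ?_, fun v c hc d hd hcd y hy hy' =>
    (hcross v c hc d hd hcd y hy y hy').ne hT hx rfl, ?_, ?_, fun v c hc d hd hcd y hy w hw =>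
    (hcross v c hc d hd hcd y hy w hw).adj hT hH, ?_⟩
  · rw [h.nodes, h.root]; exact mem_insert_of_mem hT.root_mem
  · rw [h.root, h.parent _ hT.root_mem, hT.parent_root]
  · intro c hc hcr
    rw [h.nodes, mem_insert] at hc ⊢
    rw [h.root] at hcr
    rcases hc with rfl | hc
    · rw [h.parent_x]; exact ⟨.inr hg, hgn⟩
    · rw [h.parent c hc]
      exact ⟨.inr (hT.parent_mem c hc hcr).1, (hT.parent_mem c hc hcr).2⟩
  · intro v hv hvn y
    rw [h.nodes, mem_insert] at hv
    by_cases hvx : v = x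
    · subst hvx
      rw [hBx, Set.mem_singleton_iff, Fin.ext_iff]
    · have hv' := hv.resolve_left hvx
      rw [hmem hvx, hT.leaf v hv' hvn y, or_iff_left]
      rintro ⟨-, h2⟩
      have := hT.isAncestor_of_subset hv' hg h2
      obtain ⟨c, hc, -⟩ := hT.rooted.exists_child hg this (by omega)
      have := (hT.mem_of_child hc).2
      omega
  · intro v hv hvn y
    rw [h.nodes, mem_insert] at hv
    have hvx : v ≠ x := by have := x.2; omega
    have hv' := hv.resolve_left hvx
    rw [hmem hvx, hT.node v hv' hvn y]
    constructor
    · rintro (⟨c, hc, hy⟩ | ⟨rfl, hgv⟩)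
      · exact ⟨c, hch.2 (.inl hc), (hmem (hxc hc)).2 (.inl hy)⟩
      · by_cases hvg : v = g
        · exact ⟨y, hch.2 (.inr ⟨rfl, hvg⟩), hBx.symm ▸ rfl⟩
        · obtain ⟨c, hc, hgc⟩ := hT.exists_child_of_subset hv' hg hgv hvg
          exact ⟨c, hch.2 (.inl hc), (hmem (hxc hc)).2 (.inr ⟨rfl, hgc⟩)⟩
    · rintro ⟨c, hc, hy⟩
      rcases hch.1 hc with h1 | ⟨rfl, rfl⟩
      · rcases (hmem (hxc h1)).1 hy with hy | hy
        · exact .inl ⟨c, h1, hy⟩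
        · exact .inr ⟨hy.1, hy.2.trans (hT.subset_of_child h1)⟩
      · rw [hBx] at hy
        exact .inr ⟨hy, subset_rfl⟩
  · intro v hv hvn
    rw [h.nodes, mem_insert] at hv
    obtain ⟨c, hc, d, hd, hcd⟩ := hT.two v (hv.resolve_left (by have := x.2; omega)) hvn
    exact ⟨c, hch.2 (.inl hc), d, hch.2 (.inl hd), hcd⟩
  · intro v hv
    rw [h.nodes, mem_insert] at hv
    by_cases hvx : v = x
    · rw [hvx, hBx]; exact Set.singleton_nonempty x
    · obtain ⟨y, hy⟩ := hT.nonempty v (hv.resolve_left hvx)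
      exact ⟨y, (hmem hvx).2 (.inl hy)⟩
  · ext y
    rw [h.root, hmem (fun e => hxn (e ▸ hT.root_mem)), hT.root_eq, Set.mem_insert_iff, or_comm]
    simp [hT.subset_S hg]

/-- As for `AttachLeaf`, except that `x` meets the vertices below `g` at the new node `q`, and that
`g` itself keeps its cluster. -/
theorem InsertLeaf.isClusterTree (h : InsertLeaf T T' x g q lab) (hT : T.IsClusterTree H S B)
    (hg : g ∈ T.nodes) (hx : x ∉ S) (hxn : x.val ∉ T.nodes) (hq : q ∉ T.nodes) (hqn : n ≤ q)
    (hH : AddsVertex H H' S M x) (hM : T.JoinsAt B M g lab) :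
    T'.IsClusterTree H' (insert x S) (insertClusters B x g q) := by
  have hxq : x.val ≠ q := by have := x.2; omega
  have hxg : x.val ≠ g := fun e => hxn (e ▸ hg)
  have hch := fun {v c : ℕ} => h.mem_children_iff (v := v) (c := c) hT hg hxn hq hxq
  have hxc : ∀ {v c}, c ∈ T.children v → c ≠ x.val := fun hc e => hxn (e ▸ hc.1)
  have hqc : ∀ {v c}, c ∈ T.children v → c ≠ q := fun hc e => hq (e ▸ hc.1)
  have hqv : ∀ {v c}, c ∈ T.children v → v ≠ q := fun hc e => hq (e ▸ (hT.mem_of_child hc).1)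
  have hqg : q ≠ g := fun e => hq (e ▸ hg)
  have hpg : g ≠ T.root → g ∈ T.children (T.parent g) := fun hr => ⟨hg, hr, rfl⟩
  have hBx : insertClusters B x g q x = {x} := if_pos rfl
  have hBq : ∀ {y}, y ∈ insertClusters B x g q q ↔ y = x ∨ y ∈ B g := by
    simp [insertClusters, hxq.symm]
  have hBg : insertClusters B x g q g = B g := by simp [insertClusters, hxg.symm, hqg.symm]
  have hmem : ∀ {c y}, c ≠ x.val → c ≠ q →
      (y ∈ insertClusters B x g q c ↔ y ∈ B c ∨ (y = x ∧ B g ⊆ B c ∧ c ≠ g)) := by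
    intro c y hc hc'
    simp only [insertClusters, hc, hc', if_false]
    split_ifs with hs
    · simp [hs, or_comm]
    · simp only [hs, and_false, or_false]
  have hcross : ∀ v, ∀ c ∈ T'.children v, ∀ d ∈ T'.children v, c ≠ d →
      ∀ y ∈ insertClusters B x g q c, ∀ w ∈ insertClusters B x g q d,
        CrossJoin T T' B S M x v y w := by
    have h11 : ∀ {v c d y w}, c ∈ T.children v → d ∈ T.children v → c ≠ d → y = x → B g ⊆ B c →
        w ∈ B d → CrossJoin T T' B S M x v y w := by
      intro v c d y w hc hd hcd hy hgc hw
      refine .inr (.inl ⟨hy, hT.subset_S hd.1 hw, ?_⟩)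
      rw [h.series v (hT.mem_of_child hc).1]
      exact hM.above v c hc hgc w (hT.subset_of_child hd hw) (hT.disj v d hd c hc hcd.symm w hw)
    have h12 : ∀ {v c y w}, c ∈ T.children v → c ≠ g → g ≠ T.root → v = T.parent g →
        y ∈ insertClusters B x g q c → w ∈ insertClusters B x g q q →
        CrossJoin T T' B S M x v y w := by
      rintro v c y w hc hcg hgr rfl hy hw
      have hyc := ((hmem (hxc hc) (hqc hc)).1 hy).resolve_right
        fun h => hcg (hT.children_unique hg hc (hpg hgr) h.2.1 subset_rfl)
      rcases hBq.1 hw with hw | hw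
      · exact (h11 (hpg hgr) hc hcg.symm hw subset_rfl hyc).symm
      · exact .inl ⟨_, c, hc, g, hpg hgr, hcg, hyc, hw, h.series _ (hT.mem_of_child hc).1⟩
    have h33 : ∀ {y w}, y ∈ insertClusters B x g q g → w ∈ insertClusters B x g q x →
        CrossJoin T T' B S M x q y w := by
      intro y w hy hw
      rw [hBg] at hy
      rw [hBx] at hw
      refine .inr (.inr ⟨hw, hT.subset_S hg hy, ?_⟩)
      rw [h.series_q]
      exact hM.inside y hy
    intro v c hc d hd hcd y hy w hw
    rcases hch.1 hc with h1 | h1 | h1 <;> rcases hch.1 hd with h2 | h2 | h2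
    · rw [hmem (hxc h1.1) (hqc h1.1)] at hy
      rw [hmem (hxc h2.1) (hqc h2.1)] at hw
      rcases hy with hy | hy <;> rcases hw with hw | hw
      · exact .inl ⟨v, c, h1.1, d, h2.1, hcd, hy, hw, h.series v (hT.mem_of_child h1.1).1⟩
      · exact (h11 h2.1 h1.1 hcd.symm hw.1 hw.2.1 hy).symm
      · exact h11 h1.1 h2.1 hcd hy.1 hy.2.1 hw
      · exact absurd (hT.children_unique hg h1.1 h2.1 hy.2.1 hw.2.1) hcd
    · exact h12 h1.1 h1.2 h2.2.1 h2.2.2 hy (h2.1 ▸ hw)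
    · exact absurd h2.1 (hqv h1.1)
    · exact (h12 h2.1 h2.2 h1.2.1 h1.2.2 hw (h1.1 ▸ hy)).symm
    · exact absurd (h1.1.trans h2.1.symm) hcd
    · exact absurd (h1.2.2.symm.trans h2.1) (hqv (hpg h1.2.1))
    · exact absurd h1.1 (hqv h2.1)
    · exact absurd (h2.2.2.symm.trans h1.1) (hqv (hpg h2.2.1))
    · obtain ⟨rfl, h1⟩ := h1
      rcases h1 with rfl | rfl <;> rcases h2.2 with rfl | rfl
      · exact absurd rfl hcd
      · exact h33 hy hw
      · exact (h33 hw hy).symm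
      · exact absurd rfl hcd
  refine ⟨?_, ?_, ?_, ?_, ?_, fun v c hc d hd hcd y hy hy' =>
    (hcross v c hc d hd hcd y hy y hy').ne hT hx rfl, ?_, ?_, fun v c hc d hd hcd y hy w hw =>
    (hcross v c hc d hd hcd y hy w hw).adj hT hH, ?_⟩
  · rw [h.nodes, h.root]
    split_ifs
    · exact mem_insert_of_mem (Finset.mem_insert_self _ _)
    · exact mem_insert_of_mem (mem_insert_of_mem hT.root_mem)
  · rw [h.root]
    split_ifs with hr
    · rw [h.parent_q, if_pos hr]
    · rw [h.parent _ hT.root_mem (Ne.symm hr), hT.parent_root]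
  · intro c hc hcr
    rw [h.nodes, mem_insert, mem_insert] at hc ⊢
    rw [h.root] at hcr
    rcases hc with rfl | rfl | hc
    · rw [h.parent_x]; exact ⟨.inr (.inl rfl), hqn⟩
    · rw [h.parent_q]
      split_ifs at hcr ⊢ with hr
      · exact absurd rfl hcr
      · exact ⟨.inr (.inr (hT.parent_mem g hg hr).1), (hT.parent_mem g hg hr).2⟩
    by_cases hcg : c = g
    · rw [hcg, h.parent_g]; exact ⟨.inr (.inl rfl), hqn⟩
    · rw [h.parent c hc hcg]
      have hcr' : c ≠ T.root := by
        split_ifs at hcr with hr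
        · exact hr ▸ hcg
        · exact hcr
      exact ⟨.inr (.inr (hT.parent_mem c hc hcr').1), (hT.parent_mem c hc hcr').2⟩
  · intro v hv hvn y
    rw [h.nodes, mem_insert, mem_insert] at hv
    by_cases hvx : v = x
    · subst hvx
      rw [hBx, Set.mem_singleton_iff, Fin.ext_iff]
    · have hvq : v ≠ q := by omega
      have hv' := (hv.resolve_left hvx).resolve_left hvq
      rw [hmem hvx hvq, hT.leaf v hv' hvn y, or_iff_left]
      rintro ⟨-, h2, hvg⟩
      have := hT.isAncestor_of_subset hv' hg h2
      obtain ⟨c, hc, -⟩ := hT.rooted.exists_child hg this hvg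
      have := (hT.mem_of_child hc).2
      omega
  · intro v hv hvn y
    rw [h.nodes, mem_insert, mem_insert] at hv
    have hvx : v ≠ x := by have := x.2; omega
    by_cases hvq : v = q
    · subst hvq
      rw [hBq]
      constructor
      · rintro (rfl | hy)
        · exact ⟨y, hch.2 (.inr (.inr ⟨rfl, .inr rfl⟩)), hBx.symm ▸ rfl⟩
        · exact ⟨g, hch.2 (.inr (.inr ⟨rfl, .inl rfl⟩)), hBg.symm ▸ hy⟩
      · rintro ⟨c, hc, hy⟩
        rcases hch.1 hc with h1 | h1 | ⟨-, rfl | rfl⟩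
        · exact absurd rfl (hqv h1.1)
        · exact absurd h1.2.2.symm (hqv (hpg h1.2.1))
        · exact .inr (hBg ▸ hy)
        · rw [hBx] at hy
          exact .inl hy
    have hv' := (hv.resolve_left hvx).resolve_left hvq
    rw [hmem hvx hvq, hT.node v hv' hvn y]
    constructor
    · rintro (⟨c, hc, hy⟩ | ⟨rfl, hgv, hvg⟩)
      · by_cases hcg : c = g
        · subst hcg
          exact ⟨q, hch.2 (.inr (.inl ⟨rfl, hc.2.1, hc.2.2.symm⟩)), hBq.2 (.inr hy)⟩
        · exact ⟨c, hch.2 (.inl ⟨hc, hcg⟩), (hmem (hxc hc) (hqc hc)).2 (.inl hy)⟩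
      · obtain ⟨c, hc, hgc⟩ := hT.exists_child_of_subset hv' hg hgv hvg
        by_cases hcg : c = g
        · subst hcg
          exact ⟨q, hch.2 (.inr (.inl ⟨rfl, hc.2.1, hc.2.2.symm⟩)), hBq.2 (.inl rfl)⟩
        · exact ⟨c, hch.2 (.inl ⟨hc, hcg⟩), (hmem (hxc hc) (hqc hc)).2 (.inr ⟨rfl, hgc, hcg⟩)⟩
    · rintro ⟨c, hc, hy⟩
      rcases hch.1 hc with h1 | ⟨rfl, hgr, rfl⟩ | h1
      · rcases (hmem (hxc h1.1) (hqc h1.1)).1 hy with hy | hy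
        · exact .inl ⟨c, h1.1, hy⟩
        · refine .inr ⟨hy.1, hy.2.1.trans (hT.subset_of_child h1.1), ?_⟩
          rintro rfl
          exact hT.not_subset_of_mem_children h1.1 hy.2.1
      · rcases hBq.1 hy with hy | hy
        · exact .inr ⟨hy, hT.subset_of_child (hpg hgr), hT.rooted.parent_ne hg hgr⟩
        · exact .inl ⟨g, hpg hgr, hy⟩
      · exact absurd h1.1 hvq
  · intro v hv hvn
    rw [h.nodes, mem_insert, mem_insert] at hv
    by_cases hvq : v = q
    · exact ⟨g, hch.2 (.inr (.inr ⟨hvq, .inl rfl⟩)), x, hch.2 (.inr (.inr ⟨hvq, .inr rfl⟩)),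
        hxg.symm⟩
    have hvx : v ≠ x := by have := x.2; omega
    obtain ⟨c, hc, d, hd, hcd⟩ := hT.two v ((hv.resolve_left hvx).resolve_left hvq) hvn
    have key : ∀ e ∈ T.children v, (if e = g then q else e) ∈ T'.children v := by
      intro e he
      split_ifs with heg
      · exact hch.2 (.inr (.inl ⟨rfl, heg ▸ he.2.1, heg ▸ he.2.2.symm⟩))
      · exact hch.2 (.inl ⟨he, heg⟩)
    refine ⟨_, key c hc, _, key d hd, ?_⟩
    have := hqc hc
    have := hqc hd
    split_ifs <;> omega
  · intro v hv
    rw [h.nodes, mem_insert, mem_insert] at hv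
    by_cases hvx : v = x
    · rw [hvx, hBx]; exact Set.singleton_nonempty x
    by_cases hvq : v = q
    · exact ⟨x, hvq ▸ hBq.2 (.inl rfl)⟩
    · obtain ⟨y, hy⟩ := hT.nonempty v ((hv.resolve_left hvx).resolve_left hvq)
      exact ⟨y, (hmem hvx hvq).2 (.inl hy)⟩
  · ext y
    rw [h.root, Set.mem_insert_iff]
    split_ifs with hr
    · rw [hBq, hr, hT.root_eq]
    · rw [hmem (fun e => hxn (e ▸ hT.root_mem)) (fun e => hq (e ▸ hT.root_mem)), hT.root_eq, or_comm]
      simp [hT.subset_S hg, Ne.symm hr]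

end LabelledTree

/-! ### Circular doubly linked lists -/

/-- Consecutive cells of a doubly linked list. -/
def Link (nx pv : ℕ → ℕ) (a b : ℕ) : Prop := nx a = b ∧ pv b = a

/-- The cells after the sentinel `h` are those in `l`, up to the return to `h`. -/
def Linked (nx pv : ℕ → ℕ) (h : ℕ) (l : List ℕ) : Prop := List.IsChain (Link nx pv) (h :: (l ++ [h]))

/-- Only successors of cells before the last and predecessors of cells after the first matter, so
the outer pointers at the two ends of a chain may be overwritten. -/
theorem isChain_congr {R R' : ℕ → ℕ → Prop} : ∀ {l : List ℕ}, l.IsChain R →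
    (∀ a ∈ l.dropLast, ∀ b ∈ l.tail, R a b → R' a b) → l.IsChain R'
  | [], _, _ => .nil
  | [a], _, _ => .singleton a
  | a :: b :: l, h, h' => by
    rw [List.isChain_cons_cons] at h ⊢
    refine ⟨h' a (by simp [List.dropLast]) b (by simp) h.1, isChain_congr h.2 fun c hc d hd => ?_⟩
    exact h' c (by simpa [List.dropLast] using .inr hc) d (List.mem_of_mem_tail (by simpa using hd))

theorem Linked.congr {nx pv nx' pv' : ℕ → ℕ} {h : ℕ} {l : List ℕ} (hl : Linked nx pv h l)
    (h1 : ∀ a, a = h ∨ a ∈ l → nx' a = nx a) (h2 : ∀ a, a = h ∨ a ∈ l → pv' a = pv a) :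
    Linked nx' pv' h l := by
  refine isChain_congr hl fun a ha b hb hab => ?_
  have ha' : a = h ∨ a ∈ l := by
    have : a ∈ h :: l := by
      have e : (h :: (l ++ [h])).dropLast = h :: l := by
        rw [← List.cons_append, List.dropLast_concat]
      rwa [e] at ha
    simpa using this
  have hb' : b = h ∨ b ∈ l := by simpa [or_comm] using hb
  exact ⟨(h1 a ha').trans hab.1, (h2 b hb').trans hab.2⟩

theorem Linked.insert {nx pv : ℕ → ℕ} {h c : ℕ} {l : List ℕ} (hl : Linked nx pv h l)
    (hn : l.Nodup) (hhl : h ∉ l) (hch : c ≠ h) (hcl : c ∉ l) :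
    Linked (update (update nx c (nx h)) h c)
      (update (update pv c h) (nx h) c) h (c :: l) := by
  unfold Linked at hl ⊢
  rw [List.cons_append]
  have hnd : (l ++ [h]).Nodup := by
    rw [List.nodup_append]
    exact ⟨hn, by simp, by rintro a ha b hb rfl; simp at hb; exact hhl (hb ▸ ha)⟩
  have hcm : c ∉ l ++ [h] := by simpa using ⟨hcl, hch⟩
  have hdl : (l ++ [h]).dropLast = l := List.dropLast_concat
  have hne : l ++ [h] ≠ [] := by simp
  -- After this the first cell may be the sentinel, so the empty list needs no separate treatment.
  generalize l ++ [h] = m at *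
  cases m with
  | nil => exact absurd rfl hne
  | cons f m =>
    rw [List.isChain_cons_cons] at hl ⊢
    rw [List.isChain_cons_cons]
    obtain ⟨⟨hf, hf'⟩, hl⟩ := hl
    have hfc : f ≠ c := by rintro rfl; simp at hcm
    refine ⟨⟨by simp, by simp [hf, hfc.symm]⟩, ⟨by simp [hch, hf], by simp [hf]⟩, ?_⟩
    refine isChain_congr hl fun a ha b hb hab => ?_
    rw [hdl] at ha
    have hb' : b ∈ m := by simpa using hb
    have h1 : a ≠ h := fun e => hhl (e ▸ ha)
    have h2 : a ≠ c := fun e => hcl (e ▸ ha)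
    have h3 : b ≠ f := fun e => (List.nodup_cons.1 hnd).1 (e ▸ hb')
    have h4 : b ≠ c := fun e => hcm (e ▸ List.mem_cons_of_mem _ hb')
    exact ⟨by simp [h1, h2, hab.1], by simp [hf, h3, h4, hab.2]⟩

/-- The last two conclusions locate the cells that are written; `LinkedForest.remove` needs them to
see that the other lists are untouched. -/
theorem Linked.remove {nx pv : ℕ → ℕ} {h c : ℕ} {l1 l2 : List ℕ}
    (hl : Linked nx pv h (l1 ++ c :: l2)) (hn : (l1 ++ c :: l2).Nodup) (hhl : h ∉ l1 ++ c :: l2) :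
    Linked (update nx (pv c) (nx c)) (update pv (nx c) (pv c)) h (l1 ++ l2) ∧
      (pv c = h ∨ pv c ∈ l1 ++ c :: l2) ∧ (nx c = h ∨ nx c ∈ l1 ++ c :: l2) := by
  unfold Linked at hl ⊢
  have e1 : h :: (l1 ++ c :: l2 ++ [h]) = (h :: l1) ++ c :: (l2 ++ [h]) := by simp
  have e2 : h :: (l1 ++ l2 ++ [h]) = (h :: l1) ++ (l2 ++ [h]) := by simp
  rw [e1, List.isChain_append] at hl
  rw [e2, List.isChain_append]
  obtain ⟨h1, h2, h3⟩ := hl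
  obtain ⟨X, a, hX⟩ : ∃ X a, h :: l1 = X ++ [a] :=
    ⟨_, _, (List.dropLast_append_getLast (List.cons_ne_nil h l1)).symm⟩
  obtain ⟨b, Y, hY⟩ : ∃ b Y, l2 ++ [h] = b :: Y := by
    cases l2 with
    | nil => exact ⟨h, [], rfl⟩
    | cons b Y => exact ⟨b, Y ++ [h], rfl⟩
  have ha : a = h ∨ a ∈ l1 := by
    have : a ∈ h :: l1 := by rw [hX]; simp
    simpa using this
  have hb : b = h ∨ b ∈ l2 := by
    have : b ∈ l2 ++ [h] := by rw [hY]; simp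
    simpa [or_comm] using this
  have hpc : pv c = a := (h3 a (by rw [hX]; simp) c (by simp)).2
  have hnc : nx c = b := by
    rw [hY, List.isChain_cons_cons] at h2
    exact h2.1.1
  rw [hpc, hnc]
  have hn' := hn
  rw [List.nodup_append, List.nodup_cons] at hn
  obtain ⟨hn1, ⟨hc2, hn2⟩, hdis⟩ := hn
  have hh1 : h ∉ l1 := fun e => hhl (by simp [e])
  have hh2 : h ∉ l2 := fun e => hhl (by simp [e])
  have hd12 : ∀ e, e ∈ l1 → e ∉ l2 := fun e he he' => hdis e he e (by simp [he']) rfl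
  refine ⟨⟨?_, ?_, ?_⟩, ?_, ?_⟩
  · refine isChain_congr h1 fun p hp r hr hpr => ?_
    have hpa : p ≠ a := by
      rintro rfl
      have hnd : (h :: l1).Nodup := List.nodup_cons.2 ⟨hh1, hn1⟩
      rw [hX, List.dropLast_concat] at hp
      rw [hX, List.nodup_append] at hnd
      exact hnd.2.2 p hp p (by simp) rfl
    have hrb : r ≠ b := by
      rintro rfl
      have hr' : r ∈ l1 := by simpa using hr
      rcases hb with rfl | hb
      · exact hh1 hr'
      · exact hd12 r hr' hb
    exact ⟨by simp [hpa, hpr.1], by simp [hrb, hpr.2]⟩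
  · rw [List.isChain_cons] at h2
    refine isChain_congr h2.2 fun p hp r hr hpr => ?_
    have hpa : p ≠ a := by
      rintro rfl
      rw [List.dropLast_concat] at hp
      rcases ha with rfl | ha
      · exact hh2 hp
      · exact hd12 p ha hp
    have hrb : r ≠ b := by
      rintro rfl
      have hnd : (l2 ++ [h]).Nodup := by
        rw [List.nodup_append]
        exact ⟨hn2, by simp, by rintro a ha b hb rfl; simp at hb; exact hh2 (hb ▸ ha)⟩
      rw [hY] at hnd hr
      exact (List.nodup_cons.1 hnd).1 (by simpa using hr)
    exact ⟨by simp [hpa, hpr.1], by simp [hrb, hpr.2]⟩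
  · intro p hp r hr
    rw [hX] at hp
    rw [hY] at hr
    obtain rfl : a = p := by simpa using hp
    obtain rfl : b = r := by simpa using hr
    exact ⟨by simp, by simp⟩
  · rcases ha with ha | ha
    · exact .inl ha
    · exact .inr (by simp [ha])
  · rcases hb with hb | hb
    · exact .inl hb
    · exact .inr (by simp [hb])

/-- For each node `u` in `I`, the nodes in `A` with parent `u` form a circular doubly linked list with
sentinel `u + K`. -/
structure LinkedForest (K : ℕ) (A I : Finset ℕ) (parent nx pv : ℕ → ℕ) : Prop where
  lt : ∀ c ∈ A, c < K
  lists : ∀ u ∈ I, ∃ l : List ℕ, l.Nodup ∧ (∀ c, c ∈ l ↔ c ∈ A ∧ parent c = u) ∧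
    Linked nx pv (u + K) l

namespace LinkedForest

variable {K : ℕ} {A I : Finset ℕ} {parent nx pv : ℕ → ℕ}

/-- Nodes are smaller than `K` and sentinels are not, and lists of different parents are disjoint;
so the writes reach no list but that of `p`. -/
theorem insert (h : LinkedForest K A I parent nx pv) {c p : ℕ} (hc : c ∉ A) (hcK : c < K)
    (hp : p ∈ I) :
    LinkedForest K (insert c A) I (update parent c p)
      (update (update nx c (nx (p + K))) (p + K) c)
      (update (update pv c (p + K)) (nx (p + K)) c) := by
  refine ⟨fun d hd => ?_, fun u hu => ?_⟩
  · rcases mem_insert.1 hd with rfl | hd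
    · exact hcK
    · exact h.lt d hd
  obtain ⟨l, hn, hl, hL⟩ := h.lists u hu
  have hlK : ∀ d ∈ l, d < K := fun d hd => h.lt d ((hl d).1 hd).1
  have hcl : c ∉ l := fun e => hc ((hl c).1 e).1
  by_cases hup : u = p
  · subst hup
    refine ⟨c :: l, List.nodup_cons.2 ⟨hcl, hn⟩, fun d => ?_,
      hL.insert hn (fun e => by have := hlK _ e; omega) (by omega) hcl⟩
    rw [List.mem_cons, hl, mem_insert]
    by_cases hdc : d = c
    · simp [hdc]
    · simp [hdc]
  · refine ⟨l, hn, fun d => ?_, hL.congr (fun a ha => ?_) fun a ha => ?_⟩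
    · rw [hl, mem_insert]
      by_cases hdc : d = c
      · subst hdc
        simp [hc, Ne.symm hup]
      · simp [hdc]
    · have h1 : a ≠ c := by rcases ha with rfl | ha
                            · omega
                            · exact fun e => hcl (e ▸ ha)
      have h2 : a ≠ p + K := by rcases ha with rfl | ha
                                · omega
                                · have := hlK a ha; omega
      simp [h1, h2]
    · have h1 : a ≠ c := by rcases ha with rfl | ha
                            · omega
                            · exact fun e => hcl (e ▸ ha)
      obtain ⟨l', hn', hl', hL'⟩ := h.lists p hp
      -- The second write to `pv` has a computed address; it is the sentinel or the first cell of
      -- the list of `p`.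
      have hf : nx (p + K) = p + K ∨ nx (p + K) ∈ l' := by
        unfold Linked at hL'
        cases l' with
        | nil => left; simpa [Link] using (List.isChain_cons_cons.1 hL').1.1
        | cons f m =>
          right
          have := (List.isChain_cons_cons.1 hL').1.1
          simp [this]
      have h2 : a ≠ nx (p + K) := by
        rcases hf with hf | hf
        · rw [hf]
          rcases ha with rfl | ha
          · omega
          · have := hlK a ha; omega
        · have hf' := (hl' _).1 hf
          rintro rfl
          rcases ha with ha | ha
          · have := h.lt _ hf'.1; omega
          · exact hup (((hl _).1 ha).2.symm.trans hf'.2)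
      simp [h1, h2]

theorem remove (h : LinkedForest K A I parent nx pv) {c : ℕ} (hc : c ∈ A) (hp : parent c ∈ I) :
    LinkedForest K (A.erase c) I parent
      (update nx (pv c) (nx c)) (update pv (nx c) (pv c)) := by
  obtain ⟨l', hn', hl', hL'⟩ := h.lists _ hp
  have hlK' : ∀ d ∈ l', d < K := fun d hd => h.lt d ((hl' d).1 hd).1
  have hcl : c ∈ l' := (hl' c).2 ⟨hc, rfl⟩
  obtain ⟨l1, l2, rfl⟩ := List.append_of_mem hcl
  obtain ⟨k1, k2, k3⟩ := hL'.remove hn' (fun e => by have := hlK' _ e; omega)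
  refine ⟨fun d hd => h.lt d (Finset.mem_of_mem_erase hd), fun u hu => ?_⟩
  by_cases hup : u = parent c
  · subst hup
    refine ⟨l1 ++ l2, ?_, fun d => ?_, k1⟩
    · exact hn'.sublist (by simp)
    · have hd := hl' d
      have hn2 : (c :: (l1 ++ l2)).Nodup := (List.perm_middle.nodup_iff).1 hn'
      by_cases hdc : d = c
      · subst hdc
        simp only [Finset.mem_erase, ne_eq, not_true, false_and, iff_false]
        exact (List.nodup_cons.1 hn2).1
      · simp only [List.mem_append, List.mem_cons, hdc, false_or] at hd
        simp [hdc, hd]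
  · obtain ⟨l, hn, hl, hL⟩ := h.lists u hu
    have hlK : ∀ d ∈ l, d < K := fun d hd => h.lt d ((hl d).1 hd).1
    have key : ∀ e a, (e = parent c + K ∨ e ∈ l1 ++ c :: l2) → (a = u + K ∨ a ∈ l) → a ≠ e := by
      rintro e a (rfl | he) (rfl | ha)
      · omega
      · have := hlK a ha; omega
      · have := hlK' e he; omega
      · rintro rfl
        exact hup (((hl _).1 ha).2.symm.trans ((hl' _).1 he).2)
    refine ⟨l, hn, fun d => ?_, hL.congr (fun a ha => ?_) fun a ha => ?_⟩
    · rw [hl, Finset.mem_erase]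
      by_cases hdc : d = c
      · subst hdc
        simp [Ne.symm hup]
      · simp [hdc]
    · simp [key _ a k2 ha]
    · simp [key _ a k3 ha]

theorem newNode (h : LinkedForest K A I parent nx pv) {q : ℕ} (hq : q ∉ I)
    (hqA : ∀ c ∈ A, parent c ≠ q) :
    LinkedForest K A (Insert.insert q I) parent
      (update nx (q + K) (q + K)) (update pv (q + K) (q + K)) := by
  refine ⟨h.lt, fun u hu => ?_⟩
  by_cases huq : u = q
  · subst huq
    refine ⟨[], List.nodup_nil, fun c => ?_, ?_⟩
    · simpa using hqA c
    · simp [Linked, Link]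
  · obtain ⟨l, hn, hl, hL⟩ := h.lists u ((mem_insert.1 hu).resolve_left huq)
    have key : ∀ a, a = u + K ∨ a ∈ l → a ≠ q + K := by
      rintro a (rfl | ha)
      · omega
      · have := h.lt a ((hl a).1 ha).1; omega
    exact ⟨l, hn, hl, hL.congr (fun a ha => by simp [key a ha]) fun a ha => by simp [key a ha]⟩

theorem congr_parent {parent' : ℕ → ℕ} (h : LinkedForest K A I parent nx pv)
    (hp : ∀ c ∈ A, parent' c = parent c) : LinkedForest K A I parent' nx pv := by
  refine ⟨h.lt, fun u hu => ?_⟩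
  obtain ⟨l, hn, hl, hL⟩ := h.lists u hu
  refine ⟨l, hn, fun c => ?_, hL⟩
  rw [hl]
  exact ⟨fun h => ⟨h.1, (hp c h.1).trans h.2⟩, fun h => ⟨h.1, (hp c h.1).symm.trans h.2⟩⟩

end LinkedForest

/-! ### The program -/

/-- Registers: number of internal nodes created so far; length of the output list. -/
abbrev rUsed : ℕ := 6
abbrev rOut : ℕ := 7

/-- Auxiliary registers. -/
abbrev rK : ℕ := 10
abbrev rLen : ℕ := 11
abbrev rIdx : ℕ := 12
abbrev rJ : ℕ := 13
abbrev rE : ℕ := 14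
abbrev rP : ℕ := 15
abbrev rV : ℕ := 16
abbrev rFlag : ℕ := 17
abbrev rBest : ℕ := 18
abbrev rU : ℕ := 19
abbrev rLab : ℕ := 20
abbrev rG : ℕ := 21
abbrev rQLen : ℕ := 22
abbrev rHead : ℕ := 23
abbrev rFull : ℕ := 24
abbrev rZ : ℕ := 25
abbrev rC : ℕ := 26
abbrev rNext : ℕ := 27
abbrev rLow : ℕ := 28
abbrev rY : ℕ := 29
abbrev rEx : ℕ := 30
abbrev rPrev : ℕ := 31
abbrev rA : ℕ := 32
abbrev rB : ℕ := 33

/-- Arrays: number of leaves below a node; successor and predecessor in the lists of children, where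
the cell `u + K` is the sentinel of the list of `u`; marks of the non-hollow nodes; total number of
leaves below the non-hollow children. -/
abbrev aLeaf : ℕ := 10
abbrev aNx : ℕ := 11
abbrev aPv : ℕ := 12
abbrev aMark : ℕ := 13
abbrev aNh : ℕ := 14

/-- Auxiliary arrays: the non-hollow nodes, parents first; whether all neighbours outside the subtree
are joined to the node from above; number of vertices joined from above; whether there is a candidate
below; the queue of nodes whose leaves have to be listed. -/
abbrev aOrd : ℕ := 15
abbrev aElig : ℕ := 16
abbrev aSA : ℕ := 17
abbrev aBel : ℕ := 18
abbrev aQ : ℕ := 19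

attribute [simp] rN rI rRoot rCount rX rDeg aNbr aParent aSeries aOutOff aOut aAnchor aCost aOrder
  aAdjOff aAdj rUsed rOut rK rLen rIdx rJ rE rP rV rFlag rBest rU rLab rG rQLen rHead rFull rZ rC
  rNext rLow rY rEx rPrev rA rB aLeaf aNx aPv aMark aNh aOrd aElig aSA aBel aQ
attribute [simp] wp block Exp.eval Exp.RFits Test.Holds Test.RFits isInput

/-- `r := r + 1`. -/
def incr (r : ℕ) : Cmd := .assign r (.add (.var r) (.const 1))

/-- The test `r1 ≠ r2`. -/
def neTest (r1 r2 : ℕ) : Test :=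
  .lt (.const 0) (.add (.sub (.var r1) (.var r2)) (.sub (.var r2) (.var r1)))

attribute [simp] incr neTest

/-- Counts the unmarked nodes on the path from `rE` to the root. -/
def climbCount : Cmd :=
  .while (.eq (.get aMark (.var rE)) (.const 0)) (block [
    incr rJ,
    .assign rE (.get aParent (.var rE))])

/-- Marks the unmarked nodes on the path from `rE` to the root. -/
def climbMark : Cmd :=
  .while (.eq (.get aMark (.var rE)) (.const 0)) (block [
    .store aMark (.var rE) (.const 1),
    .assign rP (.get aParent (.var rE)),
    .store aNh (.var rP) (.add (.get aNh (.var rP)) (.get aLeaf (.var rE))),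
    .assign rJ (.sub (.var rJ) (.const 1)),
    .store aOrd (.var rJ) (.var rE),
    .assign rE (.var rP)])

/-- Marks the non-hollow nodes. -/
def markPhase : Cmd :=
  .ite (.eq (.var rDeg) (.const 0)) (.assign rLen (.const 0)) (block [
    .store aMark (.var rRoot) (.const 1),
    .store aOrd (.const 0) (.var rRoot),
    .assign rLen (.const 1),
    .assign rIdx (.const 0),
    .while (.lt (.var rIdx) (.var rDeg)) (block [
      .assign rY (.get aNbr (.var rIdx)),
      .assign rE (.var rY),
      .assign rJ (.var rLen),
      climbCount,
      .assign rLen (.var rJ),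
      .assign rE (.var rY),
      climbMark,
      incr rIdx])])

/-- Computes, from the root to the leaves, which nodes are possible anchors. -/
def evalPhase : Cmd := block [
  .assign rIdx (.const 0),
  .while (.lt (.var rIdx) (.var rLen)) (block [
    .assign rV (.get aOrd (.var rIdx)),
    .assign rP (.get aParent (.var rV)),
    .store aBel (.var rV) (.const 0),
    .store aElig (.var rV) (.const 0),
    .ite (.eq (.var rV) (.var rRoot))
      (block [.store aElig (.var rV) (.const 1), .store aSA (.var rV) (.const 0)])
      (.ite (.eq (.get aElig (.var rP)) (.const 1))
        (.ite (.eq (.get aSeries (.var rP)) (.const 1))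
          (block [.store aElig (.var rV) (.const 1),
            .store aSA (.var rV) (.add (.get aSA (.var rP))
              (.sub (.get aLeaf (.var rP)) (.get aLeaf (.var rV))))])
          (.ite (.eq (.get aNh (.var rP)) (.get aLeaf (.var rV)))
            (block [.store aElig (.var rV) (.const 1),
              .store aSA (.var rV) (.get aSA (.var rP))])
            .skip))
        .skip),
    incr rIdx])]

/-- Lists the completion anchored at `rV`. -/
def emit : Cmd := block [
  .store aAnchor (.var rCount) (.var rV),
  .store aCost (.var rCount)
    (.sub (.add (.get aSA (.var rV)) (.get aNh (.var rV))) (.var rDeg)),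
  .ite (.lt (.get aCost (.var rCount)) (.var rBest))
    (block [.assign rBest (.get aCost (.var rCount)), .assign rU (.var rV)])
    .skip,
  incr rCount]

/-- Lists, from the leaves to the root, the minimal completions. -/
def enumPhase : Cmd := block [
  .assign rCount (.const 0),
  .assign rBest (.add (.get aLeaf (.var rRoot)) (.const 1)),
  .assign rIdx (.var rLen),
  .while (.lt (.const 0) (.var rIdx)) (block [
    .assign rIdx (.sub (.var rIdx) (.const 1)),
    .assign rV (.get aOrd (.var rIdx)),
    .assign rFlag (.get aBel (.var rV)),
    .ite (.eq (.get aElig (.var rV)) (.const 1))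
      (.ite (.lt (.var rV) (.var rN)) .skip
        (.ite (.lt (.get aNh (.var rV)) (.get aLeaf (.var rV)))
          (block [
            .ite (.eq (.get aSeries (.var rV)) (.const 1)) emit
              (.ite (.eq (.var rFlag) (.const 0)) emit .skip),
            .assign rFlag (.const 1)])
          .skip))
      .skip,
    .ite (.eq (.var rFlag) (.const 1)) (.store aBel (.get aParent (.var rV)) (.const 1)) .skip])]

/-- Appends `r` to the queue. -/
def push (r : ℕ) : Cmd := block [.store aQ (.var rQLen) (.var r), incr rQLen]

attribute [simp] push

/-- Appends the children of `rP` other than `rEx` to the queue. -/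
def pushChildren : Cmd := block [
  .assign rC (.get aNx (.add (.var rP) (.var rK))),
  .while (.lt (.var rC) (.var rK)) (block [
    .ite (.eq (.var rC) (.var rEx)) .skip (push rC),
    .assign rC (.get aNx (.var rC))])]

/-- Puts the non-hollow children of `rU` into the queue. -/
def scanPhase : Cmd := block [
  .assign rQLen (.const 0),
  .assign rIdx (.const 0),
  .while (.lt (.var rIdx) (.var rLen)) (block [
    .assign rV (.get aOrd (.var rIdx)),
    .ite (.eq (.var rV) (.var rRoot)) .skip
      (.ite (.eq (.get aParent (.var rV)) (.var rU)) (push rV) .skip),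
    incr rIdx])]

/-- Appends to the queue the nodes that hang off the series nodes above `rU`. -/
def seriesPhase : Cmd := block [
  .assign rE (.var rU),
  .while (neTest rE rRoot) (block [
    .assign rP (.get aParent (.var rE)),
    .ite (.eq (.get aSeries (.var rP)) (.const 1)) (block [.assign rEx (.var rE), pushChildren])
      .skip,
    .assign rE (.var rP)])]

/-- Outputs the leaves below the nodes in the queue. -/
def listPhase : Cmd := block [
  .assign rHead (.const 0),
  .while (.lt (.var rHead) (.var rQLen)) (block [
    .assign rP (.get aQ (.var rHead)),
    incr rHead,
    .ite (.lt (.var rP) (.var rN))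
      (block [.store aOut (.var rOut) (.var rP), incr rOut])
      (block [.assign rEx (.var rP), pushChildren])])]

/-- Makes `rC` a child of `rP`. -/
def insertCmd : Cmd := block [
  .assign rNext (.get aNx (.add (.var rP) (.var rK))),
  .store aNx (.var rC) (.var rNext),
  .store aPv (.var rC) (.add (.var rP) (.var rK)),
  .store aNx (.add (.var rP) (.var rK)) (.var rC),
  .store aPv (.var rNext) (.var rC),
  .store aParent (.var rC) (.var rP)]

/-- Removes `rC` from the list of its siblings. -/
def removeCmd : Cmd := block [
  .assign rNext (.get aNx (.var rC)),
  .assign rPrev (.get aPv (.var rC)),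
  .store aNx (.var rPrev) (.var rNext),
  .store aPv (.var rNext) (.var rPrev)]

/-- Creates a node `rZ` with label `rB`. -/
def newNodeCmd : Cmd := block [
  .assign rZ (.add (.var rN) (.var rUsed)),
  incr rUsed,
  .store aSeries (.var rZ) (.var rB),
  .store aNx (.add (.var rZ) (.var rK)) (.add (.var rZ) (.var rK)),
  .store aPv (.add (.var rZ) (.var rK)) (.add (.var rZ) (.var rK))]

/-- Creates a node `rZ` with label `rB` and inserts it above `rA`. -/
def aboveCmd : Cmd := block [
  newNodeCmd,
  .ite (.eq (.var rA) (.var rRoot))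
    (block [.assign rRoot (.var rZ), .store aParent (.var rZ) (.var rZ)])
    (block [.assign rC (.var rZ), .assign rP (.get aParent (.var rA)), insertCmd,
      .assign rC (.var rA), removeCmd]),
  .assign rC (.var rA),
  .assign rP (.var rZ),
  insertCmd]

/-- Moves the first `rFull` nodes of the queue to `rZ`. -/
def moveCmd : Cmd := block [
  .assign rIdx (.const 0),
  .while (.lt (.var rIdx) (.var rFull)) (block [
    .assign rC (.get aQ (.var rIdx)),
    removeCmd,
    .assign rP (.var rZ),
    insertCmd,
    incr rIdx])]

/-- Determines the children of `rU` next to which the new vertex is inserted: `rG` is one of them, and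
`rLow` is the number of leaves below them. -/
def lowerPhase : Cmd :=
  .ite (.eq (.get aSeries (.var rU)) (.const 1))
    (block [
      .assign rG (.get aNx (.add (.var rU) (.var rK))),
      .while (.eq (.get aMark (.var rG)) (.const 1)) (.assign rG (.get aNx (.var rG))),
      .assign rLow (.sub (.get aLeaf (.var rU)) (.get aNh (.var rU)))])
    (block [
      .assign rG (.get aQ (.const 0)),
      .assign rLow (.get aNh (.var rU))])

/-- Collects these children below a node `rG`. -/
def splitPhase : Cmd :=
  .ite (.eq (.get aLeaf (.var rG)) (.var rLow)) .skip
    (.ite (.eq (.get aSeries (.var rU)) (.const 1))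
      (block [
        .assign rA (.var rU),
        .assign rB (.const 1),
        aboveCmd,
        moveCmd,
        .store aLeaf (.var rZ) (.get aLeaf (.var rU)),
        .store aLeaf (.var rU) (.var rLow),
        .assign rG (.var rU)])
      (block [
        .assign rB (.const 0),
        newNodeCmd,
        .assign rC (.var rZ),
        .assign rP (.var rU),
        insertCmd,
        moveCmd,
        .store aLeaf (.var rZ) (.var rLow),
        .assign rG (.var rZ)]))

/-- Creates a node `rZ` with label `rLab` above `rG`. -/
def joinAbove : Cmd := block [
  .assign rA (.var rG),
  .assign rB (.var rLab),
  aboveCmd,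
  .store aLeaf (.var rZ) (.add (.get aLeaf (.var rG)) (.const 1))]

/-- Joins the new vertex to `rG` by a node with label `rLab`. -/
def joinPhase : Cmd := block [
  .ite (.lt (.var rG) (.var rN)) joinAbove
    (.ite (.eq (.get aSeries (.var rG)) (.var rLab))
      (block [.assign rZ (.var rG),
        .store aLeaf (.var rZ) (.add (.get aLeaf (.var rZ)) (.const 1))])
      joinAbove),
  .assign rC (.var rX),
  .assign rP (.var rZ),
  insertCmd,
  .store aLeaf (.var rX) (.const 1),
  .assign rE (.var rZ),
  .while (neTest rE rRoot) (block [
    .assign rE (.get aParent (.var rE)),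
    .store aLeaf (.var rE) (.add (.get aLeaf (.var rE)) (.const 1))])]

/-- Erases the marks. -/
def cleanPhase : Cmd := block [
  .assign rIdx (.const 0),
  .while (.lt (.var rIdx) (.var rLen)) (block [
    .assign rV (.get aOrd (.var rIdx)),
    .store aMark (.var rV) (.const 0),
    .store aNh (.var rV) (.const 0),
    incr rIdx])]

/-- The only minimal completion is empty or complete. -/
def trivialPhase : Cmd := block [
  .store aAnchor (.const 0) (.var rRoot),
  .assign rCount (.const 1),
  .assign rG (.var rRoot),
  .ite (.eq (.var rDeg) (.const 0))
    (block [.store aCost (.const 0) (.const 0), .assign rLab (.const 0),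
      .assign rQLen (.const 0)])
    (block [.store aCost (.const 0) (.sub (.get aLeaf (.var rRoot)) (.var rDeg)),
      .assign rLab (.const 1), .store aQ (.const 0) (.var rRoot), .assign rQLen (.const 1)]),
  listPhase]

/-- Insertion at the node `rU`. -/
def insertionPhase : Cmd := block [
  .assign rLab (.sub (.const 1) (.get aSeries (.var rU))),
  scanPhase,
  .assign rFull (.var rQLen),
  seriesPhase,
  listPhase,
  lowerPhase,
  splitPhase]

def finishPhase : Cmd := block [
  .store aOutOff (.add (.var rI) (.const 1)) (.var rOut),
  incr rI]

/-- The insertion of the first vertex. -/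
def firstStep : Cmd := block [
  .assign rK (.add (.add (.var rN) (.var rN)) (.var rN)),
  .assign rRoot (.var rX),
  .store aParent (.var rX) (.var rX),
  .store aLeaf (.var rX) (.const 1)]

/-- The insertion of a further vertex. -/
def laterStep : Cmd := block [
  markPhase,
  evalPhase,
  enumPhase,
  .ite (.eq (.var rCount) (.const 0)) trivialPhase insertionPhase,
  joinPhase,
  cleanPhase]

/-- The insertion of a vertex. -/
def stepCmd : Cmd := block [
  .ite (.eq (.var rI) (.const 0)) firstStep laterStep,
  finishPhase]

/-! ### Straight-line programs and blocks -/

open LabelledTree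

variable {n W : ℕ} {T T' : LabelledTree n} {G H H' : SimpleGraph (Fin n)} {S N M : Set (Fin n)}
  {s s' : State} {B : ℕ → Set (Fin n)} {u g p v : ℕ} {lab : Bool} {x y : Fin n} {X : Finset ℕ}
  {l : List ℕ} {π : Equiv.Perm (Fin n)}

/-- The effect of a program without branches and loops. -/
def Cmd.run : Cmd → State → State
  | .assign r e, s => { s with reg := update s.reg r (e.eval s) }
  | .store a i e, s =>
    { s with arr := update s.arr a (update (s.arr a) (i.eval s) (e.eval s)) }
  | .seq c1 c2, s => c2.run (c1.run s)
  | _, s => s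

/-- The program has no branches and loops, and the values it computes respect the word bound. -/
def Cmd.Safe (W : ℕ) : Cmd → State → Prop
  | .skip, _ => True
  | .assign _ e, s => e.RFits W s
  | .store _ i e, s => i.RFits W s ∧ e.RFits W s
  | .seq c1 c2, s => c1.Safe W s ∧ c2.Safe W (c1.run s)
  | _, _ => False

/-- For straight-line code the final state is a function of the initial one, so that the
postcondition can be verified by simplification. -/
theorem wp_of_run {c : Cmd} : ∀ {s : State} {Q : State → Prop}, c.Safe W s → Q (c.run s) →
    wp W c s Q := by
  induction c with
  | skip => exact fun _ h => h
  | assign r e => exact fun h h' => ⟨h, h'⟩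
  | store a i e => exact fun h h' => ⟨h.1, h.2, h'⟩
  | seq c1 c2 ih1 ih2 => exact fun h h' => ih1 h.1 (ih2 h.2 h')
  | _ => exact fun h => h.elim

theorem Ter.of_run {c : Cmd} {Q : State → Prop} (h : c.Safe W s) (hQ : Q (c.run s)) :
    Ter W c s c.bound Q :=
  Ter.of_wp (wp_of_run h hQ)

theorem Exp.Fits.eval_le {e : Exp} (h : e.Fits W s) : e.eval s ≤ W := by
  induction e with
  | const c => exact h
  | var r => exact h
  | get a e ih => exact h.2
  | add e1 e2 ih1 ih2 => exact h.2.2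
  | sub e1 e2 ih1 ih2 => exact (Nat.sub_le _ _).trans (ih1 h.1)

theorem Exec.bounded {c : Cmd} {t : ℕ} (h : Exec W c s t s') (hs : Bounded W s) :
    Bounded W s' := by
  induction h with
  | skip s => exact hs
  | assign r e s h => exact hs.updateReg r h.eval_le
  | store a i e s hi he => exact hs.updateArr a _ he.eval_le
  | seq h1 h2 ih1 ih2 => exact ih2 (ih1 hs)
  | ite_true hf hb h ih => exact ih hs
  | ite_false hf hb h ih => exact ih hs
  | while_false hf hb => exact hs
  | while_true hf hb h h' ih ih' => exact ih' (ih hs)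

/-- The rule for sequential composition, with the frame of the first part. -/
theorem Ter.split (k : ℕ) : ∀ {l : List Cmd} {s : State} {T1 T2 : ℕ} {Q Q' : State → Prop}
    (_ : Ter W (block (l.take k)) s T1 Q)
    (_ : ∀ s', Q s' → Frame (block (l.take k)) s s' → Ter W (block (l.drop k)) s' T2 Q'),
    Ter W (block l) s (T1 + T2) Q' := by
  induction k with
  | zero =>
    intro l s T1 T2 Q Q' h1 h2 hs
    obtain ⟨t, s', e, ht, hs', hq⟩ := h1 hs
    have hf := e.frame
    simp only [List.take_zero, block] at e
    cases e
    obtain ⟨t', s'', e', ht', hs'', hq'⟩ := h2 _ hq hf hs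
    exact ⟨t', s'', e', by omega, hs'', hq'⟩
  | succ k ih =>
    rintro (_ | ⟨c, l⟩) s T1 T2 Q Q' h1 h2 hs
    · obtain ⟨t, s', e, ht, hs', hq⟩ := h1 hs
      have hf := e.frame
      simp only [List.take_nil, block] at e
      cases e
      obtain ⟨t', s'', e', ht', hs'', hq'⟩ := h2 _ hq hf hs
      exact ⟨t', s'', e', by omega, hs'', hq'⟩
    · obtain ⟨t, s', e, ht, hs', hq⟩ := h1 hs
      have hf := e.frame
      simp only [List.take_succ_cons, block] at e
      cases e with
      | seq e1 e2 =>
        rename_i s1 t1 t2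
        have hs1 : Bounded W s1 := e1.bounded hs
        obtain ⟨t', s'', e', ht', hs'', hq'⟩ := ih (l := l) (s := s1) (T1 := t2) (T2 := T2)
          (Q := (· = s')) (Q' := Q') (fun _ => ⟨_, _, e2, le_rfl, hs', rfl⟩)
          (fun a ha _ => ha ▸ h2 s' hq hf) hs1
        exact ⟨_, s'', .seq e1 e', by omega, hs'', hq'⟩

theorem Ter.le {c : Cmd} {T T' : ℕ} {Q : State → Prop} (h : Ter W c s T Q)
    (hT : T ≤ T') : Ter W c s T' Q :=
  h.mono hT fun _ => id

theorem Ter.single {c : Cmd} {T : ℕ} {Q : State → Prop} (h : Ter W c s T Q) :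
    Ter W (block [c]) s (T + 1) Q :=
  Ter.seq h fun s' h' => Ter.of_run (c := .skip) trivial h'

attribute [simp] Cmd.bound Exp.cost Test.cost Cmd.Safe Cmd.run

/-! ### Marking the non-hollow nodes -/

/-- The total number of leaves below the children of `p` that belong to `X`. -/
noncomputable def leafSum (T : LabelledTree n) (X : Finset ℕ) (p : ℕ) : ℕ :=
  ∑ v ∈ X with (v ≠ T.root ∧ T.parent v = p), (T.below v).ncard

theorem climbCount_spec {y m : ℕ} (hp : s.arr aParent = T.parent)
    (hm : ∀ v, s.arr aMark v = if v ∈ X then 1 else 0) (hE : s.reg rE = y)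
    (h1 : ∀ t < m, T.parent^[t] y ∉ X) (h2 : T.parent^[m] y ∈ X) (hW : s.reg rJ + m + 1 ≤ W) :
    Ter W climbCount s (30 * m + 10) (fun s' => s'.reg rJ = s.reg rJ + m) := by
  refine (Ter.loop_frame (s0 := s) (I := fun t s' => t ≤ m ∧ s'.reg rE = T.parent^[t] y ∧
    s'.reg rJ = s.reg rJ + t) (Φ := fun t => 30 * (m - t)) ?_ ?_ 0 ?_).mono ?_ ?_
  · intro t s' hf hI
    simp
  · rintro t s' hf ⟨ht, hE', hJ⟩ hb
    have hM := hf.arr (a := aMark) rfl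
    have hP := hf.arr (a := aParent) rfl
    have htm : t < m := by
      rcases ht.lt_or_eq with h | rfl
      · exact h
      · simp [hM, hE', hm, h2] at hb
    refine ⟨t + 1, _, ?_, Ter.of_wp ?_⟩
    rotate_left
    · simp [hP, hJ, hE', hp, Function.iterate_succ_apply']
      lia
    · simp; omega
  · simp [hE]
  · simp
  · rintro s' ⟨hf, ⟨t, ht, hE', hJ⟩, hb⟩
    have hM := hf.arr (a := aMark) rfl
    rcases ht.lt_or_eq with h | rfl
    · simp [hM, hE', hm, h1 t h] at hb
    · exact hJ

/-- The cotree `T` is stored, together with the numbers of leaves. -/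
structure Env (T : LabelledTree n) (s : State) : Prop where
  reg_n : s.reg rN = n
  reg_k : s.reg rK = 3 * n
  root : s.reg rRoot = T.root
  parent : s.arr aParent = T.parent
  series : ∀ u, s.arr aSeries u = (T.series u).toNat
  leaf : ∀ u ∈ T.nodes, s.arr aLeaf u = (T.below u).ncard
  lt : ∀ u ∈ T.nodes, u < 3 * n

/-- `c` does not change the stored cotree. -/
def keepsTree (c : Cmd) : Bool :=
  !(c.modReg rN || c.modReg rK || c.modReg rRoot || c.modArr aParent || c.modArr aSeries ||
    c.modArr aLeaf)

theorem Env.frame {c : Cmd} (h : Env T s) (hf : Frame c s s')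
    (hc : keepsTree c = true) : Env T s' := by
  simp only [keepsTree, Bool.not_eq_true', Bool.or_eq_false_iff] at hc
  obtain ⟨⟨⟨⟨⟨h1, h2⟩, h3⟩, h4⟩, h5⟩, h6⟩ := hc
  exact ⟨(hf.reg h1).trans h.reg_n, (hf.reg h2).trans h.reg_k, (hf.reg h3).trans h.root,
    (hf.arr h4).trans h.parent, fun u => by rw [hf.arr h5, h.series],
    fun u hu => by rw [hf.arr h6, h.leaf u hu], h.lt⟩

/-- The nodes in `X` are marked and listed, parents first. -/
structure Marked (T : LabelledTree n) (s : State) (X : Finset ℕ) (L : ℕ) : Prop where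
  image : (Finset.range L).image (s.arr aOrd) = X
  card : X.card = L
  earlier : ∀ k < L, s.arr aOrd k ≠ T.root → ∃ j < k, s.arr aOrd j = T.parent (s.arr aOrd k)
  mark : ∀ v, s.arr aMark v = if v ∈ X then 1 else 0
  nh : ∀ p, s.arr aNh p = leafSum T X p

theorem Marked.mem {L k : ℕ} (h : Marked T s X L) (hk : k < L) :
    s.arr aOrd k ∈ X := by
  rw [← h.image]
  exact Finset.mem_image_of_mem _ (Finset.mem_range.2 hk)

theorem Marked.exists_index {L v : ℕ} (h : Marked T s X L) (hv : v ∈ X) :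
    ∃ k < L, s.arr aOrd k = v := by
  rw [← h.image] at hv
  simpa using hv

theorem Marked.injOn {L : ℕ} (h : Marked T s X L) :
    Set.InjOn (s.arr aOrd) (Set.Iio L) := by
  have := Finset.card_image_iff.1 ((congrArg Finset.card h.image).trans (by simp [h.card]))
  simpa using this

/-- For the full neighbourhood `S` every node is non-hollow, so the sum over all nodes is the size
of a set of vertices. -/
theorem leafSum_le (hT : T.IsCotreeOf H S) (hX : X ⊆ T.nodes) (p : ℕ) :
    leafSum T X p ≤ n := by
  calc _ ≤ ∑ v ∈ T.nodes with (v ≠ T.root ∧ T.parent v = p), (T.below v).ncard :=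
        Finset.sum_le_sum_of_subset (Finset.filter_subset_filter _ hX)
    _ = (T.nonhollowPart S p).ncard := hT.sum_ncard_eq (fun v => ⟨fun hv => ⟨hv, by
        rw [Set.inter_eq_self_of_subset_left (hT.below_subset v)]
        exact hT.below_nonempty v hv⟩, fun h => h.1⟩) p
    _ ≤ n := (Set.ncard_le_card _).trans (by simp)

/-- A repetition on the path would be a cycle of parent pointers; only the root has one, and it is
marked. -/
theorem iterate_parent_ne (hT : T.IsRooted) {y m : ℕ} (hroot : T.root ∈ X)
    (hy : y ∈ T.nodes) (h1 : ∀ t < m, T.parent^[t] y ∉ X) {i j : ℕ} (hi : i < m) (hij : i < j) :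
    T.parent^[i] y ≠ T.parent^[j] y := by
  intro heq
  have hnode : T.parent^[i] y ∈ T.nodes := hT.mem_of_isAncestor hy ⟨i, rfl⟩
  have hne : T.parent^[i] y ≠ T.root := fun h => h1 i hi (h ▸ hroot)
  refine hT.parent_ne hnode hne (hT.antisymm hnode (isAncestor_parent _) ?_)
  refine ⟨j - (i + 1), ?_⟩
  rw [← Function.iterate_succ_apply' T.parent, ← Function.iterate_add_apply, heq]
  congr 1
  omega

theorem card_union_iterate (hT : T.IsRooted) {y m : ℕ} (hroot : T.root ∈ X)
    (hy : y ∈ T.nodes) (h1 : ∀ t < m, T.parent^[t] y ∉ X) :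
    (X ∪ (Finset.range m).image fun t => T.parent^[t] y).card = X.card + m := by
  rw [Finset.card_union_of_disjoint, Finset.card_image_of_injOn, Finset.card_range]
  · intro i hi j hj h
    rw [Finset.coe_range, Set.mem_Iio] at hi hj
    by_contra hne
    rcases Nat.lt_or_gt_of_ne hne with h' | h'
    · exact iterate_parent_ne hT hroot hy h1 hi h' h
    · exact iterate_parent_ne hT hroot hy h1 hj h' h.symm
  · rw [Finset.disjoint_right]
    intro v hv
    obtain ⟨j, hj, rfl⟩ := Finset.mem_image.1 hv
    exact h1 j (Finset.mem_range.1 hj)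

/-- The path is met from the bottom to the top but has to be listed parents first. Having been
counted in advance, it is written backwards, from position `L + m - 1` down to `L`. Every marked
node adds its leaf count to the counter of its parent. -/
theorem climbMark_spec (hT : T.IsCotreeOf H S) (hs : Env T s) {L y m : ℕ}
    (hM : Marked T s X L) (hX : X ⊆ T.nodes) (hroot : T.root ∈ X) (hy : y ∈ T.nodes)
    (hE : s.reg rE = y) (hJ : s.reg rJ = L + m)
    (h1 : ∀ t < m, T.parent^[t] y ∉ X) (h2 : T.parent^[m] y ∈ X) (hW : n + 1 ≤ W) :
    Ter W climbMark s (60 * m + 10)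
      (fun s' => Marked T s' (X ∪ (Finset.range m).image fun t => T.parent^[t] y) (L + m)) := by
  have hnode : ∀ t, T.parent^[t] y ∈ T.nodes := fun t => hT.rooted.mem_of_isAncestor hy ⟨t, rfl⟩
  have hinj : ∀ i < m, ∀ j, i < j → T.parent^[i] y ≠ T.parent^[j] y :=
    fun i hi j hij => iterate_parent_ne hT.rooted hroot hy h1 hi hij
  set Y : ℕ → Finset ℕ := fun t => X ∪ (Finset.range t).image fun t => T.parent^[t] y with hY
  have hYs : ∀ t, Y (t + 1) = insert (T.parent^[t] y) (Y t) := by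
    intro t
    simp [hY, Finset.range_add_one, Finset.image_insert]
  have hYn : ∀ t, Y t ⊆ T.nodes := by
    intro t v hv
    rcases Finset.mem_union.1 hv with h | h
    · exact hX h
    · obtain ⟨j, -, rfl⟩ := Finset.mem_image.1 h
      exact hnode j
  have hYt : ∀ t < m, T.parent^[t] y ∉ Y t := by
    intro t ht hv
    rcases Finset.mem_union.1 hv with h | h
    · exact h1 t ht h
    · obtain ⟨j, hj, h⟩ := Finset.mem_image.1 h
      rw [Finset.mem_range] at hj
      exact hinj j (hj.trans ht) t hj h
  refine (Ter.loop_frame (s0 := s) (I := fun t s' => t ≤ m ∧ s'.reg rE = T.parent^[t] y ∧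
    s'.reg rJ = L + m - t ∧ (∀ k < L, s'.arr aOrd k = s.arr aOrd k) ∧
    (∀ j < t, s'.arr aOrd (L + m - 1 - j) = T.parent^[j] y) ∧
    (∀ v, s'.arr aMark v = if v ∈ Y t then 1 else 0) ∧
    (∀ p, s'.arr aNh p = leafSum T (Y t) p))
    (Φ := fun t => 60 * (m - t)) ?_ ?_ 0 ?_).mono ?_ ?_
  · intro t s' hf hI
    simp
  · rintro t s' hf ⟨ht, hE', hJ', ho, ho', hm, hn⟩ hb
    have hs' := hs.frame hf rfl
    have htm : t < m := by
      rcases ht.lt_or_eq with h | rfl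
      · exact h
      · simp [hE', hm, hY, h2] at hb
    have hmem := hYt t htm
    have hne : T.parent^[t] y ≠ T.root := fun h => h1 t htm (h ▸ hroot)
    have hsum : ∀ p, leafSum T (Y (t + 1)) p =
        (if p = T.parent (T.parent^[t] y) then (T.below (T.parent^[t] y)).ncard else 0) +
        leafSum T (Y t) p := by
      intro p
      rw [hYs, leafSum, leafSum, Finset.filter_insert]
      by_cases hp : p = T.parent (T.parent^[t] y)
      · rw [if_pos ⟨hne, hp.symm⟩, Finset.sum_insert (by simp [hmem]), if_pos hp]
      · rw [if_neg (fun h => hp h.2.symm), if_neg hp, zero_add]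
    have hle := leafSum_le hT (hYn (t + 1)) (T.parent (T.parent^[t] y))
    rw [hsum, if_pos rfl] at hle
    have hleaf := hs'.leaf _ (hnode t)
    have hpar := hs'.parent
    refine ⟨t + 1, _, ?_, Ter.of_run ?_ ⟨htm, ?_, ?_, fun k hk => ?_, fun j hj => ?_, fun v => ?_,
      fun p => ?_⟩⟩
    rotate_left
    · simp [hE', hpar, hleaf, hn]; omega
    · simp [hE', hpar, ← Function.iterate_succ_apply' T.parent]
    · simp [hJ']; omega
    · have : k ≠ L + m - t - 1 := by omega
      simp [hJ', this, ho k hk]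
    · rcases Nat.lt_succ_iff_lt_or_eq.1 hj with h | rfl
      · have : L + m - 1 - j ≠ L + m - t - 1 := by omega
        simp [hJ', this, ho' j h]
      · simp [hJ', hE', show L + m - 1 - j = L + m - j - 1 by omega]
    · by_cases hv : v = T.parent^[t] y <;> simp [hE', hm, hYs, hv]
    · rw [hsum]
      by_cases hp : p = T.parent (T.parent^[t] y)
      · subst hp
        simp [hE', hpar, hn, hleaf, add_comm]
      · simp [hE', hpar, hp, hn]
    · simp; omega
  · refine ⟨by simp, by simpa using hE, by simpa using hJ, by simp, by simp, ?_, ?_⟩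
    · simpa [hY] using hM.mark
    · simpa [hY] using hM.nh
  · simp
  · rintro s' ⟨hf, ⟨t, ht, hE', hJ', ho, ho', hm, hn⟩, hb⟩
    obtain rfl : t = m := by
      rcases ht.lt_or_eq with h | h
      · simp [hE', hm, hYt t h] at hb
      · exact h
    have himg : (Finset.range (L + t)).image (s'.arr aOrd) = Y t := by
      ext v
      simp only [Finset.mem_image, Finset.mem_range, hY, Finset.mem_union]
      constructor
      · rintro ⟨k, hk, rfl⟩
        rcases lt_or_ge k L with h | h
        · exact .inl (by rw [ho k h]; exact hM.mem h)
        · refine .inr ⟨L + t - 1 - k, by omega, ?_⟩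
          rw [← ho' _ (by omega)]
          congr 1
          omega
      · rintro (h | ⟨j, hj, rfl⟩)
        · obtain ⟨k, hk, rfl⟩ := hM.exists_index h
          exact ⟨k, by omega, ho k hk⟩
        · exact ⟨_, by omega, ho' j hj⟩
    refine ⟨himg, ?_, ?_, hm, hn⟩
    · rw [← hM.card]
      exact card_union_iterate hT.rooted hroot hy h1
    · intro k hk hne
      rcases lt_or_ge k L with h | h
      · rw [ho k h] at hne ⊢
        obtain ⟨j, hj, h'⟩ := hM.earlier k h hne
        exact ⟨j, hj, by rw [ho j (hj.trans h), h']⟩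
      · obtain ⟨j, hj, rfl⟩ : ∃ j < t, k = L + t - 1 - j := ⟨L + t - 1 - k, by omega, by omega⟩
        rw [ho' j hj, ← Function.iterate_succ_apply' T.parent]
        rcases Nat.lt_or_ge (j + 1) t with h' | h'
        · exact ⟨L + t - 1 - (j + 1), by omega, ho' _ h'⟩
        · obtain rfl : j + 1 = t := by omega
          obtain ⟨i, hi, h''⟩ := hM.exists_index h2
          exact ⟨i, by omega, by rw [ho i hi, h'']⟩

theorem Marked.congr {L : ℕ} (h : Marked T s X L)
    (ho : s'.arr aOrd = s.arr aOrd) (hm : s'.arr aMark = s.arr aMark)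
    (hn : s'.arr aNh = s.arr aNh) : Marked T s' X L :=
  ⟨by rw [ho, h.image], h.card, by rw [ho]; exact h.earlier, by rw [hm]; exact h.mark,
    by rw [hn]; exact h.nh⟩

/-- One round of the marking loop. -/
theorem climb_spec (hT : T.IsCotreeOf H S) (hs : Env T s) {X F : Finset ℕ} {y k : ℕ}
    (hM : Marked T s X (s.reg rLen)) (hX : X ⊆ T.nodes) (hroot : T.root ∈ X) (hy : y ∈ T.nodes)
    (hup : ∀ v ∈ X, T.parent v ∈ X) (hF : F ⊆ T.nodes)
    (hXF : X ⊆ F) (hyF : ∀ v, T.IsAncestor v y → v ∈ F) (hk : s.reg rIdx = k)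
    (hn : s.arr aNbr k = y) (hW : 10 * n + 10 ≤ W) (hkn : k ≤ n) (hyn : y < n) :
    ∃ X' ⊆ F, X ⊆ X' ∧ (∀ v, v ∈ X' ↔ v ∈ X ∨ T.IsAncestor v y) ∧
    Ter W (block [ .assign rY (.get aNbr (.var rIdx)), .assign rE (.var rY), .assign rJ (.var rLen),
      climbCount,
      .assign rLen (.var rJ),
      .assign rE (.var rY),
      climbMark,
      incr rIdx]) s (100 * (X'.card - X.card) + 60)
      (fun s' => Marked T s' X' (s'.reg rLen) ∧ s'.reg rIdx = k + 1) := by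
  have hex : ∃ m, T.parent^[m] y ∈ X := by
    obtain ⟨m, hm⟩ := hT.reaches_root y hy
    exact ⟨m, hm ▸ hroot⟩
  classical
  -- The number of nodes still unmarked on the path. Above the first marked node all are marked,
  -- since the marked set is closed under parents, so the climb can stop there.
  set m := Nat.find hex with hm
  have h1 : ∀ t < m, T.parent^[t] y ∉ X := fun t ht => Nat.find_min hex ht
  have h2 : T.parent^[m] y ∈ X := Nat.find_spec hex
  have hup' : ∀ t, T.parent^[m + t] y ∈ X := by
    intro t
    induction t with
    | zero => exact h2
    | succ t ih => rw [← add_assoc, Function.iterate_succ_apply']; exact hup _ ih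
  set X' := X ∪ (Finset.range m).image fun t => T.parent^[t] y with hX'
  have hmem : ∀ v, v ∈ X' ↔ v ∈ X ∨ T.IsAncestor v y := by
    intro v
    simp only [hX', Finset.mem_union, Finset.mem_image, Finset.mem_range]
    constructor
    · rintro (h | ⟨t, -, rfl⟩)
      · exact .inl h
      · exact .inr ⟨t, rfl⟩
    · rintro (h | ⟨t, rfl⟩)
      · exact .inl h
      · rcases lt_or_ge t m with h | h
        · exact .inr ⟨t, h, rfl⟩
        · exact .inl (by simpa [Nat.add_sub_cancel' h] using hup' (t - m))
  have hXF' : X' ⊆ F := by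
    intro v hv
    rcases (hmem v).1 hv with h | h
    · exact hXF h
    · exact hyF v h
  have hcard : X'.card = X.card + m := card_union_iterate hT.rooted hroot hy h1
  have hlen : X.card + m ≤ 3 * n := by
    rw [← hcard]
    refine (Finset.card_le_card (hXF'.trans (hF.trans ?_))).trans (Finset.card_range (3 * n)).le
    exact fun v hv => Finset.mem_range.2 (hs.lt v hv)
  rw [hM.card] at hlen
  refine ⟨X', hXF', Finset.subset_union_left, hmem, ?_⟩
  refine (Ter.split 3 (.of_run (Q := fun s1 => s1.reg rY = y ∧ s1.reg rE = y ∧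
    s1.reg rJ = s.reg rLen) ?_ ?_) fun s1 q1 f1 => .split 1 (.single (climbCount_spec
    (T := T) (X := X) (y := y) (m := m) ?_ ?_ ?_ h1 h2 ?_))
    fun s2 q2 f2 => .split 2 (.of_run (Q := fun s3 => s3.reg rLen = s.reg rLen + m ∧
      s3.reg rE = y ∧ s3.reg rJ = s.reg rLen + m) ?_ ?_)
    fun s3 h3 f3 => .split 1 (.single (climbMark_spec hT (X := X) (L := s.reg rLen)
      (y := y) (m := m) ?_ ?_ hX hroot hy ?_ ?_ h1 h2 ?_))
    fun s4 h4 f4 => .of_run ?_ ⟨?_, ?_⟩).mono ?_ fun _ h => h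
  · simp [hk, hn]; omega
  · simp [hk, hn]
  · exact (f1.arr rfl).trans hs.parent
  · rw [f1.arr rfl]
    exact hM.mark
  · exact q1.2.1
  · rw [q1.2.2]
    omega
  · simp
  · have := q2
    have h' := f2.reg (r := rY) rfl
    have h'' := f1.reg (r := rLen) rfl
    simp at q1 this h' h''
    simp [this, q1, h']
  · exact (((hs.frame f1 rfl).frame f2 rfl).frame f3 rfl)
  · exact (hM.congr (f1.arr rfl) (f1.arr rfl) (f1.arr rfl)).congr (f2.arr rfl) (f2.arr rfl)
      (f2.arr rfl) |>.congr (f3.arr rfl) (f3.arr rfl) (f3.arr rfl)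
  · exact h3.2.1
  · exact h3.2.2
  · omega
  · have g4 := f4.reg (r := rIdx) rfl
    have g3 := f3.reg (r := rIdx) rfl
    have g2 := f2.reg (r := rIdx) rfl
    have g1 := f1.reg (r := rIdx) rfl
    simp at g1 g2 g3 g4 hk
    simp [g1, g2, g3, g4, hk]; omega
  · simp [hcard]; omega
  · have := f4.reg (r := rLen) rfl
    simp at this h3
    simpa [this, h3] using h4.congr (s' := (block [incr rIdx]).run s4) rfl rfl rfl
  · have g4 := f4.reg (r := rIdx) rfl
    have g3 := f3.reg (r := rIdx) rfl
    have g2 := f2.reg (r := rIdx) rfl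
    have g1 := f1.reg (r := rIdx) rfl
    simp at g1 g2 g3 g4 hk
    simp [g1, g2, g3, g4, hk]

theorem Lists.length_eq {a : ℕ → ℕ} {b e : ℕ} {F : Set (Fin n)} (h : Lists a b e F) :
    e - b = F.ncard := by
  have := h.2.image_eq ▸ Set.InjOn.ncard_image h.2.injOn
  rw [Set.ncard_image_of_injective _ Fin.val_injective] at this
  rw [this, ← Finset.coe_Ico, Set.ncard_coe_finset, Nat.card_Ico]

theorem Lists.mem {a : ℕ → ℕ} {b e k : ℕ} {F : Set (Fin n)} (h : Lists a b e F) (hk : b ≤ k)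
    (hk' : k < e) : ∃ y ∈ F, a k = y.val := by
  obtain ⟨y, hy, h'⟩ := h.2.mapsTo (show k ∈ Set.Ico b e from ⟨hk, hk'⟩)
  exact ⟨y, hy, h'.symm⟩

theorem Lists.exists_index {a : ℕ → ℕ} {b e : ℕ} {F : Set (Fin n)} (h : Lists a b e F)
    (hy : y ∈ F) : ∃ k, b ≤ k ∧ k < e ∧ a k = y.val := by
  obtain ⟨k, hk, h'⟩ := h.2.surjOn (Set.mem_image_of_mem _ hy)
  exact ⟨k, hk.1, hk.2, h'⟩

/-- Each climb is charged to the nodes it marks for the first time. The root is marked beforehand,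
so every climb ends; for empty `N` not even the root is non-hollow, and nothing is marked. -/
theorem markPhase_spec (hT : T.IsCotreeOf H S) (hs : Env T s)
    (hX : ∀ v, v ∈ X ↔ v ∈ T.nodes ∧ (T.below v ∩ N).Nonempty)
    (hL : Lists (s.arr aNbr) 0 (s.reg rDeg) N) (hN : N ⊆ S) (hm : ∀ v, s.arr aMark v = 0)
    (hn : ∀ v, s.arr aNh v = 0) (hW : 10 * n + 10 ≤ W) :
    Ter W markPhase s (100 * X.card + 70 * N.ncard + 40)
      (fun s' => Marked T s' X (s'.reg rLen)) := by
  have hd : s.reg rDeg = N.ncard := by simpa using hL.length_eq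
  have hd' : N.ncard ≤ n := (Set.ncard_le_card _).trans (by simp)
  refine ((Ter.ite (T := 100 * X.card + 70 * N.ncard + 30) (by simp) (fun hb => ?_)
    (fun hb => ?_)).mono (by simp; omega) fun _ h => h)
  · have hb' : N = ∅ := by
      have : N.ncard = 0 := hd ▸ hb
      rwa [Set.ncard_eq_zero] at this
    have hX0 : X = ∅ := Finset.eq_empty_of_forall_notMem fun v hv => by
      obtain ⟨y, -, hy⟩ := ((hX v).1 hv).2
      simp [hb'] at hy
    refine (Ter.of_run (by simp) ?_).mono ?_ fun _ h => h
    · exact ⟨by simp [hX0], by simp [hX0], by simp, by simpa [hX0] using hm,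
        by simpa [hX0, leafSum] using hn⟩
    · simp
  · have hdpos : 0 < N.ncard := by
      rw [← hd]
      exact Nat.pos_of_ne_zero hb
    have hrN : (T.below T.root ∩ N).Nonempty := by
      rw [hT.below_root, Set.inter_eq_self_of_subset_right hN]
      exact Set.nonempty_of_ncard_ne_zero hdpos.ne'
    have hrX : T.root ∈ X := (hX _).2 ⟨hT.root_mem, hrN⟩
    have hrt := hs.root
    have hlt := hs.lt _ hT.root_mem
    refine (Ter.split 4 (.of_run (Q := fun s1 => Marked T s1 {T.root} 1 ∧ s1.reg rLen = 1 ∧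
      s1.reg rIdx = 0) ?_ ⟨⟨?_, ?_, ?_, ?_, ?_⟩, ?_, ?_⟩) fun s1 q1 f1 => .single
      (T := 100 * X.card + 70 * N.ncard + 5) ?_).le ?_
    rotate_right 2
    -- After `k` neighbours, the root and the ancestors of these neighbours are marked. The
    -- potential holds `100` for each node yet to be marked and `70` for each neighbour yet to be
    -- read.
    · refine (Ter.loop_frame (s0 := s1) (I := fun (g : ℕ × Finset ℕ) s' => g.1 ≤ N.ncard ∧
        Marked T s' g.2 (s'.reg rLen) ∧ s'.reg rIdx = g.1 ∧ g.2 ⊆ X ∧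
        ∀ v, v ∈ g.2 ↔ v ∈ T.nodes ∧ (v = T.root ∨ ∃ i < g.1, T.IsAncestor v (s.arr aNbr i)))
        (Φ := fun g => 100 * (X.card - g.2.card) + 70 * (N.ncard - g.1)) ?_ ?_ (0, {T.root})
        ?_).mono ?_ ?_
      · intro g s' hf hI
        simp
      · rintro ⟨k, X'⟩ s' hf ⟨hk, hM, hk', hXX, hXm⟩ hb
        dsimp only at hk hM hk' hXX hXm
        have hdeg : s'.reg rDeg = N.ncard := by rw [hf.reg rfl, f1.reg rfl, hd]
        have hklt : k < N.ncard := by simp at hb hdeg hk'; omega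
        have hnb : s'.arr aNbr = s.arr aNbr := by rw [hf.arr rfl, f1.arr rfl]
        obtain ⟨y, hy, hyk⟩ := hL.mem (Nat.zero_le k) (hd ▸ hklt)
        have hyS := hN hy
        have hynode : y.val ∈ T.nodes := (hT.leaf_iff y).2 hyS
        have hs' := (hs.frame f1 rfl).frame hf rfl
        obtain ⟨X'', hF, hsub, hmem, hter⟩ := climb_spec (W := W) hT hs' (F := X) (y := y.val) (k := k)
          hM (fun v hv => ((hXm v).1 hv).1) ((hXm _).2 ⟨hT.root_mem, .inl rfl⟩) hynode
          (fun v hv => (hXm _).2 ⟨hT.parent_mem v ((hXm v).1 hv).1, by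
            rcases ((hXm v).1 hv).2 with rfl | ⟨i, hi, h⟩
            · exact .inl hT.parent_root
            · exact .inr ⟨i, hi, (isAncestor_parent v).trans h⟩⟩)
          (fun v hv => ((hX v).1 hv).1) hXX
          (fun v hv => (hX v).2 ⟨hT.rooted.mem_of_isAncestor hynode hv, y, ⟨hynode, hv⟩, hy⟩)
          hk' (by rw [hnb, hyk]) hW (by omega) y.isLt
        refine ⟨(k + 1, X''), _, ?_, hter.mono le_rfl fun s'' h => ⟨hklt, h.1, h.2, hF, fun v => ?_⟩⟩
        · have h1 := Finset.card_le_card hF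
          have h2 := Finset.card_le_card hsub
          simp only [Test.cost, Exp.cost]
          omega
        · rw [hmem, hXm]
          constructor
          · rintro (⟨h, h'⟩ | h)
            · exact ⟨h, h'.imp id fun ⟨i, hi, h⟩ => ⟨i, by simp; omega, h⟩⟩
            · exact ⟨hT.rooted.mem_of_isAncestor hynode h, .inr ⟨k, by simp, by rwa [hyk]⟩⟩
          · rintro ⟨h, h' | ⟨i, hi, h'⟩⟩
            · exact .inl ⟨h, .inl h'⟩
            · rcases Nat.lt_succ_iff_lt_or_eq.1 hi with hi | rfl
              · exact .inl ⟨h, .inr ⟨i, hi, h'⟩⟩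
              · exact .inr (by rwa [← hyk])
      · refine ⟨by simp, by simpa [q1.2.1] using q1.1, q1.2.2, by simpa using hrX, fun v => ?_⟩
        simp only [Finset.mem_singleton, not_lt_zero, false_and, exists_false, or_false]
        exact ⟨fun h => ⟨h ▸ hT.root_mem, h⟩, fun h => h.2⟩
      · simp; omega
      · rintro s' ⟨hf, ⟨⟨k, X'⟩, hk, hM, hk', hXX, hXm⟩, hb⟩
        have hdeg : s'.reg rDeg = N.ncard := by rw [hf.reg rfl, f1.reg rfl, hd]
        obtain rfl : k = N.ncard := by simp at hb hdeg hk' hk; omega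
        obtain rfl : X' = X := by
          refine hXX.antisymm fun v hv => (hXm v).2 ⟨((hX v).1 hv).1, ?_⟩
          obtain ⟨-, y, hyv, hy⟩ := (hX v).1 hv
          obtain ⟨i, -, hi, h⟩ := hL.exists_index hy
          exact .inr ⟨i, hd ▸ hi, h ▸ hyv.2⟩
        exact hM
    · simp; omega
    · simp; omega
    · simp [hrt]
    · simp
    · simp [hrt]
    · intro v
      by_cases hv : v = T.root <;> simp [hrt, hm, hv]
    · intro p
      simp [leafSum, hn, Finset.filter_singleton]
    · simp
    · simp

/-! ### Evaluation of the possible anchors -/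

/-- All vertices of `N` outside the subtree of `v` are joined to `v` from above. -/
def JoinedAbove (T : LabelledTree n) (N : Set (Fin n)) (v : ℕ) : Prop :=
  N \ T.below v ⊆ T.seriesAbove v

/-- The results of the evaluation are stored at the node `v`. -/
structure Evaluated (T : LabelledTree n) (N : Set (Fin n)) (s : State) (v : ℕ) : Prop where
  elig : s.arr aElig v = 1 ↔ JoinedAbove T N v
  joined : JoinedAbove T N v → s.arr aSA v = (T.seriesAbove v).ncard

theorem ncard_le (F : Set (Fin n)) : F.ncard ≤ n := (Set.ncard_le_card _).trans (by simp)

theorem Marked.length_le {L : ℕ} (hM : Marked T s X L) (hs : Env T s')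
    (hX : X ⊆ T.nodes) : L ≤ 3 * n := by
  rw [← hM.card]
  exact (Finset.card_le_card fun v hv => Finset.mem_range.2 (hs.lt v (hX hv))).trans
    (Finset.card_range (3 * n)).le

/-- Parents precede their children in the list, so the recursions `outside_child_iff` and
`ncard_seriesAbove_child` find the values at the parent ready. At nodes that are not eligible, `aSA`
may hold an old value. -/
theorem evalPhase_spec (hT : T.IsCotreeOf H S) (hs : Env T s) (hN : N ⊆ S)
    (hX : ∀ v, v ∈ X ↔ v ∈ T.nodes ∧ (T.below v ∩ N).Nonempty)
    (hM : Marked T s X (s.reg rLen)) (hW : 10 * n + 10 ≤ W) :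
    Ter W evalPhase s (100 * X.card + 20)
      (fun s' => ∀ v ∈ X, s'.arr aBel v = 0 ∧ Evaluated T N s' v) := by
  set L := s.reg rLen with hLdef
  have hL : L ≤ 3 * n := hM.length_le hs fun v hv => ((hX v).1 hv).1
  refine (Ter.split 1 (.of_run (Q := fun s1 => s1.reg rIdx = 0) (by simp) (by simp))
    fun s1 h1 f1 => .single (T := 100 * X.card + 10) ?_).le ?_
  · have hM1 : Marked T s1 X L := hM.congr (f1.arr rfl) (f1.arr rfl) (f1.arr rfl)
    have hs1 := hs.frame f1 rfl
    refine (Ter.loop_frame (s0 := s1) (I := fun k s' => k ≤ L ∧ s'.reg rIdx = k ∧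
      ∀ j < k, s'.arr aBel (s1.arr aOrd j) = 0 ∧ Evaluated T N s' (s1.arr aOrd j))
      (Φ := fun k => 100 * (L - k)) (by simp) ?_ 0 ?_).mono ?_ ?_
    · rintro k s' f ⟨hk, hk', hI⟩ hb
      have hs' := hs1.frame f rfl
      have hlen : s'.reg rLen = L := by rw [f.reg rfl, f1.reg rfl]
      have hkL : k < L := by simp at hb hk' hlen; omega
      have ho := f.arr (a := aOrd) rfl
      have hnh : s'.arr aNh = s1.arr aNh := f.arr (a := aNh) rfl
      obtain ⟨v, hv⟩ : ∃ v, s1.arr aOrd k = v := ⟨_, rfl⟩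
      have hvX := hM1.mem hkL
      rw [hv] at hvX
      obtain ⟨hvn, hvN⟩ := (hX _).1 hvX
      -- The nodes evaluated before are different from `v`, so their results survive the round.
      have hne : ∀ j < k, s1.arr aOrd j ≠ v := fun j hj h =>
        hj.ne (hM1.injOn (Set.mem_Iio.2 (hj.trans hkL)) (Set.mem_Iio.2 hkL) (h.trans hv.symm))
      refine ⟨k + 1, 95, ?_, (Ter.split 4 (.of_run (Q := fun s2 => s2.reg rV = v ∧
        s2.reg rP = T.parent v ∧ s2.arr aBel v = 0 ∧ s2.arr aElig v = 0 ∧ s2.reg rIdx = k ∧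
        ∀ w ≠ v, s2.arr aBel w = s'.arr aBel w ∧ s2.arr aElig w = s'.arr aElig w)
        ?_ ?_) fun s2 h2 f2 => .split 1 (.single (.of_wp (Q := fun s3 => Evaluated T N s3 v ∧
        ∀ w ≠ v, s3.arr aElig w = s2.arr aElig w ∧ s3.arr aSA w = s2.arr aSA w) ?_))
        fun s3 h3 f3 => .of_run ?_ ?_).le ?_⟩
      · simp; omega
      · simp [hk', ho, hs'.parent]
      · have := hs'.parent
        simp +contextual [hk', ho, this, hv]
      · obtain ⟨hV, hP, hB, hE, hi, hw⟩ := h2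
        have hs2 := hs'.frame f2 rfl
        have hrt := hs2.root
        refine ⟨by simp, fun hb => ?_, fun hb => ?_⟩
        · have hvr : v = T.root := by simpa [hV, hrt] using hb
          refine wp_of_run (by simp; omega) ⟨⟨?_, ?_⟩, ?_⟩
          · have : JoinedAbove T N T.root := by
              rw [JoinedAbove, hT.below_root, Set.sdiff_eq_empty.2 hN]
              exact Set.empty_subset _
            simp [hV, hvr, this]
          · simp [hV, hvr, hT.seriesAbove_root]
          · simp +contextual [hV]
        · have hvr : v ≠ T.root := by simpa [hV, hrt] using hb
          have hc := hT.rooted.mem_children_parent hvn hvr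
          have hpn := hT.parent_mem v hvn
          obtain ⟨j, hj, hjp⟩ := hM1.earlier k hkL (hv ▸ hvr)
          rw [hv] at hjp
          have hpv : T.parent v ≠ v := hT.rooted.parent_ne hvn hvr
          have hEp := (hI j hj).2
          rw [hjp] at hEp
          have hE1 := (hw _ hpv).2
          have hSA := congrFun (f2.arr (a := aSA) rfl) (T.parent v)
          have hiff : JoinedAbove T N v ↔ JoinedAbove T N (T.parent v) ∧ (T.series (T.parent v) = true ∨
            (T.nonhollowPart N (T.parent v)).ncard = (T.below v).ncard) :=
            hT.outside_child_iff hc hvN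
          have hsum := hT.ncard_seriesAbove_child hc
          have hnhp : s2.arr aNh (T.parent v) = (T.nonhollowPart N (T.parent v)).ncard := by
            rw [f2.arr (a := aNh) rfl, hnh, hM1.nh, leafSum, hT.sum_ncard_eq hX]
          have hser := hs2.series (T.parent v)
          have hl1 := hs2.leaf _ hvn
          have hl2 := hs2.leaf _ hpn
          have he1 := hEp.elig
          have he2 := hEp.joined
          have hle := ncard_le (T.seriesAbove v)
          refine ⟨by simp; omega, fun hb => ?_, fun hb => ?_⟩
          · have hout : JoinedAbove T N (T.parent v) := by
              rw [← he1]
              simpa [hP, hE1] using hb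
            refine ⟨by simp; omega, fun hb => ?_, fun hb => ?_⟩
            · have hst : T.series (T.parent v) = true := by simpa [hP, hser] using hb
              rw [if_pos hst] at hsum
              refine wp_of_run ?_ ⟨⟨?_, ?_⟩, ?_⟩
              · simp [hP, hV, hSA, he2 hout, hl1, hl2]; omega
              · simp [hV, hiff, hout, hst]
              · simp [hP, hV, hSA, he2 hout, hl1, hl2, hsum]
              · simp +contextual [hV]
            · have hst : T.series (T.parent v) = false := by simpa [hP, hser] using hb
              rw [hst] at hsum hiff
              refine ⟨by simp, fun hb => ?_, fun hb => ?_⟩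
              · have hnl : (T.nonhollowPart N (T.parent v)).ncard = (T.below v).ncard := by
                  simpa [hP, hV, hnhp, hl1] using hb
                refine wp_of_run ?_ ⟨⟨?_, ?_⟩, ?_⟩
                · simp; omega
                · simp [hV, hiff, hout, hnl]
                · simp [hP, hV, hSA, he2 hout, hsum]
                · simp +contextual [hV]
              · have hnl : (T.nonhollowPart N (T.parent v)).ncard ≠ (T.below v).ncard := by
                  simpa [hP, hV, hnhp, hl1] using hb
                refine ⟨⟨?_, ?_⟩, ?_⟩
                · simp [hE, hiff, hnl]
                · simp [hiff, hnl]
                · simp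
          · have hout : ¬ JoinedAbove T N (T.parent v) := by
              rw [← he1]
              simpa [hP, hE1] using hb
            refine ⟨⟨?_, ?_⟩, ?_⟩
            · simp [hE, hiff, hout]
            · simp [hiff, hout]
            · simp
      · have g := f3.reg (r := rIdx) rfl
        simp at g h2
        simp [g, h2.2.2.2.2.1]; omega
      · have g := f3.reg (r := rIdx) rfl
        have gB := f3.arr (a := aBel) rfl
        have gS := f2.arr (a := aSA) rfl
        obtain ⟨hV, hP, hB, hE, hi, hw⟩ := h2
        simp at g gB gS
        refine ⟨hkL, by simp [g, hi], fun j hj => ?_⟩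
        simp
        rw [gB]
        rcases Nat.lt_succ_iff_lt_or_eq.1 hj with h | rfl
        · obtain ⟨hI1, hI2⟩ := hI j h
          have hj' := hne j h
          refine ⟨(hw _ hj').1.trans hI1, ⟨?_, ?_⟩⟩
          · exact (by rw [(h3.2 _ hj').1, (hw _ hj').2] : s3.arr aElig (s1.arr aOrd j) = _) ▸ hI2.elig
          · exact (by rw [(h3.2 _ hj').2]; exact congrFun gS _ :
              s3.arr aSA (s1.arr aOrd j) = s'.arr aSA _) ▸ hI2.joined
        · rw [hv]
          exact ⟨hB, ⟨h3.1.elig, h3.1.joined⟩⟩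
      · simp
    · exact ⟨by simp, h1, by simp⟩
    · simp
      rw [hM.card]
      omega
    · rintro s' ⟨f, ⟨k, hk, hk', hI⟩, hb⟩ v hv
      have hlen : s'.reg rLen = L := by rw [f.reg rfl, f1.reg rfl]
      obtain ⟨j, hj, rfl⟩ := hM1.exists_index hv
      simp at hb hk' hlen
      exact hI j (by omega)
  · simp; omega

/-! ### Enumeration of the minimal completions -/

/-- The nodes in `A` are listed as anchors, with costs `cst`; one of minimum cost is selected. -/
structure Emitted (cst : ℕ → ℕ) (A : Set ℕ) (b0 : ℕ) (s : State) : Prop where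
  bij : Set.BijOn (s.arr aAnchor) (Set.Iio (s.reg rCount)) A
  cost : ∀ i < s.reg rCount, s.arr aCost i = cst (s.arr aAnchor i)
  le : ∀ v ∈ A, s.reg rBest ≤ cst v
  best : (A = ∅ ∧ s.reg rBest = b0) ∨ (s.reg rU ∈ A ∧ s.reg rBest = cst (s.reg rU))

theorem Emitted.frame {cst : ℕ → ℕ} {A : Set ℕ} {b0 : ℕ} (h : Emitted cst A b0 s)
    (h1 : s'.arr aAnchor = s.arr aAnchor) (h2 : s'.arr aCost = s.arr aCost)
    (h3 : s'.reg rCount = s.reg rCount) (h4 : s'.reg rBest = s.reg rBest)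
    (h5 : s'.reg rU = s.reg rU) : Emitted cst A b0 s' := by
  obtain ⟨hb, hc, hl, hm⟩ := h
  constructor
  · rwa [h1, h3]
  · rwa [h1, h2, h3]
  · rwa [h4]
  · rwa [h4, h5]

theorem bijOn_update {f : ℕ → ℕ} {A : Set ℕ} {c v : ℕ} (h : Set.BijOn f (Set.Iio c) A)
    (hv : v ∉ A) : Set.BijOn (update f c v) (Set.Iio (c + 1)) (insert v A) := by
  have hE : Set.EqOn (update f c v) f (Set.Iio c) := fun i hi =>
    update_of_ne (ne_of_lt hi) _ _
  have hI : Set.Iio (c + 1) = insert c (Set.Iio c) := by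
    ext i
    simp only [Set.mem_Iio, Set.mem_insert_iff]
    omega
  rw [hI]
  have := (h.congr hE.symm).insert (a := c) (by simpa using hv)
  simpa using this

/-- The initial value `b0` of `rBest` exceeds all costs; hence the first node listed is selected in
any case, and `rU` is meaningful as soon as the list is nonempty. -/
theorem emit_spec {cst : ℕ → ℕ} {A : Set ℕ} {b0 v : ℕ} (h : Emitted cst A b0 s) (hv : v ∉ A)
    (hV : s.reg rV = v) (hc : s.arr aSA v + s.arr aNh v - s.reg rDeg = cst v)
    (hc' : s.arr aSA v + s.arr aNh v ≤ W) (hW : s.reg rCount + 1 ≤ W) (hb : cst v < b0) :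
    Ter W emit s 40 (Emitted cst (insert v A) b0) := by
  refine (Ter.split 2 (.of_run (Q := fun s1 =>
    s1.arr aAnchor = update (s.arr aAnchor) (s.reg rCount) v ∧
    s1.arr aCost = update (s.arr aCost) (s.reg rCount) (cst v)) ?_ ?_)
    fun s1 h1 f1 => .split 1 (.single (.of_wp (Q := fun s2 => (∀ w ∈ insert v A,
      s2.reg rBest ≤ cst w) ∧ s2.reg rU ∈ insert v A ∧ s2.reg rBest = cst (s2.reg rU)) ?_))
    fun s2 h2 f2 => .of_run ?_ ⟨?_, ?_, ?_, ?_⟩).le ?_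
  · simp [hV, hc']
  · simp [hV, hc]
  · have hV1 := (f1.reg (r := rV) rfl).trans hV
    have hC1 := f1.reg (r := rCount) rfl
    have hB1 := f1.reg (r := rBest) rfl
    have hU1 := f1.reg (r := rU) rfl
    have hcost : s1.arr aCost (s1.reg rCount) = cst v := by rw [hC1, h1.2, update_self]
    refine ⟨by simp, fun hb => ?_, fun hb => ?_⟩
    · have hlt : cst v < s1.reg rBest := by simpa [hcost] using hb
      refine wp_of_run (by simp) ⟨?_, ?_, ?_⟩
      · rintro w (rfl | hw)
        · simp [hcost]
        · have := h.le w hw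
          rw [← hB1] at this
          simpa [hcost] using (hlt.le.trans this)
      · simp [hV1]
      · simp [hV1, hcost]
    · have hlt : s1.reg rBest ≤ cst v := by simpa [hcost] using hb
      rw [hB1] at hlt
      refine ⟨?_, ?_, ?_⟩
      · rintro w (rfl | hw)
        · rwa [hB1]
        · rw [hB1]
          exact h.le w hw
      · rcases h.best with h' | h'
        · omega
        · rw [hU1]
          exact .inr h'.1
      · rcases h.best with h' | h'
        · omega
        · rw [hU1, hB1]
          exact h'.2
  · have g : s2.reg rCount = s.reg rCount := by rw [f2.reg rfl, f1.reg rfl]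
    simp [g]
    lia
  · simp
  · have g : s2.reg rCount = s.reg rCount := by rw [f2.reg rfl, f1.reg rfl]
    have ga : s2.arr aAnchor = s1.arr aAnchor := f2.arr rfl
    simpa [g, ga, h1.1] using bijOn_update h.bij hv
  · have g : s2.reg rCount = s.reg rCount := by rw [f2.reg rfl, f1.reg rfl]
    have ga : s2.arr aAnchor = s1.arr aAnchor := f2.arr rfl
    have gc : s2.arr aCost = s1.arr aCost := f2.arr rfl
    intro i hi
    simp [g] at hi
    simp only [List.drop, block, Cmd.run, incr]
    rw [ga, gc, h1.1, h1.2]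
    rcases Nat.lt_succ_iff_lt_or_eq.1 (Nat.lt_succ_of_le hi) with h' | rfl
    · rw [update_of_ne h'.ne, update_of_ne h'.ne, h.cost i h']
    · simp
  · simpa using h2.1
  · simpa using Or.inr h2.2

/-- There is a candidate in the subtree of `v`. -/
def HasCandidate (T : LabelledTree n) (N : Set (Fin n)) (v : ℕ) : Prop :=
  ∃ w, T.IsCandidate N w ∧ T.IsAncestor v w

/-- These are the three tests of `enumPhase`; the existence of a hollow child appears as the strict
inequality of leaf counts. -/
theorem isCandidate_iff (hT : T.IsCotreeOf H S)
    (hX : ∀ v, v ∈ X ↔ v ∈ T.nodes ∧ (T.below v ∩ N).Nonempty) (hv : v ∈ X) :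
    T.IsCandidate N v ↔ JoinedAbove T N v ∧ ¬ v < n ∧ leafSum T X v < (T.below v).ncard := by
  obtain ⟨hvn, hvN⟩ := (hX v).1 hv
  rw [leafSum, hT.sum_ncard_eq hX]
  constructor
  · intro h
    obtain ⟨c, hc, hcN⟩ := h.hollow_child
    have hn := hT.internal_of_child hc
    exact ⟨h.outside, hn.not_gt, (hT.hollow_child_iff hn).1 ⟨c, hc, hcN⟩⟩
  · rintro ⟨h1, h2, h3⟩
    exact ⟨hvn, h1, hvN, (hT.hollow_child_iff (not_lt.1 h2)).2 h3⟩

/-- Candidates are non-hollow, and so are the nodes above them. Passing flags along marked children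
therefore loses no candidate. -/
theorem hasCandidate_child_iff (hT : T.IsCotreeOf H S)
    (hX : ∀ v, v ∈ X ↔ v ∈ T.nodes ∧ (T.below v ∩ N).Nonempty) :
    (∃ c ∈ X, c ∈ T.children v ∧ HasCandidate T N c) ↔
      ∃ w, w ≠ v ∧ T.IsCandidate N w ∧ T.IsAncestor v w := by
  constructor
  · rintro ⟨c, -, hc, w, hw, hcw⟩
    refine ⟨w, ?_, hw, (isAncestor_child hc).trans hcw⟩
    rintro rfl
    exact hT.rooted.not_isAncestor_of_mem_children hc hcw
  · rintro ⟨w, hne, hw, hvw⟩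
    obtain ⟨c, hc, hcw⟩ := hT.rooted.exists_child hw.mem hvw hne.symm
    exact ⟨c, (hX c).2 ⟨hc.1, hw.nonhollow.mono
      (Set.inter_subset_inter_left _ (below_mono hcw))⟩, hc, w, hw, hcw⟩

open Classical in
/-- One round of the enumeration: the treatment of the node `v`. -/
theorem emitIfMinimal_spec (hT : T.IsCotreeOf H S) (hs : Env T s)
    (hX : ∀ v, v ∈ X ↔ v ∈ T.nodes ∧ (T.below v ∩ N).Nonempty) (hv : v ∈ X)
    (hV : s.reg rV = v) (hE : Evaluated T N s v) (hnh : s.arr aNh v = leafSum T X v)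
    (hd : s.reg rDeg = N.ncard) {A : Set ℕ} (hNS : N ⊆ S)
    (hem : Emitted (fun v => (T.anchored N v \ N).ncard) A (S.ncard + 1) s) (hvA : v ∉ A)
    (hcount : s.reg rCount + 1 ≤ W) (hn : n ≤ W)
    (hF : s.reg rFlag = if ∃ w, w ≠ v ∧ T.IsCandidate N w ∧ T.IsAncestor v w then 1 else 0) :
    Ter W (.ite (.eq (.get aElig (.var rV)) (.const 1)) (.ite (.lt (.var rV) (.var rN)) .skip
        (.ite (.lt (.get aNh (.var rV)) (.get aLeaf (.var rV))) (block [
            .ite (.eq (.get aSeries (.var rV)) (.const 1)) emit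
              (.ite (.eq (.var rFlag) (.const 0)) emit .skip),
            .assign rFlag (.const 1)])
          .skip))
      .skip) s 150 (fun s' => Emitted (fun v => (T.anchored N v \ N).ncard)
        {w | w ∈ A ∨ w = v ∧ T.IsMinCandidate N v} (S.ncard + 1) s' ∧
        s'.reg rFlag = if HasCandidate T N v then 1 else 0) := by
  have hvn := ((hX v).1 hv).1
  have hN := hs.reg_n
  have hl := hs.leaf v hvn
  have hser := hs.series v
  have hiff := isCandidate_iff hT hX hv
  have hanch := ncard_le (T.anchored N v)
  by_cases hc : T.IsCandidate N v
  · obtain ⟨h1, h2, h3⟩ := hiff.1 hc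
    have hsum : s.arr aSA v + s.arr aNh v = (T.anchored N v).ncard := by
      rw [hT.ncard_anchored (not_lt.1 h2) h1, hE.joined h1, hnh, leafSum, hT.sum_ncard_eq hX]
    have hhas : HasCandidate T N v := ⟨v, hc, .refl v⟩
    have hcost : s.arr aSA v + s.arr aNh v - s.reg rDeg = (T.anchored N v \ N).ncard := by
      rw [hsum, hd, hT.ncard_anchored_diff]
    have hlt : (T.anchored N v \ N).ncard < S.ncard + 1 :=
      Nat.lt_succ_of_le (Set.ncard_le_ncard (Set.sdiff_subset.trans (hT.anchored_subset hNS v)))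
    have hemit := emit_spec (W := W) hem hvA hV hcost (hsum ▸ hanch.trans hn) hcount hlt
    refine (Ter.ite (T := 140) (by simp; omega) (fun _ => Ter.le (Ter.ite (T := 130) (by simp)
      (fun hb => absurd hb ?_) (fun _ => Ter.le (Ter.ite (T := 120) (by simp) (fun _ => ?_)
      (fun hb => absurd ?_ hb)) ?_)) ?_) (fun hb => absurd ?_ hb)).le ?_
    · simpa [hV, hN] using h2
    · have hset : ∀ {p : Prop}, p → {w | w ∈ A ∨ w = v ∧ p} = insert v A := by
        intro p hp
        ext w
        simp [hp, or_comm]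
      refine (Ter.split 1 (T1 := 90) (Q := Emitted (fun v => (T.anchored N v \ N).ncard)
        {w | w ∈ A ∨ w = v ∧ T.IsMinCandidate N v} (S.ncard + 1)) (Ter.le (.single
        (Ter.ite (T := 60) (by simp; omega) (fun hb => ?_)
        (fun hb => ?_))) ?_) fun s1 q1 f1 => .of_run ?_ ?_).le ?_
      · have hst : T.series v = true := by simpa [hV, hser] using hb
        rw [hset ⟨hc, .inl hst⟩]
        exact hemit.le (by norm_num)
      · have hst : T.series v = false := by simpa [hV, hser] using hb
        refine (Ter.ite (T := 40) (by simp) (fun hb => ?_) (fun hb => ?_)).le ?_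
        · have hlow : ∀ w, T.IsCandidate N w → T.IsAncestor v w → w = v := by
            intro w hw hvw
            by_contra hne
            simp only [Test.Holds, Exp.eval] at hb
            rw [hF, if_pos ⟨w, hne, hw, hvw⟩] at hb
            exact one_ne_zero hb
          rw [hset ⟨hc, .inr hlow⟩]
          exact hemit
        · have hno : ¬ T.IsMinCandidate N v := by
            intro hmin
            apply hb
            simp only [Test.Holds, Exp.eval]
            rw [hF, if_neg]
            rintro ⟨w, hne, hw, hvw⟩
            rcases hmin.lowest with h | h
            · simp [hst] at h
            · exact hne (h w hw hvw)
          refine Ter.le (.of_run trivial ?_) ?_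
          · simpa [hno] using hem
          · simp
        · simp
      · simp
      · simp; omega
      · refine ⟨q1.frame rfl rfl rfl rfl rfl, ?_⟩
        simp [hhas]
      · simp
    · simpa [hV, hnh, hl] using h3
    · simp
    · simp
    · simpa [hV] using hE.elig.2 h1
    · simp
  · have hflag : (HasCandidate T N v ↔ ∃ w, w ≠ v ∧ T.IsCandidate N w ∧ T.IsAncestor v w) := by
      constructor
      · rintro ⟨w, hw, hvw⟩
        exact ⟨w, fun h => hc (h ▸ hw), hw, hvw⟩
      · rintro ⟨w, -, hw, hvw⟩
        exact ⟨w, hw, hvw⟩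
    have hno : ¬ T.IsMinCandidate N v := fun h => hc h.cand
    have hpost : Emitted (fun v => (T.anchored N v \ N).ncard)
        {w | w ∈ A ∨ w = v ∧ T.IsMinCandidate N v} (S.ncard + 1) s ∧
        s.reg rFlag = if HasCandidate T N v then 1 else 0 := by
      refine ⟨by simpa [hno] using hem, ?_⟩
      rw [hF]
      simp only [hflag]
    have hskip := fun (Q : State → Prop) (h : Q s) => Ter.of_run (W := W) (c := .skip) trivial h
    refine (Ter.ite (T := 140) (by simp; omega) (fun hb => Ter.le (Ter.ite (T := 130) (by simp)
      (fun _ => (hskip _ hpost).le (by simp)) (fun hb' => Ter.le (Ter.ite (T := 120) (by simp)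
      (fun hb'' => ?_) (fun _ => (hskip _ hpost).le (by simp))) ?_)) ?_)
      (fun _ => (hskip _ hpost).le (by simp))).le ?_
    · exfalso
      apply hc
      rw [hiff, ← hE.elig, ← hnh, ← hl]
      refine ⟨by simpa [hV] using hb, by simpa [hV, hN] using hb', by simpa [hV] using hb''⟩
    · simp
    · simp
    · simp

-- The list is read backwards, so all marked children of a node have reported to `aBel` before the
-- node itself is treated; this decides whether a parallel candidate is lowest.
open Classical in
theorem enumPhase_spec (hT : T.IsCotreeOf H S) (hs : Env T s) (hN : N ⊆ S)
    (hX : ∀ v, v ∈ X ↔ v ∈ T.nodes ∧ (T.below v ∩ N).Nonempty)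
    (hM : Marked T s X (s.reg rLen)) (hE : ∀ v ∈ X, s.arr aBel v = 0 ∧ Evaluated T N s v)
    (hd : s.reg rDeg = N.ncard) (hW : 10 * n + 10 ≤ W) :
    Ter W enumPhase s (200 * X.card + 30)
      (Emitted (fun v => (T.anchored N v \ N).ncard) {v | T.IsMinCandidate N v} (S.ncard + 1)) := by
  set L := s.reg rLen with hLdef
  have hXn : X ⊆ T.nodes := fun v hv => ((hX v).1 hv).1
  have hL : L ≤ 3 * n := hM.length_le hs hXn
  have hleaf : s.arr aLeaf T.root = S.ncard := by rw [hs.leaf _ hT.root_mem, hT.below_root]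
  have hroot := hs.root
  have hSn := ncard_le S
  refine (Ter.split 3 (.of_run (Q := fun s1 => s1.reg rCount = 0 ∧ s1.reg rBest = S.ncard + 1 ∧
    s1.reg rIdx = L) ?_ ?_) fun s1 q1 f1 => .single (T := 200 * X.card + 10) ?_).le ?_
  · simp [hroot, hleaf]; omega
  · simp [hroot, hleaf, hLdef]
  · have hM1 : Marked T s1 X L := hM.congr (f1.arr rfl) (f1.arr rfl) (f1.arr rfl)
    have hs1 := hs.frame f1 rfl
    -- When the positions from `k` on have been treated, `A k` holds the anchors listed so far, and
    -- `B k v` says that a treated node with parent `v` has a candidate in its subtree.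
    set A : ℕ → Set ℕ := fun k => {v | ∃ j, k ≤ j ∧ j < L ∧ s1.arr aOrd j = v ∧
      T.IsMinCandidate N v} with hA
    set B : ℕ → ℕ → Prop := fun k v => ∃ j, k ≤ j ∧ j < L ∧ T.parent (s1.arr aOrd j) = v ∧
      HasCandidate T N (s1.arr aOrd j) with hB
    refine (Ter.loop_frame (s0 := s1) (I := fun k s' => k ≤ L ∧ s'.reg rIdx = k ∧
      Emitted (fun v => (T.anchored N v \ N).ncard) (A k) (S.ncard + 1) s' ∧
      ∀ j < k, s'.arr aBel (s1.arr aOrd j) = if B k (s1.arr aOrd j) then 1 else 0)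
      (Φ := fun k => 200 * k) (by simp) ?_ L ?_).mono ?_ ?_
    · rintro k s' f ⟨hk, hk', hem, hbel⟩ hb
      have hs' := hs1.frame f rfl
      obtain ⟨k, rfl⟩ : ∃ k', k = k' + 1 := by
        simp [hk'] at hb
        exact ⟨k - 1, by omega⟩
      have hkL : k < L := hk
      have ho := f.arr (a := aOrd) rfl
      obtain ⟨v, hv⟩ : ∃ v, s1.arr aOrd k = v := ⟨_, rfl⟩
      have hvX := hM1.mem hkL
      rw [hv] at hvX
      have hvn := hXn hvX
      have hAk : A k = {w | w ∈ A (k + 1) ∨ w = v ∧ T.IsMinCandidate N v} := by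
        ext w
        constructor
        · rintro ⟨j, hj, hjL, h1, h2⟩
          rcases hj.lt_or_eq with h | rfl
          · exact .inl ⟨j, h, hjL, h1, h2⟩
          · rw [hv] at h1
            subst h1
            exact .inr ⟨rfl, h2⟩
        · rintro (⟨j, hj, h⟩ | ⟨rfl, h⟩)
          · exact ⟨j, by omega, h⟩
          · exact ⟨k, le_rfl, hkL, hv, h⟩
      have hvA : v ∉ A (k + 1) := by
        rintro ⟨j, hj, hjL, h1, -⟩
        have := hM1.injOn (Set.mem_Iio.2 hjL) (Set.mem_Iio.2 hkL) (h1.trans hv.symm)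
        omega
      have hcount : s'.reg rCount ≤ 3 * n := by
        have h1 : (A (k + 1)) ⊆ (X : Set ℕ) := by
          rintro w ⟨j, -, hj, rfl, -⟩
          exact hM1.mem hj
        have h2 := Set.ncard_le_ncard h1 (Finset.finite_toSet X)
        rw [← hem.bij.image_eq, Set.InjOn.ncard_image hem.bij.injOn, ← Finset.coe_Iio,
          Set.ncard_coe_finset, Set.ncard_coe_finset, Nat.card_Iio, hM.card] at h2
        omega
      have hBv : B (k + 1) v ↔ ∃ w, w ≠ v ∧ T.IsCandidate N w ∧ T.IsAncestor v w := by
        rw [← hasCandidate_child_iff hT hX]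
        constructor
        · rintro ⟨j, hj, hjL, h1, h2⟩
          refine ⟨_, hM1.mem hjL, ⟨hXn (hM1.mem hjL), fun h => ?_, h1⟩, h2⟩
          -- The root is its own parent and would raise its own flag; injectivity of the list
          -- excludes that it was treated before its turn.
          rw [h, hT.parent_root] at h1
          have := hM1.injOn (Set.mem_Iio.2 hjL) (Set.mem_Iio.2 hkL) (h.trans (h1.trans hv.symm))
          omega
        · rintro ⟨c, hcX, hc, hcc⟩
          obtain ⟨j, hjL, rfl⟩ := hM1.exists_index hcX
          refine ⟨j, ?_, hjL, hc.2.2, hcc⟩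
          obtain ⟨i, hi, h⟩ := hM1.earlier j hjL hc.2.1
          rw [hc.2.2] at h
          have := hM1.injOn (Set.mem_Iio.2 (hi.trans hjL)) (Set.mem_Iio.2 hkL) (h.trans hv.symm)
          omega
      refine ⟨k, 196, ?_, (Ter.split 3 (.of_run (Q := fun s2 => s2.reg rV = v ∧
        s2.reg rIdx = k ∧ s2.reg rFlag = if B (k + 1) v then 1 else 0)
        ?_ ?_) fun s2 q2 f2 => .split 1 (.single (emitIfMinimal_spec (s := s2) (W := W) hT
        (hs'.frame f2 rfl) hX hvX q2.1 ?_ ?_ ?_ hN (A := A (k + 1)) ?_ hvA ?_ ?_ ?_))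
        fun s3 h3 f3 => .single (.of_wp (Q := fun s4 => k ≤ L ∧ s4.reg rIdx = k ∧
          Emitted (fun v => (T.anchored N v \ N).ncard) (A k) (S.ncard + 1) s4 ∧
          ∀ j < k, s4.arr aBel (s1.arr aOrd j) = if B k (s1.arr aOrd j) then 1 else 0) ?_)).le ?_⟩
      · simp; omega
      · simp; omega
      · refine ⟨by simp [hk', ho, hv], by simp [hk'], ?_⟩
        have := hbel k (by omega)
        rw [hv] at this
        simp [hk', ho, hv, this]
      · rw [show Evaluated T N s2 v ↔ Evaluated T N s v from ?_]
        · exact (hE v hvX).2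
        · have g1 : s2.arr aElig = s.arr aElig := by rw [f2.arr rfl, f.arr rfl, f1.arr rfl]
          have g2 : s2.arr aSA = s.arr aSA := by rw [f2.arr rfl, f.arr rfl, f1.arr rfl]
          exact ⟨fun h => ⟨g1 ▸ h.elig, g2 ▸ h.joined⟩, fun h => ⟨g1 ▸ h.elig, g2 ▸ h.joined⟩⟩
      · rw [f2.arr rfl, f.arr rfl, hM1.nh]
      · rw [f2.reg rfl, f.reg rfl, f1.reg rfl, hd]
      · exact hem.frame (f2.arr rfl) (f2.arr rfl) (f2.reg rfl) (f2.reg rfl) (f2.reg rfl)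
      · rw [f2.reg rfl]
        omega
      · omega
      · rw [q2.2.2]
        simp only [hBv]
      · obtain ⟨hem3, hfl⟩ := h3
        rw [← hAk] at hem3
        have hi3 : s3.reg rIdx = k := by rw [f3.reg rfl, q2.2.1]
        have hV3 : s3.reg rV = v := by rw [f3.reg rfl, q2.1]
        have hB3 : s3.arr aBel = s'.arr aBel := by rw [f3.arr rfl, f2.arr rfl]
        have hP3 : s3.arr aParent = T.parent := ((hs'.frame f2 rfl).frame f3 rfl).parent
        have hbel3 : ∀ j < k, s3.arr aBel (s1.arr aOrd j) =
            if B (k + 1) (s1.arr aOrd j) then 1 else 0 := fun j hj => by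
          rw [hB3]
          exact hbel j (by omega)
        have hBk : ∀ w, B k w ↔ B (k + 1) w ∨ (T.parent v = w ∧ HasCandidate T N v) := by
          intro w
          constructor
          · rintro ⟨j, hj, hjL, h1, h2⟩
            rcases hj.lt_or_eq with h | rfl
            · exact .inl ⟨j, h, hjL, h1, h2⟩
            · rw [hv] at h1 h2
              exact .inr ⟨h1, h2⟩
          · rintro (⟨j, hj, h⟩ | ⟨h1, h2⟩)
            · exact ⟨j, by omega, h⟩
            · exact ⟨k, le_rfl, hkL, by rw [hv]; exact h1, by rw [hv]; exact h2⟩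
        refine ⟨by simp; omega, fun hb => ?_, fun hb => ?_⟩
        · have hcand : HasCandidate T N v := by
            by_contra h
            simp [hfl, h] at hb
          refine wp_of_run (by simp; omega) ⟨hkL.le, by simpa using hi3,
            hem3.frame rfl rfl rfl rfl rfl, fun j hj => ?_⟩
          by_cases hjp : s1.arr aOrd j = T.parent v
          · simp [hV3, hP3, hBk, hcand, hjp]
          · have : ¬ (T.parent v = s1.arr aOrd j) := fun h => hjp h.symm
            have hh := hbel3 j hj
            simp only [hBk, this, false_and, or_false]
            simpa [hV3, hP3, hjp] using hh
        · have hcand : ¬ HasCandidate T N v := by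
            intro h
            simp [hfl, h] at hb
          refine ⟨hkL.le, hi3, hem3, fun j hj => ?_⟩
          simp only [hBk, hcand, and_false, or_false]
          exact hbel3 j hj
      · simp
    · refine ⟨le_rfl, q1.2.2, ?_, fun j hj => ?_⟩
      · have hAL : A L = ∅ := by
          ext v
          simp only [hA, Set.mem_ofPred_eq, Set.mem_empty_iff_false, iff_false]
          rintro ⟨j, h1, h2, -⟩
          omega
        rw [hAL]
        refine ⟨?_, ?_, ?_, .inl ⟨rfl, q1.2.1⟩⟩
        · rw [q1.1]
          simp
        · rw [q1.1]
          simp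
        · simp
      · rw [if_neg]
        · rw [f1.arr rfl]
          exact (hE _ (hM1.mem hj)).1
        · rintro ⟨i, h1, h2, -⟩
          omega
    · simp
      rw [hM.card]
      omega
    · rintro s' ⟨f, ⟨k, hk, hk', hem, -⟩, hb⟩
      obtain rfl : k = 0 := by
        simp [hk'] at hb
        exact hb
      have : A 0 = {v | T.IsMinCandidate N v} := by
        ext v
        constructor
        · rintro ⟨j, -, -, -, h⟩
          exact h
        · intro h
          obtain ⟨j, hj, h'⟩ := hM1.exists_index ((hX v).2 ⟨h.cand.mem, h.cand.nonhollow⟩)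
          exact ⟨j, Nat.zero_le j, hj, h', h⟩
      rwa [this] at hem
  · simp; omega

/-! ### Listing the completed neighbourhood -/

/-- The subtrees of the nodes in the list `r` are disjoint, and their leaves form the set `U`. -/
structure Covers (T : LabelledTree n) (r : List ℕ) (U : Set (Fin n)) : Prop where
  mem : ∀ e ∈ r, e ∈ T.nodes
  disj : r.Pairwise fun a b => Disjoint (T.below a) (T.below b)
  union : ∀ y, y ∈ U ↔ ∃ e ∈ r, y ∈ T.below e

theorem Covers.append {r r' : List ℕ} {U U' : Set (Fin n)} (h : Covers T r U) (h' : Covers T r' U')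
    (hU : Disjoint U U') : Covers T (r ++ r') (U ∪ U') := by
  refine ⟨fun e he => ?_, List.pairwise_append.2 ⟨h.disj, h'.disj, fun a ha b hb => ?_⟩, fun y => ?_⟩
  · rcases List.mem_append.1 he with he | he
    · exact h.mem e he
    · exact h'.mem e he
  · exact hU.mono (fun y hy => (h.union y).2 ⟨a, ha, hy⟩) (fun y hy => (h'.union y).2 ⟨b, hb, hy⟩)
  · simp only [Set.mem_union, h.union, h'.union, List.mem_append, or_and_right, exists_or]

theorem Covers.tail {e : ℕ} {r : List ℕ} {U : Set (Fin n)} (h : Covers T (e :: r) U) :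
    Covers T r (U \ T.below e) := by
  obtain ⟨h1, h2, h3⟩ := h
  rw [List.pairwise_cons] at h2
  refine ⟨fun e he => h1 e (List.mem_cons_of_mem _ he), h2.2, fun y => ?_⟩
  rw [Set.mem_sdiff, h3]
  constructor
  · rintro ⟨⟨f, hf, hy⟩, hye⟩
    rcases List.mem_cons.1 hf with rfl | hf
    · exact absurd hy hye
    · exact ⟨f, hf, hy⟩
  · rintro ⟨f, hf, hy⟩
    exact ⟨⟨f, List.mem_cons_of_mem _ hf, hy⟩, fun h => Set.disjoint_left.1 (h2.1 f hf) h hy⟩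

theorem Covers.head_subset {e : ℕ} {r : List ℕ} {U : Set (Fin n)} (h : Covers T (e :: r) U) :
    T.below e ⊆ U := fun y hy => (h.union y).2 ⟨e, List.mem_cons_self, hy⟩

/-- The subtrees are disjoint and each has a leaf. Thus work proportional to the queue is paid for
by vertices of the completion. -/
theorem Covers.length_le (hT : T.IsCotreeOf H S) {r : List ℕ} : ∀ {U : Set (Fin n)},
    Covers T r U → r.length ≤ U.ncard := by
  induction r with
  | nil => simp
  | cons e r ih =>
    intro U h
    have h1 := ih h.tail
    have h2 := Set.ncard_sdiff_add_ncard_of_subset h.head_subset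
    have h3 : 0 < (T.below e).ncard := (Set.ncard_pos).2
      (hT.below_nonempty e (h.mem e List.mem_cons_self))
    simp only [List.length_cons]
    omega

/-- `l` lists the children of `u`. -/
structure ListsChildren (T : LabelledTree n) (u : ℕ) (l : List ℕ) : Prop where
  nodup : l.Nodup
  mem : ∀ c, c ∈ l ↔ c ∈ T.children u

theorem ListsChildren.covers (hT : T.IsCotreeOf H S) (h : ListsChildren T u l)
    (p : ℕ → Prop) [DecidablePred p] :
    Covers T (l.filter p) {y | ∃ c ∈ T.children u, p c ∧ y ∈ T.below c} := by
  refine ⟨fun e he => ((h.mem e).1 (List.mem_of_mem_filter he)).1, ?_, fun y => ?_⟩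
  · refine (h.nodup.filter _).imp_of_mem fun {a b} ha hb hab => ?_
    exact hT.below_disjoint ((h.mem a).1 (List.mem_of_mem_filter ha))
      ((h.mem b).1 (List.mem_of_mem_filter hb)) hab
  · simp only [Set.mem_ofPred_eq, List.mem_filter, h.mem, decide_eq_true_eq, and_assoc]

theorem ListsChildren.covers_below (hT : T.IsCotreeOf H S)
    (h : ListsChildren T u l) (hu : n ≤ u) : Covers T l (T.below u) := by
  have := h.covers hT (fun _ => True)
  simp only [decide_true, List.filter_true, true_and] at this
  convert this using 1
  ext y
  exact hT.mem_below_iff hu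

theorem ListsChildren.covers_siblings (hT : T.IsCotreeOf H S) {u c : ℕ}
    (h : ListsChildren T u l) (hc : c ∈ T.children u) :
    Covers T (l.filter (· ≠ c)) (T.below u \ T.below c) := by
  convert h.covers hT (· ≠ c) using 1
  ext y
  rw [Set.mem_sdiff, hT.mem_below_iff (hT.internal_of_child hc)]
  constructor
  · rintro ⟨⟨d, hd, hy⟩, hyc⟩
    exact ⟨d, hd, fun h => hyc (h ▸ hy), hy⟩
  · rintro ⟨d, hd, hdc, hy⟩
    exact ⟨⟨d, hd, hy⟩, fun hyc => hdc (hT.children_eq_of_mem hd hc hy hyc)⟩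

/-- The children of the nodes of `T` are linked. -/
def Forest (T : LabelledTree n) (s : State) : Prop :=
  LinkedForest (3 * n) (T.nodes.erase T.root) (T.nodes.filter (n ≤ ·)) T.parent (s.arr aNx)
    (s.arr aPv)

theorem Forest.exists_list (h : Forest T s) (hu : u ∈ T.nodes) (hun : n ≤ u) :
    ∃ l, ListsChildren T u l ∧ Linked (s.arr aNx) (s.arr aPv) (u + 3 * n) l := by
  obtain ⟨l, h1, h2, h3⟩ := h.lists u (by simp [hu, hun])
  refine ⟨l, ⟨h1, fun c => ?_⟩, h3⟩
  rw [h2, Finset.mem_erase, LabelledTree.children]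
  simp only [Set.mem_ofPred_eq]
  tauto

theorem Linked.first {nx pv : ℕ → ℕ} {h : ℕ} (hl : Linked nx pv h l) :
    nx h = l.headD h := by
  cases l with
  | nil => exact ((List.isChain_cons_cons.1 hl).1).1
  | cons a l => exact ((List.isChain_cons_cons.1 hl).1).1

theorem Linked.next {nx pv : ℕ → ℕ} {h c : ℕ} {l1 l2 : List ℕ}
    (hl : Linked nx pv h (l1 ++ c :: l2)) : nx c = l2.headD h := by
  have : List.IsChain (Link nx pv) (c :: (l2 ++ [h])) := by
    have h1 : List.IsChain (Link nx pv) ((h :: l1) ++ (c :: (l2 ++ [h]))) := by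
      simpa [Linked] using hl
    exact (List.isChain_append.1 h1).2.1
  cases l2 with
  | nil => exact ((List.isChain_cons_cons.1 this).1).1
  | cons a l => exact ((List.isChain_cons_cons.1 this).1).1

/-- The queue holds the list `l`. -/
structure Queue (s : State) (l : List ℕ) : Prop where
  length : s.reg rQLen = l.length
  get : ∀ i (h : i < l.length), s.arr aQ i = l[i]

theorem Queue.congr (h : Queue s l) (h1 : s'.reg rQLen = s.reg rQLen)
    (h2 : s'.arr aQ = s.arr aQ) : Queue s' l :=
  ⟨h1.trans h.length, by rw [h2]; exact h.get⟩

theorem Queue.push {c : ℕ} (h : Queue s l)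
    (h1 : s'.reg rQLen = s.reg rQLen + 1)
    (h2 : s'.arr aQ = update (s.arr aQ) (s.reg rQLen) c) : Queue s' (l ++ [c]) := by
  refine ⟨by rw [h1, h.length]; simp, fun i hi => ?_⟩
  rw [h2, h.length]
  rcases Nat.lt_or_ge i l.length with h' | h'
  · rw [update_of_ne h'.ne, h.get i h', List.getElem_append_left h']
  · have : i = l.length := by simp at hi; omega
    subst this
    simp

/-- In the circular list only the sentinel `u + 3 * n` is not smaller than `rK`, so the loop test
recognizes the return to it. Setting `rEx` to `u` itself excludes nothing, since no node is its own
child. -/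
theorem pushChildren_spec (hs : Env T s) {u e : ℕ} {q l : List ℕ}
    (hu : u ∈ T.nodes) (hP : s.reg rP = u) (hE : s.reg rEx = e) (hl : ListsChildren T u l)
    (hl' : Linked (s.arr aNx) (s.arr aPv) (u + 3 * n) l) (hQ : Queue s q)
    (hW : q.length + l.length + 6 * n + 1 ≤ W) :
    Ter W pushChildren s (40 * l.length + 20) (fun s' => Queue s' (q ++ l.filter (· ≠ e))) := by
  have hlt := hs.lt u hu
  have hK := hs.reg_k
  have hc : ∀ c ∈ l, c < 3 * n := fun c h => hs.lt c ((hl.mem c).1 h).1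
  refine (Ter.split 1 (.of_run (Q := fun s1 => s1.reg rC = l.headD (u + 3 * n)) ?_ ?_)
    fun s1 q1 f1 => .single (T := 40 * l.length + 10) ?_).le ?_
  · simp [hP, hK]; omega
  · simpa [hP, hK] using hl'.first
  · have hQ1 : Queue s1 q := hQ.congr (f1.reg rfl) (f1.arr rfl)
    have hK1 : s1.reg rK = 3 * n := (f1.reg rfl).trans hK
    have hE1 : s1.reg rEx = e := (f1.reg rfl).trans hE
    have hnx : s1.arr aNx = s.arr aNx := f1.arr rfl
    refine (Ter.loop_frame (s0 := s1) (I := fun (g : List ℕ × List ℕ) s' => l = g.1 ++ g.2 ∧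
      s'.reg rC = g.2.headD (u + 3 * n) ∧ Queue s' (q ++ g.1.filter (· ≠ e)))
      (Φ := fun g => 40 * g.2.length) (by simp) ?_ ([], l) ?_).mono ?_ ?_
    · rintro ⟨d, r⟩ s' f ⟨hdr, hC, hQ'⟩ hb
      dsimp only at hdr hC hQ'
      have hK' : s'.reg rK = 3 * n := (f.reg rfl).trans hK1
      have hE' : s'.reg rEx = e := (f.reg rfl).trans hE1
      have hnx' : s'.arr aNx = s.arr aNx := (f.arr rfl).trans hnx
      cases r with
      | nil => simp [hC, hK'] at hb
      | cons c r =>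
        simp only [List.headD_cons] at hC
        have hnext := Linked.next (hdr ▸ hl')
        have hlen := hQ'.length
        have hfl : (d.filter (· ≠ e)).length ≤ d.length := List.length_filter_le _ _
        have hll : l.length = d.length + r.length + 1 := by simp [hdr]; omega
        simp only [List.length_append] at hlen
        refine ⟨(d ++ [c], r), 30, ?_, (Ter.split 1 (.single (.of_wp
          (Q := fun s2 => Queue s2 (q ++ (d ++ [c]).filter (· ≠ e))) ?_)) fun s2 q2 f2 =>
          .of_run ?_ ⟨?_, ?_, ?_⟩).le ?_⟩
        · simp; omega
        · refine ⟨by simp, fun hb => ?_, fun hb => ?_⟩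
          · have : c = e := by simpa [hC, hE'] using hb
            simpa [this, wp, List.filter_append] using hQ'
          · have : c ≠ e := by simpa [hC, hE'] using hb
            refine wp_of_run ?_ ?_
            · simp
              lia
            · have := hQ'.push (s' := (push rC).run s') (c := c) (by simp) (by simp [hC])
              simpa [List.filter_append, ‹c ≠ e›] using this
        · simp
        · simp
        · simp [hdr]
        · have h1 : s2.reg rC = c := (f2.reg rfl).trans hC
          have h2 : s2.arr aNx = s.arr aNx := (f2.arr rfl).trans hnx'
          simpa [h1, h2] using hnext
        · exact q2.congr rfl rfl
    · exact ⟨by simp, q1, by simpa using hQ1⟩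
    · simp
    · rintro s' ⟨f, ⟨⟨d, r⟩, hdr, hC, hQ'⟩, hb⟩
      dsimp only at hdr hC hQ'
      have hK' : s'.reg rK = 3 * n := (f.reg rfl).trans hK1
      cases r with
      | nil =>
        rw [List.append_nil] at hdr
        rwa [hdr]
      | cons c r =>
        have := hc c (by simp [hdr])
        simp [hC, hK'] at hb; omega
  · simp; omega

/-- The non-hollow children of `u` are found among the marked nodes, because walking through all
children could be too expensive. The root is skipped, as it is its own parent. -/
theorem scanPhase_spec (hs : Env T s)
    (hX : ∀ v, v ∈ X ↔ v ∈ T.nodes ∧ (T.below v ∩ N).Nonempty)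
    (hM : Marked T s X (s.reg rLen)) (hW : 10 * n + 10 ≤ W) (hU : s.reg rU = u) :
    Ter W scanPhase s (50 * X.card + 20) (fun s' => ∃ F : List ℕ, Queue s' F ∧ F.Nodup ∧
      ∀ c, c ∈ F ↔ c ∈ T.children u ∧ (T.below c ∩ N).Nonempty) := by
  set L := s.reg rLen with hLdef
  have hXn : X ⊆ T.nodes := fun v hv => ((hX v).1 hv).1
  have hL : L ≤ 3 * n := hM.length_le hs hXn
  refine (Ter.split 2 (.of_run (Q := fun s1 => s1.reg rQLen = 0 ∧ s1.reg rIdx = 0) ?_ ?_)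
    fun s1 q1 f1 => .single (T := 50 * X.card + 10) ?_).le ?_
  · simp
  · simp
  · have hM1 : Marked T s1 X L := hM.congr (f1.arr rfl) (f1.arr rfl) (f1.arr rfl)
    have hs1 := hs.frame f1 rfl
    set F : ℕ → List ℕ := fun k => ((List.range k).map (s1.arr aOrd)).filter
      fun v => v ≠ T.root ∧ T.parent v = u with hF
    have hFs : ∀ k, F (k + 1) = F k ++ [s1.arr aOrd k].filter
        fun v => v ≠ T.root ∧ T.parent v = u := by
      intro k
      simp only [hF, List.range_succ, List.map_append, List.filter_append, List.map_singleton]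
    have hFl : ∀ k, (F k).length ≤ k := fun k => (List.length_filter_le _ _).trans (by simp)
    refine (Ter.loop_frame (s0 := s1) (I := fun k s' => k ≤ L ∧ s'.reg rIdx = k ∧ Queue s' (F k))
      (Φ := fun k => 50 * (L - k)) (by simp) ?_ 0 ?_).mono ?_ ?_
    · rintro k s' f ⟨hk, hk', hQ⟩ hb
      have hs' := hs1.frame f rfl
      have hlen : s'.reg rLen = L := by rw [f.reg rfl, f1.reg rfl]
      have hU' : s'.reg rU = u := by rw [f.reg rfl, f1.reg rfl, hU]
      have hkL : k < L := by
        simp [hk', hlen] at hb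
        exact hb
      have ho := f.arr (a := aOrd) rfl
      obtain ⟨v, hv⟩ : ∃ v, s1.arr aOrd k = v := ⟨_, rfl⟩
      have hq := hQ.length
      have hq' := hFl k
      refine ⟨k + 1, 45, ?_, (Ter.split 1 (.of_run (Q := fun s2 => s2.reg rV = v) ?_ ?_)
        fun s2 q2 f2 => .split 1 (.single (.of_wp (Q := fun s3 => Queue s3 (F (k + 1))) ?_))
        fun s3 q3 f3 => .of_run ?_ ⟨hkL, ?_, ?_⟩).le ?_⟩
      · simp; omega
      · simp
      · simp [hk', ho, hv]
      · have hs2 := hs'.frame f2 rfl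
        have hU2 : s2.reg rU = u := (f2.reg rfl).trans hU'
        have hQ2 : Queue s2 (F k) := hQ.congr (f2.reg rfl) (f2.arr rfl)
        have hrt := hs2.root
        have hp := hs2.parent
        rw [hFs, hv]
        refine ⟨by simp, fun hb => ?_, fun hb => ?_⟩
        · have hvr : v = T.root := by simpa [q2, hrt] using hb
          simpa [wp, hvr] using hQ2
        · have hvr : v ≠ T.root := by simpa [q2, hrt] using hb
          refine ⟨by simp, fun hb => ?_, fun hb => ?_⟩
          · have hvp : T.parent v = u := by simpa [q2, hp, hU2] using hb
            have hl := hQ2.length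
            refine wp_of_run ?_ ?_
            · simp
              lia
            · have := hQ2.push (s' := (push rV).run s2) (c := v) (by simp) (by simp [q2])
              simpa [hvr, hvp] using this
          · have hvp : T.parent v ≠ u := by simpa [q2, hp, hU2] using hb
            simpa [wp, hvr, hvp] using hQ2
      · have g : s3.reg rIdx = k := by rw [f3.reg rfl, f2.reg rfl, hk']
        simp [g]; omega
      · simp
      · have g : s3.reg rIdx = k := by rw [f3.reg rfl, f2.reg rfl, hk']
        simp [g]
      · exact q3.congr rfl rfl
    · exact ⟨by simp, q1.2, by simp [hF, q1.1], by simp [hF]⟩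
    · simp
      rw [hM.card]
      omega
    · rintro s' ⟨f, ⟨k, hk, hk', hQ⟩, hb⟩
      have hlen : s'.reg rLen = L := by rw [f.reg rfl, f1.reg rfl]
      have hkL : k = L := by simp [hk', hlen] at hb; omega
      rw [hkL] at hQ
      refine ⟨F L, hQ, ?_, fun c => ?_⟩
      · refine List.Nodup.filter _ ?_
        refine List.Nodup.map_on ?_ List.nodup_range
        intro a ha b hb h
        exact hM1.injOn (List.mem_range.1 ha) (List.mem_range.1 hb) h
      · simp only [hF, List.mem_filter, List.mem_map, List.mem_range, decide_eq_true_eq,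
          LabelledTree.children, Set.mem_ofPred_eq]
        constructor
        · rintro ⟨⟨j, hj, rfl⟩, h1, h2⟩
          obtain ⟨h3, h4⟩ := (hX _).1 (hM1.mem hj)
          exact ⟨⟨h3, h1, h2⟩, h4⟩
        · rintro ⟨⟨h3, h1, h2⟩, h4⟩
          obtain ⟨j, hj, h⟩ := hM1.exists_index ((hX c).2 ⟨h3, h4⟩)
          exact ⟨⟨j, hj, h⟩, h1, h2⟩
  · simp; omega

theorem length_filter_ne {e : ℕ} (h : l.Nodup) (he : e ∈ l) :
    (l.filter (· ≠ e)).length + 1 = l.length := by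
  have h1 : l.filter (· ≠ e) = l.erase e := by
    rw [h.erase_eq_filter]
    congr 1
    ext x
    by_cases hx : x = e <;> simp [hx]
  rw [h1, List.length_erase_of_mem he]
  have := List.length_pos_of_mem he
  omega

theorem Forest.congr (h : Forest T s) (h1 : s'.arr aNx = s.arr aNx)
    (h2 : s'.arr aPv = s.arr aPv) : Forest T s' := by
  rw [Forest, h1, h2]
  exact h

theorem pushSiblings_spec (hs : Env T s) (hF : Forest T s) {e : ℕ} {q l : List ℕ}
    (hp : T.parent e ∈ T.nodes) (hP : s.reg rP = T.parent e) (hE : s.reg rE = e)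
    (hl : ListsChildren T (T.parent e) l)
    (hl' : Linked (s.arr aNx) (s.arr aPv) (T.parent e + 3 * n) l) (hQ : Queue s q)
    (hW : q.length + l.length + 6 * n + 1 ≤ W) :
    Ter W (.ite (.eq (.get aSeries (.var rP)) (.const 1)) (block [.assign rEx (.var rE), pushChildren])
      .skip) s (40 * (if T.series (T.parent e) = true then l.length else 0) + 35)
      (fun s' => Queue s' (q ++ if T.series (T.parent e) = true then l.filter (· ≠ e) else [])) := by
  have hser := hs.series (T.parent e)
  by_cases hst : T.series (T.parent e) = true
  · simp only [hst, if_true]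
    refine (Ter.ite (T := 40 * l.length + 30) ?_ (fun _ => Ter.le (Ter.split 1
      (.of_run (Q := fun s1 => s1.reg rEx = e) ?_ ?_) fun s1 h1 f1 =>
      .single (pushChildren_spec (hs.frame f1 rfl) hp
      ((f1.reg rfl).trans hP) h1 hl ?_ (hQ.congr (f1.reg rfl) (f1.arr rfl)) hW)) ?_)
      (fun hb => absurd ?_ hb)).le ?_
    · simp; omega
    · simp
    · simp [hE]
    · rw [f1.arr (a := aNx) rfl, f1.arr (a := aPv) rfl]
      exact hl'
    · simp; omega
    · simp [hP, hser, hst]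
    · simp; omega
  · simp only [hst]
    refine (Ter.ite (T := 10) ?_ (fun hb => absurd hb ?_)
      (fun _ => (Ter.of_run (c := .skip) trivial ?_).le ?_)).le ?_
    · simp; omega
    · simp [hP, hser, hst]
    · simpa using hQ
    · simp
    · simp

-- The climb from `u` to the root is short by `card_ancestors_le`. The siblings pushed at a series
-- node are at most as many as the vertices below them, and `T.seriesAbove` loses exactly these
-- vertices when the climb passes that node.
open Classical in
theorem seriesPhase_spec (hT : T.IsCotreeOf H S) (hs : Env T s) (hF : Forest T s)
    (hW : 20 * n + 20 ≤ W) (hu : u ∈ T.nodes) (hU : s.reg rU = u) {q : List ℕ}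
    (hQ : Queue s q) {D : Set (Fin n)} (hD : D ⊆ T.below u) (hq : Covers T q D) :
    Ter W seriesPhase s (300 * (T.seriesAbove u).ncard + 300) (fun s' =>
      ∃ q', Queue s' (q ++ q') ∧ Covers T (q ++ q') (D ∪ T.seriesAbove u)) := by
  have hanu := hT.card_ancestors_le u hu
  refine (Ter.split 1 (.of_run (Q := fun s1 => s1.reg rE = u) ?_ ?_)
    fun s1 q1 f1 => .single (T := 300 * (T.seriesAbove u).ncard + 290) ?_).le ?_
  · simp
  · simp [hU]
  · have hs1 := hs.frame f1 rfl
    have hQ1 : Queue s1 q := hQ.congr (f1.reg rfl) (f1.arr rfl)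
    have hF1 : Forest T s1 := hF.congr (f1.arr rfl) (f1.arr rfl)
    set anc : ℕ → ℕ := fun e => (T.nodes.filter (T.IsAncestor · e)).card with hanc
    have hanu' : anc u ≤ 2 * (T.seriesAbove u).ncard + 2 := hanu
    refine (Ter.loop_frame (s0 := s1) (I := fun (g : ℕ × List ℕ) s' => s'.reg rE = g.1 ∧
      T.IsAncestor g.1 u ∧ Queue s' (q ++ g.2) ∧
      Covers T (q ++ g.2) (D ∪ (T.seriesAbove u ∩ T.below g.1)))
      (Φ := fun g => 110 * anc g.1 + 40 * (T.seriesAbove g.1).ncard) ?_ ?_ (u, []) ?_).mono ?_ ?_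
    · rintro ⟨e, q'⟩ s' f ⟨hE, heu, hQ', hC⟩
      dsimp only at hE heu hQ' hC
      have hs' := hs1.frame f rfl
      have hen := hT.rooted.mem_of_isAncestor hu heu
      have h1 := hs'.lt e hen
      have h2 := hs'.lt _ hT.root_mem
      have h3 := hs'.root
      simp [hE, h3]; omega
    · rintro ⟨e, q'⟩ s' f ⟨hE, heu, hQ', hC⟩ hb
      dsimp only at hE heu hQ' hC
      have hs' := hs1.frame f rfl
      have hF' : Forest T s' := hF1.congr (f.arr rfl) (f.arr rfl)
      have hen := hT.rooted.mem_of_isAncestor hu heu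
      have hrt := hs'.root
      have her : e ≠ T.root := by
        rintro rfl
        simp [hE, hrt] at hb
      have hc := hT.rooted.mem_children_parent hen her
      have hpn := hT.parent_mem e hen
      have hpi := hT.internal_of_child hc
      obtain ⟨l, hl, hl'⟩ := hF'.exists_list hpn hpi
      have hanc' : anc e = anc (T.parent e) + 1 := hT.ancestors_child hc
      have hsum := hT.ncard_seriesAbove_child hc
      have hpu : T.IsAncestor (T.parent e) u := (isAncestor_parent e).trans heu
      have hsib := hl.covers_siblings hT hc
      have hsub : T.below e ⊆ T.below (T.parent e) := below_mono (isAncestor_parent e)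
      have hcut : ∀ y, y ∈ T.below (T.parent e) → y ∉ T.below e →
          (y ∈ T.seriesAbove u ↔ T.series (T.parent e) = true) := fun y hy hy' =>
        hT.mem_seriesAbove_iff hc heu hy hy'
      have hDe : D ⊆ T.below e := hD.trans (below_mono heu)
      -- The excluded child `e` is walked over as well; the extra `1` is charged to the ancestor.
      have hlen : l.length ≤ 1 + (T.below (T.parent e) \ T.below e).ncard := by
        have h1 := hsib.length_le hT
        have h2 := length_filter_ne hl.nodup ((hl.mem e).2 hc)
        omega
      rw [Set.ncard_sdiff hsub] at hlen
      have hql : (q ++ q').length ≤ n := (hC.length_le hT).trans (ncard_le _)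
      have hbp := ncard_le (T.below (T.parent e))
      refine ⟨(T.parent e, q' ++ if T.series (T.parent e) = true then l.filter (· ≠ e) else []), _, ?_,
        (Ter.split 1 (.of_run (Q := fun s2 => s2.reg rP = T.parent e) ?_ ?_)
          fun s2 q2 f2 => .split 1 (.single (pushSiblings_spec (hs'.frame f2 rfl)
          (hF'.congr (f2.arr rfl) (f2.arr rfl)) hpn q2 ((f2.reg rfl).trans hE) hl ?_
          (hQ'.congr (f2.reg rfl) (f2.arr rfl)) ?_))
          fun s3 q3 f3 => .of_run ?_ ⟨?_, hpu, ?_, ?_⟩)⟩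
      · simp only [Test.cost, Exp.cost, neTest, Cmd.bound, block, List.take, List.drop]
        rw [hanc', hsum]
        split_ifs
        · omega
        · omega
      · simp
      · have := hs'.parent
        simp [hE, this]
      · rw [f2.arr (a := aNx) rfl, f2.arr (a := aPv) rfl]
        exact hl'
      · omega
      · simp
      · have : s3.reg rP = T.parent e := (f3.reg rfl).trans q2
        simp [this]
      · rw [← List.append_assoc]
        exact q3.congr rfl rfl
      · rw [← List.append_assoc]
        dsimp only
        split_ifs with hst
        · have := hC.append hsib ?_
          · convert this using 1
            ext y
            have hy' := hcut y
            simp only [Set.mem_union, Set.mem_inter_iff, Set.mem_sdiff]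
            by_cases hye : y ∈ T.below e
            · simp [hye, hsub hye]
            · by_cases hyp : y ∈ T.below (T.parent e)
              · simp [hye, hyp, hy' hyp hye, hst]
              · simp [hye, hyp]
          · rw [Set.disjoint_left]
            rintro y (hy | hy) hy'
            · exact hy'.2 (hDe hy)
            · exact hy'.2 hy.2
        · rw [List.append_nil]
          convert hC using 1
          ext y
          have hy' := hcut y
          simp only [Set.mem_union, Set.mem_inter_iff]
          by_cases hye : y ∈ T.below e
          · simp [hye, hsub hye]
          · by_cases hyp : y ∈ T.below (T.parent e)
            · simp [hye, hyp, hy' hyp hye, hst]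
            · simp [hye, hyp]
    · refine ⟨q1, .refl u, by simpa using hQ1, ?_⟩
      have : T.seriesAbove u ∩ T.below u = ∅ := (hT.seriesAbove_disjoint u).inter_eq
      simpa [this] using hq
    · simp; omega
    · rintro s' ⟨f, ⟨⟨e, q'⟩, hE, heu, hQ', hC⟩, hb⟩
      dsimp only at hE heu hQ' hC
      have hs' := hs1.frame f rfl
      have hrt := hs'.root
      have her : e = T.root := by simp [hE, hrt] at hb; omega
      rw [her, hT.below_root, Set.inter_eq_self_of_subset_left (hT.seriesAbove_subset u)] at hC
      exact ⟨q', hQ', hC⟩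
  · simp; omega

theorem Lists.snoc {a a' : ℕ → ℕ} {b e : ℕ} {F : Set (Fin n)} (h : Lists a b e F)
    (hy : y ∉ F) (ha : ∀ k < e, a' k = a k) (hay : a' e = y.val) : Lists a' b (e + 1) (insert y F) := by
  obtain ⟨hbe, h⟩ := h
  refine ⟨by omega, ?_⟩
  have hI : Set.Ico b (e + 1) = insert e (Set.Ico b e) := by
    ext i
    simp only [Set.mem_Ico, Set.mem_insert_iff]
    omega
  rw [hI, Set.image_insert_eq, ← hay]
  refine (h.congr fun i hi => (ha i hi.2).symm).insert ?_
  rw [hay]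
  rintro ⟨z, hz, hzy⟩
  exact hy (Fin.val_injective hzy ▸ hz)

theorem Lists.empty (a : ℕ → ℕ) (b : ℕ) : Lists a b b (∅ : Set (Fin n)) := by
  refine ⟨le_rfl, ?_⟩
  simp

theorem Lists.congr {a a' : ℕ → ℕ} {b e : ℕ} {F : Set (Fin n)} (h : Lists a b e F)
    (ha : ∀ k < e, a' k = a k) : Lists a' b e F :=
  ⟨h.1, h.2.congr fun i hi => (ha i hi.2).symm⟩

theorem Queue.head {l r d : List ℕ} {e : ℕ} (h : Queue s l) (hl : l = d ++ e :: r) :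
    s.arr aQ d.length = e := by
  subst hl
  rw [h.get d.length (by simp)]
  simp

/-- With `r` the open part of the queue and `U` the vertices still to be listed, `2 * U.ncard -
r.length` measures the remaining work: a leaf takes one from both, and expanding an internal node
lengthens the queue by at least one. The subtraction is not truncated because of `Covers.length_le`.
-/
theorem listPhase_spec (hT : T.IsCotreeOf H S) (hs : Env T s) (hF : Forest T s)
    (hQ : Queue s l) (hM : Covers T l M) {o : ℕ}
    (ho : s.reg rOut = o) (hW : 20 * n + 20 ≤ W) (hWo : o + n + 1 ≤ W) :
    Ter W listPhase s (400 * M.ncard + 20) (fun s' => (∃ q, Queue s' (l ++ q)) ∧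
      (∀ k < o, s'.arr aOut k = s.arr aOut k) ∧ Lists (s'.arr aOut) o (s'.reg rOut) M) := by
  refine (Ter.split 1 (.of_run (Q := fun s1 => s1.reg rHead = 0) ?_ ?_)
    fun s1 q1 f1 => .single (T := 400 * M.ncard + 10) ?_).le ?_
  · simp
  · simp
  · have hs1 := hs.frame f1 rfl
    have hQ1 : Queue s1 l := hQ.congr (f1.reg rfl) (f1.arr rfl)
    have hF1 : Forest T s1 := hF.congr (f1.arr rfl) (f1.arr rfl)
    have hout1 : s1.arr aOut = s.arr aOut := f1.arr rfl
    have hMn := ncard_le M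
    -- The ghost state is the processed part of the queue, its open part and the vertices still to
    -- be listed. The bound by `2 * n` keeps queue positions within the word bound.
    refine (Ter.loop_frame (s0 := s1) (I := fun (g : List ℕ × List ℕ × Set (Fin n)) s' =>
      (∃ q, g.1 ++ g.2.1 = l ++ q) ∧ Queue s' (g.1 ++ g.2.1) ∧ s'.reg rHead = g.1.length ∧
      Covers T g.2.1 g.2.2 ∧ g.2.2 ⊆ M ∧ g.1.length + (2 * g.2.2.ncard - g.2.1.length) ≤ 2 * n ∧
      (∀ k < o, s'.arr aOut k = s.arr aOut k) ∧ Lists (s'.arr aOut) o (s'.reg rOut) (M \ g.2.2))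
      (Φ := fun g => 200 * (2 * g.2.2.ncard - g.2.1.length)) ?_ ?_ ([], l, M) ?_).mono ?_ ?_
    · rintro g s' f -
      simp
    · rintro ⟨d, r, U⟩ s' f ⟨⟨q, hq⟩, hQ', hhd, hC, hUM, hpot, hlow, hL⟩ hb
      dsimp only at hq hQ' hhd hC hUM hpot hL
      have hs' := hs1.frame f rfl
      have hF' : Forest T s' := hF1.congr (f.arr rfl) (f.arr rfl)
      have hN := hs'.reg_n
      have hrl := hC.length_le hT
      have hUn := ncard_le U
      cases r with
      | nil =>
        have := hQ'.length
        simp [hhd, this] at hb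
      | cons e r =>
        have hhead := hQ'.head rfl
        have hen := hC.mem e List.mem_cons_self
        have hCt := hC.tail
        simp only [List.length_cons] at hrl hpot
        by_cases hlt : e < n
        · obtain ⟨y, rfl⟩ : ∃ y : Fin n, y.val = e := ⟨⟨e, hlt⟩, rfl⟩
          have hyS := (hT.leaf_iff y).1 hen
          have hyb := hT.below_leaf hyS
          have hyU : y ∈ U := hC.head_subset (by rw [hyb]; rfl)
          have hcard : (U \ T.below y.val).ncard + 1 = U.ncard := by
            rw [hyb]
            exact Set.ncard_sdiff_singleton_add_one hyU
          have hrOut := hL.length_eq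
          have hle := hL.1
          have hMU := ncard_le (M \ U)
          have hDM : (M \ (U \ T.below y.val)) = insert y (M \ U) := by
            ext z
            rw [hyb]
            by_cases hz : z = y
            · simp [hz, hUM hyU]
            · simp [hz]
          refine ⟨(d ++ [y.val], r, U \ T.below y.val), 100, ?_, (Ter.split 2 (.of_run
            (Q := fun s2 => s2.reg rP = y.val ∧ s2.reg rHead = d.length + 1) ?_ ?_)
            fun s2 q2 f2 => .single (T := 60) (Ter.le (Ter.ite (T := 40) ?_ (fun hb => ?_)
            (fun hb => absurd ?_ hb)) ?_)).le ?_⟩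
          · simp; omega
          · simp [hhd]; omega
          · simp [hhd, hhead]
          · simp
          · have hO : s2.reg rOut = s'.reg rOut := f2.reg rfl
            have hO' : s2.arr aOut = s'.arr aOut := f2.arr rfl
            refine (Ter.of_run ?_ ⟨⟨q, ?_⟩, ?_, ?_, hCt, Set.sdiff_subset.trans hUM, ?_, ?_, ?_⟩).le ?_
            · simp [hO]
              lia
            · simp
            · simpa using hq
            · simpa using hQ'.congr (s' := (block [.store aOut (.var rOut) (.var rP), incr rOut]).run s2)
                (f2.reg rfl) (f2.arr rfl)
            · simpa using q2.2
            · simp; omega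
            · intro k hk
              have : k ≠ s'.reg rOut := by omega
              simp [hO, hO', this]
              exact hlow k hk
            · dsimp only
              rw [hDM]
              have := hL.snoc (y := y) (by simp [hyU])
                (a' := update (s'.arr aOut) (s'.reg rOut) y.val)
                (fun k hk => update_of_ne hk.ne _ _) (update_self _ _ _)
              simpa [hO, hO', q2.1] using this
          · have := (f2.reg (r := rN) rfl).trans hN
            simp [q2.1, this]
          · simp
          · simp
        · have hne := not_lt.1 hlt
          obtain ⟨c, hl, hl'⟩ := hF'.exists_list hen hne
          have hcov := hl.covers_below hT hne
          have hcard := Set.ncard_sdiff_add_ncard_of_subset hC.head_subset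
          have hnew : Covers T (r ++ c) U := by
            have := hCt.append hcov Set.disjoint_sdiff_left
            rwa [Set.sdiff_union_of_subset hC.head_subset] at this
          have hnl := hnew.length_le hT
          have hc2 : 2 ≤ c.length := by
            obtain ⟨a, ha, b, hb, hab⟩ := hT.children_internal e hen hne
            have h1 := length_filter_ne hl.nodup ((hl.mem a).2 ha)
            have h2 : b ∈ c.filter (· ≠ a) := by simp [(hl.mem b).2 hb, hab.symm]
            have := List.length_pos_of_mem h2
            omega
          have hcn : e ∉ c := fun h => hT.rooted.ne_of_mem_children ((hl.mem e).1 h) rfl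
          have hfil : c.filter (· ≠ e) = c := List.filter_eq_self.2 fun a ha => by
            simp only [ne_eq, decide_eq_true_eq]
            rintro rfl
            exact hcn ha
          have hlen := hQ'.length
          have hcn' := hcov.length_le hT
          have hbn := ncard_le (T.below e)
          simp only [List.length_append, List.length_cons] at hlen hnl
          refine ⟨(d ++ [e], r ++ c, U), 40 * c.length + 90, ?_, (Ter.split 2 (.of_run
            (Q := fun s2 => s2.reg rP = e ∧ s2.reg rHead = d.length + 1) ?_ ?_)
            fun s2 q2 f2 => .single (T := 40 * c.length + 60) (Ter.le (Ter.ite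
            (T := 40 * c.length + 40) ?_ (fun hb => absurd hb ?_) (fun hb => ?_)) ?_)).le ?_⟩
          · simp; omega
          · simp [hhd]; omega
          · simp [hhd, hhead]
          · simp
          · have := (f2.reg (r := rN) rfl).trans hN
            simpa [q2.1, this] using hne
          · have hs2 := hs'.frame f2 rfl
            have hF2 := hF'.congr (s' := s2) (f2.arr rfl) (f2.arr rfl)
            have hQ2 : Queue s2 (d ++ e :: r) := hQ'.congr (f2.reg rfl) (f2.arr rfl)
            refine ((Ter.split 1 (.of_run (Q := fun s3 => s3.reg rEx = e) ?_ ?_)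
              fun s3 h3 f3 => .single ((pushChildren_spec (hs2.frame f3 rfl)
              hen ((f3.reg rfl).trans q2.1) h3 hl ?_
              (hQ2.congr (f3.reg rfl) (f3.arr rfl)) ?_).frame.mono le_rfl fun s4 h4 => ?_))).le ?_
            · simp
            · simp [q2.1]
            · rw [f3.arr (a := aNx) rfl, f3.arr (a := aPv) rfl, f2.arr (a := aNx) rfl, f2.arr (a := aPv) rfl]
              exact hl'
            · simp only [List.length_append, List.length_cons]
              omega
            · obtain ⟨hQ4, f4⟩ := h4
              rw [hfil] at hQ4
              have g1 : s4.arr aOut = s'.arr aOut := by rw [f4.arr rfl, f3.arr rfl, f2.arr rfl]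
              have g2 : s4.reg rOut = s'.reg rOut := by rw [f4.reg rfl, f3.reg rfl, f2.reg rfl]
              refine ⟨⟨q ++ c, ?_⟩, ?_, ?_, hnew, hUM, ?_, ?_, ?_⟩
              · have := congrArg (· ++ c) hq
                simpa using this
              · simpa using hQ4
              · rw [f4.reg rfl, f3.reg rfl, q2.2]
                simp
              · simp; omega
              · rwa [g1]
              · rwa [g1, g2]
            · simp; omega
          · simp; omega
          · simp; omega
    · refine ⟨⟨[], by simp⟩, by simpa using hQ1, by simpa using q1, hM, le_rfl, ?_, ?_, ?_⟩
      · simp; omega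
      · intro k hk
        rw [hout1]
      · have : s1.reg rOut = o := (f1.reg rfl).trans ho
        rw [this]
        simpa using Lists.empty (n := n) (s1.arr aOut) o
    · simp; omega
    · rintro s' ⟨f, ⟨⟨d, r, U⟩, ⟨q, hq⟩, hQ', hhd, hC, hUM, hpot, hlow, hL⟩, hb⟩
      dsimp only at hq hQ' hhd hC hUM hpot hL
      have hlen := hQ'.length
      have hr : r = [] := by
        simp [hhd, hlen] at hb
        exact hb
      subst hr
      have hU : U = ∅ := by
        ext y
        simpa using hC.union y
      rw [hU, Set.sdiff_empty] at hL
      exact ⟨⟨q, hq ▸ hQ'⟩, hlow, hL⟩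
  · simp; omega

/-! ### Pointer operations on the stored tree -/

/-- The tree `T` is stored, with linked lists of children. -/
structure Core (T : LabelledTree n) (s : State) : Prop where
  reg_n : s.reg rN = n
  reg_k : s.reg rK = 3 * n
  root : s.reg rRoot = T.root
  parent : s.arr aParent = T.parent
  series : ∀ u, s.arr aSeries u = (T.series u).toNat
  lt : ∀ u ∈ T.nodes, u < n + s.reg rUsed
  root_mem : T.root ∈ T.nodes
  forest : Forest T s

theorem insertCmd_spec {c p K : ℕ} (hc : s.reg rC = c) (hp : s.reg rP = p) (hK : s.reg rK = K)
    (hW : p + K ≤ W) :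
    Ter W insertCmd s 40 (fun s' => s'.arr aParent = update (s.arr aParent) c p ∧
      s'.arr aNx = update (update (s.arr aNx) c (s.arr aNx (p + K))) (p + K) c ∧
      s'.arr aPv = update (update (s.arr aPv) c (p + K)) (s.arr aNx (p + K)) c) := by
  refine (Ter.of_run ?_ ⟨?_, ?_, ?_⟩).le ?_
  · simp [insertCmd, hp, hK, hW]
  · simp [insertCmd]
  · simp [insertCmd, hc, hp]
  · simp [insertCmd, hc, hp, hK]
  · simp [insertCmd, hc, hp, hK]

theorem removeCmd_spec {c : ℕ} (hc : s.reg rC = c) : Ter W removeCmd s 40 (fun s' =>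
      s'.arr aNx = update (s.arr aNx) (s.arr aPv c) (s.arr aNx c) ∧
      s'.arr aPv = update (s.arr aPv) (s.arr aNx c) (s.arr aPv c)) := by
  refine (Ter.of_run ?_ ⟨?_, ?_⟩).le ?_
  · simp [removeCmd]
  · simp [removeCmd]
  · simp [removeCmd, hc]
  · simp [removeCmd, hc]

/-- The tree `T` with a new node `z` labelled `b`. -/
def relabel (T : LabelledTree n) (z : ℕ) (b : Bool) : ℕ → Bool := update T.series z b

theorem newNodeCmd_spec (h : Core T s) (hW : 7 * n + 2 * s.reg rUsed + 10 ≤ W) {b : Bool}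
    (hb : s.reg rB = b.toNat) :
    Ter W newNodeCmd s 40 (fun s' => s'.reg rZ = n + s.reg rUsed ∧ s'.reg rUsed = s.reg rUsed + 1 ∧
      (∀ u, s'.arr aSeries u = (relabel T (n + s.reg rUsed) b u).toNat) ∧
      s'.arr aNx = update (s.arr aNx) (n + s.reg rUsed + 3 * n) (n + s.reg rUsed + 3 * n) ∧
      s'.arr aPv = update (s.arr aPv) (n + s.reg rUsed + 3 * n) (n + s.reg rUsed + 3 * n)) := by
  have hN := h.reg_n
  have hK := h.reg_k
  refine (Ter.of_run ?_ ⟨?_, ?_, fun u => ?_, ?_, ?_⟩).le ?_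
  · simp [newNodeCmd, hN, hK]
    lia
  · simp [newNodeCmd]
  · simp [newNodeCmd, hN]
  · simp [newNodeCmd]
  · have := h.series u
    by_cases hu : u = n + s.reg rUsed
    · subst hu
      simp [newNodeCmd, relabel, hN, hb]
    · simp [newNodeCmd, relabel, hN, hu]
      simpa using this
  · simp [newNodeCmd, hN, hK]
  · simp [newNodeCmd, hN, hK]

/-- The tree `T` with a new node `z` inserted above `a`. -/
def raise (T : LabelledTree n) (a z : ℕ) (b : Bool) : LabelledTree n where
  nodes := insert z T.nodes
  root := if a = T.root then z else T.root
  parent := update (update T.parent z (if a = T.root then z else T.parent a)) a z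
  series := relabel T z b

/-- Only the local shape `hp` of the tree is required, because the command is also applied to trees
whose labels do not alternate. -/
theorem aboveCmd_spec (h : Core T s) (hW : 20 * n + 20 ≤ W) {a : ℕ} {b : Bool}
    (ha : a ∈ T.nodes) (hA : s.reg rA = a) (hb : s.reg rB = b.toNat)
    (hp : ∀ c ∈ T.nodes, c ≠ T.root → T.parent c ∈ T.nodes ∧ n ≤ T.parent c)
    (hu : s.reg rUsed + 1 ≤ 2 * n) :
    Ter W aboveCmd s 250 (fun s' => Core (raise T a (n + s.reg rUsed) b) s' ∧
      s'.reg rZ = n + s.reg rUsed ∧ s'.reg rUsed = s.reg rUsed + 1) := by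
  obtain ⟨z, hz⟩ : ∃ z, n + s.reg rUsed = z := ⟨_, rfl⟩
  -- Node numbers are handed out consecutively from `n` on, so the next one is fresh by `Core.lt`.
  have hzn : z ∉ T.nodes := fun h' => by
    have := h.lt z h'
    omega
  have haz : a ≠ z := fun h' => hzn (h' ▸ ha)
  have hzr : z ≠ T.root := fun h' => hzn (h' ▸ h.root_mem)
  have halt := h.lt a ha
  have hnew := newNodeCmd_spec (W := W) h (by omega) hb
  simp only [hz] at hnew ⊢
  have hI : (insert z T.nodes).filter (n ≤ ·) = insert z (T.nodes.filter (n ≤ ·)) := by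
    rw [Finset.filter_insert, if_pos (by omega)]
  have hAp : ∀ c ∈ T.nodes.erase T.root, T.parent c ∈ T.nodes ∧ n ≤ T.parent c := fun c hc =>
    hp c (Finset.mem_of_mem_erase hc) (Finset.ne_of_mem_erase hc)
  have hf1 := h.forest.newNode (q := z) (by simp [hzn]) fun c hc hcz => hzn (hcz ▸ (hAp c hc).1)
  have hRoot := h.root
  have hPar := h.parent
  have hK := h.reg_k
  have hcore : ∀ s' : State, s'.reg rN = n → s'.reg rK = 3 * n →
      s'.reg rRoot = (raise T a z b).root → s'.arr aParent = (raise T a z b).parent →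
      (∀ u, s'.arr aSeries u = (relabel T z b u).toNat) → s'.reg rUsed = s.reg rUsed + 1 →
      Forest (raise T a z b) s' → Core (raise T a z b) s' := by
    refine fun s' h1 h2 h3 h4 h5 h6 h7 => ⟨h1, h2, h3, h4, h5, fun u hu => ?_, ?_, h7⟩
    · rw [h6]
      rcases mem_insert.1 hu with rfl | hu
      · omega
      · have := h.lt u hu
        omega
    · simp only [raise]
      split_ifs <;> simp [h.root_mem]
  by_cases har : a = T.root
  · have hset : (insert z T.nodes).erase z = T.nodes := Finset.erase_insert hzn
    -- A new root is in no list; its parent pointer is set without touching the lists, and the old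
    -- root enters a list for the first time.
    have hf2 := hf1.congr_parent (parent' := update T.parent z z) fun c hc =>
      update_of_ne (fun h' : c = z => hzn (h' ▸ Finset.mem_of_mem_erase hc)) _ _
    have hf3 := hf2.insert (c := a) (p := z) (by simp [har]) (by omega) (by simp)
    rw [har, Finset.insert_erase h.root_mem, ← har] at hf3
    refine (Ter.split 1 (.single hnew) fun s1 q1 f1 => .split 1 (.single (.of_wp
      (Q := fun s2 => s2.reg rRoot = z ∧ s2.arr aParent = update T.parent z z ∧
        s2.arr aNx = s1.arr aNx ∧ s2.arr aPv = s1.arr aPv) ?_)) fun s2 q2 f2 =>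
      .split 2 (.of_run (Q := fun s3 => s3.reg rC = a ∧ s3.reg rP = z) ?_ ?_)
      fun s3 q3 f3 => (Ter.single (insertCmd_spec (K := 3 * n) q3.1 q3.2 ?_ ?_)).frame.mono le_rfl
      fun s4 q4 => ?_).le ?_
    · have g1 : s1.reg rRoot = T.root := (f1.reg rfl).trans hRoot
      have g2 : s1.reg rA = a := (f1.reg rfl).trans hA
      have g3 : s1.arr aParent = T.parent := (f1.arr rfl).trans hPar
      refine ⟨by simp, fun hb => wp_of_run ?_ ⟨?_, ?_, ?_, ?_⟩, fun hb => absurd ?_ hb⟩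
      · simp
      · simp [q1.1]
      · have := q1.1
        simp [this, g3]
      · simp
      · simp
      · simp [g1, g2, har]
    · simp
    · have g2 : s2.reg rA = a := by rw [f2.reg rfl, f1.reg rfl, hA]
      have g3 : s2.reg rZ = z := by rw [f2.reg rfl, q1.1]
      simp [g2, g3]
    · rw [f3.reg rfl, f2.reg rfl, f1.reg rfl, hK]
    · omega
    · obtain ⟨⟨g1, g2, g3⟩, f4⟩ := q4
      have e1 : s3.arr aNx = update (s.arr aNx) (z + 3 * n) (z + 3 * n) := by
        rw [f3.arr rfl, q2.2.2.1, q1.2.2.2.1]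
      have e2 : s3.arr aPv = update (s.arr aPv) (z + 3 * n) (z + 3 * n) := by
        rw [f3.arr rfl, q2.2.2.2, q1.2.2.2.2]
      refine ⟨hcore s4 ?_ ?_ ?_ ?_ ?_ ?_ ?_, ?_, ?_⟩
      · rw [f4.reg rfl, f3.reg rfl, f2.reg rfl, f1.reg rfl, h.reg_n]
      · rw [f4.reg rfl, f3.reg rfl, f2.reg rfl, f1.reg rfl, h.reg_k]
      · rw [f4.reg rfl, f3.reg rfl, q2.1, raise, if_pos har]
      · simp [g1, f3.arr (a := aParent) rfl, q2.2.1, raise, har]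
      · rw [f4.arr rfl, f3.arr rfl, f2.arr rfl]
        exact q1.2.2.1
      · rw [f4.reg rfl, f3.reg rfl, f2.reg rfl, q1.2.1]
      · rw [Forest, g2, g3, e1, e2]
        simpa [raise, hI, har, hset] using hf3
      · rw [f4.reg rfl, f3.reg rfl, f2.reg rfl, q1.1]
      · rw [f4.reg rfl, f3.reg rfl, f2.reg rfl, q1.2.1]
    · simp [insertCmd, removeCmd]
  · obtain ⟨hpn, hpi⟩ := hp a ha har
    obtain ⟨p, hpp⟩ : ∃ p, T.parent a = p := ⟨_, rfl⟩
    rw [hpp] at hpn hpi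
    have hplt := h.lt p hpn
    have hpz : p ≠ z := fun h' => hzn (h' ▸ hpn)
    have hset : (insert z T.nodes).erase T.root = insert z (T.nodes.erase T.root) :=
      Finset.erase_insert_of_ne hzr
    have haA : a ∈ T.nodes.erase T.root := by simp [har, ha]
    have hf2 := hf1.insert (c := z) (p := p) (by simp [hzn]) (by omega) (by simp [hpn, hpi])
    -- At this point both `z` and `a` are listed below `p`; now `a` is taken out, to be inserted
    -- below `z`.
    have hf3 := hf2.remove (c := a) (by simp [har, ha]) (by simp [haz, hpp, hpn, hpi])
    refine (Ter.split 1 (.single hnew) fun s1 q1 f1 => .split 1 (T1 := 130)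
      (Q := fun s2 => s2.arr aParent = update T.parent z p ∧ s2.reg rRoot = T.root ∧
        LinkedForest (3 * n) ((insert z (T.nodes.erase T.root)).erase a)
          (insert z (T.nodes.filter (n ≤ ·))) (update T.parent z p) (s2.arr aNx)
          (s2.arr aPv)) (.single (T := 129) ?_) fun s2 q2 f2 =>
      .split 2 (.of_run (Q := fun s3 => s3.reg rC = a ∧ s3.reg rP = z) ?_ ?_)
      fun s3 q3 f3 => (Ter.single (insertCmd_spec (K := 3 * n) q3.1 q3.2 ?_ ?_)).frame.mono le_rfl
      fun s4 q4 => ?_).le ?_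
    · have k1 : s1.reg rRoot = T.root := (f1.reg rfl).trans hRoot
      have k2 : s1.reg rA = a := (f1.reg rfl).trans hA
      have k3 : s1.arr aParent = T.parent := (f1.arr rfl).trans hPar
      have k4 := q1.1
      refine (Ter.ite (T := 120) ?_ (fun hb => absurd hb ?_) fun hb => ?_).le ?_
      · simp
      · simp [k1, k2, har]
      · refine (Ter.split 2 (.of_run (Q := fun s2 => s2.reg rC = z ∧ s2.reg rP = p) ?_ ?_)
          fun s2 q2 f2 => .split 1 (.single (insertCmd_spec (K := 3 * n) q2.1 q2.2 ?_ ?_))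
          fun s3 q3 f3 => .split 1 (.of_run (Q := fun s4 => s4.reg rC = a) ?_ ?_)
          fun s4 q4 f4 => (Ter.single (removeCmd_spec q4)).frame.mono le_rfl fun s5 q5 => ?_).le ?_
        · simp
        · simp [k4, k2, k3, hpp]
        · rw [f2.reg rfl, f1.reg rfl, hK]
        · omega
        · simp
        · have : s3.reg rA = a := by rw [f3.reg rfl, f2.reg rfl, k2]
          simp [this]
        · obtain ⟨⟨g1, g2⟩, f5⟩ := q5
          refine ⟨?_, ?_, ?_⟩
          · rw [f5.arr rfl, f4.arr rfl, q3.1, f2.arr rfl, k3]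
          · rw [f5.reg rfl, f4.reg rfl, f3.reg rfl, f2.reg rfl, k1]
          · rw [g1, g2, f4.arr rfl, f4.arr rfl, q3.2.1, q3.2.2, f2.arr rfl, f2.arr rfl,
              q1.2.2.2.1, q1.2.2.2.2]
            exact hf3
        · simp
      · simp
    · simp
    · have g2 : s2.reg rA = a := by rw [f2.reg rfl, f1.reg rfl, hA]
      have g3 : s2.reg rZ = z := by rw [f2.reg rfl, q1.1]
      simp [g2, g3]
    · rw [f3.reg rfl, f2.reg rfl, f1.reg rfl, hK]
    · omega
    · obtain ⟨⟨g1, g2, g3⟩, f4⟩ := q4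
      have hff := q2.2.2.insert (c := a) (p := z) (by simp) (by omega) (by simp)
      rw [Finset.insert_erase (by simp [haA])] at hff
      refine ⟨hcore s4 ?_ ?_ ?_ ?_ ?_ ?_ ?_, ?_, ?_⟩
      · rw [f4.reg rfl, f3.reg rfl, f2.reg rfl, f1.reg rfl, h.reg_n]
      · rw [f4.reg rfl, f3.reg rfl, f2.reg rfl, f1.reg rfl, h.reg_k]
      · rw [f4.reg rfl, f3.reg rfl, q2.2.1, raise, if_neg har]
      · simp [g1, f3.arr (a := aParent) rfl, q2.1, raise, har, hpp]
      · rw [f4.arr rfl, f3.arr rfl, f2.arr rfl]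
        exact q1.2.2.1
      · rw [f4.reg rfl, f3.reg rfl, f2.reg rfl, q1.2.1]
      · rw [Forest, g2, g3, f3.arr rfl, f3.arr rfl]
        simpa [raise, hI, har, hset, hpp] using hff
      · rw [f4.reg rfl, f3.reg rfl, f2.reg rfl, q1.1]
      · rw [f4.reg rfl, f3.reg rfl, f2.reg rfl, q1.2.1]
    · simp

/-- The tree `T` with the nodes in `F` moved below `z`. -/
def reparent (T : LabelledTree n) (F : List ℕ) (z : ℕ) : LabelledTree n :=
  { T with parent := fun c => if c ∈ F then z else T.parent c }

theorem moveCmd_spec (h : Core T s) (hW : 20 * n + 20 ≤ W) {F : List ℕ} {z : ℕ}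
    (hF : ∀ i (h : i < F.length), s.arr aQ i = F[i]) (hlen : s.reg rFull = F.length)
    (hFn : F.length ≤ 3 * n) (hZ : s.reg rZ = z) (hz : z ∈ T.nodes) (hzn : n ≤ z)
    (hFT : ∀ c ∈ F, c ∈ T.nodes ∧ c ≠ T.root)
    (hp : ∀ c ∈ T.nodes, c ≠ T.root → T.parent c ∈ T.nodes ∧ n ≤ T.parent c)
    (hused : s.reg rUsed ≤ 2 * n) :
    Ter W moveCmd s (150 * F.length + 20) (Core (reparent T F z)) := by
  have hzlt := h.lt z hz
  refine (Ter.split 1 (.of_run (Q := fun s1 => s1.reg rIdx = 0) ?_ ?_)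
    fun s1 h1 f1 => .single (T := 150 * F.length + 10) ?_).le ?_
  · simp
  · simp
  · refine (Ter.loop_frame (s0 := s1) (I := fun k s' => k ≤ F.length ∧ s'.reg rIdx = k ∧
      s'.arr aParent = (reparent T (F.take k) z).parent ∧ Forest (reparent T (F.take k) z) s')
      (Φ := fun k => 150 * (F.length - k)) ?_ ?_ 0 ?_).mono ?_ ?_
    · intro k s' f _
      simp
    · rintro k s' f ⟨hk, hk', hpar, hfor⟩ hb
      have g1 : s'.reg rFull = F.length := by rw [f.reg rfl, f1.reg rfl, hlen]
      have g2 : s'.reg rZ = z := by rw [f.reg rfl, f1.reg rfl, hZ]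
      have g3 : s'.arr aQ = s.arr aQ := by rw [f.arr rfl, f1.arr rfl]
      have g4 : s'.reg rK = 3 * n := by rw [f.reg rfl, f1.reg rfl, h.reg_k]
      have hkF : k < F.length := by
        simp [hk', g1] at hb
        exact hb
      obtain ⟨c, hc⟩ : ∃ c, F[k] = c := ⟨_, rfl⟩
      have hcF : c ∈ F := hc ▸ List.getElem_mem hkF
      obtain ⟨hcn, hcr⟩ := hFT c hcF
      have hqc : s'.arr aQ k = c := by rw [g3, hF k hkF, hc]
      have htake : F.take (k + 1) = F.take k ++ [c] := by
        rw [List.take_add_one, List.getElem?_eq_getElem hkF, hc]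
        rfl
      have hclt := h.lt c hcn
      have hpI : (reparent T (F.take k) z).parent c ∈ T.nodes.filter (n ≤ ·) := by
        simp only [reparent]
        split_ifs
        · simp [hz, hzn]
        · have := hp c hcn hcr
          simp [this.1, this.2]
      have hr := LinkedForest.remove hfor (c := c) (by simp [reparent, hcn, hcr]) hpI
      have hi := hr.insert (c := c) (p := z) (by simp) (by omega) (by simp [reparent, hz, hzn])
      rw [Finset.insert_erase (by simp [reparent, hcn, hcr])] at hi
      have hparn : update (reparent T (F.take k) z).parent c z =
          (reparent T (F.take (k + 1)) z).parent := by
        funext d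
        rw [htake]
        by_cases hd : d = c
        · subst hd
          simp [reparent]
        · simp [reparent, hd]
      refine ⟨k + 1, 140, ?_, (Ter.split 1 (.of_run (Q := fun s2 => s2.reg rC = c) ?_ ?_)
        fun s2 h2 f2 => .split 1 (.single (removeCmd_spec h2)) fun s3 h3 f3 =>
        .split 1 (.of_run (Q := fun s4 => s4.reg rP = z) ?_ ?_) fun s4 h4 f4 =>
        .split 1 (.single (insertCmd_spec (c := c) (K := 3 * n) ?_ h4 ?_ ?_)) fun s5 h5 f5 =>
        .of_run ?_ ⟨hkF, ?_, ?_, ?_⟩).le ?_⟩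
      · simp; omega
      · simp
      · simp [hk', hqc]
      · simp
      · have : s3.reg rZ = z := by rw [f3.reg rfl, f2.reg rfl, g2]
        simp [this]
      · rw [f4.reg rfl, f3.reg rfl, h2]
      · rw [f4.reg rfl, f3.reg rfl, f2.reg rfl, g4]
      · omega
      · have : s5.reg rIdx = k := by rw [f5.reg rfl, f4.reg rfl, f3.reg rfl, f2.reg rfl, hk']
        simp [this]; omega
      · simp
      · have : s5.reg rIdx = k := by rw [f5.reg rfl, f4.reg rfl, f3.reg rfl, f2.reg rfl, hk']
        simp [this]
      · rw [← hparn, ← hpar]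
        have := h5.1
        rw [f4.arr rfl, f3.arr rfl, f2.arr rfl] at this
        exact this
      · have e1 := h5.2.1
        have e2 := h5.2.2
        rw [f4.arr rfl, h3.1, f2.arr rfl, f2.arr rfl] at e1
        rw [f4.arr rfl, f4.arr rfl, h3.1, h3.2, f2.arr rfl, f2.arr rfl] at e2
        rw [hparn] at hi
        have : Forest (reparent T (F.take (k + 1)) z) s5 := by
          rw [Forest, e1, e2]
          exact hi
        exact this.congr rfl rfl
    · refine ⟨by simp, h1, ?_, ?_⟩
      · rw [f1.arr rfl, h.parent]
        simp [reparent]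
      · have : Forest (reparent T (F.take 0) z) s := by
          have := h.forest
          simpa [Forest, reparent] using this
        exact this.congr (f1.arr rfl) (f1.arr rfl)
    · simp
    · rintro s' ⟨f, ⟨k, hk, hk', hpar, hfor⟩, hb⟩
      have g1 : s'.reg rFull = F.length := by rw [f.reg rfl, f1.reg rfl, hlen]
      have hkF : k = F.length := by simp [hk', g1] at hb; omega
      rw [hkF, List.take_length] at hpar hfor
      refine ⟨?_, ?_, ?_, hpar, fun u => ?_, fun u hu => ?_, h.root_mem, hfor⟩
      · rw [f.reg rfl, f1.reg rfl, h.reg_n]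
      · rw [f.reg rfl, f1.reg rfl, h.reg_k]
      · rw [f.reg rfl, f1.reg rfl, h.root]
        rfl
      · rw [f.arr rfl, f1.arr rfl, h.series]
        rfl
      · rw [f.reg rfl, f1.reg rfl]
        exact h.lt u hu
  · simp; omega

/-! ### Trees that are ready for the new leaf -/

/-- A vertex with neighbourhood `M` can be inserted in the tree `T` next to the node `g`, below a
node labelled `lab`. -/
structure Ready (T : LabelledTree n) (H : SimpleGraph (Fin n)) (S : Set (Fin n))
    (B : ℕ → Set (Fin n)) (M : Set (Fin n)) (g : ℕ) (lab : Bool) : Prop where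
  cluster : T.IsClusterTree H S B
  joins : T.JoinsAt B M g lab
  mem : g ∈ T.nodes
  alt : ∀ v ∈ T.nodes, n ≤ v → v ≠ T.root → v ≠ g → T.series v ≠ T.series (T.parent v)
  top : g ≠ T.root → T.series (T.parent g) ≠ lab

/-- Alternation could fail only at `g`, and there it is what `top` says when the label of `g` is
`lab`. -/
theorem Ready.attach (h : Ready T H S B M g lab) (hgn : n ≤ g) (hlab : T.series g = lab)
    (h' : AttachLeaf T T' x g) (hx : x ∉ S) (hxn : x.val ∉ T.nodes) (hH : AddsVertex H H' S M x) :
    T'.IsCotreeOf H' (insert x S) ∧ ∀ v ∈ T'.nodes, T'.below v = attachClusters B x g v := by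
  have hc := h'.isClusterTree h.cluster h.mem hgn hx hxn hH (hlab ▸ h.joins)
  refine ⟨hc.isCotreeOf fun v hv hvn hvr => ?_, hc.below_eq⟩
  rw [h'.nodes, mem_insert] at hv
  rcases hv with rfl | hv
  · exact absurd x.isLt hvn.not_gt
  · rw [h'.root] at hvr
    have hp := (h.cluster.parent_mem v hv hvr).1
    rw [h'.parent v hv, h'.series v hv, h'.series _ hp]
    by_cases hvg : v = g
    · subst hvg
      rw [hlab]
      exact (h.top hvr).symm
    · exact h.alt v hv hvn hvr hvg

/-- A possible conflict between `g` and its parent is resolved by the node in between: its label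
`lab` differs from that of `g` by `hlab` and from that of the parent by `top`. -/
theorem Ready.insert {q : ℕ} (h : Ready T H S B M g lab) (hlab : n ≤ g → T.series g ≠ lab)
    (h' : InsertLeaf T T' x g q lab) (hx : x ∉ S) (hxn : x.val ∉ T.nodes) (hq : q ∉ T.nodes)
    (hqn : n ≤ q) (hH : AddsVertex H H' S M x) :
    T'.IsCotreeOf H' (insert x S) ∧ ∀ v ∈ T'.nodes, T'.below v = insertClusters B x g q v := by
  have hc := h'.isClusterTree h.cluster h.mem hx hxn hq hqn hH h.joins
  refine ⟨hc.isCotreeOf fun v hv hvn hvr => ?_, hc.below_eq⟩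
  rw [h'.nodes, mem_insert, mem_insert] at hv
  rcases hv with rfl | rfl | hv
  · exact absurd x.isLt hvn.not_gt
  · rw [h'.root] at hvr
    have hgr : g ≠ T.root := fun h => by simp [h] at hvr
    rw [h'.series_q, h'.parent_q, if_neg hgr, h'.series _ (h.cluster.parent_mem g h.mem hgr).1]
    exact (h.top hgr).symm
  · rw [h'.series v hv]
    by_cases hvg : v = g
    · subst hvg
      rw [h'.parent_g, h'.series_q]
      exact hlab hvn
    · have hvr' : v ≠ T.root := by
        rw [h'.root] at hvr
        split_ifs at hvr with hgr
        · rintro rfl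
          exact hvg hgr.symm
        · exact hvr
      have hp := (h.cluster.parent_mem v hv hvr').1
      rw [h'.parent v hv hvg, h'.series _ hp]
      exact h.alt v hv hvn hvr' hvg

/-- For an empty or complete neighbourhood the new vertex is joined to the whole tree; nothing lies
above the root. -/
theorem ready_root (hT : T.IsCotreeOf H S) (hM : ∀ y ∈ S, (y ∈ M ↔ lab = true)) :
    Ready T H S T.below M T.root lab where
  cluster := hT.isClusterTree
  joins := ⟨fun u c hc h => by
    have h1 := below_mono (hT.reaches_root u (hT.rooted.mem_of_mem_children hc))
    exact absurd (h1.trans h) (hT.not_below_subset_of_mem_children hc), by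
    rw [hT.below_root]
    exact hM⟩
  mem := hT.root_mem
  alt v hv hvn hvr _ := hT.alternating v hv hvn hvr
  top h := absurd rfl h

section Candidate

variable {u z : ℕ} {F : Finset ℕ}

/-- The node `c` is comparable with `u`, and strictly below `u` it would meet only one child. -/
theorem isAncestor_of_two_children (hT : T.IsCotreeOf H S) {c d e : ℕ} (hc : c ∈ T.nodes)
    (hd : d ∈ T.children u) (he : e ∈ T.children u) (hde : d ≠ e) {y w : Fin n} (hy : y ∈ T.below d)
    (hyc : y ∈ T.below c) (hw : w ∈ T.below e) (hwc : w ∈ T.below c) : T.IsAncestor c u := by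
  have hdu := (isAncestor_child hd).trans hy.2
  rcases hyc.2.total hdu with h | h
  · exact h
  · by_cases hcu : u = c
    · exact hcu ▸ .refl u
    · obtain ⟨f, hf, hfc⟩ := hT.rooted.exists_child hc h hcu
      have h1 := hT.children_eq_of_mem hd hf hy (below_mono hfc hyc)
      have h2 := hT.children_eq_of_mem he hf hw (below_mono hfc hwc)
      exact absurd (h1.trans h2.symm) hde

theorem mem_anchored_of_above (hT : T.IsCotreeOf H S) (hu : T.IsCandidate N u) {c w : ℕ}
    (hc : c ∈ T.children w) (hcu : T.IsAncestor c u) (hy : y ∈ T.below w)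
    (hyc : y ∉ T.below c) : y ∈ T.anchored N u ↔ T.series w = true := by
  rw [hu.mem_anchored_of_not_below fun h => hyc (below_mono hcu h)]
  exact hT.mem_seriesAbove_iff hc hcu hy hyc

/-- If `g` is the only hollow child of a series node, or the only non-hollow child of a parallel
one, the new vertex is joined to `g` by a node with the other label, and no children need to be
grouped. -/
theorem ready_child (hT : T.IsCotreeOf H S) (hu : T.IsCandidate N u) (hg : g ∈ T.children u)
    (hgN : (T.below g ∩ N).Nonempty ↔ T.series u = false)
    (hcN : ∀ c ∈ T.children u, c ≠ g → ((T.below c ∩ N).Nonempty ↔ T.series u = true)) :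
    Ready T H S T.below (T.anchored N u) g (!T.series u) where
  cluster := hT.isClusterTree
  joins := by
    refine ⟨fun w c hc hgc y hy hyc => ?_, fun y hy => ?_⟩
    · have hanc := (hT.isAncestor_iff hc.1 hg.1).2 hgc
      rcases hanc.eq_or_parent with rfl | hanc
      · obtain rfl : w = u := hc.2.2.symm.trans hg.2.2
        obtain ⟨d, hd, hyd⟩ := (hT.mem_below_iff (hT.internal_of_child hc)).1 hy
        rw [hT.mem_anchored_of_child hd hyd]
        exact hcN d hd fun h => hyc (h ▸ hyd)
      · rw [hg.2.2] at hanc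
        exact mem_anchored_of_above hT hu hc hanc hy hyc
    · rw [hT.mem_anchored_of_child hg hy, hgN]
      simp
  mem := hg.1
  alt v hv hvn hvr _ := hT.alternating v hv hvn hvr
  top _ := by
    rw [hg.2.2]
    simp

/-- Once the non-hollow children have left for the series node `z`, exactly the vertices outside the
completion remain below `u`, so a parallel node joins the new vertex to `u`. Both `u` and `z` are
series, a conflict that `Ready` admits at `u`. -/
theorem ready_splitAbove (hT : T.IsCotreeOf H S) (hu : T.IsCandidate N u)
    (h : SplitAbove T T' u z F) (hz : z ∉ T.nodes) (hzn : n ≤ z)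
    (hF : ∀ c, c ∈ F ↔ c ∈ T.children u ∧ (T.below c ∩ N).Nonempty) (hs : T.series u = true)
    (hF2 : ∃ c ∈ T.children u, ∃ d ∈ T.children u, c ∉ F ∧ d ∉ F ∧ c ≠ d) :
    Ready T' H S (aboveClusters T.below u z F) (T.anchored N u) u false := by
  obtain ⟨c1, hc1, c2, hc2, hcF1, hcF2, hne⟩ := hF2
  have hun := hT.internal_of_child hc1
  have hFc : ∀ c ∈ F, c ∈ T.children u := fun c hc => ((hF c).1 hc).1
  have hF1 : F.Nonempty := by
    obtain ⟨y, hy, hyN⟩ := hu.nonhollow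
    obtain ⟨c, hc, hyc⟩ := (hT.mem_below_iff hun).1 hy
    exact ⟨c, (hF c).2 ⟨hc, y, hyc, hyN⟩⟩
  have hcl := h.isClusterTree hT.isClusterTree hu.mem hun hFc hz hzn hF1 ⟨c1, hc1, c2, hc2, hcF1, hcF2, hne⟩
  have hch := fun {v c : ℕ} => h.mem_children_iff (v := v) (c := c) hT.isClusterTree hu.mem hFc hz
  have hzu : z ≠ u := fun e => hz (e ▸ hu.mem)
  have hBz : aboveClusters T.below u z F z = T.below u := by simp [aboveClusters]
  have hBu : aboveClusters T.below u z F u = {y | y ∈ T.below u ∧ ∀ c ∈ F, y ∉ T.below c} := by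
    simp [aboveClusters, hzu.symm]
  have hB : ∀ v ∈ T.nodes, v ≠ u → aboveClusters T.below u z F v = T.below v := by
    intro v hv hvu
    have : v ≠ z := fun e => hz (e ▸ hv)
    simp [aboveClusters, hvu, this]
  have hmemu : ∀ c ∈ T.children u, c ∉ F → ∀ y ∈ T.below c, y ∈ aboveClusters T.below u z F u := by
    intro c hc hcF y hy
    rw [hBu]
    exact ⟨below_mono (isAncestor_child hc) hy, fun d hd hyd =>
      hcF (hT.children_eq_of_mem hc (hFc d hd) hy hyd ▸ hd)⟩
  have hin : ∀ y ∈ T.below u, (y ∈ T.anchored N u ↔ ∃ c ∈ F, y ∈ T.below c) := by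
    intro y hy
    obtain ⟨d, hd, hyd⟩ := (hT.mem_below_iff hun).1 hy
    rw [hT.mem_anchored_of_child hd hyd]
    constructor
    · exact fun hdN => ⟨d, (hF d).2 ⟨hd, hdN⟩, hyd⟩
    · rintro ⟨c, hc, hyc⟩
      rw [hT.children_eq_of_mem hd (hFc c hc) hyd hyc]
      exact ((hF c).1 hc).2
  refine ⟨hcl, ⟨fun w c hc hsub y hy hyc => ?_, fun y hy => ?_⟩, ?_, fun v hv hvn hvr hvu => ?_, fun _ => ?_⟩
  · rcases hch.1 hc with ⟨hc, hcF, hcu⟩ | ⟨rfl, hur, rfl⟩ | ⟨rfl, hcF | rfl⟩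
    · rw [hB c hc.1 hcu] at hsub hyc
      obtain ⟨y1, hy1⟩ := hT.below_nonempty c1 hc1.1
      obtain ⟨y2, hy2⟩ := hT.below_nonempty c2 hc2.1
      have hcu' : T.IsAncestor c u := isAncestor_of_two_children hT hc.1 hc1 hc2 hne hy1
        (hsub (hmemu c1 hc1 hcF1 y1 hy1)) hy2 (hsub (hmemu c2 hc2 hcF2 y2 hy2))
      have hw := hT.rooted.mem_of_mem_children hc
      have hwu : w ≠ u := by
        rintro rfl
        exact hT.rooted.not_isAncestor_of_mem_children hc hcu'
      rw [hB w hw hwu] at hy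
      rw [h.series w hw]
      exact mem_anchored_of_above hT hu hc hcu' hy hyc
    · rw [hBz] at hyc
      have hcu := hT.rooted.mem_children_parent hu.mem hur
      have hw := hT.rooted.mem_of_mem_children hcu
      rw [hB _ hw (hT.rooted.parent_ne hu.mem hur)] at hy
      rw [h.series _ hw]
      exact mem_anchored_of_above hT hu hcu (.refl u) hy hyc
    · exfalso
      obtain ⟨y1, hy1⟩ := hT.below_nonempty c1 hc1.1
      have h1 := hmemu c1 hc1 hcF1 y1 hy1
      have h2 := hsub h1
      rw [hB c (hFc c hcF).1 (hT.rooted.ne_of_mem_children (hFc c hcF))] at h2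
      rw [hBu] at h1
      exact h1.2 c hcF h2
    · rw [hBz] at hy
      rw [hBu] at hyc
      rw [h.series_z, hs, hin y hy]
      simp only [iff_true]
      by_contra hno
      exact hyc ⟨hy, fun c hc hyc => hno ⟨c, hc, hyc⟩⟩
  · rw [hBu] at hy
    rw [hin y hy.1]
    simp only [Bool.false_eq_true, iff_false]
    rintro ⟨c, hc, hyc⟩
    exact hy.2 c hc hyc
  · rw [h.nodes]
    exact mem_insert_of_mem hu.mem
  · rw [h.nodes, mem_insert] at hv
    rw [h.root] at hvr
    rcases hv with rfl | hv
    · have hur : u ≠ T.root := fun e => by simp [e] at hvr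
      rw [h.series_z, h.parent_z, if_neg hur, h.series _ (hT.parent_mem u hu.mem)]
      exact hT.alternating u hu.mem hun hur
    · have hvr' : v ≠ T.root := by
        split_ifs at hvr with hur
        · rintro rfl
          exact hvu hur.symm
        · exact hvr
      rw [h.series v hv]
      by_cases hvF : v ∈ F
      · have := hT.alternating v hv hvn hvr'
        rw [(hFc v hvF).2.2] at this
        rwa [h.parent_F v hvF, h.series_z]
      · rw [h.parent v hv hvF hvu, h.series _ (hT.parent_mem v hv)]
        exact hT.alternating v hv hvn hvr'
  · rw [h.parent_u, h.series_z, hs]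
    simp

/-- Below the new parallel node `z` are exactly the vertices of the completion that are below `u`,
so a series node joins the new vertex to `z`. -/
theorem ready_splitBelow (hT : T.IsCotreeOf H S) (hu : T.IsCandidate N u)
    (h : SplitBelow T T' u z F) (hz : z ∉ T.nodes) (hzn : n ≤ z)
    (hF : ∀ c, c ∈ F ↔ c ∈ T.children u ∧ (T.below c ∩ N).Nonempty) (hs : T.series u = false)
    (hF2 : ∃ c ∈ F, ∃ d ∈ F, c ≠ d) :
    Ready T' H S (belowClusters T.below z F) (T.anchored N u) z true := by
  have hFc : ∀ c ∈ F, c ∈ T.children u := fun c hc => ((hF c).1 hc).1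
  obtain ⟨c1, hc1, c2, hc2, hne⟩ := hF2
  have hun := hT.internal_of_child (hFc c1 hc1)
  have hF1 : ∃ c ∈ T.children u, c ∉ F := by
    obtain ⟨c, hc, hcN⟩ := hu.hollow_child
    exact ⟨c, hc, fun h => (((hF c).1 h).2).ne_empty hcN⟩
  have hcl := h.isClusterTree hT.isClusterTree hu.mem hun hFc hz hzn ⟨c1, hc1, c2, hc2, hne⟩ hF1
  have hch := fun {v c : ℕ} => h.mem_children_iff (v := v) (c := c) hT.isClusterTree hFc hz
  have hBz : belowClusters T.below z F z = {y | ∃ c ∈ F, y ∈ T.below c} := by simp [belowClusters]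
  have hB : ∀ v ∈ T.nodes, belowClusters T.below z F v = T.below v := by
    intro v hv
    have : v ≠ z := fun e => hz (e ▸ hv)
    simp [belowClusters, this]
  have hmemz : ∀ c ∈ F, ∀ y ∈ T.below c, y ∈ belowClusters T.below z F z := by
    intro c hc y hy
    rw [hBz]
    exact ⟨c, hc, hy⟩
  have hin : ∀ y ∈ T.below u, (y ∈ T.anchored N u ↔ ∃ c ∈ F, y ∈ T.below c) := by
    intro y hy
    obtain ⟨d, hd, hyd⟩ := (hT.mem_below_iff hun).1 hy
    rw [hT.mem_anchored_of_child hd hyd]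
    constructor
    · exact fun hdN => ⟨d, (hF d).2 ⟨hd, hdN⟩, hyd⟩
    · rintro ⟨c, hc, hyc⟩
      rw [hT.children_eq_of_mem hd (hFc c hc) hyd hyc]
      exact ((hF c).1 hc).2
  obtain ⟨y1, hy1⟩ := hT.below_nonempty c1 (hFc c1 hc1).1
  obtain ⟨y2, hy2⟩ := hT.below_nonempty c2 (hFc c2 hc2).1
  refine ⟨hcl, ⟨fun w c hc hsub y hy hyc => ?_, fun y hy => ?_⟩, ?_, fun v hv hvn hvr hvz => ?_, fun _ => ?_⟩
  · rcases hch.1 hc with ⟨hc, hcF⟩ | ⟨rfl, rfl⟩ | ⟨rfl, hcF⟩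
    · rw [hB c hc.1] at hsub hyc
      have hcu' : T.IsAncestor c u := isAncestor_of_two_children hT hc.1 (hFc c1 hc1) (hFc c2 hc2)
        hne hy1 (hsub (hmemz c1 hc1 y1 hy1)) hy2 (hsub (hmemz c2 hc2 y2 hy2))
      have hw := hT.rooted.mem_of_mem_children hc
      rw [hB w hw] at hy
      rw [h.series w hw]
      exact mem_anchored_of_above hT hu hc hcu' hy hyc
    · rw [hB _ hu.mem] at hy
      rw [hBz] at hyc
      rw [h.series _ hu.mem, hs, hin y hy]
      simpa using hyc
    · exfalso
      have h1 := hsub (hmemz c1 hc1 y1 hy1)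
      have h2 := hsub (hmemz c2 hc2 y2 hy2)
      rw [hB c (hFc c hcF).1] at h1 h2
      exact hne ((hT.children_eq_of_mem (hFc c1 hc1) (hFc c hcF) hy1 h1).trans
        (hT.children_eq_of_mem (hFc c2 hc2) (hFc c hcF) hy2 h2).symm)
  · rw [hBz] at hy
    obtain ⟨c, hc, hyc⟩ := hy
    rw [hin y (below_mono (isAncestor_child (hFc c hc)) hyc)]
    simpa using ⟨c, hc, hyc⟩
  · rw [h.nodes]
    exact Finset.mem_insert_self _ _
  · rw [h.nodes, mem_insert] at hv
    rw [h.root] at hvr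
    rcases hv with rfl | hv
    · exact absurd rfl hvz
    · rw [h.series v hv]
      by_cases hvF : v ∈ F
      · have := hT.alternating v hv hvn hvr
        rw [(hFc v hvF).2.2] at this
        rwa [h.parent_F v hvF, h.series_z]
      · rw [h.parent v hv hvF, h.series _ (hT.parent_mem v hv)]
        exact hT.alternating v hv hvn hvr
  · rw [h.parent_z, h.series _ hu.mem, hs]
    simp

end Candidate

/-! ### Splitting the insertion node -/

/-- The new vertex is inserted next to the child `c` of `u`. -/
def IsLower (T : LabelledTree n) (N : Set (Fin n)) (u c : ℕ) : Prop :=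
  c ∈ T.children u ∧ ((T.below c ∩ N).Nonempty ↔ T.series u = false)

/-- The number of leaves below the children next to which the new vertex is inserted. -/
noncomputable def lowSize (T : LabelledTree n) (N : Set (Fin n)) (u : ℕ) : ℕ :=
  if T.series u = true then (T.below u).ncard - (T.nonhollowPart N u).ncard
  else (T.nonhollowPart N u).ncard

theorem ncard_lower (hT : T.IsCotreeOf H S) (hun : n ≤ u) :
    {y | ∃ c, IsLower T N u c ∧ y ∈ T.below c}.ncard = lowSize T N u := by
  rw [lowSize]
  split_ifs with hs
  · rw [← Set.ncard_sdiff (nonhollowPart_subset u)]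
    congr 1
    ext y
    rw [Set.mem_sdiff, hT.mem_below_iff hun]
    constructor
    · rintro ⟨c, ⟨hc, hcN⟩, hy⟩
      refine ⟨⟨c, hc, hy⟩, ?_⟩
      rintro ⟨d, hd, hdN, hyd⟩
      rw [hT.children_eq_of_mem hd hc hyd hy, hcN, hs] at hdN
      simp at hdN
    · rintro ⟨⟨c, hc, hy⟩, hno⟩
      refine ⟨c, ⟨hc, ?_⟩, hy⟩
      simp only [hs, Bool.true_eq_false, iff_false]
      exact fun h => hno ⟨c, hc, h, hy⟩
  · congr 1
    ext y
    simp [IsLower, nonhollowPart, hs, and_assoc]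

/-- Comparing two leaf counts reveals whether there is just one such child, without a walk through
the children. -/
theorem ncard_below_eq_lowSize_iff (hT : T.IsCotreeOf H S) (hg : IsLower T N u g) :
    (T.below g).ncard = lowSize T N u ↔ ∀ c, IsLower T N u c → c = g := by
  have hun := hT.internal_of_child hg.1
  rw [← ncard_lower hT hun]
  have hsub : T.below g ⊆ {y | ∃ c, IsLower T N u c ∧ y ∈ T.below c} := fun y hy => ⟨g, hg, hy⟩
  constructor
  · intro h c hc
    have heq := Set.eq_of_subset_of_ncard_le hsub h.ge
    obtain ⟨y, hy⟩ := hT.below_nonempty c hc.1.1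
    have : y ∈ T.below g := by
      rw [heq]
      exact ⟨c, hc, hy⟩
    exact hT.children_eq_of_mem hc.1 hg.1 hy this
  · intro h
    congr 1
    refine hsub.antisymm ?_
    rintro y ⟨c, hc, hy⟩
    exact h c hc ▸ hy

/-- At a series node the walk through the children passes only marked ones before it stops, so it is
paid for by `F`; it stops because a candidate has a hollow child. At a parallel node any element of
`F` will do. -/
theorem lowerPhase_spec (hT : T.IsCotreeOf H S) (hC : Core T s)
    (hleaf : ∀ v ∈ T.nodes, s.arr aLeaf v = (T.below v).ncard) {L : ℕ}
    (hX : ∀ v, v ∈ X ↔ v ∈ T.nodes ∧ (T.below v ∩ N).Nonempty) (hM : Marked T s X L)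
    (hu : T.IsCandidate N u) (hU : s.reg rU = u) {F : List ℕ}
    (hq : ∀ i (h : i < F.length), s.arr aQ i = F[i])
    (hF : ∀ c, c ∈ F ↔ c ∈ T.children u ∧ (T.below c ∩ N).Nonempty)
    (hused : s.reg rUsed ≤ 2 * n) (hW : 20 * n + 20 ≤ W) :
    Ter W lowerPhase s (20 * F.length + 50) (fun s' => IsLower T N u (s'.reg rG) ∧
      s'.reg rLow = lowSize T N u) := by
  obtain ⟨c0, hc0, hcN0⟩ := hu.hollow_child
  have hun := hT.internal_of_child hc0
  have hser := hC.series u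
  have hK := hC.reg_k
  have hult := hC.lt u hu.mem
  have hlu := hleaf u hu.mem
  have hnh : s.arr aNh u = (T.nonhollowPart N u).ncard := by rw [hM.nh, leafSum, hT.sum_ncard_eq hX]
  refine (Ter.ite (T := 20 * F.length + 40) (by simp; omega) (fun hb => ?_) fun hb => ?_).le ?_
  · have hs : T.series u = true := by simpa [hU, hser] using hb
    obtain ⟨l, hl, hl'⟩ := hC.forest.exists_list hu.mem hun
    refine (Ter.split 1 (.of_run (Q := fun s1 => s1.reg rG = l.headD (u + 3 * n)) ?_ ?_)
      fun s1 h1 f1 => .split 1 (Q := fun s2 => IsLower T N u (s2.reg rG))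
      (T1 := 20 * F.length + 10) (.single (T := 20 * F.length + 9) ?_)
      fun s2 h2 f2 => .of_run ?_ ⟨?_, ?_⟩).le ?_
    · simp [hU, hK]; omega
    · simpa [hU, hK] using hl'.first
    · have hmark : s1.arr aMark = s.arr aMark := f1.arr rfl
      have hnx : s1.arr aNx = s.arr aNx := f1.arr rfl
      have hex : ∀ (d r : List ℕ), l = d ++ r → (∀ c ∈ d, c ∈ F) → ∃ c r', r = c :: r' := by
        rintro d (_ | ⟨c, r'⟩) hdr hd
        · rw [List.append_nil] at hdr
          have := ((hF c0).1 (hd c0 (hdr ▸ (hl.mem c0).2 hc0))).2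
          simp [hcN0] at this
        · exact ⟨c, r', rfl⟩
      refine (Ter.loop_frame (s0 := s1) (I := fun (p : List ℕ × List ℕ) s' => l = p.1 ++ p.2 ∧
        s'.reg rG = p.2.headD (u + 3 * n) ∧ ∀ c ∈ p.1, c ∈ F)
        (Φ := fun p => 20 * (F.length - p.1.length)) ?_ ?_ ([], l) ⟨rfl, h1, by simp⟩).mono ?_ ?_
      · rintro p s' f -
        simp; omega
      · rintro ⟨d, r⟩ s' f ⟨hdr, hG, hd⟩ hb
        dsimp only at hdr hG hd
        obtain ⟨c, r', rfl⟩ := hex d r hdr hd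
        have hmark' : s'.arr aMark = s.arr aMark := (f.arr rfl).trans hmark
        have hnx' : s'.arr aNx = s.arr aNx := (f.arr rfl).trans hnx
        have hcl : c ∈ T.children u := (hl.mem c).1 (by simp [hdr])
        have hcF : c ∈ F := by
          refine (hF c).2 ⟨hcl, ((hX c).1 ?_).2⟩
          by_contra hcX
          simp only [List.headD_cons] at hG
          simp [hG, hmark', hM.mark, hcX] at hb
        have hd' : ∀ e ∈ d ++ [c], e ∈ F := by
          intro e he
          rcases List.mem_append.1 he with he | he
          · exact hd e he
          · rw [List.mem_singleton] at he
            exact he ▸ hcF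
        have hnd : (d ++ [c]).Nodup := by
          have := hl.nodup
          rw [hdr, show d ++ c :: r' = (d ++ [c]) ++ r' by simp] at this
          exact (List.nodup_append.1 this).1
        have hlen := (hnd.subperm hd').length_le
        simp only [List.length_append, List.length_singleton] at hlen
        refine ⟨(d ++ [c], r'), _, ?_, Ter.of_run ?_ ⟨?_, ?_, hd'⟩⟩
        · simp; omega
        · simp
        · simp [hdr]
        · have := Linked.next (hdr ▸ hl')
          simp only [List.headD_cons] at hG
          simpa [hG, hnx'] using this
      · simp
      · rintro s' ⟨f, ⟨⟨d, r⟩, hdr, hG, hd⟩, hb⟩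
        dsimp only at hdr hG hd
        obtain ⟨c, r', rfl⟩ := hex d r hdr hd
        have hmark' : s'.arr aMark = s.arr aMark := (f.arr rfl).trans hmark
        have hcl : c ∈ T.children u := (hl.mem c).1 (by simp [hdr])
        simp only [List.headD_cons] at hG
        rw [hG]
        refine ⟨hcl, ?_⟩
        simp only [hs, Bool.true_eq_false, iff_false]
        intro hcN
        simp [hG, hmark', hM.mark, (hX c).2 ⟨hcl.1, hcN⟩] at hb
    · simp
    · simp; omega
    · simpa using h2
    · have e1 : s2.arr aLeaf = s.arr aLeaf := by rw [f2.arr rfl, f1.arr rfl]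
      have e2 : s2.arr aNh = s.arr aNh := by rw [f2.arr rfl, f1.arr rfl]
      have e3 : s2.reg rU = u := by rw [f2.reg rfl, f1.reg rfl, hU]
      simp [e1, e2, e3, hlu, hnh, lowSize, hs]
  · have hs : T.series u = false := by simpa [hU, hser] using hb
    have hF0 : 0 < F.length := by
      obtain ⟨y, hy, hyN⟩ := hu.nonhollow
      obtain ⟨c, hc, hyc⟩ := (hT.mem_below_iff hun).1 hy
      exact List.length_pos_of_mem ((hF c).2 ⟨hc, y, hyc, hyN⟩)
    have h0 := (hF F[0]).1 (List.getElem_mem hF0)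
    refine (Ter.of_run ?_ ⟨?_, ?_⟩).le ?_
    · simp
    · simp
    · have := hq 0 hF0
      simpa [this, IsLower, hs] using h0
    · simp [hU, hnh, lowSize, hs]
  · simp; omega

/-- The program `c` does not change the stored tree. -/
def Cmd.keepsCore (c : Cmd) : Bool :=
  !(c.modReg rN || c.modReg rK || c.modReg rRoot || c.modReg rUsed || c.modArr aParent ||
    c.modArr aSeries || c.modArr aNx || c.modArr aPv)

theorem Core.frame {c : Cmd} (h : Core T s) (f : Frame c s s')
    (hc : c.keepsCore = true) : Core T s' := by
  simp only [Cmd.keepsCore, Bool.not_eq_true', Bool.or_eq_false_iff] at hc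
  obtain ⟨⟨⟨⟨⟨⟨⟨h1, h2⟩, h3⟩, h4⟩, h5⟩, h6⟩, h7⟩, h8⟩ := hc
  refine ⟨(f.reg h1).trans h.reg_n, (f.reg h2).trans h.reg_k, (f.reg h3).trans h.root,
    (f.arr h5).trans h.parent, ?_, ?_, h.root_mem, h.forest.congr (f.arr h7) (f.arr h8)⟩
  · rw [f.arr h6]
    exact h.series
  · rw [f.reg h4]
    exact h.lt

/-- The tree `T` with a new node `c` below `p`, and with labels `σ`. -/
def hang (T : LabelledTree n) (c p : ℕ) (σ : ℕ → Bool) : LabelledTree n where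
  nodes := insert c T.nodes
  root := T.root
  parent := update T.parent c p
  series := σ

/-- This serves both a fresh internal node, whose empty list and label are already stored, and the
leaf `x`, which has neither; hence the filter over `insert c T.nodes` in `hF` and the separate
labels `σ`. -/
theorem insertCmd_hang {c p : ℕ} {σ : ℕ → Bool} (hN : s.reg rN = n) (hK : s.reg rK = 3 * n)
    (hR : s.reg rRoot = T.root) (hP : s.arr aParent = T.parent)
    (hσ : ∀ v, s.arr aSeries v = (σ v).toNat) (hlt : ∀ v ∈ insert c T.nodes, v < n + s.reg rUsed)
    (hroot : T.root ∈ T.nodes)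
    (hF : LinkedForest (3 * n) (T.nodes.erase T.root) ((insert c T.nodes).filter (n ≤ ·)) T.parent
      (s.arr aNx) (s.arr aPv))
    (hc : c ∉ T.nodes) (hp : p ∈ T.nodes) (hpn : n ≤ p) (hrc : s.reg rC = c) (hrp : s.reg rP = p)
    (hused : s.reg rUsed ≤ 2 * n) (hW : 20 * n + 20 ≤ W) :
    Ter W insertCmd s 40 (Core (hang T c p σ)) := by
  have h1 := hlt p (by simp [hp])
  have h2 := hlt c (by simp)
  refine (insertCmd_spec (W := W) hrc hrp hK (by omega)).frame.mono le_rfl fun s' hs' => ?_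
  obtain ⟨⟨g1, g2, g3⟩, f⟩ := hs'
  refine ⟨(f.reg rfl).trans hN, (f.reg rfl).trans hK, (f.reg rfl).trans hR, ?_, fun v => ?_,
    fun v hv => ?_, by simp [hang, hroot], ?_⟩
  · rw [g1, hP]
    rfl
  · rw [f.arr rfl]
    exact hσ v
  · rw [f.reg rfl]
    exact hlt v hv
  · have hcr : c ≠ T.root := fun h => hc (h ▸ hroot)
    have := hF.insert (c := c) (p := p) (by simp [hc]) (by omega) (by simp [hp, hpn])
    rw [Forest, g2, g3]
    rw [← Finset.erase_insert_of_ne hcr] at this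
    exact this

/-- The non-hollow children `F` are moved whatever the label of `u` is, since the number of hollow
ones is not bounded by the completion. At a series node, `z` therefore takes the place of `u`, and
`u` becomes the node next to which the vertex is inserted. -/
theorem splitPhase_spec (hT : T.IsCotreeOf H S) (hC : Core T s)
    (hleaf : ∀ v ∈ T.nodes, s.arr aLeaf v = (T.below v).ncard)
    (hu : T.IsCandidate N u) (hU : s.reg rU = u) {F : List ℕ}
    (hq : ∀ i (h : i < F.length), s.arr aQ i = F[i]) (hlen : s.reg rFull = F.length)
    (hFn : F.length ≤ 3 * n)
    (hF : ∀ c, c ∈ F ↔ c ∈ T.children u ∧ (T.below c ∩ N).Nonempty)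
    (hG : IsLower T N u (s.reg rG)) (hL : s.reg rLow = lowSize T N u)
    (hused : s.reg rUsed + 1 ≤ 2 * n) (hW : 20 * n + 20 ≤ W) :
    Ter W splitPhase s (150 * F.length + 400) (fun s' => ∃ T' B,
      Ready T' H S B (T.anchored N u) (s'.reg rG) (!T.series u) ∧ Core T' s' ∧
      (∀ v ∈ T'.nodes, s'.arr aLeaf v = (B v).ncard) ∧ s'.reg rUsed ≤ s.reg rUsed + 1) := by
  obtain ⟨c0, hc0, hcN0⟩ := hu.hollow_child
  have hun := hT.internal_of_child hc0
  have hser := hC.series u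
  have hlow := ncard_lower (N := N) hT hun
  have hlg := hleaf _ hG.1.1
  have hFs : ∀ c, c ∈ F.toFinset ↔ c ∈ T.children u ∧ (T.below c ∩ N).Nonempty := by simpa using hF
  obtain ⟨z, hz⟩ : ∃ z, n + s.reg rUsed = z := ⟨_, rfl⟩
  have hzT : z ∉ T.nodes := fun h' => by
    have := hC.lt z h'
    omega
  have hzn : n ≤ z := by omega
  have huz : u ≠ z := fun h => hzT (h ▸ hu.mem)
  have hFT : ∀ c ∈ F, c ∈ T.nodes ∧ c ≠ T.root := fun c hc => ⟨((hF c).1 hc).1.1, ((hF c).1 hc).1.2.1⟩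
  have hFz : z ∉ F := fun h => hzT (hFT z h).1
  have huF : u ∉ F := fun h => by
    have := hT.not_below_subset_of_mem_children ((hF u).1 h).1
    exact this subset_rfl
  have hcl := hT.isClusterTree
  refine (Ter.ite (T := 150 * F.length + 390) (by simp) (fun hb => ?_) fun hb => ?_).le ?_
  · have hb' : (T.below (s.reg rG)).ncard = lowSize T N u := by
      rw [← hlg, ← hL]
      simpa using hb
    refine (Ter.of_run (c := .skip) trivial ⟨T, T.below, ?_, hC, hleaf, by simp⟩).le (by simp)
    rw [ncard_below_eq_lowSize_iff hT hG] at hb'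
    refine ready_child hT hu hG.1 hG.2 fun c hc hcg => ?_
    by_contra hno
    refine hcg (hb' c ⟨hc, ?_⟩)
    cases hs : T.series u <;> simpa [hs] using hno
  have hb' : ¬ (T.below (s.reg rG)).ncard = lowSize T N u := by
    rw [← hlg, ← hL]
    simpa using hb
  rw [ncard_below_eq_lowSize_iff hT hG] at hb'
  push Not at hb'
  obtain ⟨d, hd, hdg⟩ := hb'
  refine (Ter.ite (T := 150 * F.length + 380) (by simp; omega) (fun hs => ?_) fun hs => ?_).le ?_
  · replace hs : T.series u = true := by simpa [hU, hser] using hs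
    have hnF : ∀ c, IsLower T N u c → c ∉ F := fun c hc hcF => by
      have := hc.2.1 ((hF c).1 hcF).2
      simp [hs] at this
    have hsp : SplitAbove T (reparent (raise T u z true) F z) u z F.toFinset := by
      refine ⟨rfl, rfl, fun c hc hcF hcu => ?_, fun c hc => ?_, ?_, ?_, fun v hv => ?_, ?_⟩
      · have : c ≠ z := fun h => hzT (h ▸ hc)
        simp at hcF
        simp [reparent, raise, hcF, hcu, this]
      · simp at hc
        simp [reparent, hc]
      · simp [reparent, raise]
      · simp [reparent, raise, huz.symm, hFz]
      · have : v ≠ z := fun h => hzT (h ▸ hv)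
        simp [reparent, raise, relabel, this]
      · simp [reparent, raise, relabel, hs]
    have hR := ready_splitAbove hT hu hsp hzT hzn hFs hs
      ⟨_, hG.1, d, hd.1, by simpa using hnF _ hG, by simpa using hnF _ hd, hdg.symm⟩
    refine (Ter.split 2 (.of_run (Q := fun s1 => s1.reg rA = u ∧ s1.reg rB = 1) ?_ ?_)
      fun s1 q1 f1 => .split 1 (.single (aboveCmd_spec (b := true) (hC.frame f1 rfl) hW hu.mem
        q1.1 q1.2 (fun c => hcl.parent_mem c) ?_)) fun s2 q2 f2 =>
      .split 1 (.single (moveCmd_spec (F := F) (z := z) q2.1 hW ?_ ?_ hFn ?_ ?_ hzn ?_ ?_ ?_))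
      fun s3 h3 f3 => (Ter.of_run (Q := fun s4 => s4.reg rG = u ∧ s4.arr aLeaf = update
        (update (s.arr aLeaf) z (T.below u).ncard) u (lowSize T N u)) ?_ ?_).frame.mono
        le_rfl fun s4 h4 => ?_).le ?_
    · simp; omega
    · simp [hU]
    · rw [f1.reg rfl]
      exact hused
    · rw [f2.arr rfl, f1.arr rfl]
      exact hq
    · rw [f2.reg rfl, f1.reg rfl, hlen]
    · rw [q2.2.1, f1.reg rfl, hz]
    · simp [raise, f1.reg (r := rUsed) rfl, hz]
    · intro c hc
      have h1 : c ≠ z := fun h => hFz (h ▸ hc)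
      have h2 := hFT c hc
      refine ⟨by simp [raise, h2.1], ?_⟩
      simp only [raise, f1.reg (r := rUsed) rfl, hz]
      split_ifs
      · exact h1
      · exact h2.2
    · rw [f1.reg (r := rUsed) rfl, hz]
      intro c hc hcr
      simp only [raise] at hc hcr ⊢
      rcases eq_or_ne c u with rfl | hcu
      · simp [hzn]
      rw [update_of_ne hcu]
      rcases mem_insert.1 hc with rfl | hc
      · split_ifs at hcr with hur
        · exact absurd rfl hcr
        · have := hcl.parent_mem u hu.mem hur
          simp [hur, this.1, this.2]
      · have hcz : c ≠ z := fun h => hzT (h ▸ hc)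
        have : c ≠ T.root := by
          split_ifs at hcr with hur
          · exact fun h => hcu (h.trans hur.symm)
          · exact hcr
        rw [update_of_ne hcz]
        have := hcl.parent_mem c hc this
        exact ⟨by simp [this.1], this.2⟩
    · rw [q2.2.2, f1.reg rfl]
      exact hused
    · simp
    · have e1 : s3.reg rU = u := by rw [f3.reg rfl, f2.reg rfl, f1.reg rfl, hU]
      have e2 : s3.reg rZ = z := by rw [f3.reg rfl, q2.2.1, f1.reg rfl, hz]
      have e3 : s3.reg rLow = lowSize T N u := by rw [f3.reg rfl, f2.reg rfl, f1.reg rfl, hL]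
      have e4 : s3.arr aLeaf = s.arr aLeaf := by rw [f3.arr rfl, f2.arr rfl, f1.arr rfl]
      have := hleaf u hu.mem
      simp [e1, e2, e3, e4, this]
    · obtain ⟨⟨h4, h4'⟩, f4⟩ := h4
      refine ⟨_, _, by rw [h4, hs]; exact hR, ?_, fun v hv => ?_, ?_⟩
      · have := h3.frame f4 rfl
        rwa [f1.reg (r := rUsed) rfl, hz] at this
      · rw [h4', aboveClusters]
        rcases eq_or_ne v u with rfl | hvu
        · rw [update_self, if_neg huz, if_pos rfl, ← hlow]
          congr 1
          ext y
          simp only [Set.mem_ofPred_eq]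
          constructor
          · rintro ⟨c, hc, hy⟩
            refine ⟨below_mono (isAncestor_child hc.1) hy, ?_⟩
            intro e he hye
            have he' := (hFs e).1 he
            exact hnF c hc (by rw [hT.children_eq_of_mem hc.1 he'.1 hy hye]; simpa using he)
          · rintro ⟨hy, hyF⟩
            obtain ⟨c, hc, hyc⟩ := (hT.mem_below_iff hun).1 hy
            refine ⟨c, ⟨hc, ?_⟩, hyc⟩
            simp only [hs, Bool.true_eq_false, iff_false]
            exact fun h => hyF c ((hFs c).2 ⟨hc, h⟩) hyc
        · rw [update_of_ne hvu]
          rcases eq_or_ne v z with rfl | hvz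
          · simp
          · rw [update_of_ne hvz, if_neg hvz, if_neg hvu]
            refine hleaf v ?_
            rcases mem_insert.1 hv with h | h
            · exact absurd h hvz
            · exact h
      · rw [f4.reg rfl, f3.reg rfl, q2.2.2, f1.reg rfl]
    · simp; omega
  · replace hs : T.series u = false := by simpa [hU, hser] using hs
    have hlF : ∀ c, IsLower T N u c ↔ c ∈ F := fun c => by simp [IsLower, hF, hs]
    have hsp : SplitBelow T (reparent (hang T z u (relabel T z false)) F z) u z F.toFinset := by
      refine ⟨rfl, rfl, fun c hc hcF => ?_, fun c hc => ?_, ?_, fun v hv => ?_, ?_⟩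
      · have : c ≠ z := fun h => hzT (h ▸ hc)
        simp at hcF
        simp [reparent, hang, hcF, this]
      · simp at hc
        simp [reparent, hc]
      · simp [reparent, hang, hFz]
      · have : v ≠ z := fun h => hzT (h ▸ hv)
        simp [reparent, hang, relabel, this]
      · simp [reparent, hang, relabel, hs]
    have hR := ready_splitBelow hT hu hsp hzT hzn hFs hs
      ⟨_, by simpa using (hlF _).1 hG, d, by simpa using (hlF _).1 hd, hdg.symm⟩
    refine (Ter.split 1 (.of_run (Q := fun s1 => s1.reg rB = 0) ?_ ?_)
      fun s1 q1 f1 => .split 1 (.single (newNodeCmd_spec (b := false) (hC.frame f1 rfl) ?_ q1))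
      fun s2 q2 f2 => .split 2 (.of_run (Q := fun s3 => s3.reg rC = z ∧ s3.reg rP = u) ?_ ?_)
      fun s3 h3 f3 => .split 1 (.single (insertCmd_hang (T := T) (σ := relabel T z false) ?_ ?_
        ?_ ?_ ?_ ?_ hC.root_mem ?_ hzT hu.mem hun h3.1 h3.2 ?_ hW)) fun s4 h4 f4 =>
      .split 1 (.single (moveCmd_spec (F := F) (z := z) h4 hW ?_ ?_ hFn ?_ ?_ hzn ?_ ?_ ?_))
      fun s5 h5 f5 => (Ter.of_run (Q := fun s6 => s6.reg rG = z ∧ s6.arr aLeaf = update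
        (s.arr aLeaf) z (lowSize T N u)) ?_ ?_).frame.mono le_rfl fun s6 h6 => ?_).le ?_
    · simp
    · simp
    · rw [f1.reg rfl]
      omega
    · simp
    · have e1 : s2.reg rU = u := by rw [f2.reg rfl, f1.reg rfl, hU]
      have e2 := q2.1
      rw [f1.reg rfl, hz] at e2
      simp [e1, e2]
    · rw [f3.reg rfl, f2.reg rfl, f1.reg rfl, hC.reg_n]
    · rw [f3.reg rfl, f2.reg rfl, f1.reg rfl, hC.reg_k]
    · rw [f3.reg rfl, f2.reg rfl, f1.reg rfl, hC.root]
    · rw [f3.arr rfl, f2.arr rfl, f1.arr rfl, hC.parent]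
    · have := q2.2.2.1
      rw [f1.reg rfl, hz] at this
      rw [f3.arr rfl]
      exact this
    · intro v hv
      rw [f3.reg rfl, q2.2.1, f1.reg rfl]
      rcases mem_insert.1 hv with rfl | hv
      · omega
      · have := hC.lt v hv
        omega
    · rw [f3.arr rfl, f3.arr rfl, q2.2.2.2.1, q2.2.2.2.2, f1.reg rfl, hz, f1.arr rfl,
        f1.arr rfl, Finset.filter_insert, if_pos hzn]
      exact hC.forest.newNode (by simp [hzT]) fun c hc hcz => hzT (hcz ▸
        (hcl.parent_mem c (Finset.mem_of_mem_erase hc) (Finset.ne_of_mem_erase hc)).1)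
    · rw [f3.reg rfl, q2.2.1, f1.reg rfl]
      exact hused
    · rw [f4.arr rfl, f3.arr rfl, f2.arr rfl, f1.arr rfl]
      exact hq
    · rw [f4.reg rfl, f3.reg rfl, f2.reg rfl, f1.reg rfl, hlen]
    · rw [f4.reg rfl, f3.reg rfl, q2.1, f1.reg rfl, hz]
    · simp [hang]
    · exact fun c hc => ⟨by simp [hang, (hFT c hc).1], (hFT c hc).2⟩
    · intro c hc hcr
      simp only [hang] at hc hcr ⊢
      rcases eq_or_ne c z with rfl | hcz
      · simp [hu.mem, hun]
      · rw [update_of_ne hcz]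
        have := hcl.parent_mem c (Finset.mem_of_mem_insert_of_ne hc hcz) hcr
        exact ⟨by simp [this.1], this.2⟩
    · rw [f4.reg rfl, f3.reg rfl, q2.2.1, f1.reg rfl]
      exact hused
    · simp
    · have e2 : s5.reg rZ = z := by rw [f5.reg rfl, f4.reg rfl, f3.reg rfl, q2.1, f1.reg rfl, hz]
      have e3 : s5.reg rLow = lowSize T N u := by
        rw [f5.reg rfl, f4.reg rfl, f3.reg rfl, f2.reg rfl, f1.reg rfl, hL]
      have e4 : s5.arr aLeaf = s.arr aLeaf := by
        rw [f5.arr rfl, f4.arr rfl, f3.arr rfl, f2.arr rfl, f1.arr rfl]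
      simp [e2, e3, e4]
    · obtain ⟨⟨h6, h6'⟩, f6⟩ := h6
      refine ⟨_, _, by rw [h6, hs]; exact hR, h5.frame f6 rfl, fun v hv => ?_, ?_⟩
      · rw [h6', belowClusters]
        rcases eq_or_ne v z with rfl | hvz
        · rw [update_self, if_pos rfl, ← hlow]
          simp [hlF]
        · rw [update_of_ne hvz, if_neg hvz]
          exact hleaf v (Finset.mem_of_mem_insert_of_ne hv hvz)
      · rw [f6.reg rfl, f5.reg rfl, f4.reg rfl, f3.reg rfl, q2.2.1, f1.reg rfl]
    · simp; omega
  · simp; omega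
  · simp; omega

/-! ### Joining the new leaf and updating the leaf counts -/

open Classical in
theorem climbLeaf_spec (hT : T.IsCotreeOf H S) (hp : p ∈ T.nodes) (hC : Core T s)
    (hE : s.reg rE = p) (hL : ∀ v ∈ T.nodes, s.arr aLeaf v ≤ n + 1)
    (hused : s.reg rUsed ≤ 2 * n) (hW : 20 * n + 20 ≤ W) :
    Ter W (.while (neTest rE rRoot) (block [ .assign rE (.get aParent (.var rE)),
      .store aLeaf (.var rE) (.add (.get aLeaf (.var rE)) (.const 1))])) s
      (40 * (T.nodes.filter (T.IsAncestor · p)).card + 20) (fun s' => ∀ v, s'.arr aLeaf v =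
        s.arr aLeaf v + if T.IsAncestor v p ∧ v ≠ p ∧ v ∈ T.nodes then 1 else 0) := by
  have hR := hT.rooted
  -- While the climb is at `e`, the proper ancestors of `p` up to and including `e` have been
  -- increased; the potential counts the ancestors of `e`.
  refine (Ter.loop_frame (s0 := s) (I := fun e s' => s'.reg rE = e ∧ T.IsAncestor e p ∧
    ∀ v, s'.arr aLeaf v = s.arr aLeaf v +
      if T.IsAncestor v p ∧ v ≠ p ∧ v ∈ T.nodes ∧ T.IsAncestor e v then 1 else 0)
    (Φ := fun e => 40 * (T.nodes.filter (T.IsAncestor · e)).card) ?_ ?_ p ⟨hE, .refl p, ?_⟩).mono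
    ?_ ?_
  · rintro e s' f ⟨hE', hep, -⟩
    have hC' := hC.frame f rfl
    have h1 := hC'.lt e (hR.mem_of_isAncestor hp hep)
    have h2 := hC'.lt _ hT.root_mem
    have h3 := hC'.root
    rw [f.reg rfl] at h1 h2
    simp [hE', h3]
    lia
  · rintro e s' f ⟨hE', hep, hl⟩ hb
    have hC' := hC.frame f rfl
    have hen := hR.mem_of_isAncestor hp hep
    have h3 := hC'.root
    have h4 := hC'.parent
    have her : e ≠ T.root := by
      rintro rfl
      simp [hE', h3] at hb
    have hc := hR.mem_children_parent hen her
    have hpe := hT.parent_mem e hen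
    have hpp := (isAncestor_parent e).trans hep
    have hno : ¬ T.IsAncestor e (T.parent e) := hR.not_isAncestor_of_mem_children hc
    have hne : T.parent e ≠ p := fun h => hno (h ▸ hep)
    have hval := hl (T.parent e)
    rw [if_neg (by tauto)] at hval
    have hle := hL _ hpe
    have hanc := hT.ancestors_child hc
    refine ⟨T.parent e, _, ?_, Ter.of_run ?_ ⟨?_, hpp, fun v => ?_⟩⟩
    · simp; omega
    · simp [hE', h4] at hval hle ⊢; omega
    · simp [hE', h4]
    · by_cases hv : v = T.parent e
      · subst hv
        have : T.IsAncestor (T.parent e) p ∧ T.parent e ≠ p ∧ T.parent e ∈ T.nodes ∧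
            T.IsAncestor (T.parent e) (T.parent e) := ⟨hpp, hne, hpe, .refl _⟩
        rw [if_pos this]
        simp [hE', h4] at hval ⊢; omega
      · have hiff : (T.IsAncestor v p ∧ v ≠ p ∧ v ∈ T.nodes ∧ T.IsAncestor (T.parent e) v) ↔
            (T.IsAncestor v p ∧ v ≠ p ∧ v ∈ T.nodes ∧ T.IsAncestor e v) := by
          refine ⟨fun ⟨h1, h2, h3, h4⟩ => ⟨h1, h2, h3, ?_⟩, fun ⟨h1, h2, h3, h4⟩ =>
            ⟨h1, h2, h3, (isAncestor_parent e).trans h4⟩⟩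
          rcases h1.total hep with h | h
          · rcases h.eq_or_parent with rfl | h
            · exact .refl _
            · exact absurd (hR.antisymm hpe h h4) hv
          · exact h
        have := hl v
        simp only [hiff]
        simp [hE', h4, hv] at this ⊢
        exact this
  · intro v
    rw [if_neg, add_zero]
    rintro ⟨h1, h2, h3, h4⟩
    exact h2 (hR.antisymm hp h1 h4)
  · simp
  · rintro s' ⟨f, ⟨e, hE', hep, hl⟩, hb⟩ v
    have h3 := (hC.frame f rfl).root
    have her : e = T.root := by simp [hE', h3] at hb; omega
    rw [hl v]
    congr 2
    rw [her]
    exact propext ⟨fun h => ⟨h.1, h.2.1, h.2.2.1⟩,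
      fun h => ⟨h.1, h.2.1, h.2.2, hT.reaches_root v h.2.2⟩⟩

theorem Ready.not_mem (h : Ready T H S B M g lab) (hx : x ∉ S) : x.val ∉ T.nodes := fun hn =>
  hx (h.cluster.subset_S hn ((h.cluster.leaf _ hn x.isLt x).2 rfl))

/-- In the new cotree the vertices joined to `x` from above are neighbours of `x`. With
`card_ancestors_le` this bounds the depth of `x`, and thus the cost of updating the leaf counts. -/
theorem seriesAbove_subset (hT : T.IsCotreeOf H' (insert x S)) (hH : AddsVertex H H' S M x) :
    T.seriesAbove x ⊆ M := by
  rintro y ⟨hy, hyx, w, hw, hws⟩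
  have hxS := Set.mem_insert x S
  have hyS := (hT.leaf_iff y).1 hy
  have hne : y ≠ x := by
    rintro rfl
    exact hyx (hT.mem_below_self hxS)
  have := (hT.adj_iff y hyS x hxS hne w hw).2 hws
  exact (hH.new y (hyS.resolve_left hne)).1 this.symm

/-- `x` has been joined to `g` by the node `p` of `T'`, with clusters `B'`. -/
structure Joined (T' : LabelledTree n) (H' : SimpleGraph (Fin n)) (S : Set (Fin n)) (x : Fin n)
    (p : ℕ) (L : ℕ → ℕ) : Prop where
  cotree : T'.IsCotreeOf H' (insert x S)
  child : x.val ∈ T'.children p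
  node : (T'.below p).ncard = L p
  other : ∀ v ∈ T'.nodes, v ≠ x → v ≠ p → ∃ D : Set (Fin n), x ∉ D ∧ D.ncard = L v ∧
    (T'.below v = D ∨ T'.below v = insert x D)

/-- The stored counts are already right at `p` and are short by one exactly at its proper ancestors,
which the final climb repairs. -/
theorem Joined.ncard_below {L : ℕ → ℕ} (h : Joined T' H' S x p L)
    (hv : v ∈ T'.nodes) (hvx : v ≠ x) [Decidable (T'.IsAncestor v p ∧ v ≠ p ∧ v ∈ T'.nodes)] :
    (T'.below v).ncard = L v + if T'.IsAncestor v p ∧ v ≠ p ∧ v ∈ T'.nodes then 1 else 0 := by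
  by_cases hvp : v = p
  · subst hvp
    simp [h.node]
  · obtain ⟨D, hxD, hD, h'⟩ := h.other v hv hvx hvp
    have hiff : x ∈ T'.below v ↔ T'.IsAncestor v p := by
      refine ⟨fun hx => ?_, fun hx => ⟨h.child.1, hx.trans (isAncestor_child h.child)⟩⟩
      rcases hx.2.eq_or_parent with e | e
      · exact absurd e hvx
      · exact h.child.2.2 ▸ e
    rw [← hD]
    rcases h' with h' | h'
    · rw [if_neg, h', add_zero]
      rw [← hiff, h']
      tauto
    · rw [if_pos, h', Set.ncard_insert_of_notMem hxD]
      rw [← hiff, h']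
      simp [hvp, hv]

theorem joinPhase_spec (hR : Ready T H S B M g lab) (hC : Core T s)
    (hleaf : ∀ v ∈ T.nodes, s.arr aLeaf v = (B v).ncard) (hG : s.reg rG = g)
    (hLab : s.reg rLab = lab.toNat) (hX : s.reg rX = x) (hx : x ∉ S) (hH : AddsVertex H H' S M x)
    (hused : s.reg rUsed + 1 ≤ 2 * n) (hW : 20 * n + 20 ≤ W) :
    Ter W joinPhase s (80 * M.ncard + 600) (fun s' => ∃ T' : LabelledTree n,
      T'.IsCotreeOf H' (insert x S) ∧ Core T' s' ∧
      (∀ v ∈ T'.nodes, s'.arr aLeaf v = (T'.below v).ncard) ∧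
      s'.reg rUsed ≤ s.reg rUsed + 1) := by
  classical
  have hxT := hR.not_mem hx
  have hxn := x.isLt
  have hn := hC.reg_n
  have hser := hC.series g
  have hgl := hleaf g hR.mem
  have hBg := ncard_le (B g)
  have hBS : ∀ v ∈ T.nodes, x ∉ B v := fun v hv h => hx (hR.cluster.subset_S hv h)
  obtain ⟨z, hz⟩ : ∃ z, n + s.reg rUsed = z := ⟨_, rfl⟩
  -- Both a leaf `g` and an internal `g` with the other label need a fresh node; the two branches of
  -- the program share this proof.
  have above : (n ≤ g → T.series g ≠ lab) → Ter W joinAbove s 300 (fun s1 => ∃ T1 : LabelledTree n,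
      Core T1 s1 ∧ s1.reg rZ ∈ T1.nodes ∧ n ≤ s1.reg rZ ∧ x.val ∉ T1.nodes ∧
      (∀ v ∈ T1.nodes, s1.arr aLeaf v ≤ n + 1) ∧ s1.reg rUsed ≤ s.reg rUsed + 1 ∧
      Joined (hang T1 x (s1.reg rZ) T1.series) H' S x (s1.reg rZ) (s1.arr aLeaf)) := by
    intro hlab
    have hzT : z ∉ T.nodes := fun h' => by
      have := hC.lt z h'
      omega
    have hxz : x.val ≠ z := by omega
    have hgz : g ≠ z := fun h => hzT (h ▸ hR.mem)
    have hgx : g ≠ x := fun h => hxT (h ▸ hR.mem)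
    have hI : InsertLeaf T (hang (raise T g z lab) x z (raise T g z lab).series) x g z lab := by
      refine ⟨rfl, rfl, fun c hc hcg => ?_, ?_, ?_, ?_, fun v hv => ?_, ?_⟩
      · have h1 : c ≠ z := fun h => hzT (h ▸ hc)
        have h2 : c ≠ x := fun h => hxT (h ▸ hc)
        simp [hang, raise, hcg, h1, h2]
      · simp [hang, raise, hgx]
      · simp [hang]
      · simp [hang, raise, hgz.symm, hxz.symm]
      · have h1 : v ≠ z := fun h => hzT (h ▸ hv)
        simp [hang, raise, relabel, h1]
      · simp [hang, raise, relabel]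
    obtain ⟨hcot, hbel⟩ := hR.insert hlab hI hx hxT hzT (by omega) hH
    refine (Ter.split 2 (.of_run (Q := fun s1 => s1.reg rA = g ∧ s1.reg rB = lab.toNat) ?_ ?_)
      fun s1 q1 f1 => .split 1 (.single (aboveCmd_spec (b := lab) (hC.frame f1 rfl) hW hR.mem
        q1.1 q1.2 (fun c => hR.cluster.parent_mem c) ?_))
      fun s2 q2 f2 => (Ter.of_run (Q := fun s3 => s3.arr aLeaf = update (s.arr aLeaf) z
        ((B g).ncard + 1)) ?_ ?_).frame.mono le_rfl fun s3 h3 => ?_).le ?_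
    · simp
    · simp [hG, hLab]
    · rw [f1.reg rfl]
      exact hused
    · have e1 : s2.arr aLeaf = s.arr aLeaf := by rw [f2.arr rfl, f1.arr rfl]
      have e2 : s2.reg rG = g := by rw [f2.reg rfl, f1.reg rfl, hG]
      simp [e1, e2] at hgl ⊢; omega
    · have e1 : s2.arr aLeaf = s.arr aLeaf := by rw [f2.arr rfl, f1.arr rfl]
      have e2 : s2.reg rG = g := by rw [f2.reg rfl, f1.reg rfl, hG]
      have e3 := q2.2.1
      rw [f1.reg rfl, hz] at e3
      simp [e1, e2, e3, hgl]
    · obtain ⟨h3, f3⟩ := h3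
      have hC3 := q2.1.frame f3 rfl
      rw [f1.reg (r := rUsed) rfl, hz] at hC3
      have e3 : s3.reg rZ = z := by rw [f3.reg rfl, q2.2.1, f1.reg rfl, hz]
      have hx1 : x.val ∉ (raise T g z lab).nodes := by simp [raise, hxz, hxT]
      rw [e3, h3]
      refine ⟨_, hC3, by simp [raise], by omega, hx1, fun v hv => ?_, ?_, hcot, ?_, ?_,
        fun v hv hvx hvz => ?_⟩
      · rcases eq_or_ne v z with rfl | hvz
        · simpa using hBg
        · rw [update_of_ne hvz, hleaf v (Finset.mem_of_mem_insert_of_ne hv hvz)]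
          exact (ncard_le _).trans (by omega)
      · rw [f3.reg rfl, q2.2.2, f1.reg rfl]
      · refine ⟨by simp [hang], fun h => hx1 ?_, by simp [hang]⟩
        rw [h]
        exact hC3.root_mem
      · rw [hbel z (by simp [hang, raise]), insertClusters, if_neg hxz.symm, if_pos rfl,
          Set.ncard_insert_of_notMem (hBS g hR.mem)]
        simp
      · have hvT : v ∈ T.nodes := Finset.mem_of_mem_insert_of_ne
          (Finset.mem_of_mem_insert_of_ne hv hvx) hvz
        refine ⟨B v, hBS v hvT, ?_, ?_⟩
        · rw [update_of_ne hvz, hleaf v hvT]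
        · rw [hbel v hv, insertClusters, if_neg hvx, if_neg hvz]
          split_ifs <;> simp
    · simp
  refine (Ter.split 1 (T1 := 350) (Q := fun s1 => ∃ T1 : LabelledTree n,
      Core T1 s1 ∧ s1.reg rZ ∈ T1.nodes ∧ n ≤ s1.reg rZ ∧ x.val ∉ T1.nodes ∧
      (∀ v ∈ T1.nodes, s1.arr aLeaf v ≤ n + 1) ∧ s1.reg rUsed ≤ s.reg rUsed + 1 ∧
      Joined (hang T1 x (s1.reg rZ) T1.series) H' S x (s1.reg rZ) (s1.arr aLeaf))
      (.single (T := 349) ?_) fun s1 q1 f1 => (?_ : Ter W _ s1 (80 * M.ncard + 250) _)).le ?_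
  · refine (Ter.ite (T := 340) (by simp) (fun hb => (above fun h => ?_).le (by simp))
      fun hb => ?_).le (by simp)
    · simp [hG, hn] at hb; omega
    have hgn : n ≤ g := by simpa [hG, hn] using hb
    refine (Ter.ite (T := 330) (by simp) (fun hb => ?_) fun hb => (above fun _ h => ?_).le
      (by simp)).le (by simp)
    · have hlab : T.series g = lab := by
        have : (T.series g).toNat = lab.toNat := by simpa [hG, hser, hLab] using hb
        revert this
        cases T.series g <;> cases lab <;> simp
      have hA : AttachLeaf T (hang T x g T.series) x g := by
        refine ⟨rfl, rfl, fun c hc => ?_, by simp [hang], fun _ _ => rfl⟩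
        have h2 : c ≠ x := fun h => hxT (h ▸ hc)
        simp [hang, h2]
      obtain ⟨hcot, hbel⟩ := hR.attach hgn hlab hA hx hxT hH
      have hgx : g ≠ x := fun h => hxT (h ▸ hR.mem)
      refine ((Ter.of_run (Q := fun s1 => s1.reg rZ = g ∧ s1.arr aLeaf = update
        (s.arr aLeaf) g ((B g).ncard + 1)) ?_ ?_).frame.mono le_rfl fun s1 q1 => ?_).le ?_
      · simp [hG] at hgl ⊢; omega
      · simp [hG, hgl]
      · obtain ⟨⟨q1, h1'⟩, f1⟩ := q1
        rw [q1, h1']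
        refine ⟨T, hC.frame f1 rfl, hR.mem, hgn, hxT, fun v hv => ?_, ?_, hcot, ?_, ?_,
          fun v hv hvx hvg => ?_⟩
        · rcases eq_or_ne v g with rfl | hvg
          · simpa using hBg
          · rw [update_of_ne hvg, hleaf v hv]
            exact (ncard_le _).trans (by omega)
        · rw [f1.reg rfl]
          omega
        · refine ⟨by simp [hang], fun h => hxT ?_, by simp [hang]⟩
          rw [h]
          exact hC.root_mem
        · rw [hbel g (by simp [hang, hR.mem]), attachClusters, if_neg hgx, if_pos subset_rfl,
            Set.ncard_insert_of_notMem (hBS g hR.mem)]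
          simp
        · have hvT : v ∈ T.nodes := Finset.mem_of_mem_insert_of_ne hv hvx
          refine ⟨B v, hBS v hvT, ?_, ?_⟩
          · rw [update_of_ne hvg, hleaf v hvT]
          · rw [hbel v hv, attachClusters, if_neg hvx]
            split_ifs <;> simp
      · simp
    · simp [hG, hser, hLab, h] at hb
  · obtain ⟨T1, hC1, hzT, hzn, hxT1, hl1, hu1, hJ⟩ := q1
    obtain ⟨p, hp⟩ : ∃ p, s1.reg rZ = p := ⟨_, rfl⟩
    rw [hp] at hzT hzn hJ
    -- The depth is bounded in the new tree, where the vertices joined to `x` from above all belong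
    -- to `M`.
    have hanc := hJ.cotree.card_ancestors_le x hJ.child.1
    have hM := Set.ncard_le_ncard (seriesAbove_subset hJ.cotree hH)
    have hanc' := hJ.cotree.ancestors_child hJ.child
    have hxp : x.val ≠ p := by omega
    refine (Ter.split 2 (.of_run (Q := fun s2 => s2.reg rC = x ∧ s2.reg rP = p) ?_ ?_)
      fun s2 q2 f2 => .split 1 (.single (insertCmd_hang (T := T1) (σ := T1.series) ?_ ?_ ?_
        ?_ ?_ ?_ hC1.root_mem ?_ hxT1 hzT hzn q2.1 q2.2 ?_ hW)) fun s3 h3 f3 =>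
      .split 2 (.of_run (Q := fun s4 => s4.reg rE = p ∧ s4.arr aLeaf =
        update (s1.arr aLeaf) x 1) ?_ ?_) fun s4 h4 f4 =>
      (Ter.single (climbLeaf_spec hJ.cotree (p := p) ?_ (h3.frame f4 rfl) h4.1 ?_ ?_ hW)).frame.mono
        le_rfl fun s5 h5 => ?_).le ?_
    · simp
    · have : s1.reg rX = x := by rw [f1.reg rfl, hX]
      simp [this, hp]
    · rw [f2.reg rfl, hC1.reg_n]
    · rw [f2.reg rfl, hC1.reg_k]
    · rw [f2.reg rfl, hC1.root]
    · rw [f2.arr rfl, hC1.parent]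
    · rw [f2.arr rfl]
      exact hC1.series
    · intro v hv
      rw [f2.reg rfl]
      rcases mem_insert.1 hv with rfl | hv
      · omega
      · exact hC1.lt v hv
    · rw [Finset.filter_insert, if_neg (by omega), f2.arr rfl, f2.arr rfl]
      exact hC1.forest
    · rw [f2.reg rfl]
      omega
    · simp; omega
    · have e1 : s3.reg rX = x := by rw [f3.reg rfl, f2.reg rfl, f1.reg rfl, hX]
      have e2 : s3.reg rZ = p := by rw [f3.reg rfl, f2.reg rfl, hp]
      have e3 : s3.arr aLeaf = s1.arr aLeaf := by rw [f3.arr rfl, f2.arr rfl]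
      simp [e1, e2, e3]
    · simp [hang, hzT]
    · intro v hv
      rw [h4.2]
      rcases eq_or_ne v x with rfl | hvx
      · simp
      · rw [update_of_ne hvx]
        exact hl1 v (Finset.mem_of_mem_insert_of_ne hv hvx)
    · rw [f4.reg rfl, f3.reg rfl, f2.reg rfl]
      omega
    · obtain ⟨h5, f5⟩ := h5
      refine ⟨_, hJ.cotree, (h3.frame f4 rfl).frame f5 rfl, fun v hv => ?_, ?_⟩
      · rw [h5 v, h4.2]
        rcases eq_or_ne v x with rfl | hvx
        · rw [update_self, if_neg, hJ.cotree.below_leaf (Set.mem_insert x S)]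
          · simp
          · rintro ⟨h1, h2, -⟩
            exact hJ.cotree.rooted.not_isAncestor_of_mem_children hJ.child h1
        · rw [update_of_ne hvx, hJ.ncard_below hv hvx]
      · rw [f5.reg rfl, f4.reg rfl, f3.reg rfl, f2.reg rfl]
        exact hu1
    · simp; omega
  · omega

/-! ### The insertion of one vertex -/

theorem Core.env (h : Core T s) (hleaf : ∀ v ∈ T.nodes, s.arr aLeaf v = (T.below v).ncard)
    (hused : s.reg rUsed ≤ 2 * n) : Env T s :=
  ⟨h.reg_n, h.reg_k, h.root, h.parent, h.series, hleaf, fun v hv => by have := h.lt v hv; omega⟩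

/-- Counters are nonzero only at parents of marked nodes, which are marked themselves; so clearing
along the list restores zero everywhere. -/
theorem cleanPhase_spec (hM : Marked T s X (s.reg rLen)) (hW : X.card + 1 ≤ W) :
    Ter W cleanPhase s (50 * X.card + 20) (fun s' =>
      (∀ v, s'.arr aMark v = 0) ∧ ∀ v, s'.arr aNh v = 0) := by
  obtain ⟨L, hL⟩ : ∃ L, s.reg rLen = L := ⟨_, rfl⟩
  rw [hL] at hM
  have hc := hM.card
  refine (Ter.split 1 (.of_run (Q := fun s1 => s1.reg rIdx = 0) ?_ ?_)
    fun s1 h1 f1 => .single (T := 50 * X.card + 10) ?_).le ?_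
  · simp
  · simp
  · have hM1 : Marked T s1 X L := hM.congr (f1.arr rfl) (f1.arr rfl) (f1.arr rfl)
    refine (Ter.loop_frame (s0 := s1) (I := fun k s' => k ≤ L ∧ s'.reg rIdx = k ∧
      ∀ v, (∀ j < L, k ≤ j → s1.arr aOrd j ≠ v) → s'.arr aMark v = 0 ∧ s'.arr aNh v = 0)
      (Φ := fun k => 50 * (L - k)) ?_ ?_ 0 ⟨by simp, h1, fun v hv => ?_⟩).mono ?_ ?_
    · intro k s' f _
      simp
    · rintro k s' f ⟨hk, hk', hz⟩ hb
      have g1 : s'.reg rLen = L := by rw [f.reg rfl, f1.reg rfl, hL]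
      have g2 : s'.arr aOrd = s1.arr aOrd := f.arr rfl
      have hkL : k < L := by simpa [hk', g1] using hb
      refine ⟨k + 1, _, ?_, Ter.of_run ?_ ⟨hkL, ?_, fun v hv => ?_⟩⟩
      · simp; omega
      · simp [hk']; omega
      · simp [hk']
      · by_cases hvk : v = s1.arr aOrd k
        · subst hvk
          simp [hk', g2]
        · have := hz v fun j hj hkj => by
            rcases hkj.eq_or_lt with rfl | h
            · exact fun h => hvk h.symm
            · exact hv j hj h
          have hvk' : v ≠ s1.arr 15 k := hvk
          simp [hk', g2, hvk']
          simpa using this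
    · have hvX : v ∉ X := fun h => by
        obtain ⟨j, hj, e⟩ := hM1.exists_index h
        exact hv j hj (by simp) e
      rw [hM1.mark, if_neg hvX, hM1.nh, leafSum]
      refine ⟨rfl, Finset.sum_eq_zero fun w hw => absurd ?_ hvX⟩
      rw [mem_filter] at hw
      obtain ⟨k, hk, rfl⟩ := hM1.exists_index hw.1
      obtain ⟨j, hj, e⟩ := hM1.earlier k hk hw.2.1
      rw [← hw.2.2, ← e]
      exact hM1.mem (by omega)
    · simp; omega
    · rintro s' ⟨f, ⟨k, hk, hk', hz⟩, hb⟩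
      have g1 : s'.reg rLen = L := by rw [f.reg rfl, f1.reg rfl, hL]
      have hkL : L ≤ k := by simpa [hk', g1] using hb
      have := fun v => hz v fun j hj hkj => by omega
      exact ⟨fun v => (this v).1, fun v => (this v).2⟩
  · simp; omega

/-- The completed neighbourhood `M` has been listed from position `o` on, and it is known where to
insert the new vertex. -/
def Located (H : SimpleGraph (Fin n)) (S M : Set (Fin n)) (s s' : State) : Prop :=
  (∃ T B lab, Ready T H S B M (s'.reg rG) lab ∧ s'.reg rLab = lab.toNat ∧ Core T s' ∧
    (∀ v ∈ T.nodes, s'.arr aLeaf v = (B v).ncard) ∧ s'.reg rUsed ≤ s.reg rUsed + 1) ∧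
  (∀ k < s.reg rOut, s'.arr aOut k = s.arr aOut k) ∧
  Lists (s'.arr aOut) (s.reg rOut) (s'.reg rOut) M

theorem trivialPhase_spec (hT : T.IsCotreeOf H S) (hC : Core T s)
    (hleaf : ∀ v ∈ T.nodes, s.arr aLeaf v = (T.below v).ncard) (hused : s.reg rUsed ≤ 2 * n)
    (hN : N ⊆ S) (hd : s.reg rDeg = N.ncard) (hM : N = ∅ ∧ M = ∅ ∨ N.Nonempty ∧ M = S)
    (hW : 20 * n + 20 ≤ W) (hWo : s.reg rOut + n + 1 ≤ W) :
    Ter W trivialPhase s (400 * M.ncard + 100) (fun s' => Located H S M s s' ∧ s'.reg rCount = 1 ∧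
      s'.arr aAnchor 0 = T.root ∧ s'.arr aCost 0 = (M \ N).ncard) := by
  have hE := hC.env hleaf hused
  have hr := hC.root
  have hlr := hleaf _ hT.root_mem
  rw [hT.below_root] at hlr
  refine (Ter.split 3 (.of_run (Q := fun s1 => s1.reg rG = T.root ∧ s1.reg rCount = 1 ∧
      s1.arr aAnchor 0 = T.root) ?_ ?_) fun s1 h1 f1 => .split 1 (T1 := 30) (Q := fun s2 =>
      s2.arr aCost 0 = (M \ N).ncard ∧ ∃ l lab, Queue s2 l ∧ Covers T l M ∧
        (∀ y ∈ S, (y ∈ M ↔ lab = true)) ∧ s2.reg rLab = lab.toNat) (.single (T := 29) ?_)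
      fun s2 h2 f2 => (?_ : Ter W _ s2 (400 * M.ncard + 21) _)).le ?_
  · simp; omega
  · simp [hr]
  · have e1 : s1.reg rDeg = N.ncard := by rw [f1.reg rfl, hd]
    have e2 : s1.reg rRoot = T.root := by rw [f1.reg rfl, hr]
    have e3 : s1.arr aLeaf T.root = S.ncard := by rw [f1.arr rfl, hlr]
    refine (Ter.of_wp ?_).le ?_
    · refine ⟨by simp, fun hb => wp_of_run ?_ ⟨?_, ?_⟩, fun hb => wp_of_run ?_ ⟨?_, ?_⟩⟩
      · simp
      · rcases hM with ⟨rfl, rfl⟩ | ⟨hne, rfl⟩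
        · simp
        · exact absurd (show N.ncard = 0 from e1 ▸ hb) ((Set.ncard_pos).2 hne).ne'
      · rcases hM with ⟨rfl, rfl⟩ | ⟨hne, rfl⟩
        · refine ⟨[], false, ⟨by simp, by simp⟩, ⟨by simp, by simp, by simp⟩, by simp, by simp⟩
        · exact absurd (show N.ncard = 0 from e1 ▸ hb) ((Set.ncard_pos).2 hne).ne'
      · simp; omega
      · rcases hM with ⟨rfl, rfl⟩ | ⟨hne, rfl⟩
        · simp [e1] at hb
        · simp [e1, e2] at e3 ⊢
          rw [e3, Set.ncard_sdiff hN]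
      · rcases hM with ⟨rfl, rfl⟩ | ⟨hne, rfl⟩
        · simp [e1] at hb
        · refine ⟨[T.root], true, ⟨by simp, by simp [e2]⟩, ⟨by simp [hT.root_mem], by simp, fun y => ?_⟩,
            by simp, by simp⟩
          simp [hT.below_root]
    · simp
  · obtain ⟨hcost, l, lab, hQ, hcov, hlab, hrl⟩ := h2
    have hC2 := (hC.frame f1 rfl).frame f2 rfl
    have ho : s2.reg rOut = s.reg rOut := by rw [f2.reg rfl, f1.reg rfl]
    refine (Ter.single (listPhase_spec hT ((hE.frame f1 rfl).frame f2 rfl) hC2.forest hQ hcov ho hW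
      hWo)).frame.mono (by omega) fun s3 h3 => ?_
    obtain ⟨⟨-, hk, hl⟩, f3⟩ := h3
    refine ⟨⟨⟨T, T.below, lab, ?_, ?_, hC2.frame f3 rfl, fun v hv => ?_, ?_⟩, fun k hk' => ?_, hl⟩,
      ?_, ?_, ?_⟩
    · rw [f3.reg rfl, f2.reg rfl, h1.1]
      exact ready_root hT hlab
    · rw [f3.reg rfl, hrl]
    · rw [f3.arr rfl, f2.arr rfl, f1.arr rfl, hleaf v hv]
    · rw [f3.reg rfl, f2.reg rfl, f1.reg rfl]
      omega
    · rw [hk k hk', f2.arr rfl, f1.arr rfl]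
    · rw [f3.reg rfl, f2.reg rfl, h1.2.1]
    · rw [f3.arr rfl, f2.arr rfl, h1.2.2]
    · rw [f3.arr rfl, hcost]
  · simp; omega

/-- The vertices are listed before the tree is changed. The listing phases only append to the queue,
so the non-hollow children still occupy its first `rFull` cells when `moveCmd` needs them. -/
theorem insertionPhase_spec (hT : T.IsCotreeOf H S) (hC : Core T s)
    (hleaf : ∀ v ∈ T.nodes, s.arr aLeaf v = (T.below v).ncard) (hused : s.reg rUsed + 1 ≤ 2 * n)
    (hX : ∀ v, v ∈ X ↔ v ∈ T.nodes ∧ (T.below v ∩ N).Nonempty)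
    (hM : Marked T s X (s.reg rLen)) (hu : T.IsCandidate N u) (hU : s.reg rU = u)
    (hW : 20 * n + 20 ≤ W) (hWo : s.reg rOut + n + 1 ≤ W) :
    Ter W insertionPhase s (50 * X.card + 1000 * (T.anchored N u).ncard + 1000)
      (Located H S (T.anchored N u) s) := by
  obtain ⟨c0, hc0, -⟩ := hu.hollow_child
  have hun := hT.internal_of_child hc0
  have hE := hC.env hleaf (by omega)
  have hser := hC.series u
  have hA := anchored_eq hun hT hu.outside
  have hsA : (T.seriesAbove u).ncard ≤ (T.anchored N u).ncard :=
    Set.ncard_le_ncard (hA ▸ Set.subset_union_left)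
  have hnA : (T.nonhollowPart N u).ncard ≤ (T.anchored N u).ncard :=
    Set.ncard_le_ncard (hA ▸ Set.subset_union_right)
  refine (Ter.split 1 (.of_run (Q := fun s1 => s1.reg rLab = (!T.series u).toNat) ?_ ?_)
    fun s1 h1 f1 => .split 1 (.single (scanPhase_spec (hE.frame f1 rfl) hX
      (s := s1) ?_ (by omega) ((f1.reg rfl).trans hU))) fun s2 h2 f2 =>
    (?_ : Ter W _ s2 (1000 * (T.anchored N u).ncard + 950) _)).le ?_
  · simp; omega
  · simp [hU, hser]
    cases T.series u <;> simp
  · rw [f1.reg rfl]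
    exact hM.congr (f1.arr rfl) (f1.arr rfl) (f1.arr rfl)
  · obtain ⟨F, hQ, hFd, hF⟩ := h2
    have hcov : Covers T F (T.nonhollowPart N u) := by
      refine ⟨fun c hc => ((hF c).1 hc).1.1, hFd.imp_of_mem fun {a b} ha hb hab =>
        hT.below_disjoint ((hF a).1 ha).1 ((hF b).1 hb).1 hab, fun y => ?_⟩
      simp [nonhollowPart, hF, and_assoc]
    have hFl := hcov.length_le hT
    have hFn : F.length ≤ n := hFl.trans (ncard_le _)
    have hE2 := (hE.frame f1 rfl).frame f2 rfl
    have hC2 := (hC.frame f1 rfl).frame f2 rfl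
    have hu2 : s2.reg rUsed = s.reg rUsed := by rw [f2.reg rfl, f1.reg rfl]
    have ho2 : s2.reg rOut = s.reg rOut := by rw [f2.reg rfl, f1.reg rfl]
    have ha2 : s2.arr aOut = s.arr aOut := by rw [f2.arr rfl, f1.arr rfl]
    have hM2 : Marked T s2 X (s.reg rLen) := (hM.congr (f1.arr rfl) (f1.arr rfl)
      (f1.arr rfl)).congr (f2.arr rfl) (f2.arr rfl) (f2.arr rfl)
    have hU2 : s2.reg rU = u := by rw [f2.reg rfl, f1.reg rfl, hU]
    have hlab2 : s2.reg rLab = (!T.series u).toNat := (f2.reg rfl).trans h1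
    refine (Ter.split 1 (.of_run (Q := fun s3 => s3.reg rFull = F.length) ?_ ?_)
      fun s3 h3 f3 => .split 1 (.single (seriesPhase_spec hT (hE2.frame f3 rfl)
        (hC2.frame f3 rfl).forest hW hu.mem ((f3.reg rfl).trans hU2)
        (hQ.congr (f3.reg rfl) (f3.arr rfl)) (nonhollowPart_subset u) hcov)) fun s4 h4 f4 =>
      (?_ : Ter W _ s4 (700 * (T.anchored N u).ncard + 600) _)).le ?_
    · simp
    · simpa using hQ.length
    · obtain ⟨q', hQ4, hcov4⟩ := h4
      rw [Set.union_comm, ← hA] at hcov4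
      have hE4 := (hE2.frame f3 rfl).frame f4 rfl
      have hC4 := (hC2.frame f3 rfl).frame f4 rfl
      have hu4 : s4.reg rUsed = s.reg rUsed := by rw [f4.reg rfl, f3.reg rfl, hu2]
      have ho4 : s4.reg rOut = s.reg rOut := by rw [f4.reg rfl, f3.reg rfl, ho2]
      refine (Ter.split 1 (.single (listPhase_spec hT hE4 hC4.forest hQ4 hcov4 ho4 hW hWo))
        fun s5 h5 f5 => ?_).le (T := 400 * (T.anchored N u).ncard + 21 +
          (300 * (T.anchored N u).ncard + 500)) (by omega)
      obtain ⟨⟨q, hQ5⟩, hk5, hl5⟩ := h5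
      have hE5 := hE4.frame f5 rfl
      have hC5 := hC4.frame f5 rfl
      have hu5 : s5.reg rUsed = s.reg rUsed := by rw [f5.reg rfl, hu4]
      have hq5 : ∀ i (h : i < F.length), s5.arr aQ i = F[i] := fun i h => by
        rw [hQ5.get i (by simp; omega), List.getElem_append_left (by simp; omega),
          List.getElem_append_left h]
      have hU5 : s5.reg rU = u := by rw [f5.reg rfl, f4.reg rfl, f3.reg rfl, hU2]
      have hM5 : Marked T s5 X (s.reg rLen) := ((hM2.congr (f3.arr rfl) (f3.arr rfl)
        (f3.arr rfl)).congr (f4.arr rfl) (f4.arr rfl) (f4.arr rfl)).congr (f5.arr rfl)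
        (f5.arr rfl) (f5.arr rfl)
      refine (Ter.split 1 (.single (lowerPhase_spec hT hC5 hE5.leaf hX hM5 hu hU5 hq5 hF
        (by omega) hW)) fun s6 h6 f6 => (Ter.single (splitPhase_spec hT (hC5.frame f6 rfl)
          (hE5.frame f6 rfl).leaf hu ((f6.reg rfl).trans hU5) (F := F) ?_ ?_ (by omega) hF h6.1
          h6.2 ?_ hW)).frame.mono le_rfl fun s7 h7 => ?_).le ?_
      · rw [f6.arr rfl]
        exact hq5
      · rw [f6.reg rfl, f5.reg rfl, f4.reg rfl, h3]
      · rw [f6.reg rfl, hu5]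
        exact hused
      · obtain ⟨⟨T', B, hR, hC', hl', hu'⟩, f7⟩ := h7
        refine ⟨⟨T', B, _, hR, ?_, hC', hl', ?_⟩, fun k hk => ?_, ?_⟩
        · rw [f7.reg rfl, f6.reg rfl, f5.reg rfl, f4.reg rfl, f3.reg rfl, hlab2]
        · rw [f6.reg rfl, hu5] at hu'
          exact hu'
        · rw [f7.arr rfl, f6.arr rfl, hk5 k hk, f4.arr rfl, f3.arr rfl, ha2]
        · rw [f7.arr rfl, f6.arr rfl, f7.reg rfl, f6.reg rfl]
          exact hl5
      · omega
    · simp; omega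
  · simp; omega

theorem EnumeratesCompletions.congr (h : EnumeratesCompletions s T H S N)
    (h1 : s'.arr aAnchor = s.arr aAnchor) (h2 : s'.arr aCost = s.arr aCost)
    (h3 : s'.reg rCount = s.reg rCount) : EnumeratesCompletions s' T H S N := by
  obtain ⟨a, b, c, d⟩ := h
  rw [← h1, ← h3] at a b d
  rw [← h1, ← h2, ← h3] at c
  exact ⟨a, b, c, d⟩

theorem enumeratesCompletions_of_emitted (hT : T.IsCotreeOf H S) (hH : IsCograph (H.induce S))
    (hN : N ⊆ S) (hne : N.Nonempty) {u b0 : ℕ} (hu : T.IsCandidate N u)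
    (h : Emitted (fun v => (T.anchored N v \ N).ncard) {v | T.IsMinCandidate N v} b0 s) :
    EnumeratesCompletions s T H S N := by
  have hA : ∀ k < s.reg rCount, T.IsMinCandidate N (s.arr aAnchor k) := fun k hk => h.bij.mapsTo hk
  refine ⟨Set.BijOn.comp (f := s.arr aAnchor) (g := T.anchored N) ⟨fun v hv => ?_,
    fun v hv w hw e => hT.eq_of_anchored_subset hN hv hw e.subset, fun M hM => ?_⟩ h.bij,
    fun k hk => (hA k hk).cand.mem, h.cost,
    fun k hk _ _ => hT.isInsertionNode_anchored (hA k hk).cand⟩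
  · exact (hT.isMinimalConstrainedCompletion_iff hH hN hne).2 (.inl ⟨v, hv, rfl⟩)
  · rcases (hT.isMinimalConstrainedCompletion_iff hH hN hne).1 hM with ⟨v, hv, rfl⟩ | ⟨hno, -⟩
    · exact ⟨v, hv, rfl⟩
    · exact absurd hu (hno u)

theorem enumeratesCompletions_of_unique (hT : T.IsCotreeOf H S)
    (hM : ∀ M', IsMinimalConstrainedCompletion H S N M' ↔ M' = M) (hr : T.anchored N T.root = M)
    (htriv : M.Nonempty → M = S) (h1 : s.reg rCount = 1) (h2 : s.arr aAnchor 0 = T.root)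
    (h3 : s.arr aCost 0 = (M \ N).ncard) : EnumeratesCompletions s T H S N := by
  have h0 : ∀ k < s.reg rCount, k = 0 := fun k hk => by omega
  refine ⟨⟨fun k hk => ?_, fun k hk l hl _ => ?_, fun M' hM' => ⟨0, ?_, ?_⟩⟩, fun k hk => ?_,
    fun k hk => ?_, fun k hk hne hnS => ?_⟩
  · obtain rfl := h0 k hk
    refine (hM _).2 ?_
    rw [← hr, ← h2]
  · rw [h0 k hk, h0 l hl]
  · rw [h1]
    simp
  · rw [(hM M').1 hM', ← hr, ← h2]
  · obtain rfl := h0 k hk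
    rw [h2]
    exact hT.root_mem
  · obtain rfl := h0 k hk
    rw [h2, hr, h3]
  · obtain rfl := h0 k hk
    rw [h2, hr] at hne hnS
    exact absurd (htriv hne) hnS

/-- The cotree of `H[S]` is stored, and the machine is ready for the insertion of a vertex. -/
structure Stored (T : LabelledTree n) (H : SimpleGraph (Fin n)) (S : Set (Fin n)) (s : State) :
    Prop where
  cotree : T.IsCotreeOf H S
  core : Core T s
  leaf : ∀ v ∈ T.nodes, s.arr aLeaf v = (T.below v).ncard
  mark : ∀ v, s.arr aMark v = 0
  nh : ∀ v, s.arr aNh v = 0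
  used : s.reg rUsed + 2 ≤ 2 * S.ncard

/-- The minimal completion `M` has been computed and listed. -/
structure Completes (T : LabelledTree n) (H : SimpleGraph (Fin n)) (S N M : Set (Fin n)) (m : ℕ)
    (s s' : State) : Prop where
  enum : EnumeratesCompletions s' T H S N
  minimal : IsMinimalConstrainedCompletion H S N M
  card : M.ncard = m
  located : Located H S M s s'

/-- If nothing was listed, there is no candidate, and the empty or the complete set is the only
minimal completion. Otherwise least cost means least cardinality, as all completions contain `N`.
The minimum `m` is given in advance because the time bound must not depend on the set that the
program selects. -/
theorem exists_completes_spec (hS : Stored T H S s) (hH : IsCograph (H.induce S)) (hN : N ⊆ S)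
    (hd : s.reg rDeg = N.ncard)
    (hX : ∀ v, v ∈ X ↔ v ∈ T.nodes ∧ (T.below v ∩ N).Nonempty) {m : ℕ}
    (hm : ∃ M, IsMinimalConstrainedCompletion H S N M ∧ M.ncard = m)
    (hmin : ∀ M, IsMinimalConstrainedCompletion H S N M → m ≤ M.ncard)
    (hW : 20 * n + 20 ≤ W) (hWo : s.reg rOut + n + 1 ≤ W) {s1 : State}
    (hC : Core T s1) (hleaf : ∀ v ∈ T.nodes, s1.arr aLeaf v = (T.below v).ncard)
    (hM : Marked T s1 X (s1.reg rLen)) (hused : s1.reg rUsed = s.reg rUsed)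
    (ho : s1.reg rOut = s.reg rOut) (hao : s1.arr aOut = s.arr aOut)
    (hd1 : s1.reg rDeg = s.reg rDeg)
    (hE : Emitted (fun v => (T.anchored N v \ N).ncard) {v | T.IsMinCandidate N v} (S.ncard + 1) s1) :
    Ter W (.ite (.eq (.var rCount) (.const 0)) trivialPhase insertionPhase) s1
      (50 * X.card + 1000 * m + 1010) (fun s' => ∃ M, Completes T H S N M m s s') := by
  have hT := hS.cotree
  have hu := hS.used
  have hSn := ncard_le S
  have hloc : ∀ {M s'}, Located H S M s1 s' → Located H S M s s' := fun {M s'} h => by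
    rw [Located, hused, ho, hao] at h
    exact h
  have huniq : ∀ {M}, (∀ M', IsMinimalConstrainedCompletion H S N M' ↔ M' = M) → M.ncard = m := by
    intro M h
    obtain ⟨M', h1, h2⟩ := hm
    rw [(h M').1 h1] at h2
    exact h2
  refine (Ter.ite (T := 50 * X.card + 1000 * m + 1000) (by simp) (fun hb => ?_) fun hb => ?_).le ?_
  · have h0 : s1.reg rCount = 0 := by simpa using hb
    have hA : ∀ v, ¬ T.IsMinCandidate N v := fun v hv => by
      obtain ⟨k, hk, -⟩ := hE.bij.surjOn hv
      rw [h0] at hk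
      simp at hk
    obtain ⟨M, hM', hiff, hr, htr⟩ : ∃ M, (N = ∅ ∧ M = ∅ ∨ N.Nonempty ∧ M = S) ∧
        (∀ M', IsMinimalConstrainedCompletion H S N M' ↔ M' = M) ∧ T.anchored N T.root = M ∧
        (M.Nonempty → M = S) := by
      rcases N.eq_empty_or_nonempty with rfl | hne
      · exact ⟨∅, .inl ⟨rfl, rfl⟩, fun M' => hT.isMinimalConstrainedCompletion_empty_iff hH,
          hT.anchored_empty_root, fun h => absurd rfl h.ne_empty⟩
      · have hno : ∀ u, ¬ T.IsCandidate N u := fun u hu => by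
          obtain ⟨v, hv⟩ := hT.exists_isMinCandidate hH hN hne hu
          exact hA v hv
        refine ⟨S, .inr ⟨hne, rfl⟩, fun M' => ?_, hT.anchored_root_eq hN hne hno, fun _ => rfl⟩
        rw [hT.isMinimalConstrainedCompletion_iff hH hN hne]
        exact ⟨fun h => h.elim (fun ⟨v, hv, _⟩ => absurd hv (hA v)) (·.2), fun h => .inr ⟨hno, h⟩⟩
    have hMm := huniq hiff
    refine (trivialPhase_spec hT hC hleaf (by omega) hN (hd1.trans hd) hM' hW (by omega)).mono
      (by omega) fun s' hs' => ⟨M, ?_, (hiff M).2 rfl, hMm, hloc hs'.1⟩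
    exact enumeratesCompletions_of_unique hT hiff hr htr hs'.2.1 hs'.2.2.1 hs'.2.2.2
  · have hA : {v | T.IsMinCandidate N v} ≠ ∅ := by
      intro h0
      have : (0 : ℕ) ∈ Set.Iio (s1.reg rCount) := by simp at hb ⊢; omega
      have := hE.bij.mapsTo this
      rw [h0] at this
      exact this
    obtain ⟨huA, hbest⟩ := hE.best.resolve_left fun h => hA h.1
    obtain ⟨u, hu'⟩ : ∃ u, s1.reg rU = u := ⟨_, rfl⟩
    rw [hu'] at huA hbest
    have hne : N.Nonempty := huA.cand.nonhollow.mono Set.inter_subset_right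
    have hiff := fun {M} => hT.isMinimalConstrainedCompletion_iff hH hN hne (M := M)
    have hMin : IsMinimalConstrainedCompletion H S N (T.anchored N u) := hiff.2 (.inl ⟨u, huA, rfl⟩)
    have hcard : (T.anchored N u).ncard = m := by
      obtain ⟨M, h1, h2⟩ := hm
      refine le_antisymm ?_ (hmin _ hMin)
      rcases hiff.1 h1 with ⟨v, hv, rfl⟩ | ⟨hno, -⟩
      · have := hE.le v hv
        rw [hbest, Set.ncard_sdiff (hT.subset_anchored u), Set.ncard_sdiff (hT.subset_anchored v)]
          at this
        have h3 := Set.ncard_le_ncard (hT.subset_anchored (N := N) v)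
        omega
      · exact absurd huA.cand (hno u)
    refine (insertionPhase_spec hT hC hleaf (by omega) hX hM huA.cand hu' hW
      (by omega)).frame.mono (by omega) fun s' hs' => ⟨_, ?_, hMin, hcard, hloc hs'.1⟩
    exact (enumeratesCompletions_of_emitted hT hH hN hne huA.cand hE).congr (hs'.2.arr rfl)
      (hs'.2.arr rfl) (hs'.2.reg rfl)
  · simp; omega

-- This adds the case without candidates, where the completion is all of `S` and `card_full_le`
-- bounds the whole tree.
open Classical in
theorem card_nonhollow_le (hT : T.IsCotreeOf H S) (hH : IsCograph (H.induce S)) (hN : N ⊆ S)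
    (hM : IsMinimalConstrainedCompletion H S N M) :
    (T.nodes.filter fun v => (T.below v ∩ N).Nonempty).card ≤ 4 * M.ncard + 2 := by
  rcases N.eq_empty_or_nonempty with rfl | hne
  · simp
  · rcases (hT.isMinimalConstrainedCompletion_iff hH hN hne).1 hM with ⟨v, hv, rfl⟩ | ⟨-, rfl⟩
    · exact hT.card_nonhollow_le hN hv.cand
    · have h1 := hT.card_full_le M
      have h2 : (T.nodes.filter fun v => (T.below v ∩ N).Nonempty).card ≤
          (T.nodes.filter fun v => T.below v ⊆ M).card :=
        Finset.card_le_card fun v hv => mem_filter.2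
          ⟨(mem_filter.1 hv).1, hT.below_subset v⟩
      omega

/-- The step from `s` to `s'` completes the neighbourhood `N` of `x` to a minimal completion `M` of
size `m`, lists it, and stores the new cotree. -/
def Inserts (T : LabelledTree n) (H : SimpleGraph (Fin n)) (S N : Set (Fin n)) (x : Fin n) (m : ℕ)
    (K : Set (Fin n) → SimpleGraph (Fin n)) (s s' : State) : Prop :=
  EnumeratesCompletions s' T H S N ∧ ∃ M, IsMinimalConstrainedCompletion H S N M ∧ M.ncard = m ∧
    (∀ k < s.reg rOut, s'.arr aOut k = s.arr aOut k) ∧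
    Lists (s'.arr aOut) (s.reg rOut) (s'.reg rOut) M ∧
    ∃ T' : LabelledTree n, Stored T' (K M) (insert x S) s'

/-- The phases cost `O(X.card + m)`, and `X.card ≤ 4 * m + 2`. Since `M` is known only after the
run, the new graph is given as a function `K` of it. Splitting and joining create at most one node
each, in step with `Stored.used`. -/
theorem laterStep_spec (hS : Stored T H S s) (hH : IsCograph (H.induce S)) (hN : N ⊆ S)
    (hL : Lists (s.arr aNbr) 0 (s.reg rDeg) N) (hx : x ∉ S) (hX : s.reg rX = x) {m : ℕ}
    (hm : ∃ M, IsMinimalConstrainedCompletion H S N M ∧ M.ncard = m)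
    (hmin : ∀ M, IsMinimalConstrainedCompletion H S N M → m ≤ M.ncard)
    {K : Set (Fin n) → SimpleGraph (Fin n)} (hK : ∀ M ⊆ S, AddsVertex H (K M) S M x)
    (hW : 20 * n + 20 ≤ W) (hWo : s.reg rOut + n + 1 ≤ W) :
    Ter W laterStep s (5000 * (m + 1)) (Inserts T H S N x m K s) := by
  classical
  have hT := hS.cotree
  have hu := hS.used
  have hSn := ncard_le S
  have hE := hS.core.env hS.leaf (by omega)
  have hd : s.reg rDeg = N.ncard := by simpa using hL.length_eq
  obtain ⟨X, hXe⟩ : ∃ X, T.nodes.filter (fun v => (T.below v ∩ N).Nonempty) = X := ⟨_, rfl⟩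
  have hXm : ∀ v, v ∈ X ↔ v ∈ T.nodes ∧ (T.below v ∩ N).Nonempty := by simp [← hXe]
  have hXc : X.card ≤ 4 * m + 2 := by
    obtain ⟨M, h1, h2⟩ := hm
    rw [← h2, ← hXe]
    exact card_nonhollow_le hT hH hN h1
  have hNm : N.ncard ≤ m := by
    obtain ⟨M, h1, h2⟩ := hm
    rw [← h2]
    exact Set.ncard_le_ncard h1.1.1
  have hmn : m ≤ n := by
    obtain ⟨M, h1, h2⟩ := hm
    rw [← h2]
    exact ncard_le M
  refine (Ter.split 1 (.single (markPhase_spec hT hE hXm hL hN hS.mark hS.nh (by omega)))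
    fun s1 q1 f1 => .split 1 (.single (evalPhase_spec hT (hE.frame f1 rfl) hN hXm q1
      (by omega))) fun s2 q2 f2 => (?_ : Ter W _ s2 (300 * X.card + 1080 * m + 1800) _)).le
    (by omega)
  have hE2 := (hE.frame f1 rfl).frame f2 rfl
  have hC2 := (hS.core.frame f1 rfl).frame f2 rfl
  have hM2 : Marked T s2 X (s2.reg rLen) := by
    rw [f2.reg rfl]
    exact q1.congr (f2.arr rfl) (f2.arr rfl) (f2.arr rfl)
  refine (Ter.split 1 (.single (enumPhase_spec hT hE2 hN hXm hM2 q2 ?_ (by omega)))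
    fun s3 h3 f3 => .split 1 (.single (exists_completes_spec hS hH hN hd hXm hm hmin hW hWo
      (hC2.frame f3 rfl) (hE2.frame f3 rfl).leaf ?_ ?_ ?_ ?_ ?_ h3))
    fun s4 h4 f4 => (?_ : Ter W _ s4 (50 * X.card + 80 * m + 650) _)).le (by omega)
  · rw [f2.reg rfl, f1.reg rfl, hd]
  · rw [f3.reg rfl]
    exact hM2.congr (f3.arr rfl) (f3.arr rfl) (f3.arr rfl)
  · rw [f3.reg rfl, f2.reg rfl, f1.reg rfl]
  · rw [f3.reg rfl, f2.reg rfl, f1.reg rfl]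
  · rw [f3.arr rfl, f2.arr rfl, f1.arr rfl]
  · rw [f3.reg rfl, f2.reg rfl, f1.reg rfl]
  obtain ⟨M, hen, hMin, hcard, ⟨T4, B, lab, hR, hlab, hC4, hl4, hu4⟩, hk, hlist⟩ := h4
  have hM4 : Marked T s4 X (s4.reg rLen) := by
    rw [f4.reg rfl, f3.reg rfl]
    exact (hM2.congr (f3.arr rfl) (f3.arr rfl) (f3.arr rfl)).congr (f4.arr rfl)
      (f4.arr rfl) (f4.arr rfl)
  refine (Ter.split 1 (.single (joinPhase_spec hR hC4 hl4 rfl hlab ?_ hx (hK M hMin.1.2.1)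
    (by omega) hW)) fun s5 h5 f5 => (Ter.single (cleanPhase_spec (T := T) (X := X) ?_
      ?_)).frame.mono le_rfl fun s6 h6 => ?_).le ?_
  · rw [f4.reg rfl, f3.reg rfl, f2.reg rfl, f1.reg rfl, hX]
  · rw [f5.reg rfl]
    exact hM4.congr (f5.arr rfl) (f5.arr rfl) (f5.arr rfl)
  · omega
  · obtain ⟨T', hT', hC', hl', hu'⟩ := h5
    obtain ⟨⟨hm6, hn6⟩, f6⟩ := h6
    refine ⟨hen.congr ?_ ?_ ?_, M, hMin, hcard, fun k hk' => ?_, ?_, T', hT', hC'.frame f6 rfl,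
      fun v hv => ?_, hm6, hn6, ?_⟩
    · rw [f6.arr rfl, f5.arr rfl]
    · rw [f6.arr rfl, f5.arr rfl]
    · rw [f6.reg rfl, f5.reg rfl]
    · rw [f6.arr rfl, f5.arr rfl, hk k hk']
    · rw [f6.arr rfl, f5.arr rfl, f6.reg rfl, f5.reg rfl]
      exact hlist
    · rw [f6.arr rfl, hl' v hv]
    · rw [f6.reg rfl, Set.ncard_insert_of_notMem hx]
      omega
  · omega

/-! ### Minimal completions of the prefixes -/

section Graph

variable {V : Type*} {G H H' K : SimpleGraph V} {S N M : Set V} {x : V}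

theorem IsCograph.of_embedding {V' : Type*} {G' : SimpleGraph V'} (h : IsCograph G') (f : G ↪g G') :
    IsCograph G := ⟨fun e => h.false (f.comp e)⟩

open Classical in
/-- The graph induced by `insert x S` arises from the graph induced by `S` by adding a vertex. -/
noncomputable def induceInsertIso (H : SimpleGraph V) (hx : x ∉ S) :
    addVertex (H.induce S) (Subtype.val ⁻¹' H.neighborSet x) ≃g H.induce (insert x S) where
  toFun
    | none => ⟨x, Set.mem_insert x S⟩
    | some y => ⟨y, Set.mem_insert_of_mem x y.2⟩
  invFun y := if h : y.1 ∈ S then some ⟨y, h⟩ else none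
  left_inv := by
    rintro (_ | ⟨y, hy⟩)
    · simp [hx]
    · simp [hy]
  right_inv := by
    rintro ⟨y, rfl | hy⟩
    · simp [hx]
    · simp [hy]
  map_rel_iff' := by
    rintro (_ | y) (_ | z) <;> simp [addVertex, SimpleGraph.adj_comm]

theorem isCograph_induce_insert (hx : x ∉ S) : IsCograph (H.induce (insert x S)) ↔
      IsCograph (addVertex (H.induce S) (Subtype.val ⁻¹' H.neighborSet x)) :=
  ⟨fun h => h.of_embedding (induceInsertIso H hx).toEmbedding,
    fun h => h.of_embedding (induceInsertIso H hx).symm.toEmbedding⟩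

/-- A cograph completion below the new graph restricts on `S` to a completion below `H.induce S`, so
it agrees with it there by minimality. Its neighbourhood of `x` is then a constrained completion for
the same graph, and minimality applies to it. -/
theorem isMinimalCographCompletion_insert (hx : x ∉ S)
    (h : IsMinimalCographCompletion (G.induce S) (H.induce S)) (hH : H'.induce S = H.induce S)
    (hM : IsMinimalConstrainedCompletion H S (G.neighborSet x ∩ S) (H'.neighborSet x ∩ S)) :
    IsMinimalCographCompletion (G.induce (insert x S)) (H'.induce (insert x S)) := by
  have hpre : ∀ K : SimpleGraph V, (Subtype.val ⁻¹' (K.neighborSet x ∩ S) : Set S) =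
      Subtype.val ⁻¹' K.neighborSet x := fun K => by
    ext y
    simp
  have hle : ∀ {K K' : SimpleGraph V}, K.induce S ≤ K'.induce S →
      K.neighborSet x ∩ S ⊆ K'.neighborSet x ∩ S →
      K.induce (insert x S) ≤ K'.induce (insert x S) := by
    rintro K K' h1 h2 ⟨v, rfl | hv⟩ ⟨w, rfl | hw⟩ hvw
    · exact absurd hvw (SimpleGraph.irrefl _)
    · exact (h2 ⟨hvw, hw⟩).1
    · exact (h2 ⟨hvw.symm, hv⟩).1.symm
    · exact @h1 ⟨v, hv⟩ ⟨w, hw⟩ hvw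
  have hge : ∀ {K K' : SimpleGraph V}, K.induce (insert x S) ≤ K'.induce (insert x S) →
      K.induce S ≤ K'.induce S ∧ K.neighborSet x ∩ S ⊆ K'.neighborSet x ∩ S := by
    refine fun {K K'} h => ⟨fun v w hvw => ?_, fun y hy => ⟨?_, hy.2⟩⟩
    · exact @h ⟨v, .inr v.2⟩ ⟨w, .inr w.2⟩ hvw
    · exact @h ⟨x, .inl rfl⟩ ⟨y, .inr hy.2⟩ hy.1
  refine ⟨⟨hle (hH ▸ h.1.1) hM.1.1, ?_⟩, ?_⟩
  · rw [isCograph_induce_insert hx, hH, ← hpre]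
    exact hM.1.2.2
  · rintro K0 ⟨hG, hK⟩ hKH
    -- The competitor lives on the subtype; extending it to `V` allows restrictions to `S` and to
    -- `insert x S` to be compared.
    obtain ⟨K, rfl⟩ : ∃ K : SimpleGraph V, K.induce (insert x S) = K0 :=
      ⟨K0.map (Function.Embedding.subtype _), SimpleGraph.comap_map_eq _ _⟩
    obtain ⟨h1, h2⟩ := hge hG
    obtain ⟨h3, h4⟩ := hge hKH
    have hKS : IsCograph (K.induce S) := hK.of_embedding
      (SimpleGraph.induceHomOfLE K (Set.subset_insert x S))
    have h5 : H.induce S ≤ K.induce S := h.2 ⟨h1, hKS⟩ (hH ▸ h3)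
    have h6 : K.induce S = H.induce S := le_antisymm (hH ▸ h3) h5
    refine hle (hH ▸ h5) (hM.2 ⟨h2, Set.inter_subset_right, ?_⟩ h4)
    rw [isCograph_induce_insert hx, h6] at hK
    rwa [hpre]

theorem isMinimalCographCompletion_of_induce_univ
    (h : IsMinimalCographCompletion (G.induce Set.univ) (H.induce Set.univ)) :
    IsMinimalCographCompletion G H := by
  have e : ∀ K : SimpleGraph V, K.induce Set.univ ≃g K := SimpleGraph.induceUnivIso
  refine ⟨⟨fun v w hvw => @h.1.1 ⟨v, trivial⟩ ⟨w, trivial⟩ hvw,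
    h.1.2.of_embedding (e H).symm.toEmbedding⟩, fun K hK hKH v w hvw => ?_⟩
  exact @h.2 (K.induce Set.univ) ⟨fun a b hab => hK.1 hab, hK.2.of_embedding (e K).toEmbedding⟩
    (fun a b hab => hKH hab) ⟨v, trivial⟩ ⟨w, trivial⟩ hvw

theorem isConstrainedCompletion_congr (h : H.induce S = H'.induce S) :
    IsConstrainedCompletion H S = IsConstrainedCompletion H' S := by
  funext N M
  rw [IsConstrainedCompletion, IsConstrainedCompletion, h]

theorem isMinimalConstrainedCompletion_congr (h : H.induce S = H'.induce S) :
    IsMinimalConstrainedCompletion H S = IsMinimalConstrainedCompletion H' S := by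
  funext N M
  rw [IsMinimalConstrainedCompletion, IsMinimalConstrainedCompletion,
    isConstrainedCompletion_congr h]

theorem isMinimalCographCompletion_of_isEmpty [IsEmpty V] : IsMinimalCographCompletion G H :=
  ⟨⟨fun v => isEmptyElim v, ⟨fun e => isEmptyElim (e 0)⟩⟩, fun _ _ _ v => isEmptyElim v⟩

theorem isMinimalConstrainedCompletion_empty : IsMinimalConstrainedCompletion H ∅ ∅ ∅ := by
  refine ⟨⟨subset_rfl, subset_rfl, ⟨fun e => ?_⟩⟩, fun M _ _ => Set.empty_subset M⟩
  have : (0 : Fin 4) = 1 := e.injective (Subsingleton.elim _ _)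
  simp at this

end Graph

section Order

variable {n : ℕ} {π : Equiv.Perm (Fin n)} {i : Fin n}

theorem firstVertices_succ (π : Equiv.Perm (Fin n)) (i : Fin n) :
    firstVertices π (i + 1) = insert (π i) (firstVertices π i) := by
  ext v
  simp only [firstVertices, Set.mem_insert_iff, Set.mem_ofPred_eq, Order.lt_add_one_iff,
    le_iff_eq_or_lt]
  rw [← Fin.ext_iff, Equiv.symm_apply_eq]

theorem not_mem_firstVertices (π : Equiv.Perm (Fin n)) (i : Fin n) : π i ∉ firstVertices π i := by
  simp [firstVertices]

theorem firstVertices_zero (π : Equiv.Perm (Fin n)) : firstVertices π 0 = ∅ := by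
  simp [firstVertices]

theorem firstVertices_self (π : Equiv.Perm (Fin n)) : firstVertices π n = Set.univ := by
  simp [firstVertices]

theorem firstVertices_mono (π : Equiv.Perm (Fin n)) {i j : ℕ} (h : i ≤ j) :
    firstVertices π i ⊆ firstVertices π j := fun _ hv => lt_of_lt_of_le hv h

/-- Every edge is counted at its later end. -/
theorem sum_ncard_earlierNeighbours_le (H : SimpleGraph (Fin n)) (π : Equiv.Perm (Fin n)) :
    ∑ i : Fin n, (earlierNeighbours H π i).ncard ≤ H.edgeSet.ncard := by
  classical
  have h1 : ∀ i, (earlierNeighbours H π i).ncard = (earlierNeighbours H π i).toFinset.card :=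
    fun i => Set.ncard_eq_toFinset_card' _
  simp only [h1]
  rw [← Finset.card_sigma, Set.ncard_eq_toFinset_card']
  refine Finset.card_le_card_of_injOn (fun p => s(π p.1, p.2)) ?_ ?_
  · rintro ⟨i, y⟩ h
    have h : y ∈ earlierNeighbours H π i := by simpa using h
    simpa using h.1
  · rintro ⟨i, y⟩ h ⟨j, z⟩ h' e
    have h : y ∈ earlierNeighbours H π i := by simpa using h
    have h' : z ∈ earlierNeighbours H π j := by simpa using h'
    simp only [Sym2.eq_iff, EmbeddingLike.apply_eq_iff_eq] at e
    rcases e with ⟨rfl, rfl⟩ | ⟨rfl, rfl⟩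
    · rfl
    · have h2 := h.2
      have h3 := h'.2
      simp [firstVertices] at h2 h3; omega

end Order

/-! ### The run of the algorithm -/

/-- The graph `H[S]` with a new vertex `x` that has neighbourhood `M`. -/
def extend (H : SimpleGraph (Fin n)) (S : Set (Fin n)) (x : Fin n) (M : Set (Fin n)) :
    SimpleGraph (Fin n) :=
  SimpleGraph.fromRel fun v w => (v ∈ S ∧ w ∈ S ∧ H.Adj v w) ∨ (v = x ∧ w ∈ M)

theorem addsVertex_extend (hx : x ∉ S) : AddsVertex H (extend H S x M) S M x := by
  refine ⟨fun v hv w hw => ?_, fun y hy => ?_⟩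
  · have h1 : v ≠ x := fun h => hx (h ▸ hv)
    have h2 : w ≠ x := fun h => hx (h ▸ hw)
    simp only [extend, SimpleGraph.fromRel_adj, hv, hw, h1, h2, true_and, false_and, or_false,
      H.adj_comm w v, or_self]
    exact ⟨(·.2), fun h => ⟨h.ne, h⟩⟩
  · have h1 : x ≠ y := fun h => hx (h ▸ hy)
    simp [extend, SimpleGraph.fromRel_adj, hx, h1, h1.symm]

theorem exists_minimum (hH : T.IsCotreeOf H S) (hc : IsCograph (H.induce S)) (hN : N ⊆ S) :
    ∃ M, IsMinimalConstrainedCompletion H S N M ∧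
      ∀ M', IsMinimalConstrainedCompletion H S N M' → M.ncard ≤ M'.ncard := by
  obtain ⟨M0, -, hM0⟩ := hH.exists_minimal_subset hc hN (hH.isConstrainedCompletion_univ hc hN)
  exact Set.exists_min_image {M | IsMinimalConstrainedCompletion H S N M} Set.ncard (Set.toFinite _)
    ⟨M0, hM0⟩

/-- Nothing has been stored yet. -/
structure Fresh (s : State) : Prop where
  series : ∀ u, s.arr aSeries u = 0
  used : s.reg rUsed = 0
  mark : ∀ v, s.arr aMark v = 0
  nh : ∀ v, s.arr aNh v = 0

/-- `Core.series` describes all cells of the label array, not only those of nodes; that is why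
`Fresh` requires the array to be zero. -/
theorem firstStep_spec (h : Fresh s) (hn : s.reg rN = n) (hX : s.reg rX = x) (hW : 20 * n + 20 ≤ W) :
    Ter W firstStep s 40 (fun s' => ∃ T : LabelledTree n, Stored T H {x} s') := by
  obtain ⟨T, hT⟩ : ∃ T : LabelledTree n, T =
    ⟨{x.val}, x, update (s.arr aParent) x x, fun _ => false⟩ := ⟨_, rfl⟩
  have hch : ∀ u, T.children u = ∅ := by
    intro u
    ext c
    simp [children, hT]
    tauto
  have hcot : T.IsCotreeOf H {x} := by
    refine ⟨?_, ?_, ?_, ?_, ?_, fun u _ _ => hch u, ?_, ?_, ?_⟩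
    · simp [hT]
    · simp [hT]
    · simp [hT]
    · simp only [hT, Finset.mem_singleton, forall_eq]
      exact .refl _
    · simp [hT, Fin.ext_iff]
    · intro u hu hun
      simp [hT] at hu; omega
    · intro u hu hun
      simp [hT] at hu; omega
    · rintro v rfl w rfl hvw
      exact absurd rfl hvw
  have hb : T.below x = {x} := hcot.below_leaf rfl
  refine (Ter.of_run ?_ ⟨T, hcot, ⟨?_, ?_, ?_, ?_, fun u => ?_, ?_, hcot.root_mem, ?_⟩, ?_,
    fun v => ?_, fun v => ?_, ?_⟩).le ?_
  · simp [firstStep, hn]; omega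
  · simp [firstStep]
  · simpa [firstStep] using hn
  · simp [firstStep, hn]; omega
  · simp [firstStep, hT, hX]
  · simp [firstStep, hT, hX]
  · simpa [firstStep, hT] using h.series u
  · have := x.isLt
    simp [firstStep, hT]; omega
  · have h1 : T.nodes.erase T.root = ∅ := by simp [hT]
    have h2 : T.nodes.filter (n ≤ ·) = ∅ := by simp [hT, Finset.filter_singleton]
    rw [Forest, h1, h2]
    exact ⟨by simp, by simp⟩
  · intro v hv
    obtain rfl : v = x := by simpa [hT] using hv
    rw [hb]
    simp [firstStep, hX]
  · simpa [firstStep] using h.mark v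
  · simpa [firstStep] using h.nh v
  · have := h.used
    simpa [firstStep] using this

theorem earlierNeighbours_subset (G : SimpleGraph (Fin n)) (π : Equiv.Perm (Fin n)) (i : Fin n) :
    earlierNeighbours G π i ⊆ firstVertices π i := Set.inter_subset_right

theorem induce_eq_iff : H.induce S = H'.induce S ↔ ∀ v ∈ S, ∀ w ∈ S, (H.Adj v w ↔ H'.Adj v w) := by
  constructor
  · intro h v hv w hw
    have : (H.induce S).Adj ⟨v, hv⟩ ⟨w, hw⟩ ↔ (H'.induce S).Adj ⟨v, hv⟩ ⟨w, hw⟩ := by rw [h]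
    exact this
  · intro h
    ext v w
    exact h v v.2 w w.2

theorem earlierNeighbours_congr {k : ℕ}
    (h : H.induce (firstVertices π k) = H'.induce (firstVertices π k)) {j : Fin n} (hj : j.val < k) :
    earlierNeighbours H π j = earlierNeighbours H' π j := by
  rw [induce_eq_iff] at h
  have hx : π j ∈ firstVertices π k := by simpa [firstVertices] using hj
  ext y
  refine and_congr_left fun hy => h _ hx y (firstVertices_mono π hj.le hy)

/-- What holds after the insertion of `i` vertices: the completion is `H`, and its cotree is `T`. -/
structure RunInv (W : ℕ) (G : SimpleGraph (Fin n)) (π : Equiv.Perm (Fin n)) (i : ℕ)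
    (H : SimpleGraph (Fin n)) (T : LabelledTree n) (s : State) : Prop where
  reg_n : s.reg rN = n
  reg_i : s.reg rI = i
  fresh : i = 0 → Fresh s
  stored : 1 ≤ i → Stored T H (firstVertices π i) s
  off : s.arr aOutOff i = s.reg rOut
  off_le : ∀ j ≤ i, s.arr aOutOff j ≤ s.reg rOut
  out_le : s.reg rOut ≤ i * n
  out : ∀ j : Fin n, j.val < i → Lists (s.arr aOut) (s.arr aOutOff j) (s.arr aOutOff (j + 1))
    (earlierNeighbours H π j)
  minimal : IsMinimalCographCompletion (G.induce (firstVertices π i)) (H.induce (firstVertices π i))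

/-- What one insertion achieves. -/
structure StepRel (G : SimpleGraph (Fin n)) (π : Equiv.Perm (Fin n)) (i : Fin n)
    (H : SimpleGraph (Fin n)) (T : LabelledTree n) (H' : SimpleGraph (Fin n)) (s' : State) :
    Prop where
  agree : H'.induce (firstVertices π i) = H.induce (firstVertices π i)
  selected : IsMinimalConstrainedCompletion H (firstVertices π i) (earlierNeighbours G π i)
    (earlierNeighbours H' π i)
  minimum : ∀ M, IsMinimalConstrainedCompletion H (firstVertices π i) (earlierNeighbours G π i) M →
    (earlierNeighbours H' π i).ncard ≤ M.ncard
  enumeration : 1 ≤ i.val →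
    EnumeratesCompletions s' T H (firstVertices π i) (earlierNeighbours G π i)

/-- The first vertex is special because there is no cotree of the empty graph to start from. -/
theorem insertion_spec {i : Fin n} (h : RunInv W G π i H T s) (hX : s.reg rX = π i)
    (hL : Lists (s.arr aNbr) 0 (s.reg rDeg) (earlierNeighbours G π i)) (hS : firstVertices π i = S)
    (hW : 20 * n + 20 ≤ W) (hWo : s.reg rOut + n + 1 ≤ W) :
    ∃ m, (∀ M, IsMinimalConstrainedCompletion H S (earlierNeighbours G π i) M → m ≤ M.ncard) ∧
      Ter W (.ite (.eq (.var rI) (.const 0)) firstStep laterStep) s (5000 * (m + 1) + 50)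
        (fun s' => (1 ≤ i.val → EnumeratesCompletions s' T H S (earlierNeighbours G π i)) ∧
          ∃ M, IsMinimalConstrainedCompletion H S (earlierNeighbours G π i) M ∧ M.ncard = m ∧
            (∀ k < s.reg rOut, s'.arr aOut k = s.arr aOut k) ∧
            Lists (s'.arr aOut) (s.reg rOut) (s'.reg rOut) M ∧
            ∃ T' : LabelledTree n, Stored T' (extend H S (π i) M) (insert (π i) S) s') := by
  have hI := h.reg_i
  have hN := earlierNeighbours_subset G π i
  rw [hS] at hN
  have hx := not_mem_firstVertices π i
  rw [hS] at hx
  rcases Nat.eq_zero_or_pos i.val with hi | hi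
  · have hS0 : S = ∅ := by rw [← hS, hi, firstVertices_zero]
    subst hS0
    rw [Set.subset_empty_iff.1 hN] at hL ⊢
    refine ⟨0, fun M _ => Nat.zero_le _, ?_⟩
    refine (Ter.ite (T := 40) (by simp) (fun hb => (firstStep_spec (H := extend H ∅ (π i) ∅)
      (h.fresh hi) h.reg_n hX hW).frame.mono le_rfl fun s' hs' => ?_) fun hb => absurd ?_ hb).le ?_
    · refine ⟨fun h => by omega, ∅, isMinimalConstrainedCompletion_empty, by simp, fun k _ => ?_, ?_,
        ?_⟩
      · rw [hs'.2.arr rfl]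
      · rw [hs'.2.reg rfl]
        exact Lists.empty _ _
      · simpa using hs'.1
    · simpa [hi] using hI
    · simp
  · have hst := h.stored hi
    have hco := h.minimal.1.2
    rw [hS] at hst hco
    obtain ⟨M0, h1, h2⟩ := exists_minimum hst.cotree hco hN
    refine ⟨M0.ncard, h2, (Ter.ite (T := 5000 * (M0.ncard + 1)) (by simp) (fun hb => absurd hb ?_)
      fun hb => (laterStep_spec hst hco hN hL hx hX ⟨M0, h1, rfl⟩ h2
      (K := extend H S (π i)) (fun M _ => addsVertex_extend hx) hW hWo).mono le_rfl
      fun s' hs' => ⟨fun _ => hs'.1, hs'.2⟩).le ?_⟩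
    · simp at hI ⊢; omega
    · simp; omega

theorem stepCmd_spec {i : Fin n} (h : RunInv W G π i H T s) (hb : Bounded W s)
    (hX : s.reg rX = π i) (hL : Lists (s.arr aNbr) 0 (s.reg rDeg) (earlierNeighbours G π i))
    (hW : 20 * n + 20 ≤ W) (hWo : n * n + n + 2 ≤ W) :
    ∃ H' T' t s', Exec W stepCmd s t s' ∧ t ≤ 6000 * (1 + (earlierNeighbours H' π i).ncard) ∧
      Bounded W s' ∧ RunInv W G π (i + 1) H' T' s' ∧ StepRel G π i H T H' s' := by
  obtain ⟨S, hS⟩ : ∃ S, firstVertices π i = S := ⟨_, rfl⟩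
  have hin := i.isLt
  -- Each insertion outputs at most `n` edges; these offsets are what requires a quadratic word
  -- bound.
  have hout : s.reg rOut ≤ n * n := h.out_le.trans (Nat.mul_le_mul_right n hin.le)
  obtain ⟨m, hm, hT⟩ := insertion_spec h hX hL hS hW (by omega)
  have hx := not_mem_firstVertices π i
  rw [hS] at hx
  have hins := firstVertices_succ π i
  rw [hS] at hins
  have hter : Ter W stepCmd s (5000 * (m + 1) + 80) (fun s' => ∃ H' T', RunInv W G π (i + 1) H' T' s' ∧
      StepRel G π i H T H' s' ∧ (earlierNeighbours H' π i).ncard = m) := by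
    refine (Ter.split 1 (.single hT) fun s1 q1 f1 => (Ter.single (T := 20)
      ((Ter.of_run (Q := fun s2 => s2.reg rI = i + 1 ∧ s2.arr aOutOff =
        update (s.arr aOutOff) (i + 1) (s1.reg rOut)) ?_ ?_).le
        (by simp [finishPhase]))).frame.mono
      le_rfl fun s2 q2 => ?_).le (by omega)
    · have : s1.reg rI = i := (f1.reg rfl).trans h.reg_i
      simp [finishPhase, this]; omega
    · have e1 : s1.reg rI = i := (f1.reg rfl).trans h.reg_i
      have e2 : s1.arr aOutOff = s.arr aOutOff := f1.arr rfl
      simp [finishPhase, e1, e2]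
    · obtain ⟨hen, M, hMin, hcard, hk, hlist, T', hst⟩ := q1
      obtain ⟨⟨q2, h2'⟩, f2⟩ := q2
      have hMS := hMin.1.2.1
      have hadd := addsVertex_extend (H := H) (M := M) hx
      have hagree : (extend H S (π i) M).induce S = H.induce S := induce_eq_iff.2 hadd.old
      have hM : earlierNeighbours (extend H S (π i) M) π i = M := by
        rw [earlierNeighbours, hS]
        ext y
        exact ⟨fun hy => (hadd.new y hy.2).1 hy.1, fun hy => ⟨(hadd.new y (hMS hy)).2 hy, hMS hy⟩⟩
      have ho2 : s2.reg rOut = s1.reg rOut := f2.reg rfl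
      have ha2 : s2.arr aOut = s1.arr aOut := f2.arr rfl
      have hlen := hlist.length_eq
      have hle := hlist.1
      have hMn := ncard_le M
      refine ⟨extend H S (π i) M, T', ⟨?_, q2, by simp, fun _ => ?_, ?_, fun j hj => ?_, ?_,
        fun j hj => ?_, ?_⟩, ⟨hS ▸ hagree, ?_, ?_, fun hi => ?_⟩, by rw [hM, hcard]⟩
      · rw [f2.reg rfl, f1.reg rfl, h.reg_n]
      · rw [hins]
        refine ⟨hst.cotree, hst.core.frame f2 rfl, fun v hv => ?_, fun v => ?_, fun v => ?_, ?_⟩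
        · rw [f2.arr rfl, hst.leaf v hv]
        · rw [f2.arr rfl, hst.mark]
        · rw [f2.arr rfl, hst.nh]
        · rw [f2.reg rfl]
          exact hst.used
      · rw [h2', update_self, ho2]
      · rw [h2', ho2]
        rcases eq_or_ne j (i.val + 1) with rfl | hj'
        · simp
        · rw [update_of_ne hj']
          exact (h.off_le j (by omega)).trans hle
      · rw [ho2, Nat.succ_mul]
        have := h.out_le
        omega
      · rw [h2', ha2, update_of_ne (by omega)]
        rcases Nat.lt_succ_iff_lt_or_eq.1 hj with hj | hj
        · rw [update_of_ne (by omega), earlierNeighbours_congr (H' := H) (by rw [hS, hagree]) hj]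
          exact (h.out j hj).congr fun k hk' => hk k (hk'.trans_le (h.off_le (j + 1) (by omega)))
        · obtain rfl := Fin.ext hj
          rw [update_self, h.off, hM]
          exact hlist
      · rw [hins]
        refine isMinimalCographCompletion_insert hx (hS ▸ h.minimal) hagree ?_
        rw [earlierNeighbours, hS] at hM
        rw [hM]
        rw [earlierNeighbours, hS] at hMin
        exact hMin
      · rw [hM, hS]
        exact hMin
      · rw [hM, hS, hcard]
        exact hm
      · rw [hS]
        exact (hen hi).congr (f2.arr rfl) (f2.arr rfl) (f2.reg rfl)
  obtain ⟨t, s', h1, h2, h3, H', T', h4, h5, h6⟩ := hter hb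
  exact ⟨H', T', t, s', h1, by omega, h3, h4, h5⟩

/-- Graphs, trees and states are only known to exist step by step; this assembles them into one run.
-/
theorem exists_chain {σ : Type*} {n : ℕ} {I : ℕ → σ → Prop} {R : ℕ → σ → σ → Prop} {a0 : σ}
    (h0 : I 0 a0) (h : ∀ i < n, ∀ a, I i a → ∃ b, I (i + 1) b ∧ R i a b) :
    ∃ f : ℕ → σ, f 0 = a0 ∧ (∀ i ≤ n, I i (f i)) ∧ ∀ i < n, R i (f i) (f (i + 1)) := by
  choose! g hg using h
  let f : ℕ → σ := fun i => Nat.rec a0 (fun i a => g i a) i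
  have hI : ∀ i ≤ n, I i (f i) := fun i => by
    induction i with
    | zero => exact fun _ => h0
    | succ i ih => exact fun hi => (hg i hi _ (ih (by omega))).1
  exact ⟨f, rfl, hI, fun i hi => (hg i hi _ (hI i hi.le)).2⟩

theorem exec_while_chain {b : Test} {c : Cmd} (n : ℕ) : ∀ {s : ℕ → State} {t : ℕ → ℕ},
    (∀ i < n, Exec W c (s i) (t i) (s (i + 1))) → (∀ i ≤ n, b.Fits W (s i)) →
    (∀ i < n, b.Holds (s i)) → ¬ b.Holds (s n) →
    Exec W (.while b c) (s 0) (∑ i ∈ Finset.range n, (b.cost + 1 + t i) + (b.cost + 1)) (s n) := by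
  induction n with
  | zero => exact fun _ hf _ hb => by simpa using Exec.while_false (hf 0 le_rfl) hb
  | succ n ih =>
    intro s t hc hf hb hb'
    have := Exec.while_true (hf 0 (by omega)) (hb 0 (by omega)) (hc 0 (by omega))
      (ih (s := fun i => s (i + 1)) (t := fun i => t (i + 1)) (fun i hi => hc _ (by omega))
        (fun i hi => hf _ (by omega)) (fun i hi => hb _ (by omega)) hb')
    rw [Finset.sum_range_succ']
    convert this using 1
    ring

theorem LabelledTree.IsCotreeOf.congr (hT : T.IsCotreeOf H S) (h : H'.induce S = H.induce S) :
    T.IsCotreeOf H' S :=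
  { hT with
    adj_iff := fun v hv w hw hvw u hu =>
      (induce_eq_iff.1 h v hv w hw).trans (hT.adj_iff v hv w hw hvw u hu) }

/-- Each intermediate graph agrees with the final one on the vertices inserted so far, and all
assertions about step `i` depend only on the induced subgraph; so they can be restated for the final
graph. -/
theorem correctRun_of_chain {Hs : ℕ → SimpleGraph (Fin n)} {T : ℕ → LabelledTree n}
    {s : ℕ → State} (hI : ∀ i ≤ n, RunInv W G π i (Hs i) (T i) (s i))
    (hR : ∀ i : Fin n, StepRel G π i (Hs i) (T i) (Hs (i + 1)) (s (i + 1))) :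
    CorrectRun G π (Hs n) T s ∧
      ∀ i : Fin n, earlierNeighbours (Hs n) π i = earlierNeighbours (Hs (i + 1)) π i := by
  have agree : ∀ {i : ℕ}, i ≤ n →
      (Hs n).induce (firstVertices π i) = (Hs i).induce (firstVertices π i) := by
    intro i
    suffices h : ∀ j, i ≤ j → j ≤ n →
        (Hs j).induce (firstVertices π i) = (Hs i).induce (firstVertices π i) from
      fun hi => h n hi le_rfl
    intro j hij
    induction j, hij using Nat.le_induction with
    | base => exact fun _ => rfl
    | succ j hij ih =>
      intro hj
      rw [← ih (by omega), induce_eq_iff]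
      exact fun v hv w hw => induce_eq_iff.1 (hR ⟨j, hj⟩).agree v (firstVertices_mono π hij hv) w
        (firstVertices_mono π hij hw)
  have heN : ∀ i : Fin n, earlierNeighbours (Hs n) π i = earlierNeighbours (Hs (i + 1)) π i :=
    fun i => earlierNeighbours_congr (agree i.isLt) (Nat.lt_succ_self _)
  have hmin := fun i : Fin n => isMinimalConstrainedCompletion_congr (agree i.isLt.le)
  have hpre : ∀ i ≤ n, IsMinimalCographCompletion
      (G.induce (firstVertices π i)) ((Hs n).induce (firstVertices π i)) := fun i hi => by
    rw [agree hi]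
    exact (hI i hi).minimal
  refine ⟨⟨fun i hi => ⟨(hI i hi).reg_n, (hI i hi).reg_i⟩, hpre, ?_, fun i h1 hi => ?_,
    fun i hi j hj => ?_, fun i => ?_, fun i => ?_, fun i h1 => ?_⟩, heN⟩
  · have := hpre n le_rfl
    rw [firstVertices_self] at this
    exact isMinimalCographCompletion_of_induce_univ this
  · have hst := (hI i hi).stored h1
    refine ⟨hst.cotree.congr (agree hi), hst.core.root, fun u _ => ?_, fun u _ _ => hst.core.series u⟩
    rw [hst.core.parent]
  · rw [earlierNeighbours_congr (agree hi) hj]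
    exact (hI i hi).out j hj
  · rw [heN, hmin]
    exact (hR i).selected
  · rw [heN, hmin]
    exact (hR i).minimum
  · exact { (hR i).enumeration h1 with
      bij := by
        rw [hmin]
        exact ((hR i).enumeration h1).bij }

/-- Reads a vertex and its neighbours; only used to describe what may change. -/
def feedCmd : Cmd := block [.assign rX (.const 0), .assign rDeg (.const 0),
  .store aNbr (.const 0) (.const 0)]

theorem frame_feed (s : State) (x d : ℕ) (nbr : ℕ → ℕ) : Frame feedCmd s (s.feed x d nbr) := by
  refine ⟨fun hr => ?_, fun ha => ?_⟩
  · simp [feedCmd, Cmd.modReg] at hr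
    simp [State.feed, Ne.symm hr.1, Ne.symm hr.2]
  · simp [feedCmd, Cmd.modArr] at ha
    simp [State.feed, Ne.symm ha]

/-- `c` changes nothing that the invariant is about. -/
def Cmd.keepsRun (c : Cmd) : Bool :=
  c.keepsCore && !(c.modReg rI || c.modReg rOut || c.modArr aOutOff || c.modArr aOut ||
    c.modArr aLeaf || c.modArr aMark || c.modArr aNh)

theorem RunInv.frame {c : Cmd} {i : ℕ} (h : RunInv W G π i H T s) (f : Frame c s s')
    (hc : c.keepsRun = true) : RunInv W G π i H T s' := by
  rw [Cmd.keepsRun, Bool.and_eq_true] at hc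
  obtain ⟨hk, hc⟩ := hc
  have hk' := hk
  simp only [Cmd.keepsCore, Bool.not_eq_true', Bool.or_eq_false_iff] at hc hk'
  obtain ⟨⟨⟨⟨⟨⟨c1, c2⟩, c3⟩, c4⟩, c5⟩, c6⟩, c7⟩ := hc
  obtain ⟨⟨⟨⟨⟨⟨⟨d1, d2⟩, d3⟩, d4⟩, d5⟩, d6⟩, d7⟩, d8⟩ := hk'
  refine ⟨(f.reg d1).trans h.reg_n, (f.reg c1).trans h.reg_i, fun hi => ?_, fun hi => ?_, ?_, ?_,
    ?_, ?_, h.minimal⟩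
  · have := h.fresh hi
    exact ⟨by rw [f.arr d6]; exact this.series, (f.reg d4).trans this.used,
      by rw [f.arr c6]; exact this.mark, by rw [f.arr c7]; exact this.nh⟩
  · have := h.stored hi
    exact ⟨this.cotree, this.core.frame f hk, by rw [f.arr c5]; exact this.leaf,
      by rw [f.arr c6]; exact this.mark, by rw [f.arr c7]; exact this.nh,
      by rw [f.reg d4]; exact this.used⟩
  · rw [f.arr c3, f.reg c2, h.off]
  · rw [f.arr c3, f.reg c2]
    exact h.off_le
  · rw [f.reg c2]
    exact h.out_le
  · rw [f.arr c3, f.arr c4]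
    exact h.out

theorem runInv_zero (G : SimpleGraph (Fin n)) (π : Equiv.Perm (Fin n)) (T : LabelledTree n)
    (hn : s.reg rN = n) (hi : s.reg rI = 0) (hf : Fresh s) (ho : s.reg rOut = 0)
    (ha : s.arr aOutOff 0 = 0) : RunInv W G π 0 ⊥ T s := by
  refine ⟨hn, hi, fun _ => hf, fun h => by omega, by rw [ha, ho], fun j hj => ?_, by omega,
    fun j hj => by omega, ?_⟩
  · rw [Nat.le_zero.1 hj, ha]
    omega
  · have : IsEmpty (firstVertices π 0) := by
      rw [firstVertices_zero]
      infer_instance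
    exact isMinimalCographCompletion_of_isEmpty

/-- The run of the algorithm, if `D i` describes how the `i`-th vertex is delivered. -/
theorem run_spec {P : State → Prop} {D : ℕ → State → State → Prop} {s0 : State}
    (h0 : RunInv W G π 0 ⊥ T s0) (hb0 : Bounded W s0) (hP0 : P s0)
    (hD : ∀ (i : Fin n) (s : State), s.reg rI = i.val → Bounded W s → P s → ∃ s', D i s s' ∧ Bounded W s' ∧
      (∀ H T, RunInv W G π i H T s → RunInv W G π i H T s') ∧ s'.reg rX = π i ∧
      Lists (s'.arr aNbr) 0 (s'.reg rDeg) (earlierNeighbours G π i) ∧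
      ∀ s'', Frame stepCmd s' s'' → P s'')
    (hW : 20 * n + 20 ≤ W) (hWo : n * n + n + 2 ≤ W) :
    ∃ (H : SimpleGraph (Fin n)) (T : ℕ → LabelledTree n) (s s' : ℕ → State) (t : ℕ → ℕ),
      CorrectRun G π H T s ∧ s 0 = s0 ∧ ∀ i : Fin n, D i (s i) (s' i) ∧
        Exec W stepCmd (s' i) (t i) (s (i + 1)) ∧
        t i ≤ 6000 * (1 + (earlierNeighbours H π i).ncard) := by
  have hchain := exists_chain (n := n)
    (I := fun i (a : SimpleGraph (Fin n) × LabelledTree n × State) =>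
      RunInv W G π i a.1 a.2.1 a.2.2 ∧ Bounded W a.2.2 ∧ P a.2.2)
    (R := fun i a b => ∃ s' t, ∀ hi : i < n, D i a.2.2 s' ∧ Exec W stepCmd s' t b.2.2 ∧
      t ≤ 6000 * (1 + (earlierNeighbours b.1 π ⟨i, hi⟩).ncard) ∧
      StepRel G π ⟨i, hi⟩ a.1 a.2.1 b.1 b.2.2) (a0 := (⊥, T, s0)) ⟨h0, hb0, hP0⟩
  obtain ⟨f, hf0, hI, hR⟩ := hchain (by
    rintro i hi ⟨H, T, s⟩ ⟨hinv, hb, hP⟩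
    obtain ⟨s1, d1, d2, d3, d4, d5, d6⟩ := hD ⟨i, hi⟩ s hinv.reg_i hb hP
    obtain ⟨H', T', t, s', h1, h2, h3, h4, h5⟩ := stepCmd_spec (i := ⟨i, hi⟩) (d3 H T hinv) d2 d4 d5
      hW hWo
    exact ⟨(H', T', s'), ⟨h4, h3, d6 s' h1.frame⟩, s1, t, fun _ => ⟨d1, h1, h2, h5⟩⟩)
  have : Nonempty State := ⟨s0⟩
  choose! s' t ht using hR
  obtain ⟨h1, h2⟩ := correctRun_of_chain (fun i hi => (hI i hi).1)
    fun i => (ht i i.isLt i.isLt).2.2.2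
  refine ⟨_, _, _, s', t, h1, by rw [hf0], fun i => ⟨(ht i i.isLt i.isLt).1, (ht i i.isLt i.isLt).2.1,
    ?_⟩⟩
  rw [h2]
  exact (ht i i.isLt i.isLt).2.2.1

theorem bounded_blankState (hW : n ≤ W) : Bounded W (blankState n) := by
  refine ⟨fun r => ?_, fun a _ k => by simp [blankState]⟩
  simp only [blankState, update_apply]
  split_ifs <;> omega

/-- An instance of `run_spec` in which the delivery is `State.feed`, so no program runs between the
steps. -/
theorem incremental_spec (nbr : ℕ → ℕ → ℕ) (hnbr : ∀ i : Fin n,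
      Lists (nbr i) 0 (earlierNeighbours G π i).ncard (earlierNeighbours G π i))
    (hW : 20 * n + 20 ≤ W) (hWo : n * n + n + 2 ≤ W) :
    ∃ (H : SimpleGraph (Fin n)) (T : ℕ → LabelledTree n) (s : ℕ → State) (t : ℕ → ℕ),
      CorrectRun G π H T s ∧ s 0 = blankState n ∧ ∀ i : Fin n, Exec W stepCmd
        ((s i).feed (π i) (earlierNeighbours G π i).ncard (nbr i)) (t i) (s (i + 1)) ∧
        t i ≤ 6000 * (1 + (earlierNeighbours H π i).ncard) := by
  obtain ⟨H, T, s, s', t, h1, h2, h3⟩ := run_spec (G := G) (π := π) (T := ⟨∅, 0, id, fun _ => false⟩)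
    (P := fun _ => True) (s0 := blankState n)
    (D := fun i s s' => ∀ hi : i < n,
      s' = s.feed (π ⟨i, hi⟩) (earlierNeighbours G π ⟨i, hi⟩).ncard (nbr i))
    (runInv_zero G π _ (by simp [blankState]) (by simp [blankState])
      ⟨by simp [blankState], by simp [blankState], by simp [blankState], by simp [blankState]⟩
      (by simp [blankState]) rfl) (bounded_blankState (by omega)) trivial (by
    intro i s _ hb _
    refine ⟨s.feed (π i) (earlierNeighbours G π i).ncard (nbr i), fun _ => rfl, ⟨fun r => ?_, fun a ha k => ?_⟩, fun H T h =>
      h.frame (frame_feed s _ _ _) rfl, by simp [State.feed], by simpa [State.feed] using hnbr i,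
      fun _ _ => trivial⟩
    · have := hb.reg r
      have hx := (π i).isLt
      have hd := ncard_le (earlierNeighbours G π i)
      simp only [State.feed, update_apply]
      split_ifs
      · exact hd.trans (by omega)
      · exact hx.le.trans (by omega)
      · exact this
    · have : a ≠ aNbr := by
        rintro rfl
        simp at ha
      simp only [State.feed, update_of_ne this]
      exact hb.arr a ha k) hW hWo
  exact ⟨H, T, s, t, h1, h2, fun i => (h3 i).1 i.isLt ▸ (h3 i).2⟩

/-! ### Reading the graph from adjacency lists -/

/-- Arrays: marks of the vertices that have been treated; the lists of the earlier neighbours of the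
vertices, in the insertion order, with their offsets. -/
abbrev aDone : ℕ := 20
abbrev aEoff : ℕ := 21
abbrev aElist : ℕ := 22

attribute [simp] aDone aEoff aElist

/-- Lists the treated neighbours of a vertex. -/
def collectCmd : Cmd :=
  .while (.lt (.var rJ) (.var rE)) (block [
    .assign rY (.get aAdj (.var rJ)),
    .ite (.eq (.get aDone (.var rY)) (.const 1))
      (block [.store aElist (.var rLen) (.var rY), incr rLen])
      .skip,
    incr rJ])

/-- Lists, for every vertex, its earlier neighbours. -/
def prepCmd : Cmd :=
  .while (.lt (.var rIdx) (.var rN)) (block [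
    .assign rV (.get aOrder (.var rIdx)),
    .assign rJ (.get aAdjOff (.var rV)),
    .assign rE (.get aAdjOff (.add (.var rV) (.const 1))),
    collectCmd,
    .store aDone (.var rV) (.const 1),
    incr rIdx,
    .store aEoff (.var rIdx) (.var rLen)])

/-- Delivers the next vertex and its earlier neighbours. -/
def fetchCmd : Cmd := block [
  .assign rX (.get aOrder (.var rI)),
  .assign rJ (.get aEoff (.var rI)),
  .assign rE (.get aEoff (.add (.var rI) (.const 1))),
  .assign rDeg (.const 0),
  .while (.lt (.var rJ) (.var rE)) (block [
    .store aNbr (.var rDeg) (.get aElist (.var rJ)),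
    incr rDeg,
    incr rJ])]

/-- The adjacency list is filtered by the marks in `aDone`; results below position `o` belong to
earlier vertices and have to survive. -/
theorem collectCmd_spec {b e o : ℕ} {F D : Set (Fin n)} (hL : Lists (s.arr aAdj) b e F)
    (hJ : s.reg rJ = b) (hE : s.reg rE = e) (hlen : s.reg rLen = o)
    (hD : ∀ y : Fin n, s.arr aDone y = 1 ↔ y ∈ D) (hWe : e + n + 1 ≤ W) (hWo : o + n + 1 ≤ W) :
    Ter W collectCmd s (50 * F.ncard + 10) (fun s' => Lists (s'.arr aElist) o (s'.reg rLen) (F ∩ D) ∧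
      ∀ k < o, s'.arr aElist k = s.arr aElist k) := by
  have hlF := hL.length_eq
  refine (Ter.loop_frame (s0 := s) (I := fun k s' => b ≤ k ∧ k ≤ e ∧ s'.reg rJ = k ∧
    Lists (s'.arr aElist) o (s'.reg rLen) {y | y ∈ D ∧ ∃ j, b ≤ j ∧ j < k ∧ s.arr aAdj j = y.val} ∧
    ∀ k < o, s'.arr aElist k = s.arr aElist k) (Φ := fun k => 50 * (e - k)) ?_ ?_ b
    ⟨le_rfl, hL.1, hJ, ?_, fun _ _ => rfl⟩).mono ?_ ?_
  · intro k s' f h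
    simp
  · rintro k s' f ⟨hbk, hke, hJ', hl, hk⟩ hb
    have hE' : s'.reg rE = e := by rw [f.reg rfl, hE]
    have hA : s'.arr aAdj = s.arr aAdj := f.arr rfl
    have hDn : s'.arr aDone = s.arr aDone := f.arr rfl
    have hke' : k < e := by simpa [hJ', hE'] using hb
    obtain ⟨y, hy, hyk⟩ := hL.mem hbk hke'
    have hyn := y.isLt
    have hyD := hD y
    have hadj : s'.arr aAdj k = y := by rw [hA, hyk]
    have hset : ∀ z : Fin n, (∃ j, b ≤ j ∧ j < k + 1 ∧ s.arr aAdj j = z.val) ↔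
        z = y ∨ ∃ j, b ≤ j ∧ j < k ∧ s.arr aAdj j = z.val := by
      intro z
      constructor
      · rintro ⟨j, h1, h2, h3⟩
        rcases Nat.lt_succ_iff_lt_or_eq.1 h2 with h | rfl
        · exact .inr ⟨j, h1, h, h3⟩
        · exact .inl (Fin.ext (h3.symm.trans hyk))
      · rintro (rfl | ⟨j, h1, h2, h3⟩)
        · exact ⟨k, hbk, by omega, hyk⟩
        · exact ⟨j, h1, by omega, h3⟩
    have hno : ¬ ∃ j, b ≤ j ∧ j < k ∧ s.arr aAdj j = y.val := by
      rintro ⟨j, h1, h2, h3⟩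
      have := hL.2.injOn ⟨h1, by omega⟩ ⟨hbk, hke'⟩ (h3.trans hyk.symm)
      omega
    have hle := hl.length_eq
    have hle' := hl.1
    have hUn := ncard_le {y : Fin n | y ∈ D ∧ ∃ j, b ≤ j ∧ j < k ∧ s.arr aAdj j = y.val}
    refine ⟨k + 1, 40, by simp; omega, (Ter.split 1 (.of_run (Q := fun s1 => s1.reg rY = y) ?_ ?_)
      fun s1 q1 f1 => .split 1 (.single (.of_wp (Q := fun s2 =>
        Lists (s2.arr aElist) o (s2.reg rLen)
          {y | y ∈ D ∧ ∃ j, b ≤ j ∧ j < k + 1 ∧ s.arr aAdj j = y.val} ∧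
        ∀ k < o, s2.arr aElist k = s.arr aElist k) ?_)) fun s2 q2 f2 =>
      .of_run ?_ ⟨by omega, hke', ?_, ?_⟩).le ?_⟩
    · simp [hJ'] at hadj ⊢; omega
    · simpa [hJ'] using hadj
    · have e1 : s1.arr aDone = s.arr aDone := (f1.arr rfl).trans hDn
      have e2 : s1.arr aElist = s'.arr aElist := f1.arr rfl
      have e3 : s1.reg rLen = s'.reg rLen := f1.reg rfl
      refine ⟨by simp; omega, fun hb => wp_of_run ?_ ⟨?_, fun j hj => ?_⟩,
        fun hb => wp_of_run (c := .skip) trivial ⟨?_, fun j hj => ?_⟩⟩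
      · have : s1.reg rLen + 1 ≤ W := by omega
        simp at this ⊢; omega
      · have hyD' : y ∈ D := hyD.1 (by simpa [q1, e1] using hb)
        have hins : {z | z ∈ D ∧ ∃ j, b ≤ j ∧ j < k + 1 ∧ s.arr aAdj j = z.val} =
            insert y {z | z ∈ D ∧ ∃ j, b ≤ j ∧ j < k ∧ s.arr aAdj j = z.val} := by
          ext z
          simp only [Set.mem_insert_iff, Set.mem_ofPred_eq, hset]
          constructor
          · rintro ⟨hz, h | h⟩
            · exact .inl h
            · exact .inr ⟨hz, h⟩
          · rintro (rfl | ⟨hz, h⟩)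
            · exact ⟨hyD', .inl rfl⟩
            · exact ⟨hz, .inr h⟩
        rw [hins]
        have := hl.snoc (a' := update (s'.arr aElist) (s'.reg rLen) y) (y := y)
          (fun h => hno h.2) (fun j hj => update_of_ne hj.ne _ _) (by simp)
        simpa [q1, e2, e3] using this
      · have : j ≠ s'.reg rLen := by omega
        have h2 := hk j hj
        simp [q1, e2, e3] at this h2 ⊢
        rw [update_of_ne this, h2]
      · have hyD' : y ∉ D := fun h => hb (by simpa [q1, e1] using hyD.2 h)
        change Lists (s1.arr aElist) o (s1.reg rLen) _
        rw [e2, e3]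
        convert hl using 2
        ext z
        simp only [hset, and_congr_right_iff, or_iff_right_iff_imp]
        rintro hz rfl
        exact absurd hz hyD'
      · exact (congrFun e2 j).trans (hk j hj)
    · have : s2.reg rJ = k := by rw [f2.reg rfl, f1.reg rfl, hJ']
      simp [this]; omega
    · simp
    · have : s2.reg rJ = k := by rw [f2.reg rfl, f1.reg rfl, hJ']
      simp [this]
    · simpa using q2
  · convert Lists.empty (n := n) (s.arr aElist) o
    ext y
    simp only [Set.mem_ofPred_eq, Set.mem_empty_iff_false, iff_false]
    rintro ⟨-, j, h1, h2, -⟩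
    omega
  · simp; omega
  · rintro s' ⟨f, ⟨k, hbk, hke, hJ', hl, hk⟩, hb⟩
    have hE' : s'.reg rE = e := by rw [f.reg rfl, hE]
    obtain rfl : k = e := by simp [hJ', hE'] at hb; omega
    refine ⟨?_, hk⟩
    convert hl using 2
    ext y
    rw [Set.mem_inter_iff, and_comm]
    refine and_congr_right fun _ => ⟨fun hy => hL.exists_index hy, ?_⟩
    rintro ⟨j, h1, h2, h3⟩
    obtain ⟨z, hz, hz'⟩ := hL.mem h1 h2
    rwa [← Fin.ext (hz'.symm.trans h3)]

/-- The order and the lists of the earlier neighbours of the first `i` vertices are stored. -/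
structure Prepared (G : SimpleGraph (Fin n)) (π : Equiv.Perm (Fin n)) (i : ℕ) (s : State) : Prop where
  order : ∀ j : Fin n, s.arr aOrder j = π j
  le : ∀ j ≤ i, s.arr aEoff j ≤ j * n
  mono : ∀ j ≤ i, s.arr aEoff j ≤ s.arr aEoff i
  lists : ∀ j : Fin n, j.val < i →
    Lists (s.arr aElist) (s.arr aEoff j) (s.arr aEoff (j + 1)) (earlierNeighbours G π j)

theorem IsGraphInput.off_le (h : IsGraphInput G π s) : ∀ {v : ℕ}, v ≤ n → s.arr aAdjOff v ≤ v * n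
  | 0, _ => by simp [h.off_zero]
  | v + 1, hv => by
    have h1 := h.off_le (v := v) (by omega)
    have h2 := (h.adj ⟨v, hv⟩).length_eq
    have h3 := ncard_le (G.neighborSet ⟨v, hv⟩)
    simp only at h2
    rw [Nat.succ_mul]
    omega

theorem sum_ncard_neighborSet (G : SimpleGraph (Fin n)) (π : Equiv.Perm (Fin n)) :
    ∑ i, (G.neighborSet (π i)).ncard = 2 * G.edgeSet.ncard := by
  classical
  rw [Equiv.sum_comp π fun v => (G.neighborSet v).ncard]
  simp only [Set.ncard_eq_toFinset_card']
  exact G.sum_degrees_eq_twice_card_edges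

/-- The vertices are treated in insertion order, so at the turn of a vertex the marks are exactly
those of its predecessors. Every edge is scanned twice, once from each end, which makes the pass
linear. -/
theorem prepCmd_spec (h : IsGraphInput G π s) (hW : 20 * n + 20 ≤ W) (hWo : n * n + n + 2 ≤ W) :
    Ter W prepCmd s (100 * n + 100 * G.edgeSet.ncard + 10) (Prepared G π n) := by
  have hN : s.reg rN = n := by rw [h.reg_eq]; simp [blankState]
  -- The budget of round `i`; the rounds differ in cost, so the potential is the sum of the
  -- remaining budgets.
  let c : ℕ → ℕ := fun i => if hi : i < n then 50 * (G.neighborSet (π ⟨i, hi⟩)).ncard + 90 else 0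
  have hc : ∑ i ∈ Finset.range n, c i = 90 * n + 100 * G.edgeSet.ncard := by
    rw [← Fin.sum_univ_eq_sum_range]
    have : ∀ i : Fin n, c i = 50 * (G.neighborSet (π i)).ncard + 90 := fun i => by simp [c]
    simp only [this, Finset.sum_add_distrib, ← Finset.mul_sum, sum_ncard_neighborSet]
    simp
    ring
  refine (Ter.loop_frame (s0 := s) (I := fun i s' => i ≤ n ∧ s'.reg rIdx = i ∧
    s'.reg rLen = s'.arr aEoff i ∧ (∀ y : Fin n, s'.arr aDone y = 1 ↔ y ∈ firstVertices π i) ∧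
    Prepared G π i s') (Φ := fun i => ∑ j ∈ Finset.Ico i n, c j) ?_ ?_ 0 ?_).mono ?_ ?_
  · intro i s' f _
    simp
  · rintro i s' f ⟨hin, hI, hlen, hD, hP⟩ hb
    have hN' : s'.reg rN = n := by rw [f.reg rfl, hN]
    have hi : i < n := by simpa [hI, hN'] using hb
    have hO : s'.arr aOrder i = π ⟨i, hi⟩ := hP.order ⟨i, hi⟩
    obtain ⟨x, hx⟩ : ∃ x, π ⟨i, hi⟩ = x := ⟨_, rfl⟩
    have hxn := x.isLt
    have hA : s'.arr aAdjOff = s.arr aAdjOff := f.arr rfl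
    have hmul : ∀ {j}, j ≤ n → j * n ≤ n * n := fun hj => Nat.mul_le_mul_right n hj
    have ho1 := (h.off_le hxn.le).trans (hmul hxn.le)
    have ho2 : s.arr aAdjOff (x + 1) ≤ n * n := (h.off_le hxn).trans (hmul hxn)
    have hl1 := (hP.le i le_rfl).trans (hmul hin)
    have hl2 := hP.le i le_rfl
    have hci : c i = 50 * (G.neighborSet x).ncard + 90 := by simp [c, hi, hx]
    refine ⟨i + 1, 50 * (G.neighborSet x).ncard + 80, ?_, (Ter.split 3 (.of_run
      (Q := fun s1 => s1.reg rV = x ∧ s1.reg rJ = s.arr aAdjOff x ∧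
        s1.reg rE = s.arr aAdjOff (x + 1)) ?_ ?_) fun s1 q1 f1 => .split 1 (.single
      (collectCmd_spec (o := s'.arr aEoff i) (F := G.neighborSet x) (D := firstVertices π i) ?_ q1.2.1
        q1.2.2 ?_ ?_ (by omega) (by omega))) fun s2 q2 f2 => (Ter.of_run (Q := fun s3 =>
        s3.reg rIdx = i + 1 ∧ s3.arr aDone = update (s'.arr aDone) x 1 ∧
        s3.arr aEoff = update (s'.arr aEoff) (i + 1) (s2.reg rLen)) ?_ ?_).frame.mono le_rfl
      fun s3 q3 => ?_).le ?_⟩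
    · rw [Finset.sum_eq_sum_Ico_succ_bot hi]
      simp; omega
    · simp [hI, hx, hA] at hO ho1 ho2 ⊢
      rw [hO]
      omega
    · simp [hI, hx, hA] at hO ⊢
      simp [hO]
    · rw [f1.arr rfl, f.arr rfl]
      exact h.adj x
    · rw [f1.reg rfl, hlen]
    · rw [f1.arr rfl]
      exact hD
    · have : s2.reg rIdx = i := by rw [f2.reg rfl, f1.reg rfl, hI]
      simp [this]; omega
    · have e1 : s2.reg rIdx = i := by rw [f2.reg rfl, f1.reg rfl, hI]
      have e2 : s2.reg rV = x := by rw [f2.reg rfl, q1.1]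
      have e3 : s2.arr aDone = s'.arr aDone := by rw [f2.arr rfl, f1.arr rfl]
      have e4 : s2.arr aEoff = s'.arr aEoff := by rw [f2.arr rfl, f1.arr rfl]
      simp [e1, e2, e3, e4]
    · obtain ⟨⟨h1, h2, h3⟩, f3⟩ := q3
      have hlL := q2.1.length_eq
      have hlL' := q2.1.1
      have hcard := ncard_le (G.neighborSet x ∩ firstVertices π i)
      have e4 : s3.arr aElist = s2.arr aElist := f3.arr rfl
      refine ⟨hi, h1, ?_, fun y => ?_, fun j => ?_, fun j hj => ?_, fun j hj => ?_, fun j hj => ?_⟩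
      · rw [h3, update_self, f3.reg rfl]
      · have hsucc := firstVertices_succ π ⟨i, hi⟩
        simp only [hx] at hsucc
        rw [h2, hsucc, Set.mem_insert_iff, ← hD y]
        by_cases hyx : y = x
        · simp [hyx]
        · have : y.val ≠ x := fun h => hyx (Fin.ext h)
          simp [hyx, this]
      · rw [f3.arr rfl, f2.arr rfl, f1.arr rfl, hP.order]
      · rw [h3]
        rcases eq_or_ne j (i + 1) with rfl | hj'
        · rw [update_self, Nat.succ_mul]
          omega
        · rw [update_of_ne hj']
          exact hP.le j (by omega)
      · rw [h3, update_self]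
        rcases eq_or_ne j (i + 1) with rfl | hj'
        · simp
        · rw [update_of_ne hj']
          exact (hP.mono j (by omega)).trans hlL'
      · rw [h3, e4, update_of_ne (by omega)]
        rcases Nat.lt_succ_iff_lt_or_eq.1 hj with hj | hj
        · rw [update_of_ne (by omega)]
          refine (hP.lists j hj).congr fun k hk => ?_
          rw [q2.2 k (hk.trans_le (hP.mono (j + 1) (by omega))), f1.arr rfl]
        · subst hj
          rw [update_self, earlierNeighbours, hx]
          exact q2.1
    · simp; omega
  · refine ⟨by simp, ?_, ?_, fun y => ?_, h.order, fun j hj => ?_, fun j hj => ?_,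
      fun j hj => by omega⟩
    · rw [h.reg_eq]
      simp [blankState]
    · rw [h.reg_eq, h.arr_eq _ (by simp) (by simp) (by simp)]
      simp [blankState]
    · rw [h.arr_eq _ (by simp) (by simp) (by simp), firstVertices_zero]
      simp
    · rw [h.arr_eq _ (by simp) (by simp) (by simp)]
      simp
    · rw [Nat.le_zero.1 hj]
  · rw [← Finset.range_eq_Ico, hc]
    simp; omega
  · rintro s' ⟨f, ⟨i, hin, hI, -, -, hP⟩, hb⟩
    have hN' : s'.reg rN = n := by rw [f.reg rfl, hN]
    obtain rfl : i = n := by simp [hI, hN'] at hb; omega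
    exact hP

theorem fetchCmd_spec {i : Fin n} (h : Prepared G π n s) (hI : s.reg rI = i)
    (hW : 20 * n + 20 ≤ W) (hWo : n * n + n + 2 ≤ W) :
    Ter W fetchCmd s (50 * (earlierNeighbours G π i).ncard + 50) (fun s' => s'.reg rX = π i ∧
      Lists (s'.arr aNbr) 0 (s'.reg rDeg) (earlierNeighbours G π i)) := by
  have hin := i.isLt
  have hL := h.lists i hin
  obtain ⟨b, hb⟩ : ∃ b, s.arr aEoff i = b := ⟨_, rfl⟩
  obtain ⟨e, he⟩ : ∃ e, s.arr aEoff (i + 1) = e := ⟨_, rfl⟩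
  rw [hb, he] at hL
  have hlen := hL.length_eq
  have hcard := ncard_le (earlierNeighbours G π i)
  have hbe := hL.1
  have hO := h.order i
  have hxn := (π i).isLt
  have heW := (h.le (i + 1) hin).trans (Nat.mul_le_mul_right n hin)
  rw [he] at heW
  refine (Ter.split 4 (.of_run (Q := fun s1 => s1.reg rX = π i ∧ s1.reg rJ = b ∧ s1.reg rE = e ∧
    s1.reg rDeg = 0) ?_ ?_) fun s1 q1 f1 => .single (T := 50 * (e - b) + 10) ?_).le ?_
  · simp [hI, hO] at hO ⊢; omega
  · simp [hI] at hO hb he ⊢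
    exact ⟨hO, hb, he⟩
  · refine (Ter.loop_frame (s0 := s1) (I := fun k s' => b + k ≤ e ∧ s'.reg rJ = b + k ∧
      s'.reg rDeg = k ∧ ∀ j < k, s'.arr aNbr j = s.arr aElist (b + j))
      (Φ := fun k => 50 * (e - b - k)) ?_ ?_ 0 ⟨by omega, by simpa using q1.2.1, q1.2.2.2,
        by simp⟩).mono ?_ ?_
    · intro k s' f _
      simp
    · rintro k s' f ⟨hk, hJ, hd, hl⟩ hb'
      have hE : s'.reg rE = e := by rw [f.reg rfl, q1.2.2.1]
      have hA : s'.arr aElist = s.arr aElist := by rw [f.arr rfl, f1.arr rfl]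
      have hk' : b + k < e := by simpa [hJ, hE] using hb'
      refine ⟨k + 1, _, ?_, Ter.of_run ?_ ⟨hk', ?_, ?_, fun j hj => ?_⟩⟩
      · simp; omega
      · simp [hd, hJ]; omega
      · simp [hJ]; omega
      · simp [hd]
      · rcases Nat.lt_succ_iff_lt_or_eq.1 hj with hj | rfl
        · have h1 := hl j hj
          have h2 : j ≠ k := by omega
          simp [hd, hJ, hA, h2] at h1 ⊢
          exact h1
        · simp [hd, hJ, hA]
    · simp
    · rintro s' ⟨f, ⟨k, hk, hJ, hd, hl⟩, hb'⟩
      have hE : s'.reg rE = e := by rw [f.reg rfl, q1.2.2.1]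
      obtain rfl : e = b + k := by simp [hJ, hE] at hb'; omega
      refine ⟨by rw [f.reg rfl, q1.1], by omega, ?_⟩
      rw [hd]
      have hc : Set.BijOn (fun j => b + j) (Set.Ico 0 k) (Set.Ico b (b + k)) := by
        refine ⟨fun j hj => ?_, fun _ _ _ _ h => Nat.add_left_cancel h, fun j hj => ⟨j - b, ?_, ?_⟩⟩
        · simp at hj ⊢; omega
        · simp at hj ⊢; omega
        · simp at hj ⊢; omega
      exact (hL.2.comp hc).congr fun j hj => (hl j hj.2).symm
  · simp; omega

theorem Prepared.congr (h : Prepared G π n s) (h1 : s'.arr aOrder = s.arr aOrder)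
    (h2 : s'.arr aEoff = s.arr aEoff) (h3 : s'.arr aElist = s.arr aElist) : Prepared G π n s' :=
  ⟨h1 ▸ h.order, h2 ▸ h.le, h2 ▸ h.mono, h2 ▸ h3 ▸ h.lists⟩

/-- Here the delivery in `run_spec` is `fetchCmd`, and `Prepared` is the property that the steps
must leave intact. Fetching costs time linear in the number of earlier neighbours in `G`, which is
at most the degree in the completion. -/
theorem whole_spec {s0 : State} (h : IsGraphInput G π s0) (hW : 20 * n + 20 ≤ W)
    (hWo : n * n + n + 2 ≤ W) :
    ∃ (H : SimpleGraph (Fin n)) (T : ℕ → LabelledTree n) (s s' : ℕ → State) (t0 : ℕ) (f t : ℕ → ℕ),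
      CorrectRun G π H T s ∧ Exec W prepCmd s0 t0 (s 0) ∧ t0 ≤ 100 * n + 100 * G.edgeSet.ncard + 10 ∧
      ∀ i : Fin n, Exec W fetchCmd (s i) (f i) (s' i) ∧ (s' i).reg rX = π i ∧
        Lists ((s' i).arr aNbr) 0 ((s' i).reg rDeg) (earlierNeighbours G π i) ∧
        Exec W stepCmd (s' i) (t i) (s (i + 1)) ∧
        f i + t i ≤ 7000 * (1 + (earlierNeighbours H π i).ncard) := by
  have hb : Bounded W s0 := by
    refine ⟨fun r => ?_, fun a ha k => ?_⟩
    · rw [h.reg_eq]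
      exact (bounded_blankState (by omega)).reg r
    · simp [isInput] at ha
      rw [h.arr_eq a ha.1.1.2 ha.1.2 ha.2]
      omega
  obtain ⟨t0, s1, he, ht, hb1, hP⟩ := prepCmd_spec h hW hWo hb
  have fr := he.frame
  have hz : ∀ a, a ≠ aOrder → a ≠ aAdjOff → a ≠ aAdj → prepCmd.modArr a = false →
      ∀ k, s1.arr a k = 0 := fun a h1 h2 h3 h4 k => by rw [fr.arr h4, h.arr_eq a h1 h2 h3]
  have hreg : ∀ r, prepCmd.modReg r = false → s1.reg r = (blankState n).reg r := fun r h1 => by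
    rw [fr.reg h1, h.reg_eq]
  obtain ⟨H, T, s, s', t, h1, rfl, h3⟩ := run_spec (G := G) (π := π) (P := Prepared G π n)
    (T := ⟨∅, 0, id, fun _ => false⟩)
    (D := fun i s s' => ∀ hi : i < n, ∃ f, Exec W fetchCmd s f s' ∧
      f ≤ 50 * (earlierNeighbours G π ⟨i, hi⟩).ncard + 50 ∧ s'.reg rX = π ⟨i, hi⟩ ∧
      Lists (s'.arr aNbr) 0 (s'.reg rDeg) (earlierNeighbours G π ⟨i, hi⟩))
    (runInv_zero G π _ (hreg _ rfl) (hreg _ rfl)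
      ⟨hz _ (by simp) (by simp) (by simp) rfl, hreg _ rfl, hz _ (by simp) (by simp) (by simp) rfl,
        hz _ (by simp) (by simp) (by simp) rfl⟩ (hreg _ rfl) (hz _ (by simp) (by simp) (by simp) rfl _))
    hb1 hP (fun i s hI hbs hPs => by
      obtain ⟨f, s', e1, e2, e3, e4, e5⟩ := fetchCmd_spec hPs hI hW hWo hbs
      have ff := e1.frame
      exact ⟨s', fun _ => ⟨f, e1, e2, e4, e5⟩, e3, fun H T h => h.frame ff rfl, e4, e5, fun s'' fs =>
        hPs.congr ((fs.arr rfl).trans (ff.arr rfl)) ((fs.arr rfl).trans (ff.arr rfl))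
          ((fs.arr rfl).trans (ff.arr rfl))⟩) hW hWo
  choose d1 d2 using h3
  choose f hf using fun i : Fin n => d1 i i.isLt
  refine ⟨H, T, s, s', t0, fun i => if hi : i < n then f ⟨i, hi⟩ else 0, t, h1, he, ht, fun i => ?_⟩
  have hsub := Set.ncard_le_ncard (h1.selected i).1.1
  have hfi := hf i
  have hti := (d2 i).2
  simp only [i.isLt, dite_true, Fin.eta] at hfi ⊢
  exact ⟨hfi.1, hfi.2.2.1, hfi.2.2.2, (d2 i).1, by omega⟩

/-- An edge is paid for once, by the step that inserts its later end. -/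
theorem sum_step_le {t : ℕ → ℕ} {C : ℕ}
    (h : ∀ i : Fin n, t i ≤ C * (1 + (earlierNeighbours H π i).ncard)) :
    ∑ i ∈ Finset.range n, t i ≤ C * (n + H.edgeSet.ncard) := by
  rw [← Fin.sum_univ_eq_sum_range]
  refine (Finset.sum_le_sum fun i _ => h i).trans ?_
  rw [← Finset.mul_sum, Finset.sum_add_distrib]
  have := sum_ncard_earlierNeighbours_le H π
  simp only [Finset.sum_const, Finset.card_univ, Fintype.card_fin, smul_eq_mul, mul_one]
  gcongr

end CographCompletion

open CographCompletion in
/-- There are programs, the same for all inputs, and a constant `C` such that, on a word RAM with word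
bound `C (n + 1) ^ 2`, the following holds.

1. (Incremental algorithm.) After the initialization `init`, the vertices of a graph are presented
one by one, in any order, each with the list of its neighbours among the earlier ones, and `step` is
executed for each of them. The run is correct, the execution of `step` for a vertex of degree `d'` in
the current completion takes time at most `C (1 + d')`, and all executions together take
time at most `C (n + m' + 1)`, where `m'` is the number of edges of the final completion.

2. (Whole algorithm.) The program that runs `prep` and then the loop with body `fetch; step`, on
the adjacency lists of a graph and an arbitrary order, does the same within the same bounds. -/
theorem mainTheorem3 :
    ∃ (init prep fetch step : Cmd) (C : ℕ),
      (∀ (n : ℕ) (G : SimpleGraph (Fin n)) (π : Equiv.Perm (Fin n)) (nbr : ℕ → ℕ → ℕ),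
        (∀ i : Fin n,
          Lists (nbr i) 0 (earlierNeighbours G π i).ncard (earlierNeighbours G π i)) →
        ∃ (H : SimpleGraph (Fin n)) (T : ℕ → LabelledTree n) (s : ℕ → State) (t₀ : ℕ) (t : ℕ → ℕ),
          CorrectRun G π H T s ∧
          Exec (C * (n + 1) ^ 2) init (blankState n) t₀ (s 0) ∧
          (∀ i : Fin n,
            Exec (C * (n + 1) ^ 2) step
              ((s i).feed (π i) (earlierNeighbours G π i).ncard (nbr i)) (t i) (s (i + 1)) ∧
            t i ≤ C * (1 + (earlierNeighbours H π i).ncard)) ∧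
          t₀ + ∑ i ∈ Finset.range n, t i ≤ C * (n + H.edgeSet.ncard + 1)) ∧
      (∀ (n : ℕ) (G : SimpleGraph (Fin n)) (π : Equiv.Perm (Fin n)) (s₀ : State),
        IsGraphInput G π s₀ →
        ∃ (H : SimpleGraph (Fin n)) (T : ℕ → LabelledTree n) (s s' : ℕ → State) (t₀ : ℕ)
          (f t : ℕ → ℕ) (total : ℕ),
          CorrectRun G π H T s ∧
          Exec (C * (n + 1) ^ 2) prep s₀ t₀ (s 0) ∧
          (∀ i : Fin n,
            Exec (C * (n + 1) ^ 2) fetch (s i) (f i) (s' i) ∧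
            (s' i).reg rX = (π i).val ∧
            Lists ((s' i).arr aNbr) 0 ((s' i).reg rDeg) (earlierNeighbours G π i) ∧
            Exec (C * (n + 1) ^ 2) step (s' i) (t i) (s (i + 1)) ∧
            f i + t i ≤ C * (1 + (earlierNeighbours H π i).ncard)) ∧
          Exec (C * (n + 1) ^ 2)
            (.seq prep (.while (.lt (.var rI) (.var rN)) (.seq fetch step))) s₀ total (s n) ∧
          total ≤ C * (n + H.edgeSet.ncard + 1)) := by
  have hW : ∀ n : ℕ, 20 * n + 20 ≤ 10000 * (n + 1) ^ 2 ∧ n * n + n + 2 ≤ 10000 * (n + 1) ^ 2 :=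
    fun n => ⟨by nlinarith, by nlinarith⟩
  -- The blank state is already a valid start, so the initialization is empty. The constant leaves
  -- room above the `7000` per step for the preprocessing and the tests of the outer loop.
  refine ⟨.skip, prepCmd, fetchCmd, stepCmd, 10000, fun n G π nbr hnbr => ?_, fun n G π s₀ h => ?_⟩
  · obtain ⟨H, T, s, t, h1, h2, h3⟩ := incremental_spec nbr hnbr (hW n).1 (hW n).2
    have hs := sum_step_le fun i => (h3 i).2
    exact ⟨H, T, s, 1, t, h1, h2 ▸ .skip _, fun i => ⟨(h3 i).1, (h3 i).2.trans (by omega)⟩, by omega⟩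
  · obtain ⟨H, T, s, s', t₀, f, t, h1, h2, h3, h4⟩ := whole_spec h (hW n).1 (hW n).2
    have hs := sum_step_le (t := fun i => f i + t i) fun i => (h4 i).2.2.2.2
    -- The preprocessing is linear in the edges of `G`, and these are among the edges of `H`.
    have hE := Set.ncard_le_ncard (SimpleGraph.edgeSet_mono h1.minimal.1.1)
    refine ⟨H, T, s, s', t₀, f, t, _, h1, h2, fun i => ?_, .seq h2 (exec_while_chain
      (t := fun i => f i + t i) n (fun i hi => .seq (h4 ⟨i, hi⟩).1 (h4 ⟨i, hi⟩).2.2.2.1)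
      (fun i hi => ?_) (fun i hi => ?_) ?_), ?_⟩
    · obtain ⟨e1, e2, e3, e4, e5⟩ := h4 i
      exact ⟨e1, e2, e3, e4, by omega⟩
    · have := (hW n).1
      simp only [Test.Fits, Exp.Fits, h1.counters i hi]
      omega
    · simpa only [Test.Holds, Exp.eval, h1.counters i hi.le]
    · simp [Test.Holds, Exp.eval, h1.counters n le_rfl]
    · rw [Finset.sum_add_distrib]
      simp only [Test.cost, Exp.cost, Finset.sum_const, Finset.card_range, smul_eq_mul]
      omega
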